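/- **Setting.** Let $X$ be a smooth manifold of dimension $d$ with orientation bundle $\Lambda_X$, and let $F^*$ be a descending filtration of the complex $\mathcal A^*$ of sheaves of smooth complex forms on $X$ by subsheaves of complexes of $\mathcal A^0$-modules. Let $\mathcal V_*$ be an evenly graded commutative $\mathbb C$-algebra, and let $Q(y)=1+r_1y+r_2y^2+\cdots$ be a power series with $r_j\in\mathcal V_{2j}$. Let $K=\sum_j K_{2j}(\sigma_1,\dots,\sigma_j)$ be the multiplicative sequence of $Q$, i.e. $K(\sigma_1,\sigma_2,\dots)=\prod_i Q(x_i)$ for the elementary symmetric functions $\sigma_j$ of the $x_i$, and for $p\in\mathbb Z$ put $K^p=(2\pi i)^pK$. (The main example is $\mathcal V_*=MU_*\otimes\mathbb C$, with $Q$ the power series whose genus is multiplication by $(2\pi i)^k$ on $MU_{2k}$.) **Currents.** $\mathscr D^k(X)$ is the space of continuous linear functionals on the compactly supported smooth forms of degree $d-k$ with values in $\Lambda_X$, with $dT(\sigma)=(-1)^{k+1}T(d\sigma)$ for $T\in\mathscr D^k(X)$. A form $\omega$ is identified with the current $\sigma\mapsto\int_X\omega\wedge\sigma$. Put $\mathscr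 D^n(X;\mathcal V_*)=\bigoplus_j\mathscr D^{n+2j}(X)\otimes\mathcal V_{2j}$ and $F^p\mathcal A^n(X;\mathcal V_*)=\bigoplus_jF^{p+j}\mathcal A^{n+2j}(X)\otimes\mathcal V_{2j}$. **Geometric cycles.** A geometric cycle $\widetilde f=(f,N,\nabla)$ of codimension $n$ over a manifold $Y$ consists of a proper smooth map $f\colon Z\to Y$ with $\dim Y-\dim Z=n$, a complex orientation of $f$ (a factorization of $f$, or of $(f,0)\colon Z\to Y\times\mathbb R$ if $n$ is odd, as an embedding into the product of the target with some $\mathbb C^M$ followed by the projection, and a complex structure on the normal bundle of this embedding), a complex vector bundle $N$ that represents the resulting stable normal bundle of $f$, and a connection $\nabla$ on $N$. $\widetilde{ZMU}^n(Y)$ is the abelian group generated by the isomorphism classes of geometric cycles of codimension $n$ over $Y$, with disjoint union as the sum. Let $c(\nabla)=\sum_jc_j(\nabla)=\det\bigl(1-\tfrac1{2\pi i}F^\nabla\bigr)$, where $F^\nabla$ is the curvature, and $K^p(\nabla)=K^p(c_1(\nabla),c_2(\nabla),\dots)$. For a geometric cycle $\widetilde f$ of codimension $n$ over $X$, put $$\phi^p(\widetilde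 f)=f_*K^p(\nabla)\in\mathscr D^n(X;\mathcal V_*),\qquad \phi^p(\widetilde f)(\sigma)=\int_ZK^p(\nabla)\wedge f^*\sigma,$$ for the orientation of $f$ induced by its complex orientation, and extend $\phi^p$ additively. The group $ZMU^n(p)(X)$ of Hodge filtered cycles of degree $(n,p)$ is the subgroup of the pairs $(\widetilde f,h)$ in $\widetilde{ZMU}^n(X)\times\mathscr D^{n-1}(X;\mathcal V_*)/d\mathscr D^{n-2}(X;\mathcal V_*)$ with $\phi^p(\widetilde f)-dh\in F^p\mathcal A^n(X;\mathcal V_*)$. **Geometric bordism data.** The group of geometric bordism data over $X$ is the subgroup of $\widetilde{ZMU}^n(\mathbb R\times X)$ generated by the geometric cycles $\widetilde b$ with underlying map $b=(c,f)\colon W\to\mathbb R\times X$ for which $0$ and $1$ are regular values of $c$. For such a $\widetilde b$ and $t=0,1$, the restriction $f_t$ of $f$ to $W_t=c^{-1}(t)$, with the restricted geometric structure, is a geometric cycle $\widetilde f_t$ over $X$. Put $$\partial\widetilde b=\widetilde f_1-\widetilde f_0,\qquad \psi^p(\widetilde b)=(-1)^n\bigl(f|_{W_{[0,1]}}\bigr)_*K^p(\nabla_b),\qquad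 W_{[0,1]}=c^{-1}([0,1]),$$ where $W$ is oriented relative to $\mathbb R\times X$ by the complex orientation of $b$ and $\mathbb R$ has its standard orientation and comes first; extend $\partial$ and $\psi^p$ additively. **Proposition.** For all integers $n,p$ and every geometric bordism datum $\widetilde b$ of codimension $n$ over $X$, the current $\psi^p(\widetilde b)$ lies in $\mathscr D^{n-1}(X;\mathcal V_*)$ and $$\phi^p(\partial\widetilde b)-d\psi^p(\widetilde b)=0$$ as currents on $X$. Hence $(\partial\widetilde b,\psi^p(\widetilde b))\in ZMU^n(p)(X)$, i.e. it is a Hodge filtered cycle of degree $(n,p)$. -/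

import Mathlib

open scoped Manifold ContDiff Topology
open TopologicalSpace

noncomputable section

namespace HodgeFiltered

/-- The model space `ℝ^d`. -/
abbrev Eu (d : ℕ) : Type := EuclideanSpace ℝ (Fin d)

/-- The `j`-th standard basis vector of `ℝ^d`. -/
def stdVec {d : ℕ} (j : Fin d) : Eu d := EuclideanSpace.single j 1

/-! ### Differential forms with complex coefficients, possibly twisted by the orientation bundle -/

section Forms

variable {d : ℕ} {X : Type*} [TopologicalSpace X] [ChartedSpace (Eu d) X]

/-- The part of the coordinate domain of the chart at `i` that corresponds to `U`. -/
def chartDom (U : Opens X) (i : X) : Set (Eu d) :=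
  (chartAt (Eu d) i).target ∩ (chartAt (Eu d) i).symm ⁻¹' U

/-- The change of coordinates from the chart at `i` to the chart at `j`. -/
def coordChange (i j : X) : Eu d → Eu d :=
  fun y => chartAt (Eu d) j ((chartAt (Eu d) i).symm y)

/-- The transition function of the coefficient line bundle: the sign of the Jacobian determinant
for the orientation bundle (`tw = true`), and `1` for the trivial bundle (`tw = false`). -/
def transSign (tw : Bool) (i j : X) (y : Eu d) : ℝ :=
  if tw then ((SignType.sign (fderiv ℝ (coordChange (d := d) i j) y).det : SignType) : ℝ) else 1

/-- Families of coordinate expressions of `k`-forms, one for each chart `chartAt i`. -/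
abbrev RawForm (d : ℕ) (X : Type*) (k : ℕ) := X → Eu d → Eu d [⋀^Fin k]→L[ℝ] ℂ

/-- Smooth complex `k`-forms on the open set `U`, with values in the orientation bundle of `X`
if `tw = true`.  A form is given by its coordinate expressions in the charts of `X`, which
transform into each other by pullback along the changes of coordinates (and by the sign of the
Jacobian determinant in the twisted case); each is extended by `0` outside of its domain.  So a
twisted form is written in the chart at `i` with respect to the orientation of that chart. -/
def dForm (d : ℕ) {X : Type*} [TopologicalSpace X] [ChartedSpace (Eu d) X] (tw : Bool) (k : ℕ)
    (U : Opens X) : Submodule ℂ (RawForm d X k) where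
  carrier := {η | (∀ i, ContDiffOn ℝ ∞ (η i) (chartDom U i)) ∧
    (∀ i y, y ∉ chartDom U i → η i y = 0) ∧
    ∀ i j y, y ∈ chartDom U i → (chartAt (Eu d) i).symm y ∈ (chartAt (Eu d) j).source →
      η i y = transSign tw i j y •
        (η j (coordChange i j y)).compContinuousLinearMap (fderiv ℝ (coordChange i j) y)}
  add_mem' := by
    rintro a b ⟨ha, ha', ha''⟩ ⟨hb, hb', hb''⟩
    refine ⟨fun i => (ha i).add (hb i), fun i y hy => by simp [ha' i y hy, hb' i y hy], ?_⟩
    intro i j y hy hj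
    rw [Pi.add_apply, Pi.add_apply, ha'' i j y hy hj, hb'' i j y hy hj]
    ext v
    simp
  zero_mem' := by
    refine ⟨fun i => contDiffOn_const, fun i y _ => rfl, fun i j y _ _ => ?_⟩
    ext v
    simp
  smul_mem' := by
    rintro c a ⟨ha, ha', ha''⟩
    refine ⟨fun i => (ha i).const_smul c, fun i y hy => by simp [ha' i y hy], ?_⟩
    intro i j y hy hj
    rw [Pi.smul_apply, Pi.smul_apply, ha'' i j y hy hj]
    ext v
    simp [mul_left_comm]

theorem isOpen_chartDom (U : Opens X) (i : X) : IsOpen (chartDom (d := d) U i) :=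
  (chartAt (Eu d) i).isOpen_inter_preimage_symm U.isOpen

theorem coordChange_contDiffAt [IsManifold (𝓡 d) ∞ X] (i j : X) {y : Eu d}
    (hy : y ∈ (chartAt (Eu d) i).target)
    (hj : (chartAt (Eu d) i).symm y ∈ (chartAt (Eu d) j).source) :
    ContDiffAt ℝ ∞ (coordChange i j) y := by
  have h := contDiffWithinAt_ext_coord_change (I := 𝓡 d) (n := ∞) j i (y := y)
    (by simp [hy, hj])
  simp only [mfld_simps, contDiffWithinAt_univ] at h
  exact h

theorem eventually_coordChange (i j : X) {y : Eu d}
    (hy : y ∈ (chartAt (Eu d) i).target)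
    (hj : (chartAt (Eu d) i).symm y ∈ (chartAt (Eu d) j).source) :
    ∀ᶠ z in 𝓝 y, z ∈ (chartAt (Eu d) i).target ∧
      (chartAt (Eu d) i).symm z ∈ (chartAt (Eu d) j).source :=
  ((chartAt (Eu d) i).isOpen_inter_preimage_symm (chartAt (Eu d) j).open_source).mem_nhds ⟨hy, hj⟩

theorem coordChange_det_ne_zero [IsManifold (𝓡 d) ∞ X] (i j : X) {y : Eu d}
    (hy : y ∈ (chartAt (Eu d) i).target)
    (hj : (chartAt (Eu d) i).symm y ∈ (chartAt (Eu d) j).source) :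
    (fderiv ℝ (coordChange (d := d) i j) y).det ≠ 0 := by
  have h1 := (coordChange_contDiffAt i j hy hj).differentiableAt (by simp)
  have hy' : coordChange i j y ∈ (chartAt (Eu d) j).target := (chartAt (Eu d) j).map_source hj
  have hi' : (chartAt (Eu d) j).symm (coordChange i j y) ∈ (chartAt (Eu d) i).source := by
    rw [coordChange, (chartAt (Eu d) j).left_inv hj]
    exact (chartAt (Eu d) i).map_target hy
  have h2 := (coordChange_contDiffAt j i hy' hi').differentiableAt (by simp)
  have h3 : coordChange j i ∘ coordChange i j =ᶠ[𝓝 y] id := by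
    filter_upwards [eventually_coordChange i j hy hj] with z hz
    simp [coordChange, (chartAt (Eu d) j).left_inv hz.2, (chartAt (Eu d) i).right_inv hz.1]
  have h4 := (fderiv_comp y h2 h1).symm.trans (h3.fderiv_eq.trans fderiv_id)
  have h5 := congrArg ContinuousLinearMap.det h4
  intro h0
  rw [ContinuousLinearMap.det, ContinuousLinearMap.det, ContinuousLinearMap.toLinearMap_comp,
    LinearMap.det_comp] at h5
  rw [ContinuousLinearMap.det] at h0
  rw [h0] at h5
  simp at h5

theorem eventually_transSign [IsManifold (𝓡 d) ∞ X] (tw : Bool) (i j : X) {y : Eu d}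
    (hy : y ∈ (chartAt (Eu d) i).target)
    (hj : (chartAt (Eu d) i).symm y ∈ (chartAt (Eu d) j).source) :
    ∀ᶠ z in 𝓝 y, transSign (d := d) tw i j z = transSign tw i j y := by
  cases tw
  · simp [transSign]
  · have h1 := (coordChange_contDiffAt i j hy hj).fderiv_right (m := 0) (by simp)
    have h2 : ContinuousAt (fun z => (fderiv ℝ (coordChange (d := d) i j) z).det) y :=
      ContinuousLinearMap.continuous_det.continuousAt.comp h1.continuousAt
    have h0 := coordChange_det_ne_zero i j hy hj
    rcases lt_or_gt_of_ne h0 with h | h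
    · filter_upwards [h2.eventually_lt_const h] with z hz
      simp [transSign, sign_neg h, sign_neg hz]
    · filter_upwards [h2.eventually_const_lt h] with z hz
      simp [transSign, sign_pos h, sign_pos hz]

/-- The coordinate expressions of the exterior derivative. -/
def rawD {k : ℕ} (U : Opens X) (η : RawForm d X k) : RawForm d X (k + 1) :=
  open Classical in
  fun i y => if y ∈ chartDom U i then extDeriv (η i) y else 0

theorem two_le_infty : (2 : ℕ∞ω) ≤ ∞ := by
  exact WithTop.coe_le_coe.2 le_top

theorem rawD_mem [IsManifold (𝓡 d) ∞ X] {tw : Bool} {k : ℕ} {U : Opens X} {η : RawForm d X k}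
    (h : η ∈ dForm d tw k U) : rawD U η ∈ dForm d tw (k + 1) U := by
  obtain ⟨hs, h0, hc⟩ := h
  refine ⟨fun i => ?_, fun i y hy => by simp [rawD, hy], fun i j y hy hj => ?_⟩
  · have h1 : ContDiffOn ℝ ∞ (extDeriv (η i)) (chartDom U i) := by
      have := (hs i).fderiv_of_isOpen (m := ∞) (isOpen_chartDom U i) (by simp)
      exact (ContinuousAlternatingMap.alternatizeUncurryFinCLM ℝ (Eu d) ℂ
        (n := k)).contDiff.comp_contDiffOn this
    exact h1.congr fun y hy => by simp [rawD, hy]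
  · have hy' : coordChange i j y ∈ chartDom U j := by
      refine ⟨(chartAt (Eu d) j).map_source hj, ?_⟩
      rw [Set.mem_preimage, coordChange, (chartAt (Eu d) j).left_inv hj]
      exact hy.2
    simp only [rawD, hy, hy', if_true]
    have he : η i =ᶠ[𝓝 y] transSign tw i j y • fun z =>
        (η j (coordChange i j z)).compContinuousLinearMap (fderiv ℝ (coordChange i j) z) := by
      filter_upwards [eventually_transSign tw i j hy.1 hj, eventually_coordChange i j hy.1 hj,
        (isOpen_chartDom U i).mem_nhds hy] with z h1 h2 h3
      rw [hc i j z h3 h2.2, h1]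
      rfl
    rw [he.extDeriv_eq, extDeriv_smul, extDeriv_pullback (r := ∞) _
      (coordChange_contDiffAt i j hy.1 hj) (by simpa using two_le_infty)]
    exact ((hs j).contDiffAt ((isOpen_chartDom U j).mem_nhds hy')).differentiableAt (by simp)

/-- The exterior derivative of forms on `U`. -/
def extD [IsManifold (𝓡 d) ∞ X] {tw : Bool} {k : ℕ} {U : Opens X} (η : dForm d tw k U) :
    dForm d tw (k + 1) U :=
  ⟨rawD U η.1, rawD_mem η.2⟩

/-- The restriction of a form on `U` to an open subset `U'`. -/
def restrict {tw : Bool} {k : ℕ} {U U' : Opens X} (hU : U' ≤ U) (η : dForm d tw k U) :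
    dForm d tw k U' :=
  open Classical in
  ⟨fun i y => if y ∈ chartDom U' i then η.1 i y else 0, by
    have hsub : ∀ i : X, chartDom (d := d) U' i ⊆ chartDom U i := fun i y hy => ⟨hy.1, hU hy.2⟩
    obtain ⟨hs, h0, hc⟩ := η.2
    refine ⟨fun i => ((hs i).mono (hsub i)).congr fun y hy => by simp [hy],
      fun i y hy => by simp [hy], fun i j y hy hj => ?_⟩
    have hy' : coordChange i j y ∈ chartDom U' j := by
      refine ⟨(chartAt (Eu d) j).map_source hj, ?_⟩
      rw [Set.mem_preimage, coordChange, (chartAt (Eu d) j).left_inv hj]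
      exact hy.2
    simp only [hy, hy', if_true]
    exact hc i j y (hsub i hy) hj⟩

/-- The form vanishes outside of the set `C`. -/
def VanishesOff {k : ℕ} (η : RawForm d X k) (C : Set X) : Prop :=
  ∀ i, ∀ y ∈ (chartAt (Eu d) i).target, (chartAt (Eu d) i).symm y ∉ C → η i y = 0

/-- `𝒜_c^k(X; Λ_X)`: compactly supported smooth `k`-forms with values in the orientation bundle. -/
def testForm (d : ℕ) (X : Type*) [TopologicalSpace X] [ChartedSpace (Eu d) X] (k : ℕ) :
    Submodule ℂ (RawForm d X k) where
  carrier := {η | η ∈ dForm d true k (⊤ : Opens X) ∧ ∃ C : Set X, IsCompact C ∧ VanishesOff η C}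
  add_mem' := by
    rintro a b ⟨ha, C, hC, haC⟩ ⟨hb, C', hC', hbC⟩
    refine ⟨add_mem ha hb, C ∪ C', hC.union hC', fun i y hy hn => ?_⟩
    simp [haC i y hy (fun h => hn (Or.inl h)), hbC i y hy (fun h => hn (Or.inr h))]
  zero_mem' := ⟨zero_mem _, ∅, isCompact_empty, fun _ _ _ _ => rfl⟩
  smul_mem' := by
    rintro c a ⟨ha, C, hC, haC⟩
    exact ⟨Submodule.smul_mem _ c ha, C, hC, fun i y hy hn => by simp [haC i y hy hn]⟩

theorem rawD_vanishesOff [T2Space X] {k : ℕ} {η : RawForm d X k} {C : Set X} (hC : IsCompact C)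
    (h : VanishesOff η C) : VanishesOff (rawD ⊤ η) C := by
  intro i y hy hn
  have ho : IsOpen ((chartAt (Eu d) i).target ∩ (chartAt (Eu d) i).symm ⁻¹' Cᶜ) :=
    (chartAt (Eu d) i).isOpen_inter_preimage_symm hC.isClosed.isOpen_compl
  have he : η i =ᶠ[𝓝 y] fun _ => 0 := by
    filter_upwards [ho.mem_nhds ⟨hy, hn⟩] with z hz
    exact h i z hz.1 hz.2
  rw [rawD]
  split_ifs
  · rw [he.extDeriv_eq]
    ext v
    simp [extDeriv, ContinuousAlternatingMap.alternatizeUncurryFin_apply]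
  · rfl

/-- The exterior derivative of compactly supported twisted forms. -/
def testForm.extD [T2Space X] [IsManifold (𝓡 d) ∞ X] {k : ℕ} (σ : testForm d X k) :
    testForm d X (k + 1) :=
  ⟨rawD ⊤ σ.1, rawD_mem σ.2.1, by
    obtain ⟨C, hC, h⟩ := σ.2.2
    exact ⟨C, hC, rawD_vanishesOff hC h⟩⟩

/-- Objects `F^*` which make `X` an object of `Man_F`: descending filtrations of the sheaf of de
Rham complexes with complex coefficients of `X` by subsheaves `F^p 𝒜^*` of complexes of
`𝒜^0`-modules. -/
structure DeRhamFiltration (d : ℕ) (X : Type*) [TopologicalSpace X] [ChartedSpace (Eu d) X]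
    [IsManifold (𝓡 d) ∞ X] where
  /-- The sections `F^p 𝒜^k(U)`. -/
  F : ℤ → (k : ℕ) → (U : Opens X) → Submodule ℂ (dForm d false k U)
  descending : ∀ p k U, F (p + 1) k U ≤ F p k U
  smul_mem : ∀ p k U, ∀ η ∈ F p k U, ∀ g : X → ℂ, ContMDiffOn (𝓡 d) 𝓘(ℝ, ℂ) ∞ g U →
    ∀ ζ : dForm d false k U,
      (∀ i, ∀ y ∈ chartDom U i, ζ.1 i y = g ((chartAt (Eu d) i).symm y) • η.1 i y) → ζ ∈ F p k U
  extD_mem : ∀ p k U, ∀ η ∈ F p k U, extD η ∈ F p (k + 1) U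
  restrict_mem : ∀ p k U U' (hU : U' ≤ U), ∀ η ∈ F p k U, restrict hU η ∈ F p k U'
  glue : ∀ p k U (η : dForm d false k U),
    (∀ x ∈ U, ∃ (U' : Opens X) (hU : U' ≤ U), x ∈ U' ∧ restrict hU η ∈ F p k U') → η ∈ F p k U

/-- Currents in `𝒟^{d-k}(X)`: linear functionals on the compactly supported twisted `k`-forms which
are continuous, i.e. for which `T σ_n → 0` whenever the `σ_n` have their supports in a common
compact set and all partial derivatives of their coordinate expressions converge to `0` uniformly
on compact sets. -/
def IsCurrent {k : ℕ} (T : testForm d X k → ℂ) : Prop :=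
  IsLinearMap ℂ T ∧ ∀ s : ℕ → testForm d X k,
    (∃ C : Set X, IsCompact C ∧ ∀ n, VanishesOff (s n).1 C) →
    (∀ (i : X) (l : ℕ) (C : Set (Eu d)), IsCompact C → C ⊆ (chartAt (Eu d) i).target →
      TendstoUniformlyOn (fun n y => iteratedFDeriv ℝ l ((s n).1 i) y) (fun _ => 0)
        Filter.atTop C) →
    Filter.Tendsto (fun n => T (s n)) Filter.atTop (𝓝 0)

end Forms

/-! ### The exterior algebra in coordinates, and integration over manifolds -/

/-- The exterior algebra on `dx_0, …, dx_{m-1}` with complex coefficients. -/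
abbrev Ext (m : ℕ) : Type := ExteriorAlgebra ℂ (Fin m → ℂ)

/-- The generator `dx_j`. -/
def dx {m : ℕ} (j : Fin m) : Ext m := ExteriorAlgebra.ι ℂ (Pi.single j 1)

/-- An alternating form written as `1/k! ∑ η(e_{s_1}, …, e_{s_k}) dx_{s_1} ⋯ dx_{s_k}`. -/
def toExt {m k : ℕ} (η : Eu m [⋀^Fin k]→L[ℝ] ℂ) : Ext m :=
  ((Nat.factorial k : ℂ))⁻¹ • ∑ s : Fin k → Fin m,
    η (fun j => stdVec (s j)) • (List.ofFn fun j => dx (s j)).prod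

/-- The coefficient of `dx_0 ⋯ dx_{m-1}`. -/
def topCoeff (m : ℕ) : Ext m →ₗ[ℂ] ℂ :=
  ExteriorAlgebra.liftAlternating (Pi.single m Matrix.detRowAlternating)

/-- The subalgebra of the elements of even degree. -/
def evenSubalgebra (m : ℕ) : Subalgebra ℂ (Ext m) :=
  Algebra.adjoin ℂ {x | ∃ a b : Fin m, x = dx a * dx b}

theorem dx_mul_dx {m : ℕ} (a b : Fin m) : dx a * dx b = -(dx b * dx a) :=
  eq_neg_of_add_eq_zero_left (ExteriorAlgebra.ι_add_mul_swap _ _)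

instance (m : ℕ) : IsMulCommutative (evenSubalgebra m) :=
  Algebra.isMulCommutative_adjoin ℂ (by
    rintro _ ⟨a, b, rfl⟩ _ ⟨a', b', rfl⟩
    calc dx a * dx b * (dx a' * dx b') = dx a * (dx b * dx a') * dx b' := by
          simp only [mul_assoc]
      _ = dx a * -(dx a' * dx b) * dx b' := by rw [← dx_mul_dx]
      _ = -(dx a * dx a') * (dx b * dx b') := by simp only [mul_assoc, neg_mul, mul_neg]
      _ = (dx a' * dx a) * -(dx b' * dx b) := by rw [← dx_mul_dx, ← dx_mul_dx]
      _ = dx a' * -(dx a * dx b') * dx b := by simp only [mul_assoc, neg_mul, mul_neg]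
      _ = dx a' * (dx b' * dx a) * dx b := by rw [← dx_mul_dx]
      _ = dx a' * dx b' * (dx a * dx b) := by simp only [mul_assoc])

/-- The commutative algebra of forms of even degree, at a point and in coordinates. -/
def EvenExt (m : ℕ) : Type := evenSubalgebra m

open scoped IsMulCommutative in
instance (m : ℕ) : CommRing (EvenExt m) := inferInstanceAs (CommRing (evenSubalgebra m))

instance (m : ℕ) : Algebra ℂ (EvenExt m) := inferInstanceAs (Algebra ℂ (evenSubalgebra m))

/-- The `2`-form `dx_a ∧ dx_b`. -/
def dxdx {m : ℕ} (a b : Fin m) : EvenExt m :=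
  ⟨dx a * dx b, Algebra.subset_adjoin ⟨a, b, rfl⟩⟩

/-- The inclusion of the even forms into all forms. -/
def EvenExt.val {m : ℕ} (x : EvenExt m) : Ext m := Subtype.val x

section Integration

variable {m : ℕ} (Z : Type*) [TopologicalSpace Z] [T2Space Z] [SigmaCompactSpace Z]
  [ChartedSpace (Eu m) Z] [IsManifold (𝓡 m) ∞ Z]

/-- A smooth partition of unity subordinate to the cover of `Z` by its charts. -/
def chartPartition : SmoothPartitionOfUnity Z (𝓡 m) Z Set.univ :=
  (SmoothPartitionOfUnity.exists_isSubordinate_chartAt_source (𝓡 m) Z).choose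

/-- The integral over `Z` of the density whose expression in the coordinates of the chart at `i`
is the function `δ i`. -/
def densityIntegral (δ : Z → Eu m → ℂ) : ℂ :=
  ∑ᶠ i : Z, ∫ y in (chartAt (Eu m) i).target,
    (chartPartition (m := m) Z i ((chartAt (Eu m) i).symm y) : ℂ) * δ i y

end Integration

/-! ### The manifold structure of a regular level set -/

section LevelSet

variable {m : ℕ} {W : Type*} [TopologicalSpace W] [ChartedSpace (Eu m) W] [IsManifold (𝓡 m) ∞ W]

theorem exists_equiv_fst {m : ℕ} (l : Eu m →L[ℝ] ℝ) (hl : Function.Surjective l) :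
    ∃ A : Eu m ≃L[ℝ] ℝ × Eu (m - 1), ∀ v, (A v).1 = l v := by
  have hker : Module.finrank ℝ (LinearMap.ker l.toLinearMap) = m - 1 := by
    have h1 := l.toLinearMap.finrank_range_add_finrank_ker
    have h2 : LinearMap.range l.toLinearMap = ⊤ := LinearMap.range_eq_top.2 hl
    rw [h2, finrank_top, finrank_euclideanSpace_fin, Module.finrank_self] at h1
    omega
  obtain ⟨v₀, hv₀⟩ := hl 1
  have e : LinearMap.ker l.toLinearMap ≃ₗ[ℝ] Eu (m - 1) :=
    LinearEquiv.ofFinrankEq _ _ (by rw [hker, finrank_euclideanSpace_fin])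
  have hmem : ∀ v, v - l v • v₀ ∈ LinearMap.ker l.toLinearMap := fun v => by simp [hv₀]
  let A₀ : Eu m →ₗ[ℝ] ℝ × Eu (m - 1) :=
    l.toLinearMap.prod (e.toLinearMap ∘ₗ
      (LinearMap.codRestrict _ (LinearMap.id - l.toLinearMap.smulRight v₀) (by
        intro v; simpa using hmem v)))
  have hinj : Function.Injective A₀ := by
    rw [← LinearMap.ker_eq_bot, LinearMap.ker_eq_bot']
    intro v hv
    have h1 : l v = 0 := congrArg Prod.fst hv
    have h2 : e ⟨v - l v • v₀, hmem v⟩ = 0 := congrArg Prod.snd hv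
    have h3 := congrArg Subtype.val (e.map_eq_zero_iff.1 h2)
    simpa [h1] using h3
  have hm : 1 + (m - 1) = m := by
    have h1 := l.toLinearMap.finrank_range_add_finrank_ker
    have h2 : LinearMap.range l.toLinearMap = ⊤ := LinearMap.range_eq_top.2 hl
    rw [h2, finrank_top, finrank_euclideanSpace_fin, Module.finrank_self] at h1
    omega
  refine ⟨(LinearEquiv.ofInjectiveOfFinrankEq A₀ hinj (by
    rw [Module.finrank_prod]; simp [hm])).toContinuousLinearEquiv, fun v => rfl⟩

/-- Around a regular point, there are coordinates whose first component is the given function. -/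
theorem exists_adapted_chart {c : W → ℝ} (hc : ContMDiff (𝓡 m) 𝓘(ℝ, ℝ) ∞ c) (w : W)
    (hw : Function.Surjective (mfderiv (𝓡 m) 𝓘(ℝ, ℝ) c w)) :
    ∃ Φ : OpenPartialHomeomorph W (ℝ × Eu (m - 1)), w ∈ Φ.source ∧
      (∀ x ∈ Φ.source, (Φ x).1 = c x) ∧
      ContMDiffOn (𝓡 m) 𝓘(ℝ, ℝ × Eu (m - 1)) ∞ Φ Φ.source ∧
      ContMDiffOn 𝓘(ℝ, ℝ × Eu (m - 1)) (𝓡 m) ∞ Φ.symm Φ.target := by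
  set φ := chartAt (Eu m) w with hφ
  have hwφ : w ∈ φ.source := mem_chart_source _ w
  have hφs : ContMDiffOn 𝓘(ℝ, Eu m) (𝓡 m) ∞ φ.symm φ.target := contMDiffOn_chart_symm
  set g : Eu m → ℝ := fun y => c (φ.symm y) with hg
  have hgs : ContDiffOn ℝ ∞ g φ.target :=
    contMDiffOn_iff_contDiffOn.1 (hc.comp_contMDiffOn hφs)
  have hy0 : φ w ∈ φ.target := φ.map_source hwφ
  have hgd : fderiv ℝ g (φ w) = mfderiv (𝓡 m) 𝓘(ℝ, ℝ) c w := by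
    rw [(hc.mdifferentiableAt (by simp)).mfderiv]
    simp only [mfld_simps, fderivWithin_univ]
    rfl
  obtain ⟨A, hA⟩ := exists_equiv_fst (fderiv ℝ g (φ w)) (by rw [hgd]; exact hw)
  let G : Eu m → ℝ × Eu (m - 1) := fun y => (g y, (A y).2)
  have hGs : ContDiffOn ℝ ∞ G φ.target := hgs.prodMk (contDiff_snd.comp A.contDiff).contDiffOn
  have hGat : ∀ y ∈ φ.target, ContDiffAt ℝ ∞ G y := fun y hy =>
    hGs.contDiffAt (φ.open_target.mem_nhds hy)
  have hGd : HasFDerivAt G (A : Eu m →L[ℝ] ℝ × Eu (m - 1)) (φ w) := by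
    have h1 : HasFDerivAt g (fderiv ℝ g (φ w)) (φ w) :=
      ((hgs.contDiffAt (φ.open_target.mem_nhds hy0)).differentiableAt (by simp)).hasFDerivAt
    have h2 : HasFDerivAt (fun y => (A y).2)
        ((ContinuousLinearMap.snd ℝ ℝ (Eu (m - 1))).comp (A : Eu m →L[ℝ] ℝ × Eu (m - 1))) (φ w) :=
      ((ContinuousLinearMap.snd ℝ ℝ (Eu (m - 1))).comp
        (A : Eu m →L[ℝ] ℝ × Eu (m - 1))).hasFDerivAt
    refine (h1.prodMk h2).congr_fderiv ?_
    ext v : 1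
    exact Prod.ext (hA v).symm rfl
  let Ψ := (hGat _ hy0).toOpenPartialHomeomorph G hGd (by simp)
  have hΨ : ∀ y, Ψ y = G y := fun y => rfl
  -- the open set where the derivative is invertible
  let O : Set (Eu m) := φ.target ∩
    {y | fderiv ℝ G y ∈ Set.range ((↑) : (Eu m ≃L[ℝ] ℝ × Eu (m - 1)) → _)}
  have hO : IsOpen O :=
    ((hGs.continuousOn_fderiv_of_isOpen φ.open_target (by simp))).isOpen_inter_preimage
      φ.open_target ContinuousLinearEquiv.isOpen
  have hwO : φ w ∈ O := ⟨hy0, A, hGd.fderiv.symm⟩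
  refine ⟨φ.trans (Ψ.restr O), ?_, ?_, ?_, ?_⟩
  · simp only [OpenPartialHomeomorph.trans_source, OpenPartialHomeomorph.restr_source,
      hO.interior_eq, Set.mem_inter_iff, Set.mem_preimage]
    exact ⟨hwφ, (hGat _ hy0).mem_toOpenPartialHomeomorph_source hGd (by simp), hwO⟩
  · intro x hx
    simp only [OpenPartialHomeomorph.trans_source, Set.mem_inter_iff] at hx
    change c (φ.symm (φ x)) = c x
    rw [φ.left_inv hx.1]
  · have h1 : ContMDiffOn (𝓡 m) 𝓘(ℝ, Eu m) ∞ φ φ.source := contMDiffOn_chart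
    have h2 : ContMDiffOn 𝓘(ℝ, Eu m) 𝓘(ℝ, ℝ × Eu (m - 1)) ∞ G φ.target :=
      contMDiffOn_iff_contDiffOn.2 hGs
    exact (h2.comp h1 (fun x hx => φ.map_source hx)).mono (fun x hx => by
      simp only [OpenPartialHomeomorph.trans_source, Set.mem_inter_iff] at hx; exact hx.1)
  · have h1 : ContDiffOn ℝ ∞ Ψ.symm (Ψ.restr O).target := by
      intro y hy
      have hy1 : y ∈ Ψ.target ∧ Ψ.symm y ∈ O := by
        simpa [hO.interior_eq] using hy
      obtain ⟨B, hB⟩ := hy1.2.2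
      refine ContDiffAt.contDiffWithinAt ?_
      refine Ψ.contDiffAt_symm (f₀' := B) hy1.1 ?_ (hGat _ hy1.2.1)
      rw [hB]
      exact ((hGat _ hy1.2.1).differentiableAt (by simp)).hasFDerivAt
    have h2 : ContMDiffOn 𝓘(ℝ, ℝ × Eu (m - 1)) 𝓘(ℝ, Eu m) ∞ Ψ.symm (Ψ.restr O).target :=
      contMDiffOn_iff_contDiffOn.2 h1
    refine (hφs.comp (h2.mono ?_) ?_)
    · intro y hy
      simp only [OpenPartialHomeomorph.trans_target, Set.mem_inter_iff] at hy
      exact hy.1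
    · intro y hy
      simp only [OpenPartialHomeomorph.trans_target, Set.mem_inter_iff] at hy
      exact hy.2

/-- A chart of the level set obtained from adapted coordinates. -/
def levelChart {c : W → ℝ} {t : ℝ} (s₀ : {w // c w = t})
    (Φ : OpenPartialHomeomorph W (ℝ × Eu (m - 1)))
    (hΦ : ∀ x ∈ Φ.source, (Φ x).1 = c x) : OpenPartialHomeomorph {w // c w = t} (Eu (m - 1)) :=
  open Classical in
  have hmem : ∀ y, (t, y) ∈ Φ.target → c (Φ.symm (t, y)) = t := fun y hy => by
    rw [← hΦ _ (Φ.map_target hy), Φ.right_inv hy]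
  { toFun := fun s => (Φ s.1).2
    invFun := fun y => if h : (t, y) ∈ Φ.target then ⟨Φ.symm (t, y), hmem y h⟩ else s₀
    source := {s | s.1 ∈ Φ.source}
    target := {y | (t, y) ∈ Φ.target}
    map_source' := fun s hs => by
      have h : (t, (Φ s.1).2) = Φ s.1 := Prod.ext (by rw [hΦ _ hs, s.2]) rfl
      simp only [Set.mem_ofPred_eq, h]
      exact Φ.map_source hs
    map_target' := fun y hy => by
      simp only [Set.mem_ofPred_eq] at hy ⊢
      rw [dif_pos hy]
      exact Φ.map_target hy
    left_inv' := fun s hs => by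
      have h : (t, (Φ s.1).2) = Φ s.1 := Prod.ext (by rw [hΦ _ hs, s.2]) rfl
      have h' : (t, (Φ s.1).2) ∈ Φ.target := by rw [h]; exact Φ.map_source hs
      rw [dif_pos h']
      refine Subtype.ext ?_
      change Φ.symm (t, (Φ s.1).2) = s.1
      rw [h, Φ.left_inv hs]
    right_inv' := fun y hy => by
      simp only [Set.mem_ofPred_eq] at hy
      rw [dif_pos hy]
      change (Φ (Φ.symm (t, y))).2 = y
      rw [Φ.right_inv hy]
    open_source := Φ.open_source.preimage continuous_subtype_val
    open_target := Φ.open_target.preimage (by fun_prop)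
    continuousOn_toFun := continuous_snd.comp_continuousOn
      (Φ.continuousOn.comp continuous_subtype_val.continuousOn fun s hs => hs)
    continuousOn_invFun := by
      refine (Topology.IsEmbedding.subtypeVal.isInducing.continuousOn_iff (β := {w // c w = t})).2 ?_
      refine ContinuousOn.congr (f := fun y => Φ.symm (t, y)) ?_ ?_
      · exact Φ.continuousOn_symm.comp (by fun_prop) fun y hy => hy
      · intro y hy
        simp only [Set.mem_ofPred_eq] at hy
        simp [hy] }

/-- A regular level set is a manifold, in such a way that its inclusion is an immersion. -/
theorem exists_levelSet_structure {c : W → ℝ} (hc : ContMDiff (𝓡 m) 𝓘(ℝ, ℝ) ∞ c) (t : ℝ)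
    (ht : ∀ w, c w = t → Function.Surjective (mfderiv (𝓡 m) 𝓘(ℝ, ℝ) c w)) :
    ∃ _ : ChartedSpace (Eu (m - 1)) {w // c w = t},
      IsManifold (𝓡 (m - 1)) ∞ {w // c w = t} ∧
      ContMDiff (𝓡 (m - 1)) (𝓡 m) ∞ (Subtype.val : {w // c w = t} → W) ∧
      ∀ s : {w // c w = t},
        Function.Injective (mfderiv (𝓡 (m - 1)) (𝓡 m) (Subtype.val : {w // c w = t} → W) s) := by
  choose Φ hΦw hΦc hΦs hΦs' using
    fun s : {w // c w = t} => exists_adapted_chart hc s.1 (ht s.1 s.2)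
  let e := fun s => levelChart s (Φ s) (hΦc s)
  have hsrc : ∀ s x, x ∈ (e s).source ↔ x.1 ∈ (Φ s).source := fun s x => Iff.rfl
  have htgt : ∀ s y, y ∈ (e s).target ↔ (t, y) ∈ (Φ s).target := fun s x => Iff.rfl
  have hval : ∀ s y, y ∈ (e s).target → ((e s).symm y).1 = (Φ s).symm (t, y) := by
    intro s y hy
    have hy' : (t, y) ∈ (Φ s).target := hy
    exact congrArg Subtype.val (dif_pos hy')
  let cs : ChartedSpace (Eu (m - 1)) {w // c w = t} :=
    { atlas := Set.range e
      chartAt := e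
      mem_chart_source := hΦw
      chart_mem_atlas := fun s => ⟨s, rfl⟩ }
  have hin : ∀ s, ContMDiffOn 𝓘(ℝ, Eu (m - 1)) (𝓡 m) ∞ (fun y => (Φ s).symm (t, y))
      (e s).target := fun s =>
    (hΦs' s).comp (contMDiffOn_iff_contDiffOn.2 (by fun_prop)) fun y hy => hy
  have hout : ∀ s, ContMDiffOn (𝓡 m) 𝓘(ℝ, Eu (m - 1)) ∞ (fun x => (Φ s x).2) (Φ s).source :=
    fun s => (contMDiff_iff_contDiff.2 contDiff_snd).comp_contMDiffOn (hΦs s)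
  have hman : IsManifold (𝓡 (m - 1)) ∞ {w // c w = t} := by
    refine isManifold_of_contDiffOn _ _ _ ?_
    rintro _ _ ⟨s, rfl⟩ ⟨s', rfl⟩
    simp only [mfld_simps]
    rw [← contMDiffOn_iff_contDiffOn]
    refine ((hout s').comp ((hin s).mono ?_) ?_).congr ?_
    · exact Set.inter_subset_left
    · intro y hy
      change (Φ s).symm (t, y) ∈ (Φ s').source
      rw [← hval s y hy.1]
      exact hy.2
    · intro y hy
      change (Φ s' ((e s).symm y).1).2 = _
      rw [hval s y hy.1]
      rfl
  have hincl : ContMDiff (𝓡 (m - 1)) (𝓡 m) ∞ (Subtype.val : {w // c w = t} → W) := by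
    intro s
    have h1 : ContMDiffOn (𝓡 (m - 1)) 𝓘(ℝ, Eu (m - 1)) ∞ (e s) (e s).source :=
      contMDiffOn_chart (x := s)
    have h2 := ((hin s).comp h1 (fun x hx => (e s).map_source hx)).congr
      (f₁ := (Subtype.val : {w // c w = t} → W)) (by
        intro x hx
        change x.1 = (Φ s).symm (t, e s x)
        rw [← hval s _ ((e s).map_source hx), (e s).left_inv hx])
    exact h2.contMDiffAt ((e s).open_source.mem_nhds (hΦw s))
  refine ⟨cs, hman, hincl, fun s => ?_⟩
  have h1 : ContMDiffOn 𝓘(ℝ, Eu (m - 1)) (𝓡 (m - 1)) ∞ (e s).symm (e s).target :=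
    contMDiffOn_chart_symm (x := s)
  let ρ : W → {w // c w = t} := fun x => (e s).symm (Φ s x).2
  have hρ : MDifferentiableAt (𝓡 m) (𝓡 (m - 1)) ρ s.1 := by
    have h2 := (h1.contMDiffAt ((e s).open_target.mem_nhds
      ((e s).map_source (hΦw s)))).mdifferentiableAt (by simp)
    have h3 := ((hout s).contMDiffAt ((Φ s).open_source.mem_nhds (hΦw s))).mdifferentiableAt
      (by simp)
    exact MDifferentiableAt.comp s.1 h2 h3
  have hid : ρ ∘ (Subtype.val : {w // c w = t} → W) =ᶠ[𝓝 s] id := by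
    filter_upwards [(e s).open_source.mem_nhds (hΦw s)] with x hx
    exact (e s).left_inv hx
  have h4 := mfderiv_comp s hρ (hincl.mdifferentiableAt (by simp))
  rw [hid.mfderiv_eq, mfderiv_id] at h4
  intro a b hab
  have h5 := fun a => DFunLike.congr_fun h4 a
  have ha := h5 a
  have hb := h5 b
  simp only [ContinuousLinearMap.comp_apply] at ha hb
  exact ha.trans ((congrArg _ hab).trans hb.symm)

end LevelSet

/-! ### Geometric cycles -/

/-- `0` for even `n` and `1` for odd `n`. -/
def par (n : ℤ) : ℕ := (n % 2).toNat

/-- The ambient space `T_yY ⊕ ℝ^{par n} ⊕ ℂ^N` of the stable normal bundle, for `T_yY = E`. -/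
abbrev Amb (E : Type*) (n : ℤ) (N : ℕ) := E × (Fin (par n) → ℝ) × (Fin N → ℂ)

/-- The vector space `ℂ^r` with its complement `ℂ^k`. -/
abbrev Nor (r k : ℕ) := (Fin r → ℂ) × (Fin k → ℂ)

/-- A linear map on tangent vectors, extended by the identity to the ambient space. -/
def ambMap {E E' : Type*} [NormedAddCommGroup E] [NormedSpace ℝ E] [NormedAddCommGroup E']
    [NormedSpace ℝ E'] (n : ℤ) (N : ℕ) (L : E →L[ℝ] E') : Amb E n N →L[ℝ] Amb E' n N :=
  L.prodMap (ContinuousLinearMap.id ℝ ((Fin (par n) → ℝ) × (Fin N → ℂ)))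

/-- The derivative of a complex function on a manifold in the direction of a tangent vector. -/
def dScalar {m : ℕ} {Z : Type*} [TopologicalSpace Z] [ChartedSpace (Eu m) Z] (h : Z → ℂ) (z : Z)
    (v : TangentSpace (𝓡 m) z) : ℂ :=
  mfderiv (𝓡 m) 𝓘(ℝ, ℂ) h z v

/-- A geometric cycle of codimension `n` over `Y`: a proper complex oriented map `f : Z → Y`, with
a complex vector bundle `𝒩` representing its stable normal bundle and a connection on `𝒩`.

* `f` is factorized as the embedding `z ↦ (f z, u z)` into `Y × ℂ^N`, followed by the projection.
  For odd `n`, the map `z ↦ (f z, 0)` to `Y × ℝ` is factorized instead.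
* The bundle `𝒩` of rank `r` is given by the local trivializations over the members of the open
  cover `U` with the transition functions `g`.  The maps `q a z` are the composition of the
  projection of `T_{f z}Y ⊕ ℝ^{par n} ⊕ ℂ^N` to the normal space at `z` of the above embedding with
  an isomorphism from that normal space to `𝒩_z ⊕ ℂ^k`, in the trivialization over `U a`.  So the
  `q a` provide the normal bundle of the embedding with a complex structure and identify the
  resulting complex vector bundle with the direct sum of `𝒩` and the trivial bundle `ℂ^k`.
  The case `k = 0` is that of the normal bundle `𝒩` itself.
* The connection is `∇ = d + θ a` in the trivialization over `U a`, for a matrix `θ a` of complex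
  `1`-forms on `U a`. -/
structure GeometricCycle {E : Type*} [NormedAddCommGroup E] [NormedSpace ℝ E] {H : Type*}
    [TopologicalSpace H] (I : ModelWithCorners ℝ E H) (Y : Type*) [TopologicalSpace Y]
    [ChartedSpace H Y] [IsManifold I ∞ Y] (n : ℤ) where
  Z : Type
  [instTop : TopologicalSpace Z]
  [instT2 : T2Space Z]
  [instCountable : SecondCountableTopology Z]
  /-- The dimension of `Z`. -/
  m : ℕ
  [instCharted : ChartedSpace (Eu m) Z]
  [instManifold : IsManifold (𝓡 m) ∞ Z]
  f : Z → Y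
  f_smooth : ContMDiff (𝓡 m) I ∞ f
  f_proper : IsProperMap f
  /-- The codimension of `f` is `n` (where the empty manifold has every dimension). -/
  codim : Nonempty Z → (m : ℤ) + n = Module.finrank ℝ E
  N : ℕ
  u : Z → (Fin N → ℂ)
  u_smooth : ContMDiff (𝓡 m) 𝓘(ℝ, Fin N → ℂ) ∞ u
  isEmbedding : Topology.IsEmbedding fun z => (f z, u z)
  immersion : ∀ z (v : TangentSpace (𝓡 m) z), mfderiv (𝓡 m) I f z v = 0 →
    mfderiv (𝓡 m) 𝓘(ℝ, Fin N → ℂ) u z v = 0 → v = 0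
  r : ℕ
  k : ℕ
  A : Type
  U : A → Opens Z
  cover : ∀ z, ∃ a, z ∈ U a
  q : A → (z : Z) → Amb E n N →L[ℝ] Nor r k
  q_smooth : ∀ a, ∀ z₀ ∈ U a, ContMDiffAt (𝓡 m) 𝓘(ℝ, Amb E n N →L[ℝ] Nor r k) ∞
    (fun z => (q a z).comp (ambMap n N (tangentCoordChange I (f z₀) (f z) (f z)))) z₀
  q_surjective : ∀ a, ∀ z ∈ U a, Function.Surjective (q a z)
  q_exact : ∀ a, ∀ z ∈ U a, ∀ x : Amb E n N, q a z x = 0 ↔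
    ∃ v : TangentSpace (𝓡 m) z, x = (mfderiv (𝓡 m) I f z v, 0, mfderiv (𝓡 m) 𝓘(ℝ, Fin N → ℂ) u z v)
  g : A → A → Z → Matrix (Fin r) (Fin r) ℂ
  g_smooth : ∀ a b i j, ContMDiffOn (𝓡 m) 𝓘(ℝ, ℂ) ∞ (fun z => g a b z i j) (U a ∩ U b)
  q_trans : ∀ a b, ∀ z ∈ U a, z ∈ U b → ∀ x,
    q a z x = ((g a b z).mulVec (q b z x).1, (q b z x).2)
  θ : A → (z : Z) → Fin r → Fin r → TangentSpace (𝓡 m) z →L[ℝ] ℂ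
  θ_smooth : ∀ a i j, ∀ z₀ ∈ U a, ContMDiffAt (𝓡 m) 𝓘(ℝ, Eu m →L[ℝ] ℂ) ∞
    (fun z => (θ a z i j : Eu m →L[ℝ] ℂ).comp (tangentCoordChange (𝓡 m) z₀ z z)) z₀
  θ_trans : ∀ a b, ∀ z ∈ U a, z ∈ U b → ∀ (v : TangentSpace (𝓡 m) z) (i j : Fin r),
    dScalar (fun z => g a b z i j) z v + ∑ l, θ a z i l v * g a b z l j =
      ∑ l, g a b z i l * θ b z l j v

attribute [instance] GeometricCycle.instTop GeometricCycle.instT2 GeometricCycle.instCountable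
  GeometricCycle.instCharted GeometricCycle.instManifold

instance GeometricCycle.instSigmaCompact {E : Type*} [NormedAddCommGroup E] [NormedSpace ℝ E]
    {H : Type*} [TopologicalSpace H] {I : ModelWithCorners ℝ E H} {Y : Type*} [TopologicalSpace Y]
    [ChartedSpace H Y] [IsManifold I ∞ Y] {n : ℤ} (c : GeometricCycle I Y n) :
    SigmaCompactSpace c.Z :=
  have := ChartedSpace.locallyCompactSpace (Eu c.m) c.Z
  inferInstance

/-! ### Geometric bordism data -/

section Bordism

variable {d : ℕ} {X : Type*} [TopologicalSpace X] [ChartedSpace (Eu d) X] [IsManifold (𝓡 d) ∞ X]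
  {n : ℤ}

/-- The model with corners of `ℝ × X`. -/
abbrev cylModel (d : ℕ) : ModelWithCorners ℝ (ℝ × Eu d) (ModelProd ℝ (Eu d)) :=
  𝓘(ℝ, ℝ).prod (𝓡 d)

namespace GeometricCycle

/-- The component in `ℝ` of the map underlying a geometric cycle over `ℝ × X`. -/
def c (b : GeometricCycle (cylModel d) (ℝ × X) n) (w : b.Z) : ℝ := (b.f w).1

/-- The component in `X` of the map underlying a geometric cycle over `ℝ × X`. -/
def fX (b : GeometricCycle (cylModel d) (ℝ × X) n) (w : b.Z) : X := (b.f w).2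

/-- `t` is a regular value of the component in `ℝ`. -/
def RegularAt (b : GeometricCycle (cylModel d) (ℝ × X) n) (t : ℝ) : Prop :=
  ∀ w, b.c w = t → Function.Surjective (mfderiv (𝓡 b.m) 𝓘(ℝ, ℝ) b.c w)

theorem c_smooth (b : GeometricCycle (cylModel d) (ℝ × X) n) :
    ContMDiff (𝓡 b.m) 𝓘(ℝ, ℝ) ∞ b.c := contMDiff_fst.comp b.f_smooth

theorem fX_smooth (b : GeometricCycle (cylModel d) (ℝ × X) n) :
    ContMDiff (𝓡 b.m) (𝓡 d) ∞ b.fX := contMDiff_snd.comp b.f_smooth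

theorem mfderiv_f (b : GeometricCycle (cylModel d) (ℝ × X) n) (w : b.Z)
    (v : TangentSpace (𝓡 b.m) w) : mfderiv (𝓡 b.m) (cylModel d) b.f w v =
      (mfderiv (𝓡 b.m) 𝓘(ℝ, ℝ) b.c w v, mfderiv (𝓡 b.m) (𝓡 d) b.fX w v) := by
  have h := mfderiv_prodMk (b.c_smooth.mdifferentiableAt (x := w) (by simp))
    (b.fX_smooth.mdifferentiableAt (x := w) (by simp))
  exact DFunLike.congr_fun h v

/-- The fiber of the component in `ℝ` over `t`. -/
abbrev Fib (b : GeometricCycle (cylModel d) (ℝ × X) n) (t : ℝ) : Type := {w : b.Z // b.c w = t}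

section Fib

variable (b : GeometricCycle (cylModel d) (ℝ × X) n) (t : ℝ) (ht : b.RegularAt t)

/-- The manifold structure of the fiber over a regular value, for which the inclusion is an
immersion. -/
@[reducible]
def fibCharted : ChartedSpace (Eu (b.m - 1)) (b.Fib t) :=
  (exists_levelSet_structure b.c_smooth t ht).choose

theorem fib_isManifold :
    letI := b.fibCharted t ht
    IsManifold (𝓡 (b.m - 1)) ∞ (b.Fib t) :=
  (exists_levelSet_structure b.c_smooth t ht).choose_spec.1

theorem fib_incl_smooth :
    letI := b.fibCharted t ht
    ContMDiff (𝓡 (b.m - 1)) (𝓡 b.m) ∞ (Subtype.val : b.Fib t → b.Z) :=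
  (exists_levelSet_structure b.c_smooth t ht).choose_spec.2.1

theorem fib_incl_injective (s : b.Fib t) :
    letI := b.fibCharted t ht
    Function.Injective (mfderiv (𝓡 (b.m - 1)) (𝓡 b.m) (Subtype.val : b.Fib t → b.Z) s) :=
  (exists_levelSet_structure b.c_smooth t ht).choose_spec.2.2 s

theorem fib_dim_pos (s : b.Fib t) (ht : b.RegularAt t) : 1 ≤ b.m := by
  by_contra h
  have hm : b.m = 0 := by omega
  obtain ⟨v, hv⟩ := ht s.1 s.2 (1 : ℝ)
  have : Subsingleton (Eu b.m) := by rw [hm]; infer_instance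
  have hv0 : v = 0 := Subsingleton.elim (α := Eu b.m) v 0
  rw [hv0, map_zero] at hv
  exact zero_ne_one (α := ℝ) hv

/-- The tangent space of the fiber is the kernel of the derivative of the component in `ℝ`. -/
theorem fib_exact (s : b.Fib t) (v : TangentSpace (𝓡 b.m) s.1)
    (hv : mfderiv (𝓡 b.m) 𝓘(ℝ, ℝ) b.c s.1 v = 0) :
    letI := b.fibCharted t ht
    ∃ v', mfderiv (𝓡 (b.m - 1)) (𝓡 b.m) (Subtype.val : b.Fib t → b.Z) s v' = v := by
  let _ := b.fibCharted t ht
  let L : Eu (b.m - 1) →ₗ[ℝ] Eu b.m :=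
    (mfderiv (𝓡 (b.m - 1)) (𝓡 b.m) (Subtype.val : b.Fib t → b.Z) s :
      Eu (b.m - 1) →L[ℝ] Eu b.m).toLinearMap
  let l : Eu b.m →ₗ[ℝ] ℝ := (mfderiv (𝓡 b.m) 𝓘(ℝ, ℝ) b.c s.1 : Eu b.m →L[ℝ] ℝ).toLinearMap
  have hLinj : Function.Injective L := b.fib_incl_injective t ht s
  have hl : LinearMap.range l = ⊤ := LinearMap.range_eq_top.2 (ht s.1 s.2)
  have hcomp : ∀ x, l (L x) = 0 := by
    intro x
    have h1 := mfderiv_comp s (b.c_smooth.mdifferentiableAt (x := s.1) (by simp))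
      ((b.fib_incl_smooth t ht).mdifferentiableAt (x := s) (by simp))
    have h2 : b.c ∘ (Subtype.val : b.Fib t → b.Z) = fun _ => t := funext fun s => s.2
    rw [h2, mfderiv_const] at h1
    exact (DFunLike.congr_fun h1 x).symm
  have hle : LinearMap.range L ≤ LinearMap.ker l := by
    rintro _ ⟨x, rfl⟩
    exact hcomp x
  have hpos := b.fib_dim_pos t s ht
  have hd1 : Module.finrank ℝ (LinearMap.range L) = b.m - 1 := by
    rw [LinearMap.finrank_range_of_inj hLinj, finrank_euclideanSpace_fin]
  have hd2 : Module.finrank ℝ (LinearMap.ker l) = b.m - 1 := by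
    have h1 := l.finrank_range_add_finrank_ker
    rw [hl, finrank_top, finrank_euclideanSpace_fin, Module.finrank_self] at h1
    omega
  have heq := Submodule.eq_of_le_of_finrank_eq hle (hd1.trans hd2.symm)
  have hv' : v ∈ LinearMap.range L := by rw [heq]; exact hv
  exact hv'

/-- The inclusion of `T_xX ⊕ ℝ^{par n} ⊕ ℂ^N` into `ℝ ⊕ T_xX ⊕ ℝ^{par n} ⊕ ℂ^N`. -/
def sliceMap (d : ℕ) (n : ℤ) (N : ℕ) : Amb (Eu d) n N →L[ℝ] Amb (ℝ × Eu d) n N :=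
  ambMap n N (ContinuousLinearMap.inr ℝ ℝ (Eu d))

theorem tangentCoordChange_slice (t t' : ℝ) (x y : X)
    (hy : y ∈ (chartAt (Eu d) x).source) (ξ : Eu d) :
    tangentCoordChange (cylModel d) (t, x) (t', y) (t', y) (0, ξ) =
      (0, tangentCoordChange (𝓡 d) x y y ξ) := by
  have h1 : HasFDerivWithinAt _ _ _ _ := hasFDerivWithinAt_tangentCoordChange (I := 𝓡 d)
    (x := x) (y := y) (z := y) (by simp [hy])
  have h2 : HasFDerivWithinAt _ _ _ _ := hasFDerivWithinAt_tangentCoordChange (I := cylModel d)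
    (x := ((t, x) : ℝ × X)) (y := (t', y)) (z := (t', y)) (by simp [hy, chartAt_self_eq])
  rw [ModelWithCorners.range_eq_univ, hasFDerivWithinAt_univ] at h1 h2
  have h3 : HasFDerivAt (Prod.map id (extChartAt (𝓡 d) y ∘ (extChartAt (𝓡 d) x).symm))
      (tangentCoordChange (cylModel d) (t, x) (t', y) (t', y)) (t', extChartAt (𝓡 d) x y) := h2
  have h4 := h3.unique ((hasFDerivAt_id (𝕜 := ℝ) t').prodMap (t', extChartAt (𝓡 d) x y) h1)
  rw [h4]
  rfl

/-- The part of the open set `U a` in the fiber. -/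
def fibU (a : b.A) : Opens (b.Fib t) :=
  ⟨Subtype.val ⁻¹' (b.U a : Set b.Z), (b.U a).isOpen.preimage continuous_subtype_val⟩

theorem fib_g_smooth (a a' : b.A) (i j : Fin b.r) :
    letI := b.fibCharted t ht
    ContMDiffOn (𝓡 (b.m - 1)) 𝓘(ℝ, ℂ) ∞ (fun s : b.Fib t => b.g a a' s.1 i j)
      (b.fibU t a ∩ b.fibU t a') := by
  let _ := b.fibCharted t ht
  exact ContMDiffOn.comp (g := fun z => b.g a a' z i j) (b.g_smooth a a' i j)
    (b.fib_incl_smooth t ht).contMDiffOn fun s hs => hs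

theorem fib_θ_smooth (a : b.A) (i j : Fin b.r) (s₀ : b.Fib t) (hs₀ : s₀.1 ∈ b.U a) :
    letI := b.fibCharted t ht
    haveI := b.fib_isManifold t ht
    ContMDiffAt (𝓡 (b.m - 1)) 𝓘(ℝ, Eu (b.m - 1) →L[ℝ] ℂ) ∞
      (fun s : b.Fib t => ((b.θ a s.1 i j).comp
        (mfderiv (𝓡 (b.m - 1)) (𝓡 b.m) (Subtype.val : b.Fib t → b.Z) s) :
          Eu (b.m - 1) →L[ℝ] ℂ).comp (tangentCoordChange (𝓡 (b.m - 1)) s₀ s s)) s₀ := by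
  let _ := b.fibCharted t ht
  have := b.fib_isManifold t ht
  have hj := b.fib_incl_smooth t ht
  have h1 := (b.θ_smooth a i j s₀.1 hs₀).comp s₀ (hj s₀)
  have h2 := (hj s₀).mfderiv_const (m := ∞) (by simp)
  refine (ContMDiffAt.clm_comp h1 h2).congr_of_eventuallyEq ?_
  have h3 : ∀ᶠ s : b.Fib t in 𝓝 s₀, s.1 ∈ (chartAt (Eu b.m) s₀.1).source :=
    continuous_subtype_val.continuousAt.eventually_mem
      ((chartAt (Eu b.m) s₀.1).open_source.mem_nhds (mem_chart_source _ _))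
  have h4 : ∀ᶠ s : b.Fib t in 𝓝 s₀, s ∈ (chartAt (Eu (b.m - 1)) s₀).source :=
    (chartAt (Eu (b.m - 1)) s₀).open_source.mem_nhds (mem_chart_source _ _)
  filter_upwards [h3, h4] with s hs hs'
  have h7 := inTangentCoordinates_eq (I := 𝓡 (b.m - 1)) (I' := 𝓡 b.m) id
    (Subtype.val : b.Fib t → b.Z)
    (fun s => mfderiv (𝓡 (b.m - 1)) (𝓡 b.m) (Subtype.val : b.Fib t → b.Z) s) (x₀ := s₀) hs' hs
  have h5 := fun w => tangentCoordChange_comp (I := 𝓡 b.m) (w := s.1) (x := s₀.1) (y := s.1)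
    (z := s.1) (v := w) (by simp [hs])
  have h6 := fun w => tangentCoordChange_self (I := 𝓡 b.m) (x := s.1) (z := s.1) (v := w) (by simp)
  refine ContinuousLinearMap.ext fun v => ?_
  have h8 := congrArg (fun w => b.θ a s.1 i j (tangentCoordChange (𝓡 b.m) s₀.1 s.1 s.1 w))
    (DFunLike.congr_fun h7 v)
  refine Eq.trans ?_ h8.symm
  exact congrArg (b.θ a s.1 i j) ((h5 _).trans (h6 _)).symm

theorem fib_θ_trans (a a' : b.A) (s : b.Fib t) (hs : s.1 ∈ b.U a) (hs' : s.1 ∈ b.U a') :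
    letI := b.fibCharted t ht
    ∀ (v : TangentSpace (𝓡 (b.m - 1)) s) (i j : Fin b.r),
    dScalar (fun s : b.Fib t => b.g a a' s.1 i j) s v + ∑ l, ((b.θ a s.1 i l).comp
        (mfderiv (𝓡 (b.m - 1)) (𝓡 b.m) (Subtype.val : b.Fib t → b.Z) s)) v * b.g a a' s.1 l j =
      ∑ l, b.g a a' s.1 i l * ((b.θ a' s.1 l j).comp
        (mfderiv (𝓡 (b.m - 1)) (𝓡 b.m) (Subtype.val : b.Fib t → b.Z) s)) v := by
  let _ := b.fibCharted t ht
  intro v i j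
  have h1 := b.θ_trans a a' s.1 hs hs'
    (mfderiv (𝓡 (b.m - 1)) (𝓡 b.m) (Subtype.val : b.Fib t → b.Z) s v) i j
  refine Eq.trans ?_ h1
  refine congrArg₂ (· + ·) ?_ rfl
  have h2 : MDifferentiableAt (𝓡 b.m) 𝓘(ℝ, ℂ) (fun z => b.g a a' z i j) s.1 :=
    ((b.g_smooth a a' i j).contMDiffAt
      (((b.U a).isOpen.inter (b.U a').isOpen).mem_nhds ⟨hs, hs'⟩)).mdifferentiableAt (by simp)
  exact DFunLike.congr_fun (mfderiv_comp s h2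
    ((b.fib_incl_smooth t ht).mdifferentiableAt (x := s) (by simp))) v

theorem fib_mfderiv_f (s : b.Fib t) :
    letI := b.fibCharted t ht
    ∀ v : TangentSpace (𝓡 (b.m - 1)) s,
      mfderiv (𝓡 (b.m - 1)) (𝓡 d) (fun s : b.Fib t => b.fX s.1) s v =
        mfderiv (𝓡 b.m) (𝓡 d) b.fX s.1
          (mfderiv (𝓡 (b.m - 1)) (𝓡 b.m) (Subtype.val : b.Fib t → b.Z) s v) := by
  let _ := b.fibCharted t ht
  exact fun v => DFunLike.congr_fun (mfderiv_comp s
    (b.fX_smooth.mdifferentiableAt (x := s.1) (by simp))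
    ((b.fib_incl_smooth t ht).mdifferentiableAt (x := s) (by simp))) v

theorem fib_mfderiv_u (s : b.Fib t) :
    letI := b.fibCharted t ht
    ∀ v : TangentSpace (𝓡 (b.m - 1)) s,
      mfderiv (𝓡 (b.m - 1)) 𝓘(ℝ, Fin b.N → ℂ) (fun s : b.Fib t => b.u s.1) s v =
        mfderiv (𝓡 b.m) 𝓘(ℝ, Fin b.N → ℂ) b.u s.1
          (mfderiv (𝓡 (b.m - 1)) (𝓡 b.m) (Subtype.val : b.Fib t → b.Z) s v) := by
  let _ := b.fibCharted t ht
  exact fun v => DFunLike.congr_fun (mfderiv_comp s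
    (b.u_smooth.mdifferentiableAt (x := s.1) (by simp))
    ((b.fib_incl_smooth t ht).mdifferentiableAt (x := s) (by simp))) v

theorem fib_mfderiv_c (s : b.Fib t) :
    letI := b.fibCharted t ht
    ∀ v : TangentSpace (𝓡 (b.m - 1)) s, mfderiv (𝓡 b.m) 𝓘(ℝ, ℝ) b.c s.1
      (mfderiv (𝓡 (b.m - 1)) (𝓡 b.m) (Subtype.val : b.Fib t → b.Z) s v) = 0 := by
  let _ := b.fibCharted t ht
  intro v
  have h1 := mfderiv_comp s (b.c_smooth.mdifferentiableAt (x := s.1) (by simp))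
    ((b.fib_incl_smooth t ht).mdifferentiableAt (x := s) (by simp))
  have h2 : b.c ∘ (Subtype.val : b.Fib t → b.Z) = fun _ => t := funext fun s => s.2
  rw [h2, mfderiv_const] at h1
  exact (DFunLike.congr_fun h1 v).symm

theorem fib_proper : IsProperMap (fun s : b.Fib t => b.fX s.1) := by
  have h1 : IsProperMap (b.f ∘ (Subtype.val : b.Fib t → b.Z)) :=
    b.f_proper.comp ((isClosed_singleton.preimage
      b.c_smooth.continuous).isClosedEmbedding_subtypeVal.isProperMap)
  refine isProperMap_of_comp_of_inj (g := fun x : X => ((t, x) : ℝ × X))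
    (b.fX_smooth.continuous.comp continuous_subtype_val) (by fun_prop) ?_
    (fun x y h => (Prod.ext_iff.1 h).2)
  convert h1 using 1
  funext s
  exact Prod.ext s.2.symm rfl

theorem fib_isEmbedding : Topology.IsEmbedding (fun s : b.Fib t => (b.fX s.1, b.u s.1)) := by
  refine Topology.IsEmbedding.of_comp
    (g := fun p : X × (Fin b.N → ℂ) => (((t, p.1), p.2) : (ℝ × X) × (Fin b.N → ℂ)))
    ((b.fX_smooth.continuous.comp continuous_subtype_val).prodMk
      (b.u_smooth.continuous.comp continuous_subtype_val)) (by fun_prop) ?_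
  convert b.isEmbedding.comp (Topology.IsEmbedding.subtypeVal (p := fun w => b.c w = t)) using 1
  funext s
  exact Prod.ext (Prod.ext s.2.symm rfl) rfl

theorem fib_immersion (s : b.Fib t) :
    letI := b.fibCharted t ht
    ∀ v : TangentSpace (𝓡 (b.m - 1)) s,
      mfderiv (𝓡 (b.m - 1)) (𝓡 d) (fun s : b.Fib t => b.fX s.1) s v = 0 →
      mfderiv (𝓡 (b.m - 1)) 𝓘(ℝ, Fin b.N → ℂ) (fun s : b.Fib t => b.u s.1) s v = 0 → v = 0 := by
  let _ := b.fibCharted t ht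
  intro v h1 h2
  rw [b.fib_mfderiv_f t ht] at h1
  rw [b.fib_mfderiv_u t ht] at h2
  refine b.fib_incl_injective t ht s ?_
  rw [map_zero]
  refine b.immersion s.1 _ ?_ h2
  rw [mfderiv_f, b.fib_mfderiv_c t ht, h1]
  rfl

theorem fib_q_smooth (a : b.A) (s₀ : b.Fib t) (hs₀ : s₀.1 ∈ b.U a) :
    letI := b.fibCharted t ht
    ContMDiffAt (𝓡 (b.m - 1)) 𝓘(ℝ, Amb (Eu d) n b.N →L[ℝ] Nor b.r b.k) ∞
      (fun s : b.Fib t => ((b.q a s.1).comp (sliceMap d n b.N)).comp (ambMap n b.N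
        (tangentCoordChange (𝓡 d) (b.fX s₀.1) (b.fX s.1) (b.fX s.1)))) s₀ := by
  let _ := b.fibCharted t ht
  have h1 := (b.q_smooth a s₀.1 hs₀).comp s₀ (b.fib_incl_smooth t ht s₀)
  have h2 : ContMDiffAt (𝓡 (b.m - 1)) 𝓘(ℝ, Amb (Eu d) n b.N →L[ℝ] Nor b.r b.k) ∞
      (fun s : b.Fib t => ((b.q a s.1).comp (ambMap n b.N
        (tangentCoordChange (cylModel d) (b.f s₀.1) (b.f s.1) (b.f s.1)))).comp
          (sliceMap d n b.N)) s₀ :=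
    ContMDiffAt.clm_comp h1 contMDiffAt_const
  refine h2.congr_of_eventuallyEq ?_
  have h3 : ∀ᶠ s : b.Fib t in 𝓝 s₀, b.fX s.1 ∈ (chartAt (Eu d) (b.fX s₀.1)).source :=
    (b.fX_smooth.continuous.comp continuous_subtype_val).continuousAt.eventually_mem
      ((chartAt (Eu d) (b.fX s₀.1)).open_source.mem_nhds (mem_chart_source _ _))
  filter_upwards [h3] with s hs
  refine ContinuousLinearMap.ext fun x => ?_
  simp only [ContinuousLinearMap.comp_apply]
  congr 1
  exact Prod.ext (tangentCoordChange_slice _ _ _ _ hs x.1).symm rfl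

theorem fib_q_surjective (ht : b.RegularAt t) (a : b.A) (s : b.Fib t) (hs : s.1 ∈ b.U a) :
    Function.Surjective ((b.q a s.1).comp (sliceMap d n b.N)) := by
  intro y
  obtain ⟨x, hx⟩ := b.q_surjective a s.1 hs y
  obtain ⟨v, hv⟩ := ht s.1 s.2 x.1.1
  let x' : Amb (ℝ × Eu d) n b.N := (mfderiv (𝓡 b.m) (cylModel d) b.f s.1 v, 0,
    mfderiv (𝓡 b.m) 𝓘(ℝ, Fin b.N → ℂ) b.u s.1 v)
  have h0 : b.q a s.1 x' = 0 := (b.q_exact a s.1 hs _).2 ⟨v, rfl⟩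
  refine ⟨((x - x').1.2, (x - x').2), ?_⟩
  have h5 : b.q a s.1 (x - x') = y := by
    rw [map_sub, h0, sub_zero, hx]
  rw [← h5]
  rw [ContinuousLinearMap.comp_apply]
  congr 1
  refine Prod.ext (Prod.ext ?_ rfl) rfl
  have h7 : x'.1.1 = x.1.1 := (congrArg Prod.fst (b.mfderiv_f s.1 v)).trans hv
  change (0 : ℝ) = x.1.1 - x'.1.1
  rw [h7, sub_self]

theorem fib_q_exact (a : b.A) (s : b.Fib t) (hs : s.1 ∈ b.U a) (x : Amb (Eu d) n b.N) :
    letI := b.fibCharted t ht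
    ((b.q a s.1).comp (sliceMap d n b.N)) x = 0 ↔ ∃ v : TangentSpace (𝓡 (b.m - 1)) s,
      x = (mfderiv (𝓡 (b.m - 1)) (𝓡 d) (fun s : b.Fib t => b.fX s.1) s v, 0,
        mfderiv (𝓡 (b.m - 1)) 𝓘(ℝ, Fin b.N → ℂ) (fun s : b.Fib t => b.u s.1) s v) := by
  let _ := b.fibCharted t ht
  rw [ContinuousLinearMap.comp_apply, b.q_exact a s.1 hs]
  constructor
  · rintro ⟨v, hv⟩
    rw [mfderiv_f] at hv
    have hv1 : mfderiv (𝓡 b.m) 𝓘(ℝ, ℝ) b.c s.1 v = 0 :=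
      (congrArg (fun x : Amb (ℝ × Eu d) n b.N => x.1.1) hv).symm
    obtain ⟨v', hv'⟩ := b.fib_exact t ht s v hv1
    refine ⟨v', ?_⟩
    rw [b.fib_mfderiv_f t ht, b.fib_mfderiv_u t ht, hv']
    exact Prod.ext (congrArg (fun x : Amb (ℝ × Eu d) n b.N => x.1.2) hv)
      (congrArg (fun x : Amb (ℝ × Eu d) n b.N => x.2) hv)
  · rintro ⟨v, rfl⟩
    refine ⟨mfderiv (𝓡 (b.m - 1)) (𝓡 b.m) (Subtype.val : b.Fib t → b.Z) s v, ?_⟩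
    rw [mfderiv_f, b.fib_mfderiv_c t ht, b.fib_mfderiv_f t ht, b.fib_mfderiv_u t ht]
    rfl

theorem fib_codim (s : b.Fib t) (ht : b.RegularAt t) :
    ((b.m - 1 : ℕ) : ℤ) + n = Module.finrank ℝ (Eu d) := by
  have h1 := b.codim ⟨s.1⟩
  have h2 := b.fib_dim_pos t s ht
  rw [Module.finrank_prod, Module.finrank_self, finrank_euclideanSpace_fin] at h1
  rw [finrank_euclideanSpace_fin]
  push_cast at h1 ⊢
  omega

/-- The geometric cycle over `X` obtained from a geometric cycle over `ℝ × X` by restricting it to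
the fiber over the regular value `t`, with the induced geometric structure. -/
def fiber : GeometricCycle (𝓡 d) X n :=
  letI := b.fibCharted t ht
  haveI := b.fib_isManifold t ht
  { Z := b.Fib t
    instCountable := TopologicalSpace.Subtype.secondCountableTopology _
    m := b.m - 1
    f := fun s => b.fX s.1
    f_smooth := b.fX_smooth.comp (b.fib_incl_smooth t ht)
    f_proper := b.fib_proper t
    codim := fun ⟨s⟩ => b.fib_codim t s ht
    N := b.N
    u := fun s => b.u s.1
    u_smooth := b.u_smooth.comp (b.fib_incl_smooth t ht)
    isEmbedding := b.fib_isEmbedding t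
    immersion := b.fib_immersion t ht
    r := b.r
    k := b.k
    A := b.A
    U := b.fibU t
    cover := fun s => b.cover s.1
    q := fun a s => (b.q a s.1).comp (sliceMap d n b.N)
    q_smooth := b.fib_q_smooth t ht
    q_surjective := b.fib_q_surjective t ht
    q_exact := b.fib_q_exact t ht
    g := fun a a' s => b.g a a' s.1
    g_smooth := b.fib_g_smooth t ht
    q_trans := fun a a' s hs hs' x => b.q_trans a a' s.1 hs hs' (sliceMap d n b.N x)
    θ := fun a s i j => (b.θ a s.1 i j).comp
      (mfderiv (𝓡 (b.m - 1)) (𝓡 b.m) (Subtype.val : b.Fib t → b.Z) s)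
    θ_smooth := b.fib_θ_smooth t ht
    θ_trans := b.fib_θ_trans t ht }

end Fib

end GeometricCycle

end Bordism

/-! ### The group of geometric cycles -/

section CycleGroup

variable {E : Type*} [NormedAddCommGroup E] [NormedSpace ℝ E] {H : Type*}
  [TopologicalSpace H] {I : ModelWithCorners ℝ E H} {Y : Type*} [TopologicalSpace Y]
  [ChartedSpace H Y] [IsManifold I ∞ Y] {n : ℤ}

/-- An isomorphism of the geometric cycle `c₁` with the restriction of the geometric cycle `c₂` to
an open part of its domain.  It consists of

* a diffeomorphism `j` onto that part, compatible with the maps to `Y`;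
* an isomorphism `Φ` from the bundle of `c₁` to that of `c₂`, which identifies the connections;
* a proof that `j` and `Φ` identify the complex orientations: after stabilization by `ℂ^l` and by
  `ℂ^{l'}`, the two embeddings into `Y × ℂ^{N''}` are related by an isotopy `us` through
  factorizations of the map to `Y`, and the two identifications of the stabilized normal bundles
  with the stabilized bundle of `c₁` by a path `qs` of such identifications along the isotopy. -/
structure GeometricEmbedding (c₁ c₂ : GeometricCycle I Y n) where
  j : c₁.Z → c₂.Z
  isOpenEmbedding : Topology.IsOpenEmbedding j
  isLocalDiffeomorph : IsLocalDiffeomorph (𝓡 c₁.m) (𝓡 c₂.m) ∞ j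
  f_comp : ∀ z, c₂.f (j z) = c₁.f z
  Φ : c₁.A → c₂.A → c₁.Z → Matrix (Fin c₂.r) (Fin c₁.r) ℂ
  Φ_smooth : ∀ a a' i l, ContMDiffOn (𝓡 c₁.m) 𝓘(ℝ, ℂ) ∞ (fun z => Φ a a' z i l)
    (c₁.U a ∩ j ⁻¹' c₂.U a')
  Φ_connection : ∀ a a', ∀ z ∈ c₁.U a, j z ∈ c₂.U a' → ∀ (v : TangentSpace (𝓡 c₁.m) z) i i',
    dScalar (fun z => Φ a a' z i i') z v +
        ∑ l, c₂.θ a' (j z) i l (mfderiv (𝓡 c₁.m) (𝓡 c₂.m) j z v) * Φ a a' z l i' =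
      ∑ l, Φ a a' z i l * c₁.θ a z l i' v
  (N'' k'' l l' : ℕ)
  L₁ : ((Fin c₁.N → ℂ) × (Fin l → ℂ)) ≃ₗ[ℂ] (Fin N'' → ℂ)
  L₂ : ((Fin c₂.N → ℂ) × (Fin l' → ℂ)) ≃ₗ[ℂ] (Fin N'' → ℂ)
  B₁ : ((Fin c₁.k → ℂ) × (Fin l → ℂ)) ≃ₗ[ℂ] (Fin k'' → ℂ)
  B₂ : ((Fin c₂.k → ℂ) × (Fin l' → ℂ)) ≃ₗ[ℂ] (Fin k'' → ℂ)
  us : ℝ → c₁.Z → (Fin N'' → ℂ)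
  us_smooth : ContMDiff (𝓘(ℝ, ℝ).prod (𝓡 c₁.m)) 𝓘(ℝ, Fin N'' → ℂ) ∞
    (fun x : ℝ × c₁.Z => us x.1 x.2)
  us_zero : ∀ z, us 0 z = L₁ (c₁.u z, 0)
  us_one : ∀ z, us 1 z = L₂ (c₂.u (j z), 0)
  us_isEmbedding : ∀ t ∈ Set.Icc (0 : ℝ) 1, Topology.IsEmbedding fun z => (c₁.f z, us t z)
  us_immersion : ∀ t ∈ Set.Icc (0 : ℝ) 1, ∀ z (v : TangentSpace (𝓡 c₁.m) z),
    mfderiv (𝓡 c₁.m) I c₁.f z v = 0 →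
      mfderiv (𝓡 c₁.m) 𝓘(ℝ, Fin N'' → ℂ) (us t) z v = 0 → v = 0
  qs : ℝ → c₁.A → c₁.Z → Amb E n N'' →L[ℝ] Nor c₁.r k''
  qs_smooth : ∀ a, ∀ t₀, ∀ z₀ ∈ c₁.U a,
    ContMDiffAt (𝓘(ℝ, ℝ).prod (𝓡 c₁.m)) 𝓘(ℝ, Amb E n N'' →L[ℝ] Nor c₁.r k'') ∞
      (fun x : ℝ × c₁.Z => (qs x.1 a x.2).comp
        (ambMap n N'' (tangentCoordChange I (c₁.f z₀) (c₁.f x.2) (c₁.f x.2)))) (t₀, z₀)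
  qs_trans : ∀ t, ∀ a b, ∀ z ∈ c₁.U a, z ∈ c₁.U b → ∀ x,
    qs t a z x = ((c₁.g a b z).mulVec (qs t b z x).1, (qs t b z x).2)
  qs_surjective : ∀ t ∈ Set.Icc (0 : ℝ) 1, ∀ a, ∀ z ∈ c₁.U a, Function.Surjective (qs t a z)
  qs_exact : ∀ t ∈ Set.Icc (0 : ℝ) 1, ∀ a, ∀ z ∈ c₁.U a, ∀ x : Amb E n N'', qs t a z x = 0 ↔
    ∃ v : TangentSpace (𝓡 c₁.m) z,
      x = (mfderiv (𝓡 c₁.m) I c₁.f z v, 0, mfderiv (𝓡 c₁.m) 𝓘(ℝ, Fin N'' → ℂ) (us t) z v)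
  qs_zero : ∀ a, ∀ z ∈ c₁.U a, ∀ ξ τ v w, qs 0 a z (ξ, τ, L₁ (v, w)) =
    ((c₁.q a z (ξ, τ, v)).1, B₁ ((c₁.q a z (ξ, τ, v)).2, w))
  qs_one : ∀ a a', ∀ z ∈ c₁.U a, j z ∈ c₂.U a' → ∀ ξ τ v w,
    ((Φ a a' z).mulVec (qs 1 a z (ξ, τ, L₂ (v, w))).1, (qs 1 a z (ξ, τ, L₂ (v, w))).2) =
      ((c₂.q a' (j z) (ξ, τ, v)).1, B₂ ((c₂.q a' (j z) (ξ, τ, v)).2, w))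

variable (I Y n) in
/-- The relations between geometric cycles: isomorphic cycles are equal, and a cycle which is
isomorphic to the disjoint union of two cycles is the sum of these. -/
def cycleRelations : Set (FreeAbelianGroup (GeometricCycle I Y n)) :=
  {x | ∃ (c₁ c : GeometricCycle I Y n) (e : GeometricEmbedding c₁ c), Function.Surjective e.j ∧
      x = FreeAbelianGroup.of c - FreeAbelianGroup.of c₁} ∪
  {x | ∃ (c₁ c₂ c : GeometricCycle I Y n) (e₁ : GeometricEmbedding c₁ c)
      (e₂ : GeometricEmbedding c₂ c), IsCompl (Set.range e₁.j) (Set.range e₂.j) ∧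
      x = FreeAbelianGroup.of c - (FreeAbelianGroup.of c₁ + FreeAbelianGroup.of c₂)}

variable (I Y n) in
/-- The abelian group generated by the isomorphism classes of geometric cycles of codimension `n`
over `Y`, with disjoint union as the sum. -/
abbrev CycleGroup := FreeAbelianGroup (GeometricCycle I Y n) ⧸
  AddSubgroup.closure (cycleRelations I Y n)

end CycleGroup

/-! ### Chern forms and multiplicative sequences -/

section Genus

variable {V : Type*} [CommRing V]

theorem isSymmetric_homogeneousComponent {σ : Type*} (j : ℕ) {p : MvPolynomial σ V}
    (hp : p.IsSymmetric) : (MvPolynomial.homogeneousComponent j p).IsSymmetric := fun e => by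
  rw [MvPolynomial.rename_homogeneousComponent, hp e]

/-- The product of the `Q(x_i)`, for `Q` truncated after the terms of degree `j`, in the variables
`x_0, …, x_{j-1}`. -/
def prodQ (Q : PowerSeries V) (j : ℕ) : MvPolynomial (Fin j) V :=
  ∏ i, Polynomial.aeval (MvPolynomial.X i) (PowerSeries.trunc (j + 1) Q)

theorem prodQ_isSymmetric (Q : PowerSeries V) (j : ℕ) : (prodQ Q j).IsSymmetric := fun e => by
  rw [prodQ, map_prod]
  refine Eq.trans (Finset.prod_congr rfl fun i _ => ?_) (Equiv.prod_comp e fun i =>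
    Polynomial.aeval (MvPolynomial.X i : MvPolynomial (Fin j) V) (PowerSeries.trunc (j + 1) Q))
  rw [← Polynomial.aeval_algHom_apply, MvPolynomial.rename_X]

/-- The `j`-th polynomial of the multiplicative sequence `K^Q` (of degree `2j` if `x_i` has degree
`2`), in the elementary symmetric functions `σ_1, …, σ_j` (the variable of index `i` is
`σ_{i+1}`): it is the homogeneous part of degree `j` of `∏ Q(x_i)`, for which `j` variables
suffice. -/
def multSeq (Q : PowerSeries V) (j : ℕ) : MvPolynomial (Fin j) V :=
  (MvPolynomial.esymmAlgEquiv (Fin j) V (Fintype.card_fin j)).symm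
    ⟨MvPolynomial.homogeneousComponent j (prodQ Q j),
      isSymmetric_homogeneousComponent j (prodQ_isSymmetric Q j)⟩

end Genus

namespace GeometricCycle

variable {E : Type*} [NormedAddCommGroup E] [NormedSpace ℝ E] {H : Type*}
  [TopologicalSpace H] {I : ModelWithCorners ℝ E H} {Y : Type*} [TopologicalSpace Y]
  [ChartedSpace H Y] [IsManifold I ∞ Y] {n : ℤ} (c : GeometricCycle I Y n)

/-- The point of `Z` with the coordinates `y` in the chart at `i`. -/
def pt (i : c.Z) (y : Eu c.m) : c.Z := (chartAt (Eu c.m) i).symm y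

/-- The tangent vector at `z` with the given coordinates with respect to the chart at `i`. -/
def coordVec (i z : c.Z) : Eu c.m →L[ℝ] TangentSpace (𝓡 c.m) z :=
  tangentCoordChange (𝓡 c.m) i z z

/-- The connection matrix over `U a` in the coordinates of the chart at `i`. -/
def connLoc (a : c.A) (i : c.Z) (s t : Fin c.r) (y : Eu c.m) : Eu c.m →L[ℝ] ℂ :=
  (c.θ a (c.pt i y) s t).comp (c.coordVec i (c.pt i y))

/-- The curvature `dθ + θ ∧ θ` over `U a` in the coordinates of the chart at `i`. -/
def curvLoc (a : c.A) (i : c.Z) (y : Eu c.m) (s t : Fin c.r) (v w : Eu c.m) : ℂ :=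
  fderiv ℝ (c.connLoc a i s t) y v w - fderiv ℝ (c.connLoc a i s t) y w v +
    ∑ l, (c.connLoc a i s l y v * c.connLoc a i l t y w -
      c.connLoc a i s l y w * c.connLoc a i l t y v)

/-- The curvature as a matrix of `2`-forms. -/
def curvMatrix (a : c.A) (i : c.Z) (y : Eu c.m) : Matrix (Fin c.r) (Fin c.r) (EvenExt c.m) :=
  fun s t => (2 : ℂ)⁻¹ • ∑ x : Fin c.m, ∑ x' : Fin c.m,
    c.curvLoc a i y s t (stdVec x) (stdVec x') • dxdx x x'

/-- The `l`-th Chern form of the connection, in the coordinates of the chart at `i`: the part of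
degree `2l` of `det (1 - F / (2πi))`, i.e. the coefficient of `T^l` in `det (1 - T F / (2πi))`. -/
def chernForm (l : ℕ) (i : c.Z) (y : Eu c.m) : EvenExt c.m :=
  (((2 * Real.pi * Complex.I : ℂ)⁻¹ •
    c.curvMatrix (c.cover (c.pt i y)).choose i y).charpolyRev).coeff l

/-- The product of the Chern forms according to a monomial in `σ_1, …, σ_j`. -/
def chernMonomial {j : ℕ} (α : Fin j →₀ ℕ) (i : c.Z) (y : Eu c.m) : EvenExt c.m :=
  α.prod fun x e => c.chernForm (x + 1) i y ^ e

end GeometricCycle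

/-! ### Orientations, push-forward currents, and Hodge filtered cycles -/

/-- Two bases of a real vector space define the same orientation: every top-dimensional alternating
form takes values of the same sign on them. -/
def SameOrientation {W : Type*} [AddCommGroup W] [Module ℝ W] {M : ℕ} (v w : Fin M → W) : Prop :=
  ∀ μ : W [⋀^Fin M]→ₗ[ℝ] ℝ, 0 ≤ μ v * μ w

/-- The oriented real basis `e_1, i e_1, e_2, i e_2, …` of `ℂ^r`. -/
def complexFrame (r : ℕ) (x : Fin (r * 2)) : Fin r → ℂ :=
  Pi.single x.divNat (if x.modNat = 0 then 1 else Complex.I)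

/-- The oriented real basis of `ℂ^r ⊕ ℂ^k`. -/
def normalFrame (r k : ℕ) : Fin (r * 2 + k * 2) → Nor r k :=
  Fin.append (fun x => (complexFrame r x, 0)) (fun x => (0, complexFrame k x))

/-- The basis of the ambient space obtained from a basis of `T_yY`. -/
def ambFrame {E : Type*} [AddCommGroup E] (n : ℤ) (N : ℕ) {D : ℕ} (w : Fin D → E) :
    Fin (D + par n + N * 2) → Amb E n N :=
  Fin.append (Fin.append (fun x => (w x, 0, 0)) (fun x => (0, Pi.single x 1, 0)))
    (fun x => (0, 0, complexFrame N x))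

namespace GeometricCycle

variable {E : Type*} [NormedAddCommGroup E] [NormedSpace ℝ E] {H : Type*}
  [TopologicalSpace H] {I : ModelWithCorners ℝ E H} {Y : Type*} [TopologicalSpace Y]
  [ChartedSpace H Y] [IsManifold I ∞ Y] {n : ℤ} (c : GeometricCycle I Y n)

/-- The bases `v` of `T_zZ` and `w` of `T_{f z}Y = E` define corresponding orientations, for the
orientation of `f` induced by its complex orientation: the orientation of
`T_{f z}Y ⊕ ℝ^{par n} ⊕ ℂ^N` given by `w` is the one given by `v` and by the complex orientation of
the normal space. -/
def OrientationCompatible (z : c.Z) (v : Fin c.m → TangentSpace (𝓡 c.m) z) {D : ℕ}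
    (w : Fin D → E) : Prop :=
  ∃ (h : D + par n + c.N * 2 = c.m + (c.r * 2 + c.k * 2)) (a : c.A)
    (s : Fin (c.r * 2 + c.k * 2) → Amb E n c.N), z ∈ c.U a ∧
    (∀ x, c.q a z (s x) = normalFrame c.r c.k x) ∧
    SameOrientation (ambFrame n c.N w)
      (Fin.append (fun x => ((mfderiv (𝓡 c.m) I c.f z (v x), 0,
        mfderiv (𝓡 c.m) 𝓘(ℝ, Fin c.N → ℂ) c.u z (v x)) : Amb E n c.N)) s ∘ Fin.cast h)

open Classical in
/-- The sign which compares the orientation of the chart at `i` with that given by `w`. -/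
def orientationSign (i z : c.Z) {D : ℕ} (w : Fin D → E) : ℂ :=
  if c.OrientationCompatible z (fun x => c.coordVec i z (stdVec x)) w then 1 else -1

end GeometricCycle

section Currents

variable {d : ℕ} {X : Type*} [TopologicalSpace X] [ChartedSpace (Eu d) X]
  {V : Type*} [CommRing V] [Algebra ℂ V]

variable (d X V) in
/-- Families of `V`-valued functions on the twisted test forms of all degrees `k`. -/
abbrev CurrentFamily := (k : ℕ) → testForm d X k → V

/-- The group `𝒟^n(X; 𝒱_*) = ⨁_j 𝒟^{n+2j}(X) ⊗ 𝒱_{2j}`, as a space of families of functions on the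
test forms: `T ⊗ v` acts by `σ ↦ T(σ) v`, and `T ∈ 𝒟^{d-k}(X)` acts on test forms of degree
`k = d - (n + 2j)`. -/
def currents (d : ℕ) (X : Type*) [TopologicalSpace X] [ChartedSpace (Eu d) X] (𝒱 : ℤ → Submodule ℂ V)
    (n : ℤ) : Submodule ℂ (CurrentFamily d X V) :=
  Submodule.span ℂ {S | ∃ (j : ℤ) (k : ℕ) (T : testForm d X k → ℂ), (d : ℤ) - k = n + 2 * j ∧
    IsCurrent T ∧ ∃ v ∈ 𝒱 (2 * j), S = Pi.single k fun σ => T σ • v}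

/-- The exterior derivative of currents: `(dT)(σ) = (-1)^{r+1} T(dσ)` for `T ∈ 𝒟^r(X)`; here `T` acts
on forms of degree `k + 1`, so `r = d - (k + 1)`. -/
def dCurrent [T2Space X] [IsManifold (𝓡 d) ∞ X] :
    CurrentFamily d X V →ₗ[ℂ] CurrentFamily d X V where
  toFun T := fun k σ => ((-1 : ℂ) ^ (((d : ℤ) - (k + 1)) + 1)) • T (k + 1) (testForm.extD σ)
  map_add' _ _ := by
    funext k σ
    exact smul_add _ _ _
  map_smul' _ _ := by
    funext k σ
    exact smul_comm _ _ _

/-- The exact currents in `𝒟^n(X; 𝒱_*)`, i.e. `d𝒟^{n-1}(X; 𝒱_*)`. -/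
def exactCurrents (d : ℕ) (X : Type*) [TopologicalSpace X] [ChartedSpace (Eu d) X] [T2Space X]
    [IsManifold (𝓡 d) ∞ X] (𝒱 : ℤ → Submodule ℂ V) (n : ℤ) : Submodule ℂ (currents d X 𝒱 n) :=
  ((currents d X 𝒱 (n - 1)).map dCurrent).comap (currents d X 𝒱 n).subtype

/-- The current `σ ↦ ∫_X η ∧ σ` of a form, with coefficient `v`. -/
def formCurrent [T2Space X] [SigmaCompactSpace X] [IsManifold (𝓡 d) ∞ X] {l : ℕ}
    (η : dForm d false l (⊤ : Opens X)) (v : V) : CurrentFamily d X V :=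
  fun _ σ => densityIntegral X (fun i y => topCoeff d (toExt (η.1 i y) * toExt (σ.1 i y))) • v

/-- The group `F^p𝒜^n(X; 𝒱_*) = ⨁_j F^{p+j}𝒜^{n+2j}(X) ⊗ 𝒱_{2j}`, as a group of currents. -/
def filteredForms [T2Space X] [SigmaCompactSpace X] [IsManifold (𝓡 d) ∞ X]
    (F : DeRhamFiltration d X) (𝒱 : ℤ → Submodule ℂ V) (p n : ℤ) :
    Submodule ℂ (CurrentFamily d X V) :=
  Submodule.span ℂ {S | ∃ (j : ℤ) (l : ℕ) (η : dForm d false l (⊤ : Opens X)), (l : ℤ) = n + 2 * j ∧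
    η ∈ F.F (p + j) l ⊤ ∧ ∃ v ∈ 𝒱 (2 * j), S = formCurrent η v}

open Classical in
/-- The current `σ ↦ ∫_S K^p(∇) ∧ h^*σ` for a part `S` of the domain `Z` of a geometric cycle over
`Y` and a map `h : Z → X`, where `K^p = (2πi)^p ∑_j K_j` for the multiplicative sequence of `Q`.
The orientations are determined by bases `w` of `T_{f z}Y` that correspond to the orientations of
the charts `chartAt (h z)` of `X`.  The integral is applied to the coefficients of the monomials
in the Chern forms, which are elements of `V`. -/
def pushCurrent {E : Type*} [NormedAddCommGroup E] [NormedSpace ℝ E] {H : Type*}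
    [TopologicalSpace H] {I : ModelWithCorners ℝ E H} {Y : Type*} [TopologicalSpace Y]
    [ChartedSpace H Y] [IsManifold I ∞ Y] {n : ℤ} (c : GeometricCycle I Y n) (S : Set c.Z)
    (h : c.Z → X) {D : ℕ} (w : Fin D → E) (Q : PowerSeries V) (p : ℤ) : CurrentFamily d X V :=
  fun _ σ => ((2 * Real.pi * Complex.I : ℂ) ^ p) • ∑ j ∈ Finset.range (c.m + 1),
    ∑ α ∈ (multSeq Q j).support,
      densityIntegral c.Z (fun i y =>
        if c.pt i y ∈ S then
          c.orientationSign i (c.pt i y) w * topCoeff c.m ((c.chernMonomial α i y).val *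
            toExt ((σ.1 (h (c.pt i y)) (chartAt (Eu d) (h (c.pt i y)) (h (c.pt i y)))
              ).compContinuousLinearMap
              ((mfderiv (𝓡 c.m) (𝓡 d) h (c.pt i y)).comp (c.coordVec i (c.pt i y)))))
        else 0) • (multSeq Q j).coeff α

variable [IsManifold (𝓡 d) ∞ X] {n : ℤ}

/-- The current `φ^p(c) = f_* K^p(∇)` of a geometric cycle. -/
def cyclePhi (Q : PowerSeries V) (p : ℤ) (c : GeometricCycle (𝓡 d) X n) : CurrentFamily d X V :=
  pushCurrent c Set.univ c.f stdVec Q p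

/-- The homomorphism `φ^p` on formal sums of geometric cycles. -/
def phi (Q : PowerSeries V) (p : ℤ) :
    FreeAbelianGroup (GeometricCycle (𝓡 d) X n) →+ CurrentFamily d X V :=
  FreeAbelianGroup.lift (cyclePhi Q p)

variable (d X n) in
/-- Geometric bordism data over `X`: geometric cycles over `ℝ × X` for which `0` and `1` are regular
values of the component in `ℝ`. -/
def BordismDatum := {b : GeometricCycle (cylModel d) (ℝ × X) n // b.RegularAt 0 ∧ b.RegularAt 1}

/-- The boundary `∂b = f_1 - f_0`, on formal sums of geometric bordism data. -/
def boundary : FreeAbelianGroup (BordismDatum d X n) →+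
    FreeAbelianGroup (GeometricCycle (𝓡 d) X n) :=
  FreeAbelianGroup.lift fun b => FreeAbelianGroup.of (b.1.fiber 1 b.2.2) -
    FreeAbelianGroup.of (b.1.fiber 0 b.2.1)

/-- The basis of `T_{(t,x)}(ℝ × X) = ℝ ⊕ T_xX` which consists of `∂/∂t` and the coordinate vectors
of the chart at `x`. -/
def cylFrame (d : ℕ) : Fin (d + 1) → ℝ × Eu d :=
  Fin.cons (1, 0) fun x => (0, stdVec x)

/-- The current `ψ^p(b) = (-1)^n (f|_{W_{[0,1]}})_* K^p(∇)` of a geometric bordism datum. -/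
def bordismPsi (Q : PowerSeries V) (p : ℤ) (b : BordismDatum d X n) : CurrentFamily d X V :=
  ((-1 : ℂ) ^ n) • pushCurrent b.1 (b.1.c ⁻¹' Set.Icc 0 1) b.1.fX (cylFrame d) Q p

/-- The homomorphism `ψ^p` on formal sums of geometric bordism data. -/
def psi (Q : PowerSeries V) (p : ℤ) :
    FreeAbelianGroup (BordismDatum d X n) →+ CurrentFamily d X V :=
  FreeAbelianGroup.lift (bordismPsi Q p)

/-- The group `ZMU^n(p)(X)` of Hodge filtered cycles: the subgroup of the pairs `(f, h)` in
`CycleGroup × 𝒟^{n-1}(X; 𝒱_*)/d𝒟^{n-2}(X; 𝒱_*)` with `φ^p(f) - dh ∈ F^p𝒜^n(X; 𝒱_*)`. -/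
def hodgeFilteredCycles [T2Space X] [SigmaCompactSpace X] (F : DeRhamFiltration d X)
    (𝒱 : ℤ → Submodule ℂ V) (Q : PowerSeries V) (n p : ℤ) :
    AddSubgroup (CycleGroup (𝓡 d) X n × (currents d X 𝒱 (n - 1) ⧸ exactCurrents d X 𝒱 (n - 1))) :=
  AddSubgroup.map
    (AddMonoidHom.prodMap (QuotientAddGroup.mk' (AddSubgroup.closure (cycleRelations (𝓡 d) X n)))
      (exactCurrents d X 𝒱 (n - 1)).mkQ.toAddMonoidHom)
    (AddSubgroup.comap
      ((phi Q p).comp (AddMonoidHom.fst _ _) - (dCurrent.toAddMonoidHom.comp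
        (currents d X 𝒱 (n - 1)).subtype.toAddMonoidHom).comp (AddMonoidHom.snd _ _))
      (filteredForms F 𝒱 p n).toAddSubgroup)

end Currents

end HodgeFiltered

end

open HodgeFiltered

set_option linter.unusedSectionVars false

noncomputable section

namespace HodgeFiltered

/-! The statement is Stokes' formula on the part of `W` between two level sets of `c`. Chern forms
are closed and of even degree, so `d(K ∧ f^*σ) = K ∧ f^*dσ` for a test form `σ` of degree `k`. Hence
`ψ(b)(dσ)` is, up to the factor `(-1)^n`, the integral of an exact form over `c⁻¹[0,1]`. By Stokes
this is the integral over `W_1` minus the integral over `W_0`, that is `φ(f_1)(σ) - φ(f_0)(σ)`. A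
Chern monomial of weight `j` contributes only if `2j + k + 1 = m`, where `m = dim W` and `m + n = d
+ 1`. Then the sign `(-1)^(d-k)` in the definition of `d` on currents equals `(-1)^(n+2j)` and
cancels the `(-1)^n` of `ψ`. The difference `φ(∂b) - dψ(b)` is therefore zero and lies in every step
of the Hodge filtration.

Forms are treated in coordinates as functions with values in the exterior algebra, with `dE = ∑ dx_j
∂_j`. Closedness of all Chern forms at once (`chernOf_mem_smooth`) comes from the Bianchi identity:
it says that the first jet of the curvature matrix, over a square-zero extension, is conjugate to a
constant matrix, so the coefficients of its characteristic polynomial have no derivative. The same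
conjugation principle (`charpolyRev_eq_of_conj`) gives independence of the trivialization
(`chernOf_gauge`); naturality is `chernOf_pullback`.

`W` itself need not be orientable. The test form is twisted by the orientation bundle of `X`, and
the complex orientation of `b` orients `W` relative to `ℝ × X`; together they make the integrand a
form twisted by the orientation bundle of `W` (`TwistedFamily`), whose exterior derivative is a
density. Two facts about orientations are needed: the relative sign is locally constant, up to the
orientation characters of the charts of `X` (`eventually_orientationSign`), and a fibre with its
induced complex orientation carries the boundary orientation (`orientationSign_fiber`). Both follow
by evaluating one volume form on frames adapted to the extension of the normal space by the tangent
space (`exists_blockDet`), together with the positivity of complex-linear determinants.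

Stokes is proved for half spaces by Fubini and integration by parts, transported to charts whose
first coordinate is `c`, and globalized by a partition of unity (`stokes_sublevel_succ`,
`stokes_Icc`). A cut-off in the variable `c` makes supports compact, by properness of `b`. That
`ψ(b)` lies in `𝒟^{n-1}(X; 𝒱_*)` needs continuity of each push-forward (`isCurrent_cylIntegral`) and
the fact that the weight-`j` part of the multiplicative sequence has coefficients in `𝒱_{2j}`
(`coeff_multSeq`). -/

/-- The basis of the exterior algebra formed by the products of the `dx_j`. -/
def extBasis (m : ℕ) : Module.Basis (Finset (Fin m)) ℂ (Ext m) :=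
  (Pi.basisFun ℂ (Fin m)).ExteriorAlgebra

/-- Left multiplication, as an embedding of the exterior algebra into a normed algebra. -/
def extLeftMul (m : ℕ) : Ext m →ₐ[ℂ] ((Finset (Fin m) → ℂ) →L[ℂ] (Finset (Fin m) → ℂ)) :=
  ((Module.End.toContinuousLinearMap (𝕜 := ℂ) (Finset (Fin m) → ℂ)).toAlgHom.comp
    ((extBasis m).equivFun.conjAlgEquiv ℂ).toAlgHom).comp (Algebra.lmul ℂ (Ext m))

theorem extLeftMul_injective (m : ℕ) : Function.Injective (extLeftMul m) := by
  refine ((Module.End.toContinuousLinearMap (𝕜 := ℂ) _).injective.comp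
    ((extBasis m).equivFun.conjAlgEquiv ℂ).injective).comp Algebra.lmul_injective

/-- A submultiplicative norm is what lets the product rule of calculus apply to functions with
values in forms. It is induced from the operator algebra, into which the exterior algebra embeds by
left multiplication; in finite dimensions the particular norm does not matter. -/
instance extNormedRing (m : ℕ) : NormedRing (Ext m) :=
  NormedRing.induced _ _ (extLeftMul m) (extLeftMul_injective m)

instance extNormedAlgebra (m : ℕ) : NormedAlgebra ℂ (Ext m) :=
  NormedAlgebra.induced ℂ _ _ (extLeftMul m)

instance extFiniteDimensional (m : ℕ) : FiniteDimensional ℂ (Ext m) :=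
  Module.Basis.finiteDimensional_of_finite (extBasis m)

/-- Fixes the real scalar action to be the one underlying the complex normed structure, ahead of any
other that instance search could find, so that all real derivatives refer to the same action. -/
instance (priority := 2000) extRealSMul (m : ℕ) : SMul ℝ (Ext m) :=
  (NormedSpace.complexToReal (E := Ext m)).toModule.toSMul

variable {m m' m'' k : ℕ}

/-- The coefficient of a basis vector of the exterior algebra, as a continuous linear map. -/
def extCoord (I : Finset (Fin m)) : Ext m →L[ℝ] ℂ :=
  (LinearMap.toContinuousLinearMap ((extBasis m).coord I)).restrictScalars ℝ

theorem sum_extCoord_smul (x : Ext m) : ∑ I, extCoord I x • extBasis m I = x :=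
  (extBasis m).sum_repr x

/-- `topCoeff` as a continuous linear map. -/
def topCoeffL (m : ℕ) : Ext m →L[ℝ] ℂ :=
  (LinearMap.toContinuousLinearMap (topCoeff m)).restrictScalars ℝ

theorem topCoeffL_apply (x : Ext m) : topCoeffL m x = topCoeff m x := rfl

/-! ### Pullback in the exterior algebra -/

/-- The matrix of a linear map, with complex entries. -/
def matOf (L : Eu m' →L[ℝ] Eu m) : Matrix (Fin m) (Fin m') ℂ := fun j x => (L (stdVec x) j : ℂ)

theorem sum_coord_smul_stdVec (v : Eu m) : ∑ j, v j • (stdVec j : Eu m) = v := by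
  ext i
  simp [stdVec, Finset.sum_apply, Pi.single_apply]

theorem matOf_comp (L : Eu m' →L[ℝ] Eu m) (L' : Eu m'' →L[ℝ] Eu m') :
    matOf (L.comp L') = matOf L * matOf L' := by
  ext j x
  have h : L (L' (stdVec x)) = ∑ l, (L' (stdVec x)) l • L (stdVec l) := by
    conv_lhs => rw [← sum_coord_smul_stdVec (L' (stdVec x))]
    simp only [map_sum, map_smul]
  simp only [matOf, Matrix.mul_apply, ContinuousLinearMap.comp_apply, h]
  simp [mul_comm]

theorem det_matOf (L : Eu m →L[ℝ] Eu m) : (matOf L).det = (L.det : ℂ) := by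
  have h1 : L.det = (LinearMap.toMatrix (EuclideanSpace.basisFun (Fin m) ℝ).toBasis
      (EuclideanSpace.basisFun (Fin m) ℝ).toBasis L.toLinearMap).det := by
    rw [LinearMap.det_toMatrix]
  rw [h1]
  have h2 := RingHom.map_det Complex.ofRealHom (LinearMap.toMatrix
      (EuclideanSpace.basisFun (Fin m) ℝ).toBasis
      (EuclideanSpace.basisFun (Fin m) ℝ).toBasis L.toLinearMap)
  refine Eq.trans ?_ h2.symm
  congr 1

/-- The pullback of the exterior algebra under a linear map. -/
def pb (L : Eu m' →L[ℝ] Eu m) : Ext m →ₐ[ℂ] Ext m' :=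
  ExteriorAlgebra.map (matOf L).vecMulLinear

theorem pb_ι (L : Eu m' →L[ℝ] Eu m) (a : Fin m → ℂ) :
    pb L (ExteriorAlgebra.ι ℂ a) = ∑ x, (∑ j, a j * (L (stdVec x) j : ℂ)) • dx x := by
  rw [pb, ExteriorAlgebra.map_apply_ι]
  have h : (matOf L).vecMulLinear a = ∑ x, (∑ j, a j * (L (stdVec x) j : ℂ)) • Pi.single x 1 := by
    ext x
    simp [Matrix.vecMul, dotProduct, matOf, Finset.sum_apply, Pi.single_apply]
  rw [h, map_sum]
  exact Finset.sum_congr rfl fun x _ => by rw [map_smul]; rfl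

theorem pb_dx (L : Eu m' →L[ℝ] Eu m) (j : Fin m) :
    pb L (dx j) = ∑ x, (L (stdVec x) j : ℂ) • dx x := by
  rw [dx, pb_ι]
  simp [Pi.single_apply]

theorem pb_comp (L : Eu m' →L[ℝ] Eu m) (L' : Eu m'' →L[ℝ] Eu m') (x : Ext m) :
    pb (L.comp L') x = pb L' (pb L x) := by
  rw [pb, pb, pb, ← AlgHom.comp_apply, ExteriorAlgebra.map_comp_map, matOf_comp]
  congr 2
  refine LinearMap.ext fun a => ?_
  simp [Matrix.vecMul_vecMul]

theorem topCoeff_ιMulti (v : Fin m → Fin m → ℂ) :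
    topCoeff m (ExteriorAlgebra.ιMulti ℂ m v) = Matrix.det (Matrix.of v) := by
  rw [topCoeff, ExteriorAlgebra.liftAlternating_apply_ιMulti]
  simp
  rfl

theorem topCoeff_ιMulti_of_ne (h : k ≠ m) (v : Fin k → Fin m → ℂ) :
    topCoeff m (ExteriorAlgebra.ιMulti ℂ k v) = 0 := by
  rw [topCoeff, ExteriorAlgebra.liftAlternating_apply_ιMulti, Pi.single_eq_of_ne h]
  rfl

/-- Wedges of covectors span, so it suffices to compare on them. In degree `m` this is
multiplicativity of the determinant; in other degrees both sides vanish. It is the algebraic half of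
the change of variables formula. -/
theorem topCoeff_pb (L : Eu m →L[ℝ] Eu m) (x : Ext m) :
    topCoeff m (pb L x) = (L.det : ℂ) * topCoeff m x := by
  have h : (topCoeff m) ∘ₗ (pb L).toLinearMap = (L.det : ℂ) • topCoeff m := by
    refine ExteriorAlgebra.lhom_ext fun k => ?_
    ext v
    simp only [LinearMap.compAlternatingMap_apply, LinearMap.comp_apply, AlgHom.toLinearMap_apply,
      LinearMap.smul_apply, smul_eq_mul]
    rw [pb, ExteriorAlgebra.map_apply_ιMulti]
    by_cases hk : k = m
    · subst hk
      rw [topCoeff_ιMulti, topCoeff_ιMulti, ← det_matOf, mul_comm, ← Matrix.det_mul]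
      rfl
    · rw [topCoeff_ιMulti_of_ne hk, topCoeff_ιMulti_of_ne hk, mul_zero]
  exact DFunLike.congr_fun h x

theorem toExt_eq (η : Eu m [⋀^Fin k]→L[ℝ] ℂ) :
    toExt η = ((Nat.factorial k : ℂ))⁻¹ • ∑ s : Fin k → Fin m,
      η (fun j => stdVec (s j)) • ExteriorAlgebra.ιMulti ℂ k (fun j => Pi.single (s j) 1) := rfl

/-- `toExt` as a continuous linear map. -/
def toExtL (m k : ℕ) : (Eu m [⋀^Fin k]→L[ℝ] ℂ) →L[ℝ] Ext m :=
  ((Nat.factorial k : ℂ))⁻¹ • ∑ s : Fin k → Fin m,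
    (ContinuousAlternatingMap.apply ℝ (Eu m) ℂ (fun j => stdVec (s j))).smulRight
      (ExteriorAlgebra.ιMulti ℂ k (fun j => Pi.single (s j) 1))

theorem toExtL_apply (η : Eu m [⋀^Fin k]→L[ℝ] ℂ) : toExtL m k η = toExt η := by
  simp [toExtL, toExt_eq]

/-- Expanding each `L^*dx` on one side and each `L e_r` on the other turns both into the same double
sum over index tuples `s` and `r`. Since all tuples are summed, not only increasing ones, no minors
have to be collected. -/
theorem pb_toExt (L : Eu m' →L[ℝ] Eu m) (η : Eu m [⋀^Fin k]→L[ℝ] ℂ) :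
    pb L (toExt η) = toExt (η.compContinuousLinearMap L) := by
  rw [toExt_eq, toExt_eq, map_smul, map_sum]
  congr 1
  have h1 : ∀ s : Fin k → Fin m, pb L (η (fun j => stdVec (s j)) •
      ExteriorAlgebra.ιMulti ℂ k (fun j => Pi.single (s j) 1)) =
      ∑ r : Fin k → Fin m', η (fun j => stdVec (s j)) • (∏ j, (L (stdVec (r j)) (s j) : ℂ)) •
        ExteriorAlgebra.ιMulti ℂ k (fun j => Pi.single (r j) 1) := by
    intro s
    rw [map_smul, pb, ExteriorAlgebra.map_apply_ιMulti, ← Finset.smul_sum]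
    congr 1
    have h2 : (⇑(matOf L).vecMulLinear ∘ fun j => Pi.single (s j) (1 : ℂ)) =
        fun j => ∑ x, (L (stdVec x) (s j) : ℂ) • (Pi.single x 1 : Fin m' → ℂ) := by
      funext j
      ext x
      simp [Finset.sum_apply, Pi.single_apply, matOf]
    rw [h2]
    refine ((ExteriorAlgebra.ιMulti ℂ k).toMultilinearMap.map_sum
      (fun j x => (L (stdVec x) (s j) : ℂ) • (Pi.single x 1 : Fin m' → ℂ))).trans ?_
    refine Finset.sum_congr rfl fun r _ => ?_
    exact (ExteriorAlgebra.ιMulti ℂ k).toMultilinearMap.map_smul_univ _ _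
  rw [Finset.sum_congr rfl fun s _ => h1 s, Finset.sum_comm]
  refine Finset.sum_congr rfl fun r _ => ?_
  simp only [smul_smul]
  rw [← Finset.sum_smul]
  congr 1
  have h3 : (fun j => L (stdVec (r j))) =
      fun j => ∑ x, (L (stdVec (r j)) x) • (stdVec x : Eu m) := by
    funext j
    rw [sum_coord_smul_stdVec]
  change _ = η (fun j => L (stdVec (r j)))
  rw [h3]
  refine Eq.symm ((η.toMultilinearMap.map_sum
    (fun j x => (L (stdVec (r j)) x) • (stdVec x : Eu m))).trans ?_)
  refine Finset.sum_congr rfl fun s _ => ?_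
  refine (η.toMultilinearMap.map_smul_univ _ _).trans ?_
  rw [← Complex.coe_smul, smul_eq_mul, mul_comm]
  simp

/-! ### The exterior derivative of functions with values in the exterior algebra -/

section ExteriorDerivative

variable {m m' k : ℕ}

/-- The exterior derivative `∑ dx_j ∂_j ξ` of a form in coordinates. -/
def dE (ξ : Eu m → Ext m) (y : Eu m) : Ext m := ∑ j, dx j * fderiv ℝ ξ y (stdVec j)

theorem dE_congr {ξ ξ' : Eu m → Ext m} {y : Eu m} (h : ξ =ᶠ[𝓝 y] ξ') : dE ξ y = dE ξ' y := by
  simp only [dE, h.fderiv_eq]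

theorem dE_const (x : Ext m) (y : Eu m) : dE (fun _ => x) y = 0 := by
  simp [dE]

theorem dE_add {ξ ξ' : Eu m → Ext m} {y : Eu m} (h : DifferentiableAt ℝ ξ y)
    (h' : DifferentiableAt ℝ ξ' y) : dE (fun z => ξ z + ξ' z) y = dE ξ y + dE ξ' y := by
  simp only [dE, fderiv_fun_add h h', add_apply, mul_add,
    Finset.sum_add_distrib]

theorem dE_sum {ι : Type*} (s : Finset ι) {ξ : ι → Eu m → Ext m} {y : Eu m}
    (h : ∀ i ∈ s, DifferentiableAt ℝ (ξ i) y) :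
    dE (fun z => ∑ i ∈ s, ξ i z) y = ∑ i ∈ s, dE (ξ i) y := by
  simp only [dE, fderiv_fun_sum h, sum_apply, Finset.mul_sum]
  exact Finset.sum_comm

theorem dE_const_smul (c : ℂ) {ξ : Eu m → Ext m} {y : Eu m} (h : DifferentiableAt ℝ ξ y) :
    dE (fun z => c • ξ z) y = c • dE ξ y := by
  simp only [dE, fderiv_fun_const_smul h, smul_apply, mul_smul_comm,
    Finset.smul_sum]

/-- The differential of a function. -/
def dFun (a : Eu m → ℂ) (y : Eu m) : Ext m := ∑ j, fderiv ℝ a y (stdVec j) • dx j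

theorem dE_smul {a : Eu m → ℂ} {ξ : Eu m → Ext m} {y : Eu m} (ha : DifferentiableAt ℝ a y)
    (h : DifferentiableAt ℝ ξ y) :
    dE (fun z => a z • ξ z) y = dFun a y * ξ y + a y • dE ξ y := by
  simp only [dE, dFun, Finset.sum_mul, Finset.smul_sum, ← Finset.sum_add_distrib]
  refine Finset.sum_congr rfl fun j _ => ?_
  rw [fderiv_fun_smul ha h]
  simp only [add_apply, smul_apply,
    ContinuousLinearMap.smulRight_apply, mul_add, mul_smul_comm, smul_mul_assoc]
  rw [add_comm]

/-- The Leibniz rule for an even factor. The only input is that `dx j` passes the value `a y`, so no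
grading of the exterior algebra has to be set up; the anticommuting version plays the role of an odd
factor. -/
theorem dE_mul_of_commute {a ξ : Eu m → Ext m} {y : Eu m} (ha : DifferentiableAt ℝ a y)
    (h : DifferentiableAt ℝ ξ y) (hc : ∀ j, dx j * a y = a y * dx j) :
    dE (fun z => a z * ξ z) y = dE a y * ξ y + a y * dE ξ y := by
  simp only [dE, Finset.sum_mul, Finset.mul_sum, ← Finset.sum_add_distrib]
  refine Finset.sum_congr rfl fun j _ => ?_
  rw [fderiv_fun_mul' ha h]
  simp only [add_apply, smul_apply, smul_eq_mul,
    op_smul_eq_mul, mul_add, ← mul_assoc, hc j]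
  rw [add_comm]

theorem dE_mul_of_anticommute {a ξ : Eu m → Ext m} {y : Eu m} (ha : DifferentiableAt ℝ a y)
    (h : DifferentiableAt ℝ ξ y) (hc : ∀ j, dx j * a y = -(a y * dx j)) :
    dE (fun z => a z * ξ z) y = dE a y * ξ y - a y * dE ξ y := by
  simp only [dE, Finset.sum_mul, Finset.mul_sum, ← Finset.sum_sub_distrib]
  refine Finset.sum_congr rfl fun j _ => ?_
  rw [fderiv_fun_mul' ha h]
  simp only [add_apply, smul_apply, smul_eq_mul,
    op_smul_eq_mul, mul_add, ← mul_assoc, hc j]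
  rw [add_comm, neg_mul, sub_eq_add_neg]

theorem dx_mul_sum_smul_dx (j : Fin m) (c : Fin m → ℂ) :
    dx j * ∑ x, c x • dx x = -((∑ x, c x • dx x) * dx j) := by
  simp only [Finset.mul_sum, Finset.sum_mul, ← Finset.sum_neg_distrib]
  refine Finset.sum_congr rfl fun x _ => ?_
  rw [mul_smul_comm, dx_mul_dx, smul_mul_assoc, smul_neg]

theorem eq_zero_of_eq_neg {x : Ext m} (h : x = -x) : x = 0 := by
  have h1 : (2 : ℂ) • x = 0 := by
    rw [two_smul]
    nth_rewrite 1 [h]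
    exact neg_add_cancel x
  exact (smul_eq_zero.1 h1).resolve_left two_ne_zero

theorem sum_symm_smul_dx_mul_dx (c : Fin m → Fin m → ℂ) (hc : ∀ i j, c i j = c j i) :
    ∑ i, ∑ j, c i j • (dx i * dx j : Ext m) = 0 := by
  have h : ∑ i, ∑ j, c i j • (dx i * dx j : Ext m) =
      -∑ i, ∑ j, c i j • (dx i * dx j : Ext m) := by
    conv_lhs => rw [Finset.sum_comm]
    simp only [← Finset.sum_neg_distrib]
    refine Finset.sum_congr rfl fun i _ => Finset.sum_congr rfl fun j _ => ?_
    rw [dx_mul_dx, smul_neg, hc]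
  exact eq_zero_of_eq_neg h

theorem differentiableAt_sum_smul_dx {a : Fin m → Eu m → ℂ} {y : Eu m}
    (ha : ∀ x, DifferentiableAt ℝ (a x) y) :
    DifferentiableAt ℝ (fun z => ∑ x, a x z • (dx x : Ext m)) y :=
  DifferentiableAt.fun_sum fun x _ => (ha x).smul_const _

theorem dE_sum_smul_dx {a : Fin m → Eu m → ℂ} {y : Eu m} (ha : ∀ x, DifferentiableAt ℝ (a x) y) :
    dE (fun z => ∑ x, a x z • dx x) y =
      ∑ j, ∑ x, fderiv ℝ (a x) y (stdVec j) • (dx j * dx x) := by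
  rw [dE]
  refine Finset.sum_congr rfl fun j _ => ?_
  rw [fderiv_fun_sum fun x _ => (ha x).smul_const _]
  simp only [sum_apply, Finset.mul_sum]
  refine Finset.sum_congr rfl fun x _ => ?_
  rw [fderiv_smul_const (ha x)]
  simp

/-- Symmetric second derivatives are paired with the antisymmetric products `dx_j dx_x`. -/
theorem dE_dE {ξ : Eu m → Ext m} {y : Eu m} (h : ContDiffAt ℝ ∞ ξ y) : dE (dE ξ) y = 0 := by
  have hd : ContDiffAt ℝ ∞ (fderiv ℝ ξ) y := h.fderiv_right (by simp)
  have hd' : DifferentiableAt ℝ (fderiv ℝ ξ) y := hd.differentiableAt (by simp)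
  have hs : IsSymmSndFDerivAt ℝ ξ y := h.isSymmSndFDerivAt (by simpa using two_le_infty)
  have h1 : ∀ j, fderiv ℝ (dE ξ) y (stdVec j) =
      ∑ x, dx x * fderiv ℝ (fderiv ℝ ξ) y (stdVec j) (stdVec x) := by
    intro j
    have hx : ∀ x : Fin m, HasFDerivAt (fun z => dx x * fderiv ℝ ξ z (stdVec x))
        ((ContinuousLinearMap.mul ℝ (Ext m) (dx x)).comp
          ((fderiv ℝ (fderiv ℝ ξ) y).flip (stdVec x))) y := fun x =>
      (ContinuousLinearMap.mul ℝ (Ext m) (dx x)).hasFDerivAt.comp y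
        (hd'.hasFDerivAt.clm_apply (hasFDerivAt_const (stdVec x) y) |>.congr_fderiv (by
          ext v; simp))
    have h2 : HasFDerivAt (dE ξ) _ y := HasFDerivAt.fun_sum (u := Finset.univ) fun x _ => hx x
    rw [h2.fderiv]
    simp
  rw [dE]
  simp only [h1, Finset.mul_sum, ← mul_assoc]
  have h3 : ∑ j, ∑ x, (dx j * dx x : Ext m) * fderiv ℝ (fderiv ℝ ξ) y (stdVec j) (stdVec x) =
      -∑ j, ∑ x, (dx j * dx x : Ext m) * fderiv ℝ (fderiv ℝ ξ) y (stdVec j) (stdVec x) := by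
    conv_lhs => rw [Finset.sum_comm]
    simp only [← Finset.sum_neg_distrib]
    refine Finset.sum_congr rfl fun i _ => Finset.sum_congr rfl fun j _ => ?_
    rw [dx_mul_dx, neg_mul, hs.eq]
  exact eq_zero_of_eq_neg h3

/-! ### Pullback of forms under smooth maps -/

/-- `pb L x` is polynomial in the matrix entries of `L`, which is seen by induction on words in the
generators. -/
theorem contDiffAt_pb_const {E : Type*} [NormedAddCommGroup E] [NormedSpace ℝ E] {n : ℕ∞ω}
    {A : E → Eu m' →L[ℝ] Eu m} {y : E} (hA : ContDiffAt ℝ n A y) (x : Ext m) :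
    ContDiffAt ℝ n (fun z => pb (A z) x) y := by
  induction x using CliffordAlgebra.left_induction with
  | algebraMap r =>
    have h : (fun z => pb (A z) (algebraMap ℂ (Ext m) r)) = fun _ => algebraMap ℂ (Ext m') r :=
      funext fun z => AlgHom.commutes _ _
    exact h ▸ contDiffAt_const
  | add x y hx hy => simpa only [map_add] using hx.add hy
  | ι_mul x v hx =>
    simp only [map_mul]
    refine ContDiffAt.mul ?_ hx
    have h : (fun z => pb (A z) (CliffordAlgebra.ι _ v)) =
      fun z => ∑ x, (∑ j, v j * (A z (stdVec x) j : ℂ)) • dx x := funext fun z => pb_ι (A z) v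
    rw [h]
    refine ContDiffAt.sum fun x _ => ContDiffAt.fun_smul ?_ contDiffAt_const
    refine ContDiffAt.sum fun j _ => contDiffAt_const.mul ?_
    have h2 : ContDiffAt ℝ n (fun z => A z (stdVec x)) y := hA.clm_apply contDiffAt_const
    exact Complex.ofRealCLM.contDiff.contDiffAt.comp y
      ((EuclideanSpace.proj (𝕜 := ℝ) j).contDiff.contDiffAt.comp y h2)

/-- Separates the dependence on `L` from that on `x`: the coefficients depend on `x` alone and the
pulled-back basis vectors on `L` alone. -/
theorem pb_eq_sum (L : Eu m' →L[ℝ] Eu m) (x : Ext m) :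
    pb L x = ∑ I, extCoord I x • pb L (extBasis m I) := by
  conv_lhs => rw [← sum_extCoord_smul x]
  simp only [map_sum, map_smul]

theorem contDiffAt_pb {E : Type*} [NormedAddCommGroup E] [NormedSpace ℝ E] {n : ℕ∞ω}
    {A : E → Eu m' →L[ℝ] Eu m} {ξ : E → Ext m} {y : E} (hA : ContDiffAt ℝ n A y)
    (hξ : ContDiffAt ℝ n ξ y) : ContDiffAt ℝ n (fun z => pb (A z) (ξ z)) y := by
  simp only [fun z => pb_eq_sum (A z) (ξ z)]
  exact ContDiffAt.sum fun I _ => ((extCoord I).contDiff.contDiffAt.comp y hξ).smul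
    (contDiffAt_pb_const hA _)

/-- The pullback of a constant `1`-form is the differential of a function, so its exterior
derivative is the second derivative of `g` contracted with `dx_i dx_j`, and vanishes by symmetry.
Products of generators follow from the Leibniz rule. -/
theorem dE_pb_const {g : Eu m' → Eu m} {y : Eu m'} (hg : ContDiffAt ℝ ∞ g y) (x : Ext m) :
    dE (fun z => pb (fderiv ℝ g z) x) y = 0 := by
  have hd : ContDiffAt ℝ ∞ (fderiv ℝ g) y := hg.fderiv_right (by simp)
  have hs : IsSymmSndFDerivAt ℝ g y := hg.isSymmSndFDerivAt (by simpa using two_le_infty)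
  have hdiff : ∀ x : Ext m, DifferentiableAt ℝ (fun z => pb (fderiv ℝ g z) x) y := fun x =>
    (contDiffAt_pb_const hd x).differentiableAt (by simp)
  induction x using CliffordAlgebra.left_induction with
  | algebraMap r =>
    have h : (fun z => pb (fderiv ℝ g z) (algebraMap ℂ (Ext m) r)) =
      fun _ => algebraMap ℂ (Ext m') r := funext fun z => AlgHom.commutes _ _
    exact (congrArg (fun ξ => dE ξ y) h).trans (dE_const _ _)
  | add x x' hx hx' =>
    simp only [map_add]
    rw [dE_add (hdiff x) (hdiff x'), hx, hx', add_zero]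
  | ι_mul x v hx =>
    simp only [map_mul]
    let l : Eu m →L[ℝ] ℂ := ∑ j, v j • (Complex.ofRealCLM.comp (EuclideanSpace.proj (𝕜 := ℝ) j))
    have h : (fun z => pb (fderiv ℝ g z) (CliffordAlgebra.ι _ v)) =
        fun z => ∑ x, l (fderiv ℝ g z (stdVec x)) • dx x := by
      funext z
      refine (pb_ι (fderiv ℝ g z) v).trans ?_
      simp [l, sum_apply]
    have ha : ∀ x : Fin m', HasFDerivAt (fun z => l (fderiv ℝ g z (stdVec x)))
        (l.comp ((fderiv ℝ (fderiv ℝ g) y).flip (stdVec x))) y := fun x =>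
      l.hasFDerivAt.comp y ((hd.differentiableAt (by simp)).hasFDerivAt.clm_apply
        (hasFDerivAt_const (stdVec x) y) |>.congr_fderiv (by ext v; simp))
    rw [dE_mul_of_anticommute (hdiff _) (hdiff x), hx, mul_zero, sub_zero]
    · rw [h, dE_sum_smul_dx fun x => (ha x).differentiableAt]
      rw [sum_symm_smul_dx_mul_dx _ fun i j => ?_, zero_mul]
      rw [(ha _).fderiv, (ha _).fderiv]
      simp only [ContinuousLinearMap.comp_apply, ContinuousLinearMap.flip_apply]
      rw [hs.eq]
    · intro j
      have := congrFun h y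
      rw [this]
      exact dx_mul_sum_smul_dx j _

theorem dFun_comp {g : Eu m' → Eu m} {y : Eu m'} (hg : DifferentiableAt ℝ g y) {a : Eu m → ℂ}
    (ha : DifferentiableAt ℝ a (g y)) :
    dFun (fun z => a (g z)) y = pb (fderiv ℝ g y) (dFun a (g y)) := by
  simp only [dFun, map_sum, map_smul, pb_dx, Finset.smul_sum, smul_smul]
  rw [Finset.sum_comm]
  refine Finset.sum_congr rfl fun x _ => ?_
  rw [← Finset.sum_smul]
  congr 1
  rw [show (fun z => a (g z)) = a ∘ g from rfl, fderiv_comp y ha hg, ContinuousLinearMap.comp_apply]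
  conv_lhs => rw [← sum_coord_smul_stdVec (fderiv ℝ g y (stdVec x))]
  simp [mul_comm]

/-- The exterior derivative commutes with the pullback under smooth maps. -/
theorem dE_pb {g : Eu m' → Eu m} {y : Eu m'} (hg : ContDiffAt ℝ ∞ g y) {ξ : Eu m → Ext m}
    (hξ : DifferentiableAt ℝ ξ (g y)) :
    dE (fun z => pb (fderiv ℝ g z) (ξ (g z))) y = pb (fderiv ℝ g y) (dE ξ (g y)) := by
  have hd : ContDiffAt ℝ ∞ (fderiv ℝ g) y := hg.fderiv_right (by simp)
  have hg' : DifferentiableAt ℝ g y := hg.differentiableAt (by simp)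
  have hdiff : ∀ x : Ext m, DifferentiableAt ℝ (fun z => pb (fderiv ℝ g z) x) y := fun x =>
    (contDiffAt_pb_const hd x).differentiableAt (by simp)
  have hc : ∀ I, DifferentiableAt ℝ (fun u => extCoord I (ξ u)) (g y) := fun I =>
    (extCoord I).differentiableAt.comp _ hξ
  -- A form is a sum of scalar functions times constant forms. The functions obey the chain rule
  -- `dFun_comp`, and the pulled-back constant forms are closed.
  simp only [fun z => pb_eq_sum (fderiv ℝ g z) (ξ (g z))]
  rw [dE_sum Finset.univ (ξ := fun I z => extCoord I (ξ (g z)) • pb (fderiv ℝ g z) (extBasis m I))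
    fun I _ => ((hc I).comp y hg').fun_smul (hdiff _)]
  have h2 : ξ = fun u => ∑ I, extCoord I (ξ u) • extBasis m I :=
    funext fun u => (sum_extCoord_smul _).symm
  have h3 : dE ξ (g y) = ∑ I, dFun (fun u => extCoord I (ξ u)) (g y) * extBasis m I := by
    conv_lhs => rw [h2]
    rw [dE_sum _ fun I _ => (hc I).smul_const _]
    refine Finset.sum_congr rfl fun I _ => ?_
    rw [dE_smul (hc I) (differentiableAt_const _), dE_const, smul_zero, add_zero]
  rw [h3, map_sum]
  refine Finset.sum_congr rfl fun I _ => ?_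
  have h4 := dE_smul (a := fun z => extCoord I (ξ (g z)))
    (ξ := fun z => pb (fderiv ℝ g z) (extBasis m I)) ((hc I).comp y hg') (hdiff (extBasis m I))
  rw [h4, dE_pb_const hg, smul_zero, add_zero, map_mul,
    dFun_comp hg' (a := fun u => extCoord I (ξ u)) (hc I)]

/-- Moving the `i`-th factor of a wedge to the front produces a sign that cancels the one in
`extDeriv`. After summation over all index tuples the `k + 1` terms are therefore equal, and the
factor `k + 1` turns `1/(k+1)!` into `1/k!`. -/
theorem toExt_extDeriv {η : Eu m → Eu m [⋀^Fin k]→L[ℝ] ℂ} {y : Eu m}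
    (h : DifferentiableAt ℝ η y) : dE (fun z => toExt (η z)) y = toExt (extDeriv η y) := by
  have h1 : (fun z => toExt (η z)) = fun z => toExtL m k (η z) :=
    funext fun z => (toExtL_apply _).symm
  have h2 : HasFDerivAt (fun z => toExt (η z)) ((toExtL m k).comp (fderiv ℝ η y)) y := by
    rw [h1]
    exact (toExtL m k).hasFDerivAt.comp y h.hasFDerivAt
  rw [dE, h2.fderiv]
  simp only [ContinuousLinearMap.comp_apply, toExtL_apply]
  rw [toExt_eq]
  have h3 : ∀ s : Fin (k + 1) → Fin m, extDeriv η y (fun j => stdVec (s j)) •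
      ExteriorAlgebra.ιMulti ℂ (k + 1) (fun j => (Pi.single (s j) 1 : Fin m → ℂ)) =
      ∑ i, fderiv ℝ η y (stdVec (s i)) (fun j => stdVec (s (i.succAbove j))) • (dx (s i) *
        ExteriorAlgebra.ιMulti ℂ k (fun j => (Pi.single (s (i.succAbove j)) 1 : Fin m → ℂ))) := by
    intro s
    rw [extDeriv, ContinuousAlternatingMap.alternatizeUncurryFin_apply, Finset.sum_smul]
    refine Finset.sum_congr rfl fun i _ => ?_
    have h4 := AlternatingMap.neg_one_pow_smul_map_insertNth (ExteriorAlgebra.ιMulti ℂ (k + 1)) i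
      (Pi.single (s i) 1 : Fin m → ℂ) (fun j => (Pi.single (s (i.succAbove j)) 1 : Fin m → ℂ))
    have h5 : i.insertNth (Pi.single (s i) 1 : Fin m → ℂ)
        (fun j => (Pi.single (s (i.succAbove j)) 1 : Fin m → ℂ)) =
        fun j => (Pi.single (s j) 1 : Fin m → ℂ) :=
      Fin.insertNth_self_removeNth i (fun j => (Pi.single (s j) 1 : Fin m → ℂ))
    rw [h5] at h4
    have h6 : ExteriorAlgebra.ιMulti ℂ (k + 1) (Matrix.vecCons (Pi.single (s i) 1 : Fin m → ℂ)
        (fun j => (Pi.single (s (i.succAbove j)) 1 : Fin m → ℂ))) = dx (s i) *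
        ExteriorAlgebra.ιMulti ℂ k (fun j => (Pi.single (s (i.succAbove j)) 1 : Fin m → ℂ)) := by
      rw [ExteriorAlgebra.ιMulti_succ_apply]
      rfl
    rw [← h6, ← h4]
    rw [smul_comm, smul_assoc]
    rfl
  simp only [h3]
  rw [Finset.sum_comm]
  have h7 : ∀ i : Fin (k + 1), ∑ s : Fin (k + 1) → Fin m,
      fderiv ℝ η y (stdVec (s i)) (fun j => stdVec (s (i.succAbove j))) • (dx (s i) *
        ExteriorAlgebra.ιMulti ℂ k (fun j => (Pi.single (s (i.succAbove j)) 1 : Fin m → ℂ))) =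
      ∑ x, dx x * ∑ s : Fin k → Fin m, fderiv ℝ η y (stdVec x) (fun j => stdVec (s j)) •
        ExteriorAlgebra.ιMulti ℂ k (fun j => (Pi.single (s j) 1 : Fin m → ℂ)) := by
    intro i
    -- A tuple of length `k + 1` is its `i`-th entry `x` together with the remaining tuple of length
    -- `k`.
    rw [← (Fin.insertNthEquiv (fun _ => Fin m) i).sum_comp, Fintype.sum_prod_type]
    refine Finset.sum_congr rfl fun x _ => ?_
    rw [Finset.mul_sum]
    refine Finset.sum_congr rfl fun s _ => ?_
    simp [Fin.insertNthEquiv]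
  simp only [h7, Finset.sum_const, Finset.card_univ, Fintype.card_fin]
  simp only [toExt_eq, mul_smul_comm, ← Finset.smul_sum]
  rw [← Nat.cast_smul_eq_nsmul ℂ, smul_smul]
  congr 1
  rw [Nat.factorial_succ, Nat.cast_mul, mul_inv, mul_comm, ← mul_assoc, mul_inv_cancel₀, one_mul]
  exact_mod_cast Nat.succ_ne_zero k

end ExteriorDerivative

/-! ### The algebra of even forms -/

section EvenForms

variable {m m' k : ℕ}

/-- The inclusion of the even forms into all forms, as a homomorphism of algebras. -/
def EvenExt.valHom (m : ℕ) : EvenExt m →ₐ[ℂ] Ext m := (evenSubalgebra m).val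

theorem EvenExt.val_injective : Function.Injective (EvenExt.val (m := m)) := Subtype.val_injective

theorem EvenExt.val_smul (c : ℂ) (x : EvenExt m) : (c • x).val = c • x.val := rfl

theorem EvenExt.val_sum {ι : Type*} (s : Finset ι) (f : ι → EvenExt m) :
    (∑ i ∈ s, f i).val = ∑ i ∈ s, (f i).val :=
  map_sum (EvenExt.valHom m) f s

/-- The `dx_j` generate the exterior algebra, so commuting with them is being central. Even forms
qualify because two transpositions cancel in sign. -/
theorem commute_of_commute_dx {x : Ext m} (h : ∀ j, dx j * x = x * dx j) (y : Ext m) :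
    y * x = x * y := by
  induction y using CliffordAlgebra.left_induction with
  | algebraMap r => exact Algebra.commutes r x
  | add y y' hy hy' => rw [add_mul, mul_add, hy, hy']
  | ι_mul y v hy =>
    have hv : CliffordAlgebra.ι (0 : QuadraticForm ℂ (Fin m → ℂ)) v = ∑ j, v j • (dx j : Ext m) := by
      have h1 : v = ∑ j, v j • (Pi.single j 1 : Fin m → ℂ) := by
        ext x
        simp [Finset.sum_apply, Pi.single_apply]
      conv_lhs => rw [h1]
      simp only [map_sum, map_smul]
      rfl
    have h2 : CliffordAlgebra.ι (0 : QuadraticForm ℂ (Fin m → ℂ)) v * x =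
        x * CliffordAlgebra.ι (0 : QuadraticForm ℂ (Fin m → ℂ)) v := by
      rw [hv]
      simp only [Finset.sum_mul, Finset.mul_sum, smul_mul_assoc, mul_smul_comm, h]
    rw [mul_assoc, hy, ← mul_assoc, h2, mul_assoc]

theorem EvenExt.dx_mul_val (x : EvenExt m) (j : Fin m) : dx j * x.val = x.val * dx j := by
  obtain ⟨x, hx⟩ := x
  change dx j * x = x * dx j
  induction hx using Algebra.adjoin_induction with
  | mem x hx =>
    obtain ⟨a, b, rfl⟩ := hx
    rw [← mul_assoc, dx_mul_dx j a, neg_mul, mul_assoc, dx_mul_dx j b, mul_neg, neg_neg, mul_assoc]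
  | algebraMap r => exact (Algebra.commutes r _).symm
  | add x y _ _ hx hy => rw [mul_add, add_mul, hx, hy]
  | mul x y _ _ hx hy => rw [← mul_assoc, hx, mul_assoc, hy, mul_assoc]

theorem EvenExt.mul_val (x : EvenExt m) (y : Ext m) : y * x.val = x.val * y :=
  commute_of_commute_dx x.dx_mul_val y

theorem pb_mem_evenSubalgebra (L : Eu m' →L[ℝ] Eu m) {x : Ext m} (hx : x ∈ evenSubalgebra m) :
    pb L x ∈ evenSubalgebra m' := by
  induction hx using Algebra.adjoin_induction with
  | mem x hx =>
    obtain ⟨a, b, rfl⟩ := hx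
    rw [map_mul, pb_dx, pb_dx, Finset.sum_mul]
    refine Subalgebra.sum_mem _ fun x _ => ?_
    rw [Finset.mul_sum]
    refine Subalgebra.sum_mem _ fun x' _ => ?_
    rw [smul_mul_smul_comm]
    exact Subalgebra.smul_mem _ (Algebra.subset_adjoin (s := {x | ∃ a b : Fin m', x = dx a * dx b}) ⟨x, x', rfl⟩) _
  | algebraMap r => rw [AlgHom.commutes]; exact Subalgebra.algebraMap_mem _ _
  | add x y _ _ hx hy => rw [map_add]; exact Subalgebra.add_mem _ hx hy
  | mul x y _ _ hx hy => rw [map_mul]; exact Subalgebra.mul_mem _ hx hy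

/-- The pullback of even forms. -/
def pbEven (L : Eu m' →L[ℝ] Eu m) : EvenExt m →ₐ[ℂ] EvenExt m' :=
  AlgHom.codRestrict ((pb L).comp (evenSubalgebra m).val) (evenSubalgebra m')
    fun x => pb_mem_evenSubalgebra L x.2

theorem pbEven_val (L : Eu m' →L[ℝ] Eu m) (x : EvenExt m) : (pbEven L x).val = pb L x.val := rfl

/-- These instances turn `Ext m` into a symmetric bimodule over the commutative ring of even forms,
which makes `TrivSqZeroExt (EvenExt m) (Ext m)` a commutative ring, so that determinants can be
taken in it. -/
instance evenModule (m : ℕ) : Module (EvenExt m) (Ext m) :=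
  Module.compHom (Ext m) (EvenExt.valHom m).toRingHom

instance evenModuleOp (m : ℕ) : Module (EvenExt m)ᵐᵒᵖ (Ext m) :=
  Module.compHom (Ext m) ((RingHom.id (EvenExt m)).fromOpposite fun x y => Commute.all x y)

theorem even_smul_def (x : EvenExt m) (y : Ext m) : x • y = x.val * y := rfl

instance evenCentralScalar (m : ℕ) : IsCentralScalar (EvenExt m) (Ext m) := ⟨fun _ _ => rfl⟩

/-- The algebra of functions with values in the even forms which are smooth at `y`. -/
def smoothEven (m : ℕ) (y : Eu m) : Subalgebra ℂ (Eu m → EvenExt m) where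
  carrier := {f | ContDiffAt ℝ ∞ (fun z => (f z).val) y}
  mul_mem' {a b} (ha : ContDiffAt ℝ ∞ (fun z => (a z).val) y)
    (hb : ContDiffAt ℝ ∞ (fun z => (b z).val) y) := ContDiffAt.mul ha hb
  add_mem' {a b} (ha : ContDiffAt ℝ ∞ (fun z => (a z).val) y)
    (hb : ContDiffAt ℝ ∞ (fun z => (b z).val) y) := ContDiffAt.add ha hb
  algebraMap_mem' r := by
    have h : (fun z => ((algebraMap ℂ (Eu m → EvenExt m) r) z).val) = fun _ => algebraMap ℂ _ r :=
      rfl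
    exact (congrArg (fun f => ContDiffAt ℝ ∞ f y) h).mpr contDiffAt_const

/-- The value of a smooth function, together with its exterior derivative. -/
def firstJet (m : ℕ) (y : Eu m) : smoothEven m y →+* TrivSqZeroExt (EvenExt m) (Ext m) where
  toFun f := TrivSqZeroExt.inl (f.1 y) + TrivSqZeroExt.inr (dE (fun z => (f.1 z).val) y)
  map_one' := by
    have h : (fun z : Eu m => ((1 : smoothEven m y).1 z).val) = fun _ => 1 := rfl
    rw [h, dE_const, TrivSqZeroExt.inr_zero, add_zero]
    rfl
  map_zero' := by
    have h : (fun z : Eu m => ((0 : smoothEven m y).1 z).val) = fun _ => 0 := rfl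
    rw [h, dE_const, TrivSqZeroExt.inr_zero, add_zero]
    rfl
  -- Writing the jet as `f(y) + ε df(y)` with `ε² = 0`, multiplicativity is the Leibniz rule;
  -- centrality of even forms puts both terms on the same side.
  map_mul' f g := by
    have hf : ContDiffAt ℝ ∞ (fun z => (f.1 z).val) y := f.2
    have hg : ContDiffAt ℝ ∞ (fun z => (g.1 z).val) y := g.2
    have h := dE_mul_of_commute (hf.differentiableAt (by simp)) (hg.differentiableAt (by simp))
      fun j => (f.1 y).dx_mul_val j
    have h1 : (fun z => ((f * g).1 z).val) = fun z => (f.1 z).val * (g.1 z).val := rfl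
    rw [h1, h]
    ext
    · simp
    · simp only [TrivSqZeroExt.snd_add, TrivSqZeroExt.snd_inl, TrivSqZeroExt.snd_inr,
        TrivSqZeroExt.snd_mul, TrivSqZeroExt.fst_add, TrivSqZeroExt.fst_inl,
        TrivSqZeroExt.fst_inr, zero_add, add_zero, op_smul_eq_smul]
      rw [even_smul_def, even_smul_def, EvenExt.mul_val, add_comm]
  map_add' f g := by
    have hf : ContDiffAt ℝ ∞ (fun z => (f.1 z).val) y := f.2
    have hg : ContDiffAt ℝ ∞ (fun z => (g.1 z).val) y := g.2
    have h := dE_add (hf.differentiableAt (by simp)) (hg.differentiableAt (by simp))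
    have h1 : (fun z => ((f + g).1 z).val) = fun z => (f.1 z).val + (g.1 z).val := rfl
    rw [h1, h]
    ext <;> simp

theorem snd_firstJet {y : Eu m} (f : smoothEven m y) :
    (firstJet m y f).snd = dE (fun z => (f.1 z).val) y := by
  simp [firstJet]

/-- The evaluation of smooth functions. -/
def evalEven (m : ℕ) (y z : Eu m) : smoothEven m y →+* EvenExt m :=
  (Pi.evalRingHom (fun _ => EvenExt m) z).comp (smoothEven m y).subtype

/-- The closed even forms are an algebra. -/
def closedEven (m : ℕ) (y : Eu m) : Subalgebra ℂ (Eu m → EvenExt m) where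
  carrier := {f | ContDiffAt ℝ ∞ (fun z => (f z).val) y ∧ dE (fun z => (f z).val) y = 0}
  mul_mem' {a b} ha hb := by
    refine ⟨ContDiffAt.mul ha.1 hb.1, ?_⟩
    have h := dE_mul_of_commute (ha.1.differentiableAt (by simp)) (hb.1.differentiableAt (by simp))
      fun j => (a y).dx_mul_val j
    rw [ha.2, hb.2, zero_mul, mul_zero, zero_add] at h
    exact h
  add_mem' {a b} ha hb := by
    refine ⟨ContDiffAt.add ha.1 hb.1, ?_⟩
    have h := dE_add (ha.1.differentiableAt (by simp)) (hb.1.differentiableAt (by simp))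
    rw [ha.2, hb.2, zero_add] at h
    exact h
  algebraMap_mem' r := by
    have h : (fun z => ((algebraMap ℂ (Eu m → EvenExt m) r) z).val) = fun _ => algebraMap ℂ _ r :=
      rfl
    refine ⟨(congrArg (fun f => ContDiffAt ℝ ∞ f y) h).mpr contDiffAt_const, ?_⟩
    exact (congrArg (fun f => dE f y) h).trans (dE_const _ _)

end EvenForms

/-! ### The reverse characteristic polynomial -/

section Charpoly

variable {R S : Type*} [CommRing R] [CommRing S] {r : ℕ}

theorem charpolyRev_map (φ : R →+* S) (M : Matrix (Fin r) (Fin r) R) :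
    (M.map φ).charpolyRev = M.charpolyRev.map φ := by
  rw [Matrix.charpolyRev, Matrix.charpolyRev, ← Polynomial.coe_mapRingHom, RingHom.map_det]
  congr 1
  ext i j : 2
  simp [Matrix.one_apply, apply_ite]

/-- Take determinants in `(1 - X A) U = U (1 - X B)` and cancel the unit `det U`. In this form no
inverse of `U` has to be named. -/
theorem charpolyRev_eq_of_conj {A B U : Matrix (Fin r) (Fin r) R} (hU : IsUnit U.det)
    (h : A * U = U * B) : A.charpolyRev = B.charpolyRev := by
  have h1 : (1 - (Polynomial.X : Polynomial R) • A.map Polynomial.C) * U.map Polynomial.C =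
      U.map Polynomial.C * (1 - (Polynomial.X : Polynomial R) • B.map Polynomial.C) := by
    have h2 := congrArg (fun M => M.map Polynomial.C) h
    simp only [Matrix.map_mul] at h2
    rw [sub_mul, mul_sub, one_mul, mul_one, smul_mul_assoc, mul_smul_comm, h2]
  have h3 := congrArg Matrix.det h1
  rw [Matrix.det_mul, Matrix.det_mul, mul_comm] at h3
  have h4 : IsUnit (U.map Polynomial.C).det := by
    have := hU.map (Polynomial.C (R := R))
    rwa [RingHom.map_det] at this
  exact h4.mul_left_cancel h3

/-- Scaling the matrix by `c` amounts to substituting `c X` for `X`. -/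
theorem coeff_charpolyRev_smul (c : R) (M : Matrix (Fin r) (Fin r) R) (l : ℕ) :
    (c • M).charpolyRev.coeff l = M.charpolyRev.coeff l * c ^ l := by
  rw [← Polynomial.comp_C_mul_X_coeff]
  congr 1
  rw [Matrix.charpolyRev, Matrix.charpolyRev, ← Polynomial.coe_compRingHom_apply, RingHom.map_det]
  congr 1
  refine Matrix.ext fun i j => ?_
  by_cases h : i = j <;> simp [h] <;> ring

end Charpoly

/-! ### Curvature and Chern forms of a matrix of `1`-forms -/

section Curvature

variable {m m' r : ℕ}

/-- A matrix of `1`-forms in coordinates. -/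
abbrev ConnMatrix (m r : ℕ) := Fin r → Fin r → Eu m → Eu m →L[ℝ] ℂ

/-- The element of the exterior algebra given by a `1`-form. -/
def oneForm (l : Eu m →L[ℝ] ℂ) : Ext m := ∑ x, l (stdVec x) • dx x

/-- The curvature `dθ + θ ∧ θ` of the connection `d + θ`. -/
def curvOf (θ : ConnMatrix m r) (y : Eu m) : Matrix (Fin r) (Fin r) (EvenExt m) :=
  fun s t => (2 : ℂ)⁻¹ • ∑ x : Fin m, ∑ x' : Fin m,
    (fderiv ℝ (θ s t) y (stdVec x) (stdVec x') - fderiv ℝ (θ s t) y (stdVec x') (stdVec x) +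
    ∑ l, (θ s l y (stdVec x) * θ l t y (stdVec x') - θ s l y (stdVec x') * θ l t y (stdVec x))) •
      dxdx x x'

/-- The Chern forms of the connection `d + θ`. -/
def chernOf (θ : ConnMatrix m r) (l : ℕ) (y : Eu m) : EvenExt m :=
  (((2 * Real.pi * Complex.I : ℂ)⁻¹ • curvOf θ y).charpolyRev).coeff l

theorem contDiffAt_oneForm {a : Eu m → Eu m →L[ℝ] ℂ} {y : Eu m} (h : ContDiffAt ℝ ∞ a y) :
    ContDiffAt ℝ ∞ (fun z => oneForm (a z)) y :=
  ContDiffAt.sum fun _ _ => ContDiffAt.fun_smul (h.clm_apply contDiffAt_const) contDiffAt_const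

theorem dE_oneForm {a : Eu m → Eu m →L[ℝ] ℂ} {y : Eu m} (h : DifferentiableAt ℝ a y) :
    dE (fun z => oneForm (a z)) y =
      ∑ x, ∑ x', fderiv ℝ a y (stdVec x) (stdVec x') • (dx x * dx x') := by
  have ha : ∀ x : Fin m, HasFDerivAt (fun z => a z (stdVec x))
      ((fderiv ℝ a y).flip (stdVec x)) y := fun x =>
    h.hasFDerivAt.clm_apply (hasFDerivAt_const (stdVec x) y) |>.congr_fderiv (by ext v; simp)
  refine (dE_sum_smul_dx fun x => (ha x).differentiableAt).trans ?_
  simp only [(ha _).fderiv]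
  rfl

/-- The sum runs over ordered pairs of indices and antisymmetrizing doubles it; this is why the
coordinate formula for the curvature carries the factor `1/2`. -/
theorem half_sum_sub_smul_dx (c : Fin m → Fin m → ℂ) :
    (2 : ℂ)⁻¹ • ∑ x, ∑ x', (c x x' - c x' x) • (dx x * dx x' : Ext m) =
      ∑ x, ∑ x', c x x' • (dx x * dx x' : Ext m) := by
  have h1 : ∑ x, ∑ x', c x' x • (dx x * dx x' : Ext m) =
      -∑ x, ∑ x', c x x' • (dx x * dx x' : Ext m) := by
    rw [Finset.sum_comm]
    simp only [← Finset.sum_neg_distrib]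
    refine Finset.sum_congr rfl fun x _ => Finset.sum_congr rfl fun x' _ => ?_
    rw [dx_mul_dx, smul_neg]
  simp only [sub_smul, Finset.sum_sub_distrib]
  rw [h1, sub_neg_eq_add, ← two_smul ℂ, smul_smul, inv_mul_cancel₀ two_ne_zero, one_smul]

theorem oneForm_mul_oneForm (a b : Eu m →L[ℝ] ℂ) :
    oneForm a * oneForm b = ∑ x, ∑ x', (a (stdVec x) * b (stdVec x')) • (dx x * dx x' : Ext m) := by
  rw [oneForm, oneForm, Finset.sum_mul_sum]
  simp only [smul_mul_smul_comm]

/-- Replaces the coordinate formula by `dθ + θ ∧ θ` inside the exterior algebra, where the rules for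
`dE` apply. -/
theorem curvOf_val {θ : ConnMatrix m r} {y : Eu m} (h : ∀ s t, DifferentiableAt ℝ (θ s t) y)
    (s t : Fin r) : (curvOf θ y s t).val =
      dE (fun z => oneForm (θ s t z)) y + ∑ l, oneForm (θ s l y) * oneForm (θ l t y) := by
  have h1 : (curvOf θ y s t).val = (2 : ℂ)⁻¹ • ∑ x : Fin m, ∑ x' : Fin m,
    ((fderiv ℝ (θ s t) y (stdVec x) (stdVec x') + ∑ l, θ s l y (stdVec x) * θ l t y (stdVec x')) -
      (fderiv ℝ (θ s t) y (stdVec x') (stdVec x) +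
        ∑ l, θ s l y (stdVec x') * θ l t y (stdVec x))) • (dx x * dx x' : Ext m) := by
    rw [curvOf, EvenExt.val_smul, EvenExt.val_sum]
    congr 1
    refine Finset.sum_congr rfl fun x _ => ?_
    rw [EvenExt.val_sum]
    refine Finset.sum_congr rfl fun x' _ => ?_
    rw [EvenExt.val_smul]
    congr 1
    rw [Finset.sum_sub_distrib]
    ring
  rw [h1, half_sum_sub_smul_dx (fun x x' => fderiv ℝ (θ s t) y (stdVec x) (stdVec x') +
    ∑ l, θ s l y (stdVec x) * θ l t y (stdVec x')), dE_oneForm (h s t)]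
  simp only [oneForm_mul_oneForm, add_smul, Finset.sum_add_distrib, Finset.sum_smul]
  congr 1
  rw [Finset.sum_comm]
  refine Eq.trans ?_ Finset.sum_comm
  rw [Finset.sum_comm]
  refine Finset.sum_congr rfl fun x _ => ?_
  exact Finset.sum_comm

theorem dx_mul_oneForm (j : Fin m) (a : Eu m →L[ℝ] ℂ) :
    dx j * oneForm a = -(oneForm a * dx j) := dx_mul_sum_smul_dx j _

theorem contDiffAt_dE {ξ : Eu m → Ext m} {y : Eu m} (h : ContDiffAt ℝ ∞ ξ y) :
    ContDiffAt ℝ ∞ (dE ξ) y := by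
  have hd : ContDiffAt ℝ ∞ (fderiv ℝ ξ) y := h.fderiv_right (by simp)
  exact ContDiffAt.sum fun j _ => contDiffAt_const.mul (hd.clm_apply contDiffAt_const)

theorem eventually_curvOf_val {θ : ConnMatrix m r} {y : Eu m}
    (h : ∀ s t, ContDiffAt ℝ ∞ (θ s t) y) (s t : Fin r) :
    (fun z => (curvOf θ z s t).val) =ᶠ[𝓝 y] fun z =>
      dE (fun z => oneForm (θ s t z)) z + ∑ l, oneForm (θ s l z) * oneForm (θ l t z) := by
  have h1 : ∀ᶠ z in 𝓝 y, ∀ s t, ContDiffAt ℝ 1 (θ s t) z :=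
    Filter.eventually_all.2 fun s => Filter.eventually_all.2 fun t =>
      ((h s t).of_le (by simp)).eventually (by simp)
  filter_upwards [h1] with z hz
  exact curvOf_val (fun s t => (hz s t).differentiableAt (by simp)) s t

theorem contDiffAt_curvOf {θ : ConnMatrix m r} {y : Eu m}
    (h : ∀ s t, ContDiffAt ℝ ∞ (θ s t) y) (s t : Fin r) :
    ContDiffAt ℝ ∞ (fun z => (curvOf θ z s t).val) y := by
  refine ContDiffAt.congr_of_eventuallyEq ?_ (eventually_curvOf_val h s t)
  exact (contDiffAt_dE (contDiffAt_oneForm (h s t))).add (ContDiffAt.sum fun l _ =>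
    (contDiffAt_oneForm (h s l)).mul (contDiffAt_oneForm (h l t)))

/-- The Bianchi identity. -/
theorem dE_curvOf {θ : ConnMatrix m r} {y : Eu m}
    (h : ∀ s t, ContDiffAt ℝ ∞ (θ s t) y) (s t : Fin r) :
    dE (fun z => (curvOf θ z s t).val) y =
      ∑ l, (curvOf θ y s l).val * oneForm (θ l t y) -
        ∑ l, oneForm (θ s l y) * (curvOf θ y l t).val := by
  have h1 := fun s t => contDiffAt_oneForm (h s t)
  have h2 := fun s t => (h1 s t).differentiableAt (by simp)
  have h3 := curvOf_val (fun s t => (h s t).differentiableAt (by simp))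
  rw [dE_congr (eventually_curvOf_val h s t), dE_add
    ((contDiffAt_dE (h1 s t)).differentiableAt (by simp))
    (DifferentiableAt.fun_sum fun l _ => (h2 s l).fun_mul (h2 l t)), dE_dE (h1 s t), zero_add,
    dE_sum Finset.univ (ξ := fun l z => oneForm (θ s l z) * oneForm (θ l t z))
      fun l _ => (h2 s l).mul (h2 l t)]
  simp only [h3, add_mul, mul_add, Finset.sum_add_distrib, Finset.sum_mul, Finset.mul_sum]
  -- The cubic terms `θ ∧ θ ∧ θ` on the two sides agree by associativity and cancel, leaving `dθ ∧ θ
  -- - θ ∧ dθ`.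
  have h4 : ∑ l, ∑ l', oneForm (θ s l' y) * oneForm (θ l' l y) * oneForm (θ l t y) =
      ∑ l, ∑ l', oneForm (θ s l y) * (oneForm (θ l l' y) * oneForm (θ l' t y)) := by
    rw [Finset.sum_comm]
    simp only [mul_assoc]
  rw [h4, add_sub_add_right_eq_sub, ← Finset.sum_sub_distrib]
  exact Finset.sum_congr rfl fun l _ => dE_mul_of_anticommute (h2 s l) (h2 l t)
    fun j => dx_mul_oneForm j _

/-- The Bianchi identity `dF = Fθ - θF` says exactly that `(F + ε dF)(1 - εθ) = (1 - εθ)F` when `ε²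
= 0`. So the first jet of `F` is conjugate to the matrix `F(y)` without `ε`-part, and every
coefficient of its characteristic polynomial has zero `ε`-part, which is its exterior derivative. -/
theorem chernOf_mem_smooth {θ : ConnMatrix m r} {y : Eu m} (h : ∀ s t, ContDiffAt ℝ ∞ (θ s t) y)
    (l : ℕ) : ∃ C : smoothEven m y, C.1 = chernOf θ l ∧ (firstJet m y C).snd = 0 := by
  let F : Matrix (Fin r) (Fin r) (smoothEven m y) := fun s t =>
    ⟨fun z => (2 * Real.pi * Complex.I : ℂ)⁻¹ • curvOf θ z s t,
      ContDiffAt.const_smul (2 * Real.pi * Complex.I : ℂ)⁻¹ (contDiffAt_curvOf h s t)⟩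
  refine ⟨F.charpolyRev.coeff l, ?_, ?_⟩
  · funext z
    have h1 : F.map (evalEven m y z) = (2 * Real.pi * Complex.I : ℂ)⁻¹ • curvOf θ z := rfl
    rw [chernOf, ← h1, charpolyRev_map, Polynomial.coeff_map]
    rfl
  · rw [← Polynomial.coeff_map, ← charpolyRev_map]
    let B : Matrix (Fin r) (Fin r) (EvenExt m) := fun s t => (F s t).1 y
    let Θ : Matrix (Fin r) (Fin r) (TrivSqZeroExt (EvenExt m) (Ext m)) :=
      fun s t => TrivSqZeroExt.inr (oneForm (θ s t y))
    have hΘ : Θ * Θ = 0 := by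
      refine Matrix.ext fun s t => ?_
      rw [Matrix.mul_apply]
      exact Finset.sum_eq_zero fun _ _ => TrivSqZeroExt.inr_mul_inr _ _ _
    have hU : IsUnit (1 - Θ).det := by
      refine IsUnit.of_mul_eq_one (1 + Θ).det ?_
      rw [← Matrix.det_mul, sub_mul, one_mul, mul_add, hΘ, mul_one, add_zero, add_sub_cancel_right,
        Matrix.det_one]
    -- The base component of this equation is trivial; its square-zero component is the Bianchi
    -- identity, scaled by `1/(2πi)`.
    have hconj : F.map (firstJet m y) * (1 - Θ) =
        (1 - Θ) * B.map (TrivSqZeroExt.inlHom (EvenExt m) (Ext m)) := by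
      rw [mul_sub, sub_mul, mul_one, one_mul]
      refine Matrix.ext fun s t => ?_
      simp only [Matrix.sub_apply, Matrix.mul_apply, Matrix.map_apply]
      have hd : ∀ s t, dE (fun z => ((F s t).1 z).val) y = (2 * Real.pi * Complex.I : ℂ)⁻¹ •
          dE (fun z => (curvOf θ z s t).val) y := fun s t =>
        dE_const_smul _ ((contDiffAt_curvOf h s t).differentiableAt (by simp))
      ext
      · simp only [Θ, TrivSqZeroExt.fst_sub, TrivSqZeroExt.fst_sum, TrivSqZeroExt.fst_mul,
          TrivSqZeroExt.fst_inr, mul_zero, zero_mul, Finset.sum_const_zero]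
        simp [firstJet, B]
      · simp only [Θ, TrivSqZeroExt.snd_sub, TrivSqZeroExt.snd_sum, TrivSqZeroExt.snd_mul,
          TrivSqZeroExt.fst_inr, TrivSqZeroExt.snd_inr, snd_firstJet, hd, dE_curvOf h]
        simp only [firstJet, RingHom.coe_mk, MonoidHom.coe_mk, OneHom.coe_mk,
          TrivSqZeroExt.fst_add, TrivSqZeroExt.fst_inl, TrivSqZeroExt.fst_inr, add_zero,
          MulOpposite.op_zero, zero_smul, TrivSqZeroExt.inlHom_apply, TrivSqZeroExt.snd_inl, B,
          zero_add, op_smul_eq_smul, even_smul_def]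
        have hB : ∀ s t, ((F s t).1 y).val = (2 * Real.pi * Complex.I : ℂ)⁻¹ •
          (curvOf θ y s t).val := fun s t => rfl
        simp only [hB, smul_mul_assoc, ← Finset.smul_sum, ← smul_sub, ← smul_neg, zero_sub]
        congr 1
        simp only [EvenExt.mul_val]
        abel
    rw [charpolyRev_eq_of_conj hU hconj, charpolyRev_map, Polynomial.coeff_map]
    simp

/-- The Chern forms are smooth and closed. -/
theorem chernOf_mem_closedEven {θ : ConnMatrix m r} {y : Eu m}
    (h : ∀ s t, ContDiffAt ℝ ∞ (θ s t) y) (l : ℕ) : chernOf θ l ∈ closedEven m y := by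
  obtain ⟨C, hC, hC'⟩ := chernOf_mem_smooth h l
  rw [snd_firstJet] at hC'
  rw [← hC]
  exact ⟨C.2, hC'⟩

theorem add_eq_add_of_neg_add (a b c d d' : Ext m) (h : -a + b + d = c - a + d') :
    d + b = d' + c := by
  have h2 : -a + b + d + a = c - a + d' + a := by rw [h]
  calc d + b = -a + b + d + a := by abel
    _ = c - a + d' + a := h2
    _ = d' + c := by abel

theorem oneForm_mul_comm (a b : Eu m →L[ℝ] ℂ) : oneForm a * oneForm b = -(oneForm b * oneForm a) := by
  rw [oneForm, Finset.sum_mul, Finset.mul_sum, ← Finset.sum_neg_distrib]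
  refine Finset.sum_congr rfl fun x _ => ?_
  rw [smul_mul_assoc, dx_mul_oneForm, mul_smul_comm, smul_neg]

/-- Near `y` the differential of `a` is `dE` of `a • 1`, so this is an instance of `dE_dE`. -/
theorem dE_dFun {a : Eu m → ℂ} {y : Eu m} (h : ContDiffAt ℝ ∞ a y) : dE (dFun a) y = 0 := by
  have h2 : dFun a =ᶠ[𝓝 y] dE (fun z => a z • (1 : Ext m)) := by
    have h3 : ∀ᶠ z in 𝓝 y, ContDiffAt ℝ 1 a z := (h.of_le (by simp)).eventually (by simp)
    filter_upwards [h3] with z hz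
    rw [dE_smul (hz.differentiableAt (by simp)) (differentiableAt_const _), dE_const]
    simp
  rw [dE_congr h2]
  exact dE_dE (ContDiffAt.fun_smul h contDiffAt_const)

/-- Differentiate the transition law `dg + θg = gθ'` and use `d(dg) = 0`. Substituting the law for
the remaining `dg` produces mixed terms in `θ` and `θ'` that cancel, and `Fg = gF'` is left. The law
is assumed near `y` because it is differentiated. -/
theorem curvOf_gauge {θ θ' : ConnMatrix m r} {g : Eu m → Matrix (Fin r) (Fin r) ℂ} {y : Eu m}
    (h : ∀ s t, DifferentiableAt ℝ (θ s t) y) (h' : ∀ s t, DifferentiableAt ℝ (θ' s t) y)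
    (hg : ∀ s t, ContDiffAt ℝ ∞ (fun z => g z s t) y)
    (hθ : ∀ᶠ z in 𝓝 y, ∀ s t v, fderiv ℝ (fun z => g z s t) z v + ∑ l, θ s l z v * g z l t =
      ∑ l, g z s l * θ' l t z v) : ∀ s t, ∑ l, g y l t • (curvOf θ y s l).val = ∑ l, g y s l • (curvOf θ' y l t).val := by
  have hgd := fun s t => (hg s t).differentiableAt (by simp)
  have e1 : ∀ᶠ z in 𝓝 y, ∀ s t, dFun (fun z => g z s t) z + ∑ l, g z l t • oneForm (θ s l z) =
      ∑ l, g z s l • oneForm (θ' l t z) := by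
    filter_upwards [hθ] with z hz s t
    simp only [dFun, oneForm, Finset.smul_sum, smul_smul]
    rw [Finset.sum_comm, ← Finset.sum_add_distrib, Finset.sum_comm]
    refine Finset.sum_congr rfl fun x _ => ?_
    rw [← Finset.sum_smul, ← Finset.sum_smul, ← add_smul, ← hz s t (stdVec x)]
    simp only [mul_comm]
  have hof : ∀ {a : Eu m → Eu m →L[ℝ] ℂ}, DifferentiableAt ℝ a y →
      DifferentiableAt ℝ (fun z => oneForm (a z)) y := fun ha =>
    differentiableAt_sum_smul_dx fun x => ha.clm_apply (differentiableAt_const _)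
  have e2 : ∀ s t, ∑ l, (dFun (fun z => g z l t) y * oneForm (θ s l y) +
        g y l t • dE (fun z => oneForm (θ s l z)) y) =
      ∑ l, (dFun (fun z => g z s l) y * oneForm (θ' l t y) +
        g y s l • dE (fun z => oneForm (θ' l t z)) y) := by
    intro s t
    have hdd : dE (fun z => dFun (fun z => g z s t) z) y = 0 := dE_dFun (hg s t)
    have hdf : DifferentiableAt ℝ (fun z => dFun (fun z => g z s t) z) y := by
      refine differentiableAt_sum_smul_dx fun x => ?_
      exact (((hg s t).fderiv_right (m := ∞) (by simp)).differentiableAt (by simp)).clm_apply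
        (differentiableAt_const _)
    have h4 : dE (fun z => dFun (fun z => g z s t) z + ∑ l, g z l t • oneForm (θ s l z)) y =
        dE (fun z => ∑ l, g z s l • oneForm (θ' l t z)) y :=
      dE_congr (by filter_upwards [e1] with z hz using hz s t)
    rw [dE_add hdf (DifferentiableAt.fun_sum fun l _ => (hgd l t).fun_smul (hof (h s l))), hdd,
      zero_add, dE_sum Finset.univ (ξ := fun l z => g z l t • oneForm (θ s l z))
        fun l _ => (hgd l t).fun_smul (hof (h s l)),
      dE_sum Finset.univ (ξ := fun l z => g z s l • oneForm (θ' l t z))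
        fun l _ => (hgd s l).fun_smul (hof (h' l t))] at h4
    rw [Finset.sum_congr rfl fun l _ => dE_smul (hgd l t) (hof (h s l)),
      Finset.sum_congr rfl fun l _ => dE_smul (hgd s l) (hof (h' l t))] at h4
    exact h4
  have e3 := e1.self_of_nhds
  have e4 : ∀ s t, dFun (fun z => g z s t) y = ∑ l, g y s l • oneForm (θ' l t y) -
      ∑ l, g y l t • oneForm (θ s l y) := fun s t => eq_sub_of_add_eq (e3 s t)
  intro s t
  have e6 := e2 s t
  simp only [e4, Finset.sum_add_distrib, sub_mul, Finset.sum_sub_distrib, Finset.sum_mul,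
    smul_mul_assoc] at e6
  simp only [curvOf_val h, curvOf_val h', smul_add, Finset.sum_add_distrib, Finset.smul_sum]
  -- The three identities only exchange summation indices and transpose `1`-forms. They bring the
  -- mixed terms on the two sides into the same shape and the quadratic terms into the order in
  -- which they occur in the curvature.
  have c1 : ∑ x, ∑ x', g y x x' • (oneForm (θ' x' t y) * oneForm (θ s x y)) =
      -∑ x, ∑ x', g y x' x • (oneForm (θ s x' y) * oneForm (θ' x t y)) := by
    rw [Finset.sum_comm]
    simp only [← Finset.sum_neg_distrib]
    refine Finset.sum_congr rfl fun x _ => Finset.sum_congr rfl fun x' _ => ?_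
    rw [oneForm_mul_comm, smul_neg]
  have c2 : ∑ x, ∑ x', g y x' t • (oneForm (θ x x' y) * oneForm (θ s x y)) =
      -∑ x, ∑ x', g y x t • (oneForm (θ s x' y) * oneForm (θ x' x y)) := by
    rw [Finset.sum_comm]
    simp only [← Finset.sum_neg_distrib]
    refine Finset.sum_congr rfl fun x _ => Finset.sum_congr rfl fun x' _ => ?_
    rw [oneForm_mul_comm, smul_neg]
  have c3 : ∑ x, ∑ x', g y s x' • (oneForm (θ' x' x y) * oneForm (θ' x t y)) =
      ∑ x, ∑ x', g y s x • (oneForm (θ' x x' y) * oneForm (θ' x' t y)) := by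
    rw [Finset.sum_comm]
  rw [c1, c2, c3] at e6
  rw [sub_neg_eq_add] at e6
  exact add_eq_add_of_neg_add _ _ _ _ _ e6

/-- Chern forms do not depend on the trivialization. -/
theorem chernOf_gauge {θ θ' : ConnMatrix m r} {g : Eu m → Matrix (Fin r) (Fin r) ℂ} {y : Eu m}
    (h : ∀ s t, DifferentiableAt ℝ (θ s t) y) (h' : ∀ s t, DifferentiableAt ℝ (θ' s t) y)
    (hg : ∀ s t, ContDiffAt ℝ ∞ (fun z => g z s t) y) (hu : IsUnit (g y).det)
    (hθ : ∀ᶠ z in 𝓝 y, ∀ s t v, fderiv ℝ (fun z => g z s t) z v + ∑ l, θ s l z v * g z l t =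
      ∑ l, g z s l * θ' l t z v) (l : ℕ) : chernOf θ l y = chernOf θ' l y := by
  have e5 := curvOf_gauge h h' hg hθ
  let G : Matrix (Fin r) (Fin r) (EvenExt m) := (g y).map (algebraMap ℂ (EvenExt m))
  have hG : IsUnit G.det := by
    have := hu.map (algebraMap ℂ (EvenExt m))
    rwa [RingHom.map_det] at this
  have hconj : curvOf θ y * G = G * curvOf θ' y := by
    refine Matrix.ext fun s t => EvenExt.val_injective ?_
    rw [Matrix.mul_apply, Matrix.mul_apply, EvenExt.val_sum, EvenExt.val_sum]
    refine Eq.trans ?_ ((e5 s t).trans ?_)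
    · refine Finset.sum_congr rfl fun l _ => ?_
      rw [← EvenExt.val_smul, Algebra.smul_def, mul_comm]
      rfl
    · refine Finset.sum_congr rfl fun l _ => ?_
      rw [← EvenExt.val_smul, Algebra.smul_def]
      rfl
  have h1 : ((2 * Real.pi * Complex.I : ℂ)⁻¹ • curvOf θ y) * G =
      G * ((2 * Real.pi * Complex.I : ℂ)⁻¹ • curvOf θ' y) := by
    rw [smul_mul_assoc, mul_smul_comm, hconj]
  rw [chernOf, chernOf, charpolyRev_eq_of_conj hG h1]

theorem pb_oneForm (L : Eu m' →L[ℝ] Eu m) (a : Eu m →L[ℝ] ℂ) :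
    pb L (oneForm a) = oneForm (a.comp L) := by
  simp only [oneForm, map_sum, map_smul, pb_dx, Finset.smul_sum, smul_smul]
  rw [Finset.sum_comm]
  refine Finset.sum_congr rfl fun x _ => ?_
  rw [← Finset.sum_smul, ContinuousLinearMap.comp_apply]
  congr 1
  conv_rhs => rw [← sum_coord_smul_stdVec (L (stdVec x))]
  simp [mul_comm]

/-- Chern forms are compatible with pullbacks. -/
theorem chernOf_pullback {θ : ConnMatrix m r} {θ' : ConnMatrix m' r} {g : Eu m' → Eu m} {y : Eu m'}
    (hg : ContDiffAt ℝ ∞ g y) (h : ∀ s t, ContDiffAt ℝ ∞ (θ s t) (g y))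
    (hθ : ∀ᶠ z in 𝓝 y, ∀ s t, θ' s t z = (θ s t (g z)).comp (fderiv ℝ g z)) (l : ℕ) :
    chernOf θ' l y = pbEven (fderiv ℝ g y) (chernOf θ l (g y)) := by
  have hd : ContDiffAt ℝ ∞ (fderiv ℝ g) y := hg.fderiv_right (by simp)
  have hθe : ∀ s t, θ' s t =ᶠ[𝓝 y] fun z => (θ s t (g z)).comp (fderiv ℝ g z) := fun s t => by
    filter_upwards [hθ] with z hz using hz s t
  have h' : ∀ s t, DifferentiableAt ℝ (θ' s t) y := fun s t =>
    (((h s t).comp y hg).clm_comp hd).differentiableAt (by simp)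
      |>.congr_of_eventuallyEq (hθe s t)
  have e : curvOf θ' y = (curvOf θ (g y)).map (pbEven (fderiv ℝ g y)) := by
    refine Matrix.ext fun s t => EvenExt.val_injective ?_
    rw [Matrix.map_apply, pbEven_val, curvOf_val h',
      curvOf_val fun s t => (h s t).differentiableAt (by simp), map_add, map_sum]
    congr 1
    · rw [← dE_pb hg ((contDiffAt_oneForm (h s t)).differentiableAt (by simp))]
      refine dE_congr ?_
      filter_upwards [hθe s t] with z hz
      rw [hz, pb_oneForm]
    · refine Finset.sum_congr rfl fun l _ => ?_
      rw [map_mul, pb_oneForm, pb_oneForm, (hθe _ _).self_of_nhds, (hθe _ _).self_of_nhds]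
  rw [chernOf, chernOf, e]
  have e' : (2 * Real.pi * Complex.I : ℂ)⁻¹ • (curvOf θ (g y)).map (pbEven (fderiv ℝ g y)) =
      ((2 * Real.pi * Complex.I : ℂ)⁻¹ • curvOf θ (g y)).map
        (pbEven (fderiv ℝ g y)).toRingHom := by
    refine Matrix.ext fun s t => ?_
    exact (map_smul (pbEven (fderiv ℝ g y)) _ _).symm
  rw [e', charpolyRev_map, Polynomial.coeff_map]
  rfl

/-- The Chern forms are homogeneous. -/
theorem pb_two_smul_chernOf (θ : ConnMatrix m r) (l : ℕ) (y : Eu m) :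
    pbEven ((2 : ℝ) • ContinuousLinearMap.id ℝ (Eu m)) (chernOf θ l y) =
      (2 : ℂ) ^ (2 * l) • chernOf θ l y := by
  have hdx : ∀ j : Fin m, pb ((2 : ℝ) • ContinuousLinearMap.id ℝ (Eu m)) (dx j) =
      (2 : ℂ) • dx j := by
    intro j
    rw [pb_dx]
    have : ∀ x : Fin m, ((((2 : ℝ) • ContinuousLinearMap.id ℝ (Eu m)) (stdVec x) j : ℝ) : ℂ) •
        (dx x : Ext m) = if x = j then (2 : ℂ) • dx j else 0 := by
      intro x
      by_cases h : x = j
      · subst h; simp [stdVec]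
      · simp [stdVec, h, Ne.symm h]
    rw [Finset.sum_congr rfl fun x _ => this x]
    simp
  -- Degrees are recognized by pulling back along multiplication by `2`. It scales the curvature, a
  -- matrix of `2`-forms, by `4`, hence the `l`-th coefficient of the characteristic polynomial by
  -- `4^l`.
  have e : ((2 * Real.pi * Complex.I : ℂ)⁻¹ • curvOf θ y).map
      (pbEven ((2 : ℝ) • ContinuousLinearMap.id ℝ (Eu m))).toRingHom =
      (algebraMap ℂ (EvenExt m) 4) • ((2 * Real.pi * Complex.I : ℂ)⁻¹ • curvOf θ y) := by
    refine Matrix.ext fun s t => ?_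
    simp only [Matrix.map_apply, Matrix.smul_apply, smul_eq_mul, ← Algebra.smul_def]
    refine (map_smul (pbEven _) _ _).trans ?_
    rw [smul_comm]
    congr 1
    simp only [curvOf, map_smul, map_sum]
    rw [smul_comm]
    congr 1
    simp only [Finset.smul_sum]
    refine Finset.sum_congr rfl fun x _ => Finset.sum_congr rfl fun x' _ => ?_
    rw [smul_comm]
    congr 1
    refine EvenExt.val_injective ?_
    rw [pbEven_val, EvenExt.val_smul]
    change pb _ (dx x * dx x') = (4 : ℂ) • (dx x * dx x')
    rw [map_mul, hdx, hdx, smul_mul_smul_comm]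
    norm_num
  have e2 : pbEven ((2 : ℝ) • ContinuousLinearMap.id ℝ (Eu m)) (chernOf θ l y) =
      (((2 * Real.pi * Complex.I : ℂ)⁻¹ • curvOf θ y).map
      (pbEven ((2 : ℝ) • ContinuousLinearMap.id ℝ (Eu m))).toRingHom).charpolyRev.coeff l := by
    rw [charpolyRev_map, Polynomial.coeff_map]
    rfl
  rw [e2, e, coeff_charpolyRev_smul]
  change chernOf θ l y * _ = _
  rw [mul_comm, ← map_pow, ← Algebra.smul_def, pow_mul]
  norm_num

end Curvature

open MeasureTheory

/-! ### Integration of densities -/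

section Density

variable {m : ℕ} {Z : Type*} [TopologicalSpace Z] [T2Space Z] [SigmaCompactSpace Z]
  [ChartedSpace (Eu m) Z] [IsManifold (𝓡 m) ∞ Z]

/-- The density vanishes outside of `K`. -/
def DensityVanishesOff (δ : Z → Eu m → ℂ) (K : Set Z) : Prop :=
  ∀ i, ∀ y ∈ (chartAt (Eu m) i).target, (chartAt (Eu m) i).symm y ∉ K → δ i y = 0

/-- The density is supported in `K` and locally integrable. -/
def DensityIntegrable (δ : Z → Eu m → ℂ) (K : Set Z) : Prop :=
  DensityVanishesOff δ K ∧ ∀ i, IntegrableOn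
    (fun y => (chartPartition (m := m) Z i ((chartAt (Eu m) i).symm y) : ℂ) * δ i y)
    (chartAt (Eu m) i).target

variable (m) in
theorem chartPartition_tsupport (i : Z) :
    tsupport (chartPartition (m := m) Z i) ⊆ (chartAt (Eu m) i).source :=
  (SmoothPartitionOfUnity.exists_isSubordinate_chartAt_source (𝓡 m) Z).choose_spec i

variable (m) in
theorem chartPartition_eq_zero {i z : Z} (hz : z ∉ (chartAt (Eu m) i).source) :
    chartPartition (m := m) Z i z = 0 := by
  by_contra h
  exact hz (chartPartition_tsupport m i (subset_tsupport _ h))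

variable (m) in
theorem exists_finset_chartPartition {K : Set Z} (hK : IsCompact K) :
    ∃ s : Finset Z, ∀ i ∉ s, ∀ z ∈ K, chartPartition (m := m) Z i z = 0 := by
  have h := (chartPartition (m := m) Z).locallyFinite.finite_nonempty_inter_compact hK
  refine ⟨h.toFinset, fun i hi z hz => ?_⟩
  by_contra h'
  exact hi (h.mem_toFinset.2 ⟨z, h', hz⟩)

/-- A `finsum` is zero by default when infinitely many terms are nonzero. A compact support meets
only finitely many members of the partition, so the integral is an honest finite sum, with a set of
indices that works for all densities supported in `K`. -/
theorem densityIntegral_eq_sum {δ : Z → Eu m → ℂ} {K : Set Z} (hδ : DensityVanishesOff δ K)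
    {s : Finset Z} (hs : ∀ i ∉ s, ∀ z ∈ K, chartPartition (m := m) Z i z = 0) :
    densityIntegral Z δ = ∑ i ∈ s, ∫ y in (chartAt (Eu m) i).target,
      (chartPartition (m := m) Z i ((chartAt (Eu m) i).symm y) : ℂ) * δ i y := by
  refine finsum_eq_sum_of_support_subset _ fun i hi => ?_
  by_contra his
  refine hi (setIntegral_eq_zero_of_forall_eq_zero fun y hy => ?_)
  by_cases hz : (chartAt (Eu m) i).symm y ∈ K
  · rw [hs i (by simpa using his) _ hz]
    simp
  · rw [hδ i y hy hz, mul_zero]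

theorem densityIntegral_zero : densityIntegral Z (fun _ (_ : Eu m) => (0 : ℂ)) = 0 := by
  simp [densityIntegral]

theorem densityIntegral_congr {δ δ' : Z → Eu m → ℂ}
    (h : ∀ i, ∀ y ∈ (chartAt (Eu m) i).target, δ i y = δ' i y) :
    densityIntegral Z δ = densityIntegral Z δ' := by
  refine finsum_congr fun i => setIntegral_congr_fun (chartAt (Eu m) i).open_target.measurableSet ?_
  intro y hy
  simp only [h i y hy]

theorem densityIntegral_const_mul (a : ℂ) {δ : Z → Eu m → ℂ} {K : Set Z} (hK : IsCompact K)
    (hδ : DensityVanishesOff δ K) :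
    densityIntegral Z (fun i y => a * δ i y) = a * densityIntegral Z δ := by
  obtain ⟨s, hs⟩ := exists_finset_chartPartition m hK
  rw [densityIntegral_eq_sum hδ hs, densityIntegral_eq_sum (K := K) (fun i y hy hz => by
    rw [hδ i y hy hz, mul_zero]) hs, Finset.mul_sum]
  refine Finset.sum_congr rfl fun i _ => ?_
  rw [← integral_const_mul]
  simp only [mul_left_comm]

theorem densityIntegral_add {δ δ' : Z → Eu m → ℂ} {K : Set Z} (hK : IsCompact K)
    (h : DensityIntegrable δ K) (h' : DensityIntegrable δ' K) :
    densityIntegral Z (fun i y => δ i y + δ' i y) = densityIntegral Z δ + densityIntegral Z δ' := by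
  obtain ⟨s, hs⟩ := exists_finset_chartPartition m hK
  rw [densityIntegral_eq_sum h.1 hs, densityIntegral_eq_sum h'.1 hs,
    densityIntegral_eq_sum (K := K) (fun i y hy hz => by
      rw [h.1 i y hy hz, h'.1 i y hy hz, add_zero]) hs, ← Finset.sum_add_distrib]
  refine Finset.sum_congr rfl fun i _ => ?_
  simp only [mul_add]
  exact integral_add (h.2 i) (h'.2 i)

theorem DensityIntegrable.sum {ι : Type*} {s : Finset ι} {δ : ι → Z → Eu m → ℂ} {K : Set Z}
    (h : ∀ a ∈ s, DensityIntegrable (δ a) K) :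
    DensityIntegrable (fun i y => ∑ a ∈ s, δ a i y) K := by
  refine ⟨fun i y hy hz => Finset.sum_eq_zero fun a ha => (h a ha).1 i y hy hz, fun i => ?_⟩
  simp only [Finset.mul_sum]
  exact integrable_finsetSum s fun a ha => (h a ha).2 i

theorem densityIntegral_sum {ι : Type*} (s : Finset ι) {δ : ι → Z → Eu m → ℂ} {K : Set Z}
    (hK : IsCompact K) (h : ∀ a ∈ s, DensityIntegrable (δ a) K) :
    densityIntegral Z (fun i y => ∑ a ∈ s, δ a i y) = ∑ a ∈ s, densityIntegral Z (δ a) := by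
  classical
  induction s using Finset.induction_on with
  | empty => simp [densityIntegral_zero]
  | insert a s ha ih =>
    simp only [Finset.sum_insert ha]
    rw [densityIntegral_add hK (h a (Finset.mem_insert_self _ _))
      (DensityIntegrable.sum fun b hb => h b (Finset.mem_insert_of_mem hb)),
      ih fun b hb => h b (Finset.mem_insert_of_mem hb)]

theorem DensityIntegrable.mono {δ : Z → Eu m → ℂ} {K K' : Set Z} (h : DensityIntegrable δ K)
    (hK : K ⊆ K') : DensityIntegrable δ K' :=
  ⟨fun i y hy hz => h.1 i y hy fun h' => hz (hK h'), h.2⟩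

/-- The part of a density over `S`. -/
def densityOn (S : Set Z) (δ : Z → Eu m → ℂ) : Z → Eu m → ℂ :=
  open Classical in fun i y => if (chartAt (Eu m) i).symm y ∈ S then δ i y else 0

theorem continuousOn_chartPartition (Φ : OpenPartialHomeomorph Z (Eu m)) (i : Z) :
    ContinuousOn (fun y => (chartPartition (m := m) Z i (Φ.symm y) : ℂ)) Φ.target :=
  Complex.continuous_ofReal.comp_continuousOn
    ((chartPartition (m := m) Z i).contMDiff.continuous.comp_continuousOn Φ.continuousOn_symm)

theorem DensityIntegrable.densityOn {S : Set Z} (hS : IsClosed S) {δ : Z → Eu m → ℂ} {K : Set Z}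
    (h : DensityIntegrable δ K) : DensityIntegrable (densityOn S δ) K := by
  classical
  refine ⟨fun i y hy hz => ?_, fun i => ?_⟩
  · simp only [HodgeFiltered.densityOn, h.1 i y hy hz, ite_self]
  · have ho := (chartAt (Eu m) i).isOpen_inter_preimage_symm hS.isOpen_compl
    have h1 := (h.2 i).indicator ho.measurableSet.compl
    refine IntegrableOn.congr_fun h1 (fun y hy => ?_)
      (chartAt (Eu m) i).open_target.measurableSet
    by_cases hz : (chartAt (Eu m) i).symm y ∈ S
    · have : y ∈ ((chartAt (Eu m) i).target ∩ (chartAt (Eu m) i).symm ⁻¹' Sᶜ)ᶜ :=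
        fun h' => h'.2 hz
      simp [HodgeFiltered.densityOn, hz]
    · have : y ∉ ((chartAt (Eu m) i).target ∩ (chartAt (Eu m) i).symm ⁻¹' Sᶜ)ᶜ :=
        fun h' => h' ⟨hy, hz⟩
      rw [Set.indicator_of_notMem this]
      simp [HodgeFiltered.densityOn, hz]

theorem DensityIntegrable.densityOn_open {S : Set Z} (hS : IsOpen S) {δ : Z → Eu m → ℂ} {K : Set Z}
    (h : DensityIntegrable δ K) : DensityIntegrable (HodgeFiltered.densityOn S δ) K := by
  classical
  refine ⟨fun i y hy hz => ?_, fun i => ?_⟩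
  · simp only [HodgeFiltered.densityOn, h.1 i y hy hz, ite_self]
  · have ho := (chartAt (Eu m) i).isOpen_inter_preimage_symm hS
    refine IntegrableOn.congr_fun ((h.2 i).indicator ho.measurableSet) (fun y hy => ?_)
      (chartAt (Eu m) i).open_target.measurableSet
    by_cases hz : (chartAt (Eu m) i).symm y ∈ S
    · simp [HodgeFiltered.densityOn, hz, hy]
    · simp [HodgeFiltered.densityOn, hz]

/-- The compact set in the coordinate domain on which the localization of a density lives. -/
theorem isCompact_image_chartPartition {K : Set Z} (hK : IsCompact K) (i : Z) :
    IsCompact ((chartAt (Eu m) i) '' (K ∩ tsupport (chartPartition (m := m) Z i))) ∧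
      (chartAt (Eu m) i) '' (K ∩ tsupport (chartPartition (m := m) Z i)) ⊆
        (chartAt (Eu m) i).target ∧
      ∀ δ : Z → Eu m → ℂ, DensityVanishesOff δ K → ∀ y ∈ (chartAt (Eu m) i).target \
        (chartAt (Eu m) i) '' (K ∩ tsupport (chartPartition (m := m) Z i)),
        (chartPartition (m := m) Z i ((chartAt (Eu m) i).symm y) : ℂ) * δ i y = 0 := by
  have hsub : K ∩ tsupport (chartPartition (m := m) Z i) ⊆ (chartAt (Eu m) i).source :=
    Set.inter_subset_right.trans (chartPartition_tsupport m i)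
  refine ⟨(hK.inter_right (isClosed_tsupport _)).image_of_continuousOn
    ((chartAt (Eu m) i).continuousOn.mono hsub), ?_, ?_⟩
  · rintro _ ⟨z, hz, rfl⟩
    exact (chartAt (Eu m) i).map_source (hsub hz)
  · intro δ hδ y hy
    by_cases hz : (chartAt (Eu m) i).symm y ∈ K
    · by_cases hz' : (chartAt (Eu m) i).symm y ∈ tsupport (chartPartition (m := m) Z i)
      · exact absurd ⟨_, ⟨hz, hz'⟩, (chartAt (Eu m) i).right_inv hy.1⟩ hy.2
      · rw [image_eq_zero_of_notMem_tsupport hz']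
        simp
    · rw [hδ i y hy.1 hz, mul_zero]

theorem DensityIntegrable.of_continuousOn {δ : Z → Eu m → ℂ} {K : Set Z} (hK : IsCompact K)
    (hv : DensityVanishesOff δ K) (hc : ∀ i, ContinuousOn (δ i) (chartAt (Eu m) i).target) :
    DensityIntegrable δ K := by
  refine ⟨hv, fun i => ?_⟩
  obtain ⟨h1, h2, h3⟩ := isCompact_image_chartPartition (m := m) hK i
  have h4 := ((continuousOn_chartPartition (chartAt (Eu m) i) i).mul (hc i)).mono h2
  exact (h4.integrableOn_compact h1).of_forall_sdiff_eq_zero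
    (chartAt (Eu m) i).open_target.measurableSet (h3 δ hv)

/-- The integral of a density which is supported in the domain of a chart. -/
theorem densityIntegral_eq_integral_chart {δ : Z → Eu m → ℂ} {K : Set Z} (hK : IsCompact K)
    (hv : DensityVanishesOff δ K) (Φ : OpenPartialHomeomorph Z (Eu m)) (hKΦ : K ⊆ Φ.source)
    {F : Eu m → ℂ} (hF : IntegrableOn F Φ.target)
    (hF0 : ∀ u ∈ Φ.target, Φ.symm u ∉ K → F u = 0)
    (hδ : ∀ i, ∀ y ∈ (chartAt (Eu m) i).target, (chartAt (Eu m) i).symm y ∈ Φ.source →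
      DifferentiableAt ℝ (fun y => Φ ((chartAt (Eu m) i).symm y)) y ∧
      δ i y = |(fderiv ℝ (fun y => Φ ((chartAt (Eu m) i).symm y)) y).det| •
        F (Φ ((chartAt (Eu m) i).symm y))) :
    DensityIntegrable δ K ∧ densityIntegral Z δ = ∫ u in Φ.target, F u := by
  let φ := fun i : Z => chartAt (Eu m) i
  let g := fun (i : Z) (y : Eu m) => Φ ((φ i).symm y)
  let s := fun i : Z => (φ i).target ∩ (φ i).symm ⁻¹' Φ.source
  have hs : ∀ i, IsOpen (s i) := fun i => (φ i).isOpen_inter_preimage_symm Φ.open_source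
  have hsub : ∀ i, s i ⊆ (φ i).target := fun i => Set.inter_subset_left
  let P := fun (i : Z) (u : Eu m) => (chartPartition (m := m) Z i (Φ.symm u) : ℂ) * F u
  have himg : ∀ i, g i '' s i = Φ.target ∩ Φ.symm ⁻¹' (φ i).source := by
    intro i
    ext u
    constructor
    · rintro ⟨y, hy, rfl⟩
      refine ⟨Φ.map_source hy.2, ?_⟩
      rw [Set.mem_preimage]
      simp only [g]
      rw [Φ.left_inv hy.2]
      exact (φ i).map_target hy.1
    · rintro ⟨hu, hu'⟩
      refine ⟨φ i (Φ.symm u), ⟨(φ i).map_source hu', ?_⟩, ?_⟩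
      · rw [Set.mem_preimage, (φ i).left_inv hu']
        exact Φ.map_target hu
      · simp only [g]
        rw [(φ i).left_inv hu', Φ.right_inv hu]
  have hinj : ∀ i, Set.InjOn (g i) (s i) := by
    intro i y hy y' hy' h
    exact (φ i).symm.injOn hy.1 hy'.1 (Φ.injOn hy.2 hy'.2 h)
  have hder : ∀ i, ∀ y ∈ s i, HasFDerivWithinAt (g i) (fderiv ℝ (g i) y) (s i) y := fun i y hy =>
    (hδ i y hy.1 hy.2).1.hasFDerivAt.hasFDerivWithinAt
  -- The transformation law of a density is precisely the integrand of the change of variables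
  -- formula.
  have hPeq : ∀ i, ∀ y ∈ s i, |(fderiv ℝ (g i) y).det| • P i (g i y) =
      (chartPartition (m := m) Z i ((φ i).symm y) : ℂ) * δ i y := by
    intro i y hy
    rw [(hδ i y hy.1 hy.2).2]
    simp only [P, g]
    rw [Φ.left_inv hy.2, mul_smul_comm]
  have hPint : ∀ i, IntegrableOn (P i) Φ.target := fun i =>
    Integrable.bdd_mul (c := 1) hF ((continuousOn_chartPartition Φ i).aestronglyMeasurable
      Φ.open_target.measurableSet) (Filter.Eventually.of_forall fun u => by
        rw [Complex.norm_real, Real.norm_of_nonneg ((chartPartition (m := m) Z).nonneg i _)]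
        exact (chartPartition (m := m) Z).le_one i _)
  have hvs : ∀ i, ∀ y ∈ (φ i).target \ s i,
      (chartPartition (m := m) Z i ((φ i).symm y) : ℂ) * δ i y = 0 := by
    intro i y hy
    rw [hv i y hy.1 fun h => hy.2 ⟨hy.1, hKΦ h⟩, mul_zero]
  have hint : ∀ i, IntegrableOn
      (fun y => (chartPartition (m := m) Z i ((φ i).symm y) : ℂ) * δ i y) (φ i).target := by
    intro i
    have h1 : IntegrableOn (P i) (g i '' s i) := by
      rw [himg]
      exact (hPint i).mono_set Set.inter_subset_left
    have h2 := (integrableOn_image_iff_integrableOn_abs_det_fderiv_smul volume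
      (hs i).measurableSet (hder i) (hinj i) (P i)).1 h1
    exact (h2.congr_fun (hPeq i) (hs i).measurableSet).of_forall_sdiff_eq_zero
      (φ i).open_target.measurableSet (hvs i)
  -- Each patch is moved to the coordinates of `Φ`. The part of `Φ.target` that the chart at `i`
  -- does not reach contributes nothing, as the `i`-th partition function vanishes outside that
  -- chart.
  have hval : ∀ i, ∫ y in (φ i).target, (chartPartition (m := m) Z i ((φ i).symm y) : ℂ) * δ i y =
      ∫ u in Φ.target, P i u := by
    intro i
    rw [setIntegral_eq_of_subset_of_forall_sdiff_eq_zero (φ i).open_target.measurableSet (hsub i)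
      (hvs i), ← setIntegral_congr_fun (hs i).measurableSet (hPeq i),
      ← integral_image_eq_integral_abs_det_fderiv_smul volume (hs i).measurableSet (hder i)
        (hinj i), himg]
    refine (setIntegral_eq_of_subset_of_forall_sdiff_eq_zero Φ.open_target.measurableSet
      Set.inter_subset_left fun u hu => ?_).symm
    simp only [P]
    rw [chartPartition_eq_zero m fun h => hu.2 ⟨hu.1, h⟩]
    simp
  refine ⟨⟨hv, hint⟩, ?_⟩
  obtain ⟨t, ht⟩ := exists_finset_chartPartition m hK
  rw [densityIntegral_eq_sum hv ht]
  rw [Finset.sum_congr rfl fun i _ => hval i, ← integral_finsetSum _ fun i _ => hPint i]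
  refine setIntegral_congr_fun Φ.open_target.measurableSet fun u hu => ?_
  simp only [P, ← Finset.sum_mul]
  by_cases hz : Φ.symm u ∈ K
  -- On `K` the patches recombine because the partition functions sum to one.
  · have h1 : ∑ i ∈ t, chartPartition (m := m) Z i (Φ.symm u) = 1 := by
      rw [← (chartPartition (m := m) Z).sum_eq_one (Set.mem_univ (Φ.symm u))]
      refine (finsum_eq_sum_of_support_subset _ fun i hi => ?_).symm
      by_contra hit
      exact hi (ht i (by simpa using hit) _ hz)
    rw [← Complex.ofReal_sum, h1, Complex.ofReal_one, one_mul]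
  · rw [hF0 u hu hz, mul_zero]

end Density

/-! ### The theorem of Stokes for a half space -/

section HalfSpace

variable {n : ℕ}

/-- The inclusion of `ℝ^n` into `ℝ^{n+1}` as the last coordinates. -/
def inclL (n : ℕ) : Eu n →L[ℝ] Eu (n + 1) :=
  LinearMap.toContinuousLinearMap
    { toFun := fun x => WithLp.toLp 2 (Fin.cons 0 x.ofLp)
      map_add' := fun x y => by
        ext j
        refine Fin.cases ?_ (fun j => ?_) j <;> simp
      map_smul' := fun c x => by
        ext j
        refine Fin.cases ?_ (fun j => ?_) j <;> simp }

/-- The point with first coordinate `t` and the other coordinates given by `x`. -/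
def consE (t : ℝ) (x : Eu n) : Eu (n + 1) := WithLp.toLp 2 (Fin.cons t x.ofLp)

@[simp] theorem inclL_zero (x : Eu n) : inclL n x 0 = 0 := rfl

@[simp] theorem inclL_succ (x : Eu n) (j : Fin n) : inclL n x j.succ = x j := rfl

@[simp] theorem consE_zero (t : ℝ) (x : Eu n) : consE t x 0 = t := rfl

@[simp] theorem consE_succ (t : ℝ) (x : Eu n) (j : Fin n) : consE t x j.succ = x j := rfl

theorem consE_eq (t : ℝ) (x : Eu n) : consE t x = t • stdVec 0 + inclL n x := by
  ext j
  refine Fin.cases ?_ (fun j => ?_) j <;> simp [stdVec]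

theorem contDiff_consE : ContDiff ℝ ∞ fun p : ℝ × Eu n => consE p.1 p.2 := by
  simp only [consE_eq]
  exact (contDiff_fst.smul contDiff_const).add ((inclL n).contDiff.comp contDiff_snd)

theorem fderiv_consE (t : ℝ) (x : Eu n) : HasFDerivAt (consE t) (inclL n) x := by
  have : consE (n := n) t = fun x => t • stdVec 0 + inclL n x := funext fun x => consE_eq t x
  rw [this]
  exact (inclL n).hasFDerivAt.const_add _

/-- Laplace expansion along the row of `dx 0` leaves the minor of the last `n` coordinates, which is
the restriction to the hyperplane. This is where the convention that the normal direction comes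
first enters. -/
theorem topCoeff_dx_zero_mul (x : Ext (n + 1)) :
    topCoeff (n + 1) (dx 0 * x) = topCoeff n (pb (inclL n) x) := by
  have h : (topCoeff (n + 1)) ∘ₗ (LinearMap.mulLeft ℂ (dx 0)) =
      (topCoeff n) ∘ₗ (pb (inclL n)).toLinearMap := by
    refine ExteriorAlgebra.lhom_ext fun k => ?_
    ext v
    simp only [LinearMap.compAlternatingMap_apply, LinearMap.comp_apply, AlgHom.toLinearMap_apply,
      LinearMap.mulLeft_apply]
    have h1 : dx 0 * ExteriorAlgebra.ιMulti ℂ k v =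
        ExteriorAlgebra.ιMulti ℂ (k + 1) (Matrix.vecCons (Pi.single 0 1) v) := by
      rw [ExteriorAlgebra.ιMulti_succ_apply]
      rfl
    rw [h1, pb, ExteriorAlgebra.map_apply_ιMulti]
    by_cases hk : k = n
    · subst hk
      rw [topCoeff_ιMulti, topCoeff_ιMulti, Matrix.det_succ_row_zero, Fin.sum_univ_succ]
      simp only [Matrix.of_apply, Matrix.cons_val_zero, Pi.single_apply, Fin.succ_ne_zero]
      simp only [Fin.val_zero, pow_zero, if_true, mul_one, one_mul, if_false, mul_zero, zero_mul,
        Finset.sum_const_zero, add_zero]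
      congr 1
      ext i j
      simp only [Matrix.submatrix_apply, Matrix.of_apply, Matrix.cons_val_succ, Function.comp_apply,
        Matrix.vecMulLinear_apply, Matrix.vecMul, dotProduct, matOf, Fin.sum_univ_succ]
      simp [stdVec, Fin.zero_succAbove, apply_ite]
    · rw [topCoeff_ιMulti_of_ne hk, topCoeff_ιMulti_of_ne (by omega)]
  exact DFunLike.congr_fun h x

/-- Fubini with the first coordinate split off: `consE` preserves volume, being composed of the
identifications of Euclidean spaces with products of lines. -/
theorem integral_eu_succ {f : Eu (n + 1) → ℂ} (hf : Integrable f) :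
    ∫ y, f y = ∫ x : Eu n, ∫ t : ℝ, f (consE t x) := by
  have h1 := PiLp.volume_preserving_toLp (Fin (n + 1))
  have h2 := (volume_preserving_piFinSuccAbove (fun _ : Fin (n + 1) => ℝ) 0).symm
  have h3 := PiLp.volume_preserving_ofLp (Fin n)
  have hm : MeasurePreserving (fun p : ℝ × Eu n => consE p.1 p.2) := by
    have h4 := h1.comp (h2.comp ((MeasurePreserving.id (volume : Measure ℝ)).prod h3))
    have h5 : (fun p : ℝ × Eu n => consE p.1 p.2) = WithLp.toLp 2 ∘
        (MeasurableEquiv.piFinSuccAbove (fun _ : Fin (n + 1) => ℝ) 0).symm ∘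
        Prod.map id WithLp.ofLp := by
      funext p
      simp only [consE, Function.comp_apply, Prod.map, MeasurableEquiv.piFinSuccAbove_symm_apply,
        Fin.insertNthEquiv, id, Equiv.coe_fn_mk, Fin.insertNth_zero]
      rfl
    rw [h5]
    exact h4
  have he : MeasurableEmbedding (fun p : ℝ × Eu n => consE p.1 p.2) := by
    refine Continuous.measurableEmbedding contDiff_consE.continuous ?_
    intro p p' h
    refine Prod.ext ?_ ?_
    · have := congrArg (fun y : Eu (n + 1) => y 0) h
      simpa using this
    · ext j
      have := congrArg (fun y : Eu (n + 1) => y j.succ) h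
      simpa using this
  rw [← hm.integral_comp he, Measure.volume_eq_prod]
  exact integral_prod_symm _ (by
    rw [← Measure.volume_eq_prod]
    exact (hm.integrable_comp_emb he).2 hf)

theorem measurableSet_halfSpace (t : ℝ) : MeasurableSet {y : Eu (n + 1) | y 0 ≤ t} := by
  have : IsClosed {y : Eu (n + 1) | y 0 ≤ t} :=
    isClosed_le (EuclideanSpace.proj (𝕜 := ℝ) (0 : Fin (n + 1))).continuous continuous_const
  exact this.measurableSet

/-- On each line in the normal direction this is the fundamental theorem of calculus on `(-∞, t]`;
compact support removes the lower endpoint. -/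
theorem integral_halfSpace_normal {G : Eu (n + 1) → ℂ} (hG : ContDiff ℝ ∞ G)
    (hc : HasCompactSupport G) (t : ℝ) :
    ∫ y in {y : Eu (n + 1) | y 0 ≤ t}, fderiv ℝ G y (stdVec 0) = ∫ x : Eu n, G (consE t x) := by
  have hint : Integrable (fun y => fderiv ℝ G y (stdVec 0)) :=
    ((hG.continuous_fderiv (by simp)).clm_apply continuous_const).integrable_of_hasCompactSupport
      (hc.fderiv_apply ℝ _)
  rw [← integral_indicator (measurableSet_halfSpace t),
    integral_eu_succ (hint.indicator (measurableSet_halfSpace t))]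
  refine integral_congr_ae (Filter.Eventually.of_forall fun x => ?_)
  have hcons : ∀ s : ℝ, HasDerivAt (fun s => consE s x) (stdVec 0) s := by
    intro s
    simp only [consE_eq]
    have := ((hasDerivAt_id s).smul_const (stdVec 0 : Eu (n + 1))).add_const (inclL n x)
    simpa using this
  have hd : ∀ s, HasDerivAt (fun s => G (consE s x)) (fderiv ℝ G (consE s x) (stdVec 0)) s :=
    fun s => ((hG.differentiable (by simp)) _).hasFDerivAt.comp_hasDerivAt s (hcons s)
  have hGs : ContDiff ℝ 1 (fun s : ℝ => G (consE s x)) :=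
    (hG.comp (contDiff_consE.comp (contDiff_id.prodMk contDiff_const))).of_le (by simp)
  have hcs : HasCompactSupport (fun s : ℝ => G (consE s x)) := by
    have himg : IsCompact ((EuclideanSpace.proj (𝕜 := ℝ) (0 : Fin (n + 1))) '' tsupport G) :=
      hc.isCompact.image (EuclideanSpace.proj (𝕜 := ℝ) (0 : Fin (n + 1))).continuous
    refine HasCompactSupport.intro himg fun s hs => ?_
    by_contra h
    exact hs ⟨consE s x, subset_tsupport _ h, rfl⟩
  have h1 := HasCompactSupport.integral_Iic_deriv_eq hGs hcs t
  simp only [(hd _).deriv] at h1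
  rw [← integral_indicator measurableSet_Iic] at h1
  refine Eq.trans (integral_congr_ae (Filter.Eventually.of_forall fun s => ?_)) h1
  by_cases hs : s ≤ t <;> simp [Set.indicator_apply, hs]

/-- Integration by parts against the indicator function of the half space, which is constant along
tangential lines and so has line derivative zero there. -/
theorem integral_halfSpace_tangential {G : Eu (n + 1) → ℂ} (hG : ContDiff ℝ ∞ G)
    (hc : HasCompactSupport G) (t : ℝ) (j : Fin n) :
    ∫ y in {y : Eu (n + 1) | y 0 ≤ t}, fderiv ℝ G y (stdVec j.succ) = 0 := by
  classical
  have hint : Integrable (fun y => fderiv ℝ G y (stdVec j.succ)) :=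
    ((hG.continuous_fderiv (by simp)).clm_apply continuous_const).integrable_of_hasCompactSupport
      (hc.fderiv_apply ℝ _)
  have hint' : Integrable G := hG.continuous.integrable_of_hasCompactSupport hc
  let f : Eu (n + 1) → ℝ := Set.indicator {y : Eu (n + 1) | y 0 ≤ t} 1
  have hfi : ∀ H : Eu (n + 1) → ℂ, (fun y => ContinuousLinearMap.lsmul ℝ ℝ (f y) (H y)) =
      Set.indicator {y : Eu (n + 1) | y 0 ≤ t} H := by
    intro H
    funext y
    by_cases hy : y 0 ≤ t <;> simp [f, hy]
  have h := integral_bilinear_hasLineDerivAt_right_eq_neg_left_of_integrable (μ := volume)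
    (f := f) (f' := fun _ => 0) (g := G) (g' := fun y => fderiv ℝ G y (stdVec j.succ))
    (v := stdVec j.succ) (B := ContinuousLinearMap.lsmul ℝ ℝ) (by simp)
    (by rw [hfi]; exact hint.indicator (measurableSet_halfSpace t))
    (by rw [hfi]; exact hint'.indicator (measurableSet_halfSpace t))
    (fun y _ => by
      have : (fun s : ℝ => f (y + s • stdVec j.succ)) = fun _ => f y := by
        funext s
        simp [f, Set.indicator_apply, stdVec]
      rw [HasLineDerivAt, this]
      exact hasDerivAt_const _ _)
    (fun y _ => ((hG.differentiable (by simp)) y).hasFDerivAt.hasLineDerivAt _)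
  rw [hfi (fun y => fderiv ℝ G y (stdVec j.succ)), integral_indicator (measurableSet_halfSpace t)]
    at h
  rw [h]
  simp

/-- Integration by parts against the constant function `1`. -/
theorem integral_fderiv_eq_zero {m : ℕ} {G : Eu m → ℂ} (hG : ContDiff ℝ ∞ G)
    (hc : HasCompactSupport G) (v : Eu m) : ∫ y, fderiv ℝ G y v = 0 := by
  have hint : Integrable (fun y => fderiv ℝ G y v) :=
    ((hG.continuous_fderiv (by simp)).clm_apply continuous_const).integrable_of_hasCompactSupport
      (hc.fderiv_apply ℝ _)
  have hint' : Integrable G := hG.continuous.integrable_of_hasCompactSupport hc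
  have h := integral_bilinear_hasLineDerivAt_right_eq_neg_left_of_integrable (μ := volume)
    (f := fun _ : Eu m => (1 : ℝ)) (f' := fun _ => 0) (g := G)
    (g' := fun y => fderiv ℝ G y v) (v := v) (B := ContinuousLinearMap.lsmul ℝ ℝ) (by simp)
    (by simpa using hint) (by simpa using hint')
    (fun y _ => by
      rw [HasLineDerivAt]
      exact hasDerivAt_const _ _)
    (fun y _ => ((hG.differentiable (by simp)) y).hasFDerivAt.hasLineDerivAt _)
  simpa using h

/-- Exhibits the top coefficient of an exterior derivative as a divergence, so that Stokes can be
checked one partial derivative at a time. -/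
theorem topCoeff_dE {m : ℕ} {ξ : Eu m → Ext m} (hξ : ContDiff ℝ ∞ ξ) (y : Eu m) :
    topCoeff m (dE ξ y) =
      ∑ j, fderiv ℝ (fun z => topCoeff m (dx j * ξ z)) y (stdVec j) := by
  rw [dE, map_sum]
  refine Finset.sum_congr rfl fun j _ => ?_
  have h : HasFDerivAt (fun z => topCoeff m (dx j * ξ z))
      ((topCoeffL m).comp ((ContinuousLinearMap.mul ℝ (Ext m) (dx j)).comp (fderiv ℝ ξ y))) y :=
    (topCoeffL m).hasFDerivAt.comp y ((ContinuousLinearMap.mul ℝ (Ext m) (dx j)).hasFDerivAt.comp y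
      ((hξ.differentiable (by simp)) y).hasFDerivAt)
  rw [h.fderiv]
  rfl

theorem contDiff_topCoeff_dx_mul {m : ℕ} {ξ : Eu m → Ext m} (hξ : ContDiff ℝ ∞ ξ) (j : Fin m) :
    ContDiff ℝ ∞ (fun z => topCoeff m (dx j * ξ z)) :=
  (topCoeffL m).contDiff.comp (contDiff_const.mul hξ)

theorem hasCompactSupport_topCoeff_dx_mul {m : ℕ} {ξ : Eu m → Ext m} (hc : HasCompactSupport ξ)
    (j : Fin m) : HasCompactSupport (fun z => topCoeff m (dx j * ξ z)) :=
  hc.comp_left (g := fun x => topCoeff m (dx j * x)) (by simp)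

theorem integrable_fderiv_apply {m : ℕ} {G : Eu m → ℂ} (hG : ContDiff ℝ ∞ G)
    (hc : HasCompactSupport G) (v : Eu m) : Integrable (fun y => fderiv ℝ G y v) :=
  ((hG.continuous_fderiv (by simp)).clm_apply continuous_const).integrable_of_hasCompactSupport
    (hc.fderiv_apply ℝ _)

/-- The theorem of Stokes for compactly supported forms on `ℝ^m`. -/
theorem integral_topCoeff_dE {m : ℕ} {ξ : Eu m → Ext m} (hξ : ContDiff ℝ ∞ ξ)
    (hc : HasCompactSupport ξ) : ∫ y, topCoeff m (dE ξ y) = 0 := by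
  simp only [topCoeff_dE hξ]
  rw [integral_finsetSum _ fun j _ => integrable_fderiv_apply (contDiff_topCoeff_dx_mul hξ j)
    (hasCompactSupport_topCoeff_dx_mul hc j) _]
  exact Finset.sum_eq_zero fun j _ => integral_fderiv_eq_zero (contDiff_topCoeff_dx_mul hξ j)
    (hasCompactSupport_topCoeff_dx_mul hc j) _

/-- The theorem of Stokes for a half space. -/
theorem integral_halfSpace_topCoeff_dE {ξ : Eu (n + 1) → Ext (n + 1)} (hξ : ContDiff ℝ ∞ ξ)
    (hc : HasCompactSupport ξ) (t : ℝ) :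
    ∫ y in {y : Eu (n + 1) | y 0 ≤ t}, topCoeff (n + 1) (dE ξ y) =
      ∫ x : Eu n, topCoeff n (pb (inclL n) (ξ (consE t x))) := by
  have hs : ∀ j, ContDiff ℝ ∞ (fun z => topCoeff (n + 1) (dx j * ξ z)) :=
    contDiff_topCoeff_dx_mul hξ
  have hk : ∀ j, HasCompactSupport (fun z => topCoeff (n + 1) (dx j * ξ z)) :=
    hasCompactSupport_topCoeff_dx_mul hc
  have h0 : ∀ z, topCoeff (n + 1) (dx 0 * ξ z) = topCoeff n (pb (inclL n) (ξ z)) :=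
    fun z => topCoeff_dx_zero_mul _
  have hE := fun y => topCoeff_dE hξ y
  generalize hG : (fun j z => topCoeff (n + 1) (dx j * ξ z)) = G at *
  have hG' : ∀ j z, topCoeff (n + 1) (dx j * ξ z) = G j z := fun j z => by rw [← hG]
  simp only [hG'] at hs hk h0 hE
  simp only [hE, ← h0]
  -- Of the divergence only the normal component `j = 0` survives.
  rw [integral_finsetSum _ fun j _ => (integrable_fderiv_apply (hs j) (hk j) _).integrableOn,
    Fin.sum_univ_succ, Finset.sum_eq_zero fun j _ =>
      integral_halfSpace_tangential (hs j.succ) (hk j.succ) t j, add_zero]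
  exact integral_halfSpace_normal (hs 0) (hk 0) t

end HalfSpace

/-! ### The theorem of Stokes for sublevel sets -/

section Sign

/-- The sign of a real number, as a complex number. -/
def sgn (r : ℝ) : ℂ := ((SignType.sign r : ℝ) : ℂ)

theorem sgn_mul (r s : ℝ) : sgn (r * s) = sgn r * sgn s := by
  simp [sgn, sign_mul]

theorem sgn_pos {r : ℝ} (h : 0 < r) : sgn r = 1 := by simp [sgn, sign_pos h]

theorem sgn_neg {r : ℝ} (h : r < 0) : sgn r = -1 := by simp [sgn, sign_neg h]

theorem sgn_mul_ofReal (r : ℝ) : sgn r * r = (|r| : ℝ) := by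
  rw [sgn, ← Complex.ofReal_mul, sign_mul_self]

theorem eventually_sgn_eq {T : Type*} [TopologicalSpace T] {f : T → ℝ} {y : T}
    (hf : ContinuousAt f y) (h : f y ≠ 0) : ∀ᶠ z in 𝓝 y, sgn (f z) = sgn (f y) := by
  rcases lt_or_gt_of_ne h with h | h
  · filter_upwards [hf.eventually_lt_const h] with z hz
    rw [sgn_neg h, sgn_neg hz]
  · filter_upwards [hf.eventually_const_lt h] with z hz
    rw [sgn_pos h, sgn_pos hz]

end Sign

/-! ### Changes of coordinates between smooth local charts -/

section Transition

variable {m : ℕ} {W : Type*} [TopologicalSpace W] [ChartedSpace (Eu m) W]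

/-- A local diffeomorphism to the model space. -/
structure SmoothChart (Φ : OpenPartialHomeomorph W (Eu m)) : Prop where
  smooth : ContMDiffOn (𝓡 m) 𝓘(ℝ, Eu m) ∞ Φ Φ.source
  smooth_symm : ContMDiffOn 𝓘(ℝ, Eu m) (𝓡 m) ∞ Φ.symm Φ.target

theorem smoothChart_chartAt [IsManifold (𝓡 m) ∞ W] (x : W) : SmoothChart (chartAt (Eu m) x) :=
  ⟨contMDiffOn_chart, contMDiffOn_chart_symm⟩

theorem SmoothChart.contDiffAt_comp_symm {Φ : OpenPartialHomeomorph W (Eu m)} (hΦ : SmoothChart Φ)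
    {E : Type*} [NormedAddCommGroup E] [NormedSpace ℝ E] {f : W → E} {y : Eu m}
    (hy : y ∈ Φ.target) (hf : ContMDiffAt (𝓡 m) 𝓘(ℝ, E) ∞ f (Φ.symm y)) :
    ContDiffAt ℝ ∞ (fun z => f (Φ.symm z)) y := by
  rw [← contMDiffAt_iff_contDiffAt]
  exact hf.comp y (hΦ.smooth_symm.contMDiffAt (Φ.open_target.mem_nhds hy))

/-- The change of coordinates between two charts. -/
def chartTrans (Φ Ψ : OpenPartialHomeomorph W (Eu m)) : Eu m → Eu m := fun y => Ψ (Φ.symm y)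

variable {Φ Ψ Θ : OpenPartialHomeomorph W (Eu m)}

theorem contDiffAt_chartTrans (hΦ : SmoothChart Φ) (hΨ : SmoothChart Ψ) {y : Eu m}
    (hy : y ∈ Φ.target) (hy' : Φ.symm y ∈ Ψ.source) : ContDiffAt ℝ ∞ (chartTrans Φ Ψ) y :=
  hΦ.contDiffAt_comp_symm hy (hΨ.smooth.contMDiffAt (Ψ.open_source.mem_nhds hy'))

theorem eventually_chartTrans {y : Eu m} (hy : y ∈ Φ.target) (hy' : Φ.symm y ∈ Ψ.source) :
    ∀ᶠ z in 𝓝 y, z ∈ Φ.target ∧ Φ.symm z ∈ Ψ.source :=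
  (Φ.isOpen_inter_preimage_symm Ψ.open_source).mem_nhds ⟨hy, hy'⟩

theorem chartTrans_mem {y : Eu m} (hy' : Φ.symm y ∈ Ψ.source) : chartTrans Φ Ψ y ∈ Ψ.target :=
  Ψ.map_source hy'

theorem symm_chartTrans {y : Eu m} (hy' : Φ.symm y ∈ Ψ.source) :
    Ψ.symm (chartTrans Φ Ψ y) = Φ.symm y := Ψ.left_inv hy'

theorem fderiv_chartTrans_comp (hΦ : SmoothChart Φ) (hΨ : SmoothChart Ψ) (hΘ : SmoothChart Θ)
    {y : Eu m} (hy : y ∈ Φ.target) (hΨy : Φ.symm y ∈ Ψ.source) (hΘy : Φ.symm y ∈ Θ.source) :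
    fderiv ℝ (chartTrans Φ Θ) y =
      (fderiv ℝ (chartTrans Ψ Θ) (chartTrans Φ Ψ y)).comp (fderiv ℝ (chartTrans Φ Ψ) y) := by
  rw [← fderiv_comp y ((contDiffAt_chartTrans hΨ hΘ (chartTrans_mem hΨy)
    (by rwa [symm_chartTrans hΨy])).differentiableAt (by simp))
    ((contDiffAt_chartTrans hΦ hΨ hy hΨy).differentiableAt (by simp))]
  refine Filter.EventuallyEq.fderiv_eq ?_
  filter_upwards [eventually_chartTrans hy hΨy] with z hz
  rw [Function.comp_apply, chartTrans, chartTrans, symm_chartTrans hz.2]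

theorem fderiv_chartTrans_self {y : Eu m} (hy : y ∈ Φ.target) :
    fderiv ℝ (chartTrans Φ Φ) y = ContinuousLinearMap.id ℝ (Eu m) := by
  have h : chartTrans Φ Φ =ᶠ[𝓝 y] id := by
    filter_upwards [Φ.open_target.mem_nhds hy] with z hz
    exact Φ.right_inv hz
  rw [h.fderiv_eq, fderiv_id]

theorem det_comp_clm (A B : Eu m →L[ℝ] Eu m) : (A.comp B).det = A.det * B.det := by
  rw [ContinuousLinearMap.det, ContinuousLinearMap.det, ContinuousLinearMap.det,
    ContinuousLinearMap.toLinearMap_comp, LinearMap.det_comp]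

/-- Going there and back is the identity, so the Jacobian determinant divides `1`. Non-vanishing
makes its sign locally constant. -/
theorem det_chartTrans_ne_zero (hΦ : SmoothChart Φ) (hΨ : SmoothChart Ψ) {y : Eu m}
    (hy : y ∈ Φ.target) (hy' : Φ.symm y ∈ Ψ.source) :
    (fderiv ℝ (chartTrans Φ Ψ) y).det ≠ 0 := by
  have h1 := fderiv_chartTrans_comp hΦ hΨ hΦ hy hy' (Φ.map_target hy)
  rw [fderiv_chartTrans_self hy] at h1
  have h2 := congrArg ContinuousLinearMap.det h1
  rw [det_comp_clm] at h2
  intro h0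
  rw [h0, mul_zero] at h2
  simp [ContinuousLinearMap.det] at h2

theorem eventually_sgn_chartTrans (hΦ : SmoothChart Φ) (hΨ : SmoothChart Ψ) {y : Eu m}
    (hy : y ∈ Φ.target) (hy' : Φ.symm y ∈ Ψ.source) :
    ∀ᶠ z in 𝓝 y, sgn (fderiv ℝ (chartTrans Φ Ψ) z).det = sgn (fderiv ℝ (chartTrans Φ Ψ) y).det :=
  eventually_sgn_eq (f := fun z => (fderiv ℝ (chartTrans Φ Ψ) z).det)
    (ContinuousLinearMap.continuous_det.continuousAt.comp
      ((contDiffAt_chartTrans hΦ hΨ hy hy').fderiv_right (m := 0) (by simp)).continuousAt)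
    (det_chartTrans_ne_zero hΦ hΨ hy hy')

end Transition

/-! ### Forms twisted by the orientation bundle, in coordinates -/

section TwistedFamily

variable {m : ℕ} {W : Type*} [TopologicalSpace W] [ChartedSpace (Eu m) W] [IsManifold (𝓡 m) ∞ W]

/-- The coordinate expressions, in all charts, of a smooth form with values in the orientation
bundle. -/
structure TwistedFamily (ξ : W → Eu m → Ext m) : Prop where
  smooth : ∀ i, ∀ y ∈ (chartAt (Eu m) i).target, ContDiffAt ℝ ∞ (ξ i) y
  compat : ∀ i j y, y ∈ (chartAt (Eu m) i).target →
    (chartAt (Eu m) i).symm y ∈ (chartAt (Eu m) j).source →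
    ξ i y = sgn (fderiv ℝ (coordChange (d := m) i j) y).det •
      pb (fderiv ℝ (coordChange i j) y) (ξ j (coordChange i j y))

/-- The family vanishes outside of `K`. -/
def FamilyVanishesOff (ξ : W → Eu m → Ext m) (K : Set W) : Prop :=
  ∀ i, ∀ y ∈ (chartAt (Eu m) i).target, (chartAt (Eu m) i).symm y ∉ K → ξ i y = 0

/-- The product of a family with a function. -/
def familySMul (g : W → ℝ) (ξ : W → Eu m → Ext m) : W → Eu m → Ext m :=
  fun i y => (g ((chartAt (Eu m) i).symm y) : ℂ) • ξ i y

theorem TwistedFamily.smul {ξ : W → Eu m → Ext m} (h : TwistedFamily ξ) {g : W → ℝ}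
    (hg : ContMDiff (𝓡 m) 𝓘(ℝ, ℝ) ∞ g) : TwistedFamily (familySMul g ξ) := by
  refine ⟨fun i y hy => ?_, fun i j y hy hj => ?_⟩
  · have h1 := (smoothChart_chartAt i).contDiffAt_comp_symm hy (hg.contMDiffAt)
    exact (Complex.ofRealCLM.contDiff.contDiffAt.comp y h1).smul (h.smooth i y hy)
  · rw [familySMul, familySMul, h.compat i j y hy hj, map_smul, smul_comm, coordChange,
      (chartAt (Eu m) j).left_inv hj]

/-- The expression of the family with respect to the chart `Φ`, whose domain is contained in the
domain of the chart at `x`. -/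
def familyInChart (ξ : W → Eu m → Ext m) (x : W) (Φ : OpenPartialHomeomorph W (Eu m)) (u : Eu m) :
    Ext m :=
  sgn (fderiv ℝ (chartTrans Φ (chartAt (Eu m) x)) u).det •
    pb (fderiv ℝ (chartTrans Φ (chartAt (Eu m) x)) u) (ξ x (chartTrans Φ (chartAt (Eu m) x) u))

variable {ξ : W → Eu m → Ext m} {x : W} {Φ : OpenPartialHomeomorph W (Eu m)}

/-- The sign of the Jacobian is locally constant; freezing it at `u` leaves a manifestly smooth
expression. -/
theorem TwistedFamily.contDiffAt_familyInChart (h : TwistedFamily ξ) (hΦ : SmoothChart Φ)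
    (hx : Φ.source ⊆ (chartAt (Eu m) x).source) {u : Eu m} (hu : u ∈ Φ.target) :
    ContDiffAt ℝ ∞ (familyInChart ξ x Φ) u := by
  have hu' : Φ.symm u ∈ (chartAt (Eu m) x).source := hx (Φ.map_target hu)
  have h1 := contDiffAt_chartTrans hΦ (smoothChart_chartAt x) hu hu'
  have h2 : ContDiffAt ℝ ∞ (fun z => sgn (fderiv ℝ (chartTrans Φ (chartAt (Eu m) x)) u).det •
      pb (fderiv ℝ (chartTrans Φ (chartAt (Eu m) x)) z)
        (ξ x (chartTrans Φ (chartAt (Eu m) x) z))) u :=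
    (contDiffAt_pb (h1.fderiv_right (by simp)) ((h.smooth x _ (chartTrans_mem hu')).comp u
      h1)).const_smul _
  refine h2.congr_of_eventuallyEq ?_
  filter_upwards [eventually_sgn_chartTrans hΦ (smoothChart_chartAt x) hu hu'] with z hz
  rw [familyInChart, hz]

theorem TwistedFamily.eq_familyInChart (h : TwistedFamily ξ) (hΦ : SmoothChart Φ)
    (hx : Φ.source ⊆ (chartAt (Eu m) x).source) {i : W} {y : Eu m}
    (hy : y ∈ (chartAt (Eu m) i).target) (hy' : (chartAt (Eu m) i).symm y ∈ Φ.source) :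
    ξ i y = sgn (fderiv ℝ (chartTrans (chartAt (Eu m) i) Φ) y).det •
      pb (fderiv ℝ (chartTrans (chartAt (Eu m) i) Φ) y)
        (familyInChart ξ x Φ (chartTrans (chartAt (Eu m) i) Φ y)) := by
  have h1 := fderiv_chartTrans_comp (smoothChart_chartAt i) hΦ (smoothChart_chartAt x) hy hy'
    (hx hy')
  have h2 := h.compat i x y hy (hx hy')
  have h3 : coordChange (d := m) i x = chartTrans (chartAt (Eu m) i) (chartAt (Eu m) x) := rfl
  rw [h3, h1, det_comp_clm, sgn_mul, pb_comp] at h2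
  rw [h2, familyInChart, map_smul, smul_smul, mul_comm]
  rw [chartTrans, chartTrans, chartTrans, Φ.left_inv hy']

/-- The sign from the twist and the determinant from `topCoeff_pb` combine to the absolute value of
the Jacobian. Thus the exterior derivative of a twisted family of top degree is a density and can be
integrated without an orientation. -/
theorem TwistedFamily.topCoeff_dE_eq (h : TwistedFamily ξ) (hΦ : SmoothChart Φ)
    (hx : Φ.source ⊆ (chartAt (Eu m) x).source) {i : W} {y : Eu m}
    (hy : y ∈ (chartAt (Eu m) i).target) (hy' : (chartAt (Eu m) i).symm y ∈ Φ.source) :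
    topCoeff m (dE (ξ i) y) = |(fderiv ℝ (chartTrans (chartAt (Eu m) i) Φ) y).det| •
      topCoeff m (dE (familyInChart ξ x Φ) (chartTrans (chartAt (Eu m) i) Φ y)) := by
  have h1 := contDiffAt_chartTrans (smoothChart_chartAt i) hΦ hy hy'
  have h2 := h.contDiffAt_familyInChart hΦ hx (chartTrans_mem hy')
  have h3 : ξ i =ᶠ[𝓝 y] fun z => sgn (fderiv ℝ (chartTrans (chartAt (Eu m) i) Φ) y).det •
      pb (fderiv ℝ (chartTrans (chartAt (Eu m) i) Φ) z)
        (familyInChart ξ x Φ (chartTrans (chartAt (Eu m) i) Φ z)) := by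
    filter_upwards [eventually_chartTrans hy hy',
      eventually_sgn_chartTrans (smoothChart_chartAt i) hΦ hy hy'] with z hz hz'
    rw [h.eq_familyInChart hΦ hx hz.1 hz.2, hz']
  have h4 : DifferentiableAt ℝ (fun z => pb (fderiv ℝ (chartTrans (chartAt (Eu m) i) Φ) z)
        (familyInChart ξ x Φ (chartTrans (chartAt (Eu m) i) Φ z))) y :=
    (contDiffAt_pb (n := ∞) (h1.fderiv_right (by simp)) (h2.comp y h1)).differentiableAt (by simp)
  rw [dE_congr h3, dE_const_smul _ h4, dE_pb h1 (h2.differentiableAt (by simp)), map_smul,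
    topCoeff_pb, smul_eq_mul, ← mul_assoc, sgn_mul_ofReal]
  rfl

end TwistedFamily

/-! ### Determinants of frames -/

section FrameDet

variable {m n : ℕ}

/-- The determinant of a frame of `ℝ^m`. -/
def frameDet (m : ℕ) : Eu m [⋀^Fin m]→ₗ[ℝ] ℝ := (EuclideanSpace.basisFun (Fin m) ℝ).toBasis.det

theorem frameDet_map (A : Eu m →L[ℝ] Eu m) (v : Fin m → Eu m) :
    frameDet m (fun j => A (v j)) = A.det * frameDet m v :=
  (EuclideanSpace.basisFun (Fin m) ℝ).toBasis.det_comp A.toLinearMap v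

theorem frameDet_stdVec : frameDet m stdVec = 1 := by
  have h : (stdVec : Fin m → Eu m) = (EuclideanSpace.basisFun (Fin m) ℝ).toBasis := by
    funext j
    simp [stdVec]
  rw [h]
  exact (EuclideanSpace.basisFun (Fin m) ℝ).toBasis.det_self

theorem frameDet_apply (v : Fin m → Eu m) : frameDet m v = (Matrix.of fun j x => v x j).det := by
  rw [frameDet, Module.Basis.det_apply]
  congr 1

theorem frameDet_clm (A : Eu m →L[ℝ] Eu m) : frameDet m (fun j => A (stdVec j)) = A.det := by
  rw [frameDet_map, frameDet_stdVec, mul_one]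

/-- All vectors but the first have zeroth coordinate `0`, so one term of the Laplace expansion
survives. This compares an orientation with the induced one on a boundary hyperplane. -/
theorem frameDet_cons (a : Eu (n + 1)) (v : Fin n → Eu n) :
    frameDet (n + 1) (Fin.cons a fun j => inclL n (v j)) = a 0 * frameDet n v := by
  rw [frameDet_apply, frameDet_apply, Matrix.det_succ_row_zero, Fin.sum_univ_succ]
  simp only [Matrix.of_apply, Fin.cons_zero, Fin.cons_succ, inclL_zero, Fin.val_zero, pow_zero, one_mul, mul_zero,
    zero_mul, Finset.sum_const_zero, add_zero]
  congr 2

end FrameDet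

/-! ### Extension by zero of locally supported forms -/

section Extension

variable {m : ℕ}

/-- Near `K` the extension is `f`, and on the open complement of `K` it is zero. -/
theorem contDiff_indicator {G : Type*} [NormedAddCommGroup G] [NormedSpace ℝ G] {f : Eu m → G}
    {U K : Set (Eu m)} (hU : IsOpen U) (hK : IsCompact K) (hKU : K ⊆ U)
    (hf : ∀ u ∈ U, ContDiffAt ℝ ∞ f u) (h0 : ∀ u ∈ U, u ∉ K → f u = 0) :
    ContDiff ℝ ∞ (U.indicator f) ∧ ∀ u ∉ K, U.indicator f u = 0 := by
  have h1 : ∀ u ∉ K, U.indicator f u = 0 := by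
    intro u hu
    by_cases huU : u ∈ U
    · rw [Set.indicator_of_mem huU, h0 u huU hu]
    · rw [Set.indicator_of_notMem huU]
  refine ⟨contDiff_iff_contDiffAt.2 fun u => ?_, h1⟩
  by_cases hu : u ∈ K
  · refine (hf u (hKU hu)).congr_of_eventuallyEq ?_
    filter_upwards [hU.mem_nhds (hKU hu)] with z hz
    rw [Set.indicator_of_mem hz]
  · refine (contDiffAt_const (c := 0)).congr_of_eventuallyEq ?_
    filter_upwards [hK.isClosed.isOpen_compl.mem_nhds hu] with z hz
    exact h1 z hz

theorem dE_eq_zero_of_notMem {ξ : Eu m → Ext m} {K : Set (Eu m)} (hK : IsCompact K)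
    (h : ∀ u ∉ K, ξ u = 0) {u : Eu m} (hu : u ∉ K) : dE ξ u = 0 := by
  have h1 : ξ =ᶠ[𝓝 u] fun _ => 0 := by
    filter_upwards [hK.isClosed.isOpen_compl.mem_nhds hu] with z hz
    exact h z hz
  rw [dE_congr h1, dE_const]

theorem integrable_topCoeff_dE {ξ : Eu m → Ext m} (hξ : ContDiff ℝ ∞ ξ) {K : Set (Eu m)}
    (hK : IsCompact K) (h : ∀ u ∉ K, ξ u = 0) : Integrable fun u => topCoeff m (dE ξ u) := by
  have hc : Continuous fun u => topCoeff m (dE ξ u) :=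
    (topCoeffL m).continuous.comp (contDiff_iff_contDiffAt.2 fun u =>
      contDiffAt_dE hξ.contDiffAt).continuous
  refine hc.integrable_of_hasCompactSupport (HasCompactSupport.intro hK fun u hu => ?_)
  rw [dE_eq_zero_of_notMem hK h hu, map_zero]

end Extension

/-! ### The integral of an exterior derivative within one chart -/

section Piece

variable {m : ℕ} {W : Type*} [TopologicalSpace W] [T2Space W] [SigmaCompactSpace W]
  [ChartedSpace (Eu m) W] [IsManifold (𝓡 m) ∞ W] {ξ : W → Eu m → Ext m} {x : W}
  {Φ : OpenPartialHomeomorph W (Eu m)} {K : Set W}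

/-- The expression of a family supported in the domain of a chart extends to the model space. -/
theorem TwistedFamily.exists_extension (h : TwistedFamily ξ) (hΦ : SmoothChart Φ)
    (hx : Φ.source ⊆ (chartAt (Eu m) x).source) (hK : IsCompact K) (hKΦ : K ⊆ Φ.source)
    (hv : FamilyVanishesOff ξ K) :
    ∃ Ξ : Eu m → Ext m, ContDiff ℝ ∞ Ξ ∧ (∀ u ∉ Φ '' K, Ξ u = 0) ∧
      ∀ u ∈ Φ.target, Ξ u = familyInChart ξ x Φ u := by
  have hK' : IsCompact (Φ '' K) := hK.image_of_continuousOn (Φ.continuousOn.mono hKΦ)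
  have hsub : Φ '' K ⊆ Φ.target := by
    rintro _ ⟨z, hz, rfl⟩
    exact Φ.map_source (hKΦ hz)
  have h1 := contDiff_indicator Φ.open_target hK' hsub
    (fun u hu => h.contDiffAt_familyInChart hΦ hx hu) (fun u hu huK => by
      rw [familyInChart, hv x _ (chartTrans_mem (hx (Φ.map_target hu))), map_zero, smul_zero]
      rw [symm_chartTrans (hx (Φ.map_target hu))]
      exact fun hz => huK ⟨_, hz, Φ.right_inv hu⟩)
  exact ⟨_, h1.1, h1.2, fun u hu => Set.indicator_of_mem hu _⟩

theorem notMem_image_of_symm {u : Eu m} (hKΦ : K ⊆ Φ.source)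
    (hz : Φ.symm u ∉ K) : u ∉ Φ '' K := by
  rintro ⟨z, hz', rfl⟩
  rw [Φ.left_inv (hKΦ hz')] at hz
  exact hz hz'

/-- The integral of the exterior derivative over the part `S` of the manifold, in a chart. -/
theorem TwistedFamily.densityIntegral_piece (h : TwistedFamily ξ) (hΦ : SmoothChart Φ)
    (hx : Φ.source ⊆ (chartAt (Eu m) x).source) (hK : IsCompact K) (hKΦ : K ⊆ Φ.source)
    (hv : FamilyVanishesOff ξ K) {Ξ : Eu m → Ext m} (hΞ : ContDiff ℝ ∞ Ξ)
    (hΞ0 : ∀ u ∉ Φ '' K, Ξ u = 0) (hΞ1 : ∀ u ∈ Φ.target, Ξ u = familyInChart ξ x Φ u)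
    {S : Set W} {S' : Set (Eu m)} (hS' : MeasurableSet S')
    (hSS' : ∀ w ∈ Φ.source, w ∈ S ↔ Φ w ∈ S') :
    DensityIntegrable (densityOn S fun i y => topCoeff m (dE (ξ i) y)) K ∧
      densityIntegral W (densityOn S fun i y => topCoeff m (dE (ξ i) y)) =
        ∫ u in S', topCoeff m (dE Ξ u) := by
  classical
  have hK' : IsCompact (Φ '' K) := hK.image_of_continuousOn (Φ.continuousOn.mono hKΦ)
  have hint := integrable_topCoeff_dE hΞ hK' hΞ0
  have hF0 : ∀ u ∉ Φ '' K, S'.indicator (fun u => topCoeff m (dE Ξ u)) u = 0 := by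
    intro u hu
    by_cases huS : u ∈ S'
    · rw [Set.indicator_of_mem huS, dE_eq_zero_of_notMem hK' hΞ0 hu, map_zero]
    · rw [Set.indicator_of_notMem huS]
  have hd : ∀ i, ∀ y ∈ (chartAt (Eu m) i).target, (chartAt (Eu m) i).symm y ∉ K →
      dE (ξ i) y = 0 := by
    intro i y hy hz
    have : ξ i =ᶠ[𝓝 y] fun _ => 0 := by
      filter_upwards [((chartAt (Eu m) i).isOpen_inter_preimage_symm
        hK.isClosed.isOpen_compl).mem_nhds ⟨hy, hz⟩] with z hz
      exact hv i z hz.1 hz.2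
    rw [dE_congr this, dE_const]
  have h1 := densityIntegral_eq_integral_chart hK
    (δ := densityOn S fun i y => topCoeff m (dE (ξ i) y))
    (F := S'.indicator fun u => topCoeff m (dE Ξ u)) (fun i y hy hz => by
      simp only [densityOn, hd i y hy hz, map_zero, ite_self]) Φ hKΦ
    (hint.indicator hS').integrableOn
    (fun u _ hz => hF0 u (notMem_image_of_symm hKΦ hz)) (fun i y hy hy' => by
      refine ⟨(contDiffAt_chartTrans (smoothChart_chartAt i) hΦ hy hy').differentiableAt (by simp),
        ?_⟩
      have h2 := h.topCoeff_dE_eq hΦ hx hy hy'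
      -- The extension agrees with the coordinate expression on an open set, so the derivatives
      -- agree as well.
      have h3 : dE (familyInChart ξ x Φ) (chartTrans (chartAt (Eu m) i) Φ y) =
          dE Ξ (chartTrans (chartAt (Eu m) i) Φ y) := by
        refine dE_congr ?_
        filter_upwards [Φ.open_target.mem_nhds (chartTrans_mem hy')] with z hz
        exact (hΞ1 z hz).symm
      rw [h3] at h2
      by_cases hyS : (chartAt (Eu m) i).symm y ∈ S
      · rw [Set.indicator_of_mem ((hSS' _ hy').1 hyS)]
        simp only [densityOn, hyS, if_true]
        exact h2
      · rw [Set.indicator_of_notMem fun h' => hyS ((hSS' _ hy').2 h')]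
        simp [densityOn, hyS])
  refine ⟨h1.1, h1.2.trans ?_⟩
  rw [setIntegral_eq_integral_of_forall_compl_eq_zero, integral_indicator hS']
  intro u hu
  refine hF0 u ?_
  rintro ⟨z, hz, rfl⟩
  exact hu (Φ.map_source (hKΦ hz))

/-- The contribution of a chart whose domain does not meet the level set. -/
theorem TwistedFamily.densityIntegral_interior (h : TwistedFamily ξ) (hΦ : SmoothChart Φ)
    (hx : Φ.source ⊆ (chartAt (Eu m) x).source) (hK : IsCompact K) (hKΦ : K ⊆ Φ.source)
    (hv : FamilyVanishesOff ξ K) {S : Set W} (hS : Φ.source ⊆ S ∨ Disjoint Φ.source S) :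
    DensityIntegrable (densityOn S fun i y => topCoeff m (dE (ξ i) y)) K ∧
      densityIntegral W (densityOn S fun i y => topCoeff m (dE (ξ i) y)) = 0 := by
  obtain ⟨Ξ, h1, h2, h3⟩ := h.exists_extension hΦ hx hK hKΦ hv
  rcases hS with hS | hS
  · have h4 := h.densityIntegral_piece hΦ hx hK hKΦ hv h1 h2 h3 (S := S) MeasurableSet.univ
      (fun w hw => by simp [hS hw])
    refine ⟨h4.1, h4.2.trans ?_⟩
    rw [setIntegral_univ]
    exact integral_topCoeff_dE h1 (HasCompactSupport.intro
      (hK.image_of_continuousOn (Φ.continuousOn.mono hKΦ)) h2)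
  · have h4 := h.densityIntegral_piece hΦ hx hK hKΦ hv h1 h2 h3 (S := S) MeasurableSet.empty
      (fun w hw => by simp [Set.disjoint_left.1 hS hw])
    refine ⟨h4.1, h4.2.trans ?_⟩
    simp

end Piece

/-! ### Level sets with the boundary orientation -/

section Boundary

/-- The coordinate expression of the inclusion of a level set. -/
def inclLoc {m n : ℕ} {W : Type*} [TopologicalSpace W] [ChartedSpace (Eu m) W] {c : W → ℝ} {t : ℝ}
    [ChartedSpace (Eu n) {w // c w = t}] (i' : {w // c w = t}) (i : W) : Eu n → Eu m :=
  fun y => chartAt (Eu m) i ((chartAt (Eu n) i').symm y).1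

/-- The frame `ν, ∂ι/∂y_1, …, ∂ι/∂y_n`. -/
def bdryFrame {m n : ℕ} (hmn : m = n + 1) (ν : Eu m) (J : Eu n →L[ℝ] Eu m) : Fin m → Eu m :=
  (Fin.cons ν fun j => J (stdVec j)) ∘ Fin.cast hmn

/-- The density on the level set is the restriction of the form, where the level set is oriented
as the boundary of the sublevel set. -/
def IsBoundaryDensity {m n : ℕ} (hmn : m = n + 1) {W : Type*} [TopologicalSpace W]
    [ChartedSpace (Eu m) W] (c : W → ℝ) (t : ℝ) [ChartedSpace (Eu n) {w // c w = t}]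
    (ξ : W → Eu m → Ext m) (δ : {w // c w = t} → Eu n → ℂ) : Prop :=
  ∀ i', ∀ y ∈ (chartAt (Eu n) i').target, ∀ i,
    ((chartAt (Eu n) i').symm y).1 ∈ (chartAt (Eu m) i).source → ∀ ν : Eu m,
    0 < fderiv ℝ (fun z => c ((chartAt (Eu m) i).symm z)) (inclLoc i' i y) ν →
    δ i' y = sgn (frameDet m (bdryFrame hmn ν (fderiv ℝ (inclLoc i' i) y))) *
      topCoeff n (pb (fderiv ℝ (inclLoc i' i) y) (ξ i (inclLoc i' i y)))

/-- The isomorphism of `ℝ × ℝ^n` with `ℝ^{n+1}`. -/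
def consCLE (n : ℕ) : (ℝ × Eu n) ≃L[ℝ] Eu (n + 1) :=
  LinearEquiv.toContinuousLinearEquiv
    { toFun := fun p => consE p.1 p.2
      invFun := fun y => (y 0, WithLp.toLp 2 fun j => y j.succ)
      map_add' := fun p q => by
        ext j
        refine Fin.cases ?_ (fun j => ?_) j <;> simp
      map_smul' := fun a p => by
        ext j
        refine Fin.cases ?_ (fun j => ?_) j <;> simp
      left_inv := fun p => by
        refine Prod.ext (by simp) ?_
        ext j
        simp
      right_inv := fun y => by
        ext j
        refine Fin.cases ?_ (fun j => ?_) j <;> simp }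

theorem consCLE_apply {n : ℕ} (p : ℝ × Eu n) : consCLE n p = consE p.1 p.2 := rfl

variable {n : ℕ} {W : Type*} [TopologicalSpace W] [T2Space W]
  [ChartedSpace (Eu (n + 1)) W] [IsManifold (𝓡 (n + 1)) ∞ W] {c : W → ℝ} {t : ℝ}

/-- `IsBoundaryDensity` determines the density only once some vector with `dc(ν) > 0` is given;
regularity supplies one with `dc(ν) = 1`. -/
theorem exists_pos_direction (hc : ContMDiff (𝓡 (n + 1)) 𝓘(ℝ, ℝ) ∞ c) (w : W)
    (hw : Function.Surjective (mfderiv (𝓡 (n + 1)) 𝓘(ℝ, ℝ) c w)) :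
    ∃ ν, 0 < fderiv ℝ (fun z => c ((chartAt (Eu (n + 1)) w).symm z))
      (chartAt (Eu (n + 1)) w w) ν := by
  have h : fderiv ℝ (fun z => c ((chartAt (Eu (n + 1)) w).symm z)) (chartAt (Eu (n + 1)) w w) =
      mfderiv (𝓡 (n + 1)) 𝓘(ℝ, ℝ) c w := by
    rw [(hc.mdifferentiableAt (by simp)).mfderiv]
    simp only [mfld_simps, fderivWithin_univ]
    rfl
  obtain ⟨ν, hν⟩ := hw (1 : ℝ)
  refine ⟨ν, ?_⟩
  rw [h]
  exact one_pos.trans_eq hν.symm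

variable [ChartedSpace (Eu n) {w // c w = t}]
  {ξ : W → Eu (n + 1) → Ext (n + 1)} {δ : {w // c w = t} → Eu n → ℂ} {K : Set W}

theorem IsBoundaryDensity.vanishesOff (hδ : IsBoundaryDensity rfl c t ξ δ)
    (hc : ContMDiff (𝓡 (n + 1)) 𝓘(ℝ, ℝ) ∞ c)
    (hreg : ∀ w, c w = t → Function.Surjective (mfderiv (𝓡 (n + 1)) 𝓘(ℝ, ℝ) c w))
    (hv : FamilyVanishesOff ξ K) : DensityVanishesOff δ (Subtype.val ⁻¹' K) := by
  intro i' y hy hz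
  set w := (chartAt (Eu n) i').symm y with hw
  obtain ⟨ν, hν⟩ := exists_pos_direction hc w.1 (hreg w.1 w.2)
  rw [hδ i' y hy w.1 (mem_chart_source _ _) ν hν, hv, map_zero, map_zero, mul_zero]
  · exact (chartAt (Eu (n + 1)) w.1).map_source (mem_chart_source _ _)
  · rw [inclLoc, (chartAt (Eu (n + 1)) w.1).left_inv (mem_chart_source _ _)]
    exact hz

variable [SigmaCompactSpace W] [SigmaCompactSpace {w // c w = t}]
  [IsManifold (𝓡 n) ∞ {w // c w = t}]

/-- The integral over the level set of a form supported in the domain of an adapted chart. -/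
theorem IsBoundaryDensity.densityIntegral_piece (hδ : IsBoundaryDensity rfl c t ξ δ)
    (h : TwistedFamily ξ) (hc : ContMDiff (𝓡 (n + 1)) 𝓘(ℝ, ℝ) ∞ c)
    (hreg : ∀ w, c w = t → Function.Surjective (mfderiv (𝓡 (n + 1)) 𝓘(ℝ, ℝ) c w))
    (hι : ContMDiff (𝓡 n) (𝓡 (n + 1)) ∞ (Subtype.val : {w // c w = t} → W))
    (s₀ : {w // c w = t}) {x : W} {Φ₁ : OpenPartialHomeomorph W (ℝ × Eu n)}
    (hΦ₁ : ∀ w ∈ Φ₁.source, (Φ₁ w).1 = c w)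
    (hΦ : SmoothChart (Φ₁.transHomeomorph (consCLE n).toHomeomorph))
    (hx : Φ₁.source ⊆ (chartAt (Eu (n + 1)) x).source) (hK : IsCompact K) (hKΦ : K ⊆ Φ₁.source)
    (hv : FamilyVanishesOff ξ K) {Ξ : Eu (n + 1) → Ext (n + 1)} (hΞ : ContDiff ℝ ∞ Ξ)
    (hΞ0 : ∀ u ∉ (Φ₁.transHomeomorph (consCLE n).toHomeomorph) '' K, Ξ u = 0)
    (hΞ1 : ∀ u ∈ (Φ₁.transHomeomorph (consCLE n).toHomeomorph).target,
      Ξ u = familyInChart ξ x (Φ₁.transHomeomorph (consCLE n).toHomeomorph) u) :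
    DensityIntegrable δ (Subtype.val ⁻¹' K) ∧
      densityIntegral {w // c w = t} δ = ∫ u, topCoeff n (pb (inclL n) (Ξ (consE t u))) := by
  set Φ := Φ₁.transHomeomorph (consCLE n).toHomeomorph with hΦdef
  have hΦa : ∀ w, Φ w = consE (Φ₁ w).1 (Φ₁ w).2 := fun w => rfl
  have hKc : IsCompact (Subtype.val ⁻¹' K : Set {w // c w = t}) :=
    (isClosed_singleton.preimage hc.continuous).isClosedEmbedding_subtypeVal.isCompact_preimage hK
  -- In the coordinates `Φ` the level set is the hyperplane where the first coordinate is `t`; its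
  -- chart `Φ'` consists of the remaining coordinates.
  let Φ' : OpenPartialHomeomorph {w // c w = t} (Eu n) := levelChart (m := n + 1) s₀ Φ₁ hΦ₁
  have hΦ'a : ∀ s, Φ' s = (Φ₁ s.1).2 := fun s => rfl
  have hΦΦ' : ∀ s : {w // c w = t}, s.1 ∈ Φ₁.source → Φ s.1 = consE t (Φ' s) := by
    intro s hs
    rw [hΦa, hΦ'a, hΦ₁ _ hs, s.2]
  let F : Eu n → ℂ := fun u => topCoeff n (pb (inclL n) (Ξ (consE t u)))
  have hF0 : ∀ u, u ∉ Φ' '' (Subtype.val ⁻¹' K) → F u = 0 := by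
    intro u hu
    simp only [F]
    rw [hΞ0, map_zero, map_zero]
    rintro ⟨z, hz, hzu⟩
    have h1 : Φ₁ z = (t, u) := (consCLE n).injective hzu
    have h2 : c z = t := by rw [← hΦ₁ z (hKΦ hz), h1]
    refine hu ⟨⟨z, h2⟩, hz, ?_⟩
    rw [hΦ'a, h1]
  have hK' : IsCompact (Φ' '' (Subtype.val ⁻¹' K)) :=
    hKc.image_of_continuousOn (Φ'.continuousOn.mono fun s hs => hKΦ hs)
  have hFc : Continuous F := by
    have h1 : ContDiff ℝ ∞ fun u => pb (inclL n) (Ξ (consE t u)) :=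
      contDiff_iff_contDiffAt.2 fun u => contDiffAt_pb contDiffAt_const
        (hΞ.contDiffAt.comp u (contDiff_consE.contDiffAt.comp u
          (contDiffAt_const.prodMk contDiffAt_id)))
    exact (topCoeffL n).continuous.comp h1.continuous
  have hFi : Integrable F :=
    hFc.integrable_of_hasCompactSupport (HasCompactSupport.intro hK' hF0)
  have h1 := densityIntegral_eq_integral_chart hKc (hδ.vanishesOff hc hreg hv) Φ'
    (fun s hs => hKΦ hs) (F := F) hFi.integrableOn
    (fun u _ hz => hF0 u (notMem_image_of_symm (fun s hs => hKΦ hs) hz)) (fun i' y hy hy' => by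
      set s := (chartAt (Eu n) i').symm y with hs
      have hsΦ : s.1 ∈ Φ.source := hy'
      obtain ⟨ν, hν⟩ := exists_pos_direction hc s.1 (hreg s.1 s.2)
      have hmem : s.1 ∈ (chartAt (Eu (n + 1)) s.1).source := mem_chart_source _ _
      have hsm := (smoothChart_chartAt (m := n) i')
      have hιs : ContDiffAt ℝ ∞ (inclLoc (m := n + 1) i' s.1) y := hsm.contDiffAt_comp_symm hy
        (f := fun s' => chartAt (Eu (n + 1)) s.1 s'.1)
        ((contMDiffOn_chart.contMDiffAt
          ((chartAt (Eu (n + 1)) s.1).open_source.mem_nhds hmem)).comp s hι.contMDiffAt)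
      have hΦs : ContDiffAt ℝ ∞ (fun z => Φ ((chartAt (Eu n) i').symm z).1) y :=
        hsm.contDiffAt_comp_symm hy (f := fun s' => Φ s'.1)
          ((hΦ.smooth.contMDiffAt (Φ.open_source.mem_nhds hsΦ)).comp s hι.contMDiffAt)
      have hΦ's : DifferentiableAt ℝ (fun z => Φ' ((chartAt (Eu n) i').symm z)) y := by
        have h2 := ((ContinuousLinearMap.snd ℝ ℝ (Eu n)).comp
          ((consCLE n).symm : Eu (n + 1) →L[ℝ] ℝ × Eu n)).differentiableAt.comp y
            (hΦs.differentiableAt (by simp))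
        refine h2.congr_of_eventuallyEq (Filter.Eventually.of_forall fun z => ?_)
        change _ = ((consCLE n).symm ((consCLE n) (Φ₁ ((chartAt (Eu n) i').symm z).1))).2
        rw [ContinuousLinearEquiv.symm_apply_apply]
        rfl
      refine ⟨hΦ's, ?_⟩
      have hev : ∀ᶠ z in 𝓝 y, z ∈ (chartAt (Eu n) i').target ∧
          ((chartAt (Eu n) i').symm z).1 ∈ Φ.source ∧
          ((chartAt (Eu n) i').symm z).1 ∈ (chartAt (Eu (n + 1)) s.1).source :=
        ((chartAt (Eu n) i').isOpen_inter_preimage_symm ((Φ.open_source.inter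
          (chartAt (Eu (n + 1)) s.1).open_source).preimage continuous_subtype_val)).mem_nhds
            ⟨hy, hsΦ, hmem⟩
      set y₁ := inclLoc (m := n + 1) i' s.1 y with hy₁
      change 0 < fderiv ℝ (fun z => c ((chartAt (Eu (n + 1)) s.1).symm z)) y₁ ν at hν
      have hy₁t : y₁ ∈ (chartAt (Eu (n + 1)) s.1).target :=
        (chartAt (Eu (n + 1)) s.1).map_source hmem
      have hy₁s : (chartAt (Eu (n + 1)) s.1).symm y₁ = s.1 :=
        (chartAt (Eu (n + 1)) s.1).left_inv hmem
      set G := fderiv ℝ (chartTrans (chartAt (Eu (n + 1)) s.1) Φ) y₁ with hG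
      set J := fderiv ℝ (inclLoc (m := n + 1) i' s.1) y with hJ
      set P := fderiv ℝ (fun z => Φ' ((chartAt (Eu n) i').symm z)) y with hP
      have hGd := contDiffAt_chartTrans (smoothChart_chartAt s.1) hΦ hy₁t
        (by rw [hy₁s]; exact hsΦ)
      -- In adapted coordinates the inclusion of the level set is `consE t`, whose derivative is the
      -- linear inclusion `inclL n`.
      have hGJ : G.comp J = (inclL n).comp P := by
        have h2 := (hGd.differentiableAt (by simp)).hasFDerivAt.comp y
          (hιs.differentiableAt (by simp)).hasFDerivAt
        have h3 := (fderiv_consE t (Φ' s)).comp y hΦ's.hasFDerivAt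
        refine h2.unique (h3.congr_of_eventuallyEq ?_)
        filter_upwards [hev] with z hz
        change Φ ((chartAt (Eu (n + 1)) s.1).symm (chartAt (Eu (n + 1)) s.1
          ((chartAt (Eu n) i').symm z).1)) = consE t (Φ' ((chartAt (Eu n) i').symm z))
        rw [(chartAt (Eu (n + 1)) s.1).left_inv hz.2.2, hΦΦ' _ hz.2.1]
      have hGν : G ν 0 = fderiv ℝ (fun z => c ((chartAt (Eu (n + 1)) s.1).symm z)) y₁ ν := by
        have h2 := (EuclideanSpace.proj (𝕜 := ℝ) (0 : Fin (n + 1))).hasFDerivAt.comp y₁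
          (hGd.differentiableAt (by simp)).hasFDerivAt
        have h3 : (fun z => c ((chartAt (Eu (n + 1)) s.1).symm z)) =ᶠ[𝓝 y₁]
            (EuclideanSpace.proj (𝕜 := ℝ) (0 : Fin (n + 1))) ∘
              chartTrans (chartAt (Eu (n + 1)) s.1) Φ := by
          filter_upwards [eventually_chartTrans (Ψ := Φ) hy₁t (by rw [hy₁s]; exact hsΦ)] with z hz
          exact (hΦ₁ _ hz.2).symm
        rw [h3.fderiv_eq, h2.fderiv]
        rfl
      -- `G` carries the frame `(ν, J e_1, …)` to `(G ν, inclL (P e_1), …)`. Its determinant is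
      -- computed once from `G` and once as a block determinant whose corner `G ν 0 = dc(ν)` is
      -- positive; so the boundary sign is that of `det P` times that of `det G`.
      have hsign : G.det * frameDet (n + 1) (bdryFrame rfl ν J) = G ν 0 * P.det := by
        rw [← frameDet_map, ← frameDet_clm P, ← frameDet_cons]
        congr 1
        funext j
        refine Fin.cases rfl (fun j => ?_) j
        exact DFunLike.congr_fun hGJ (stdVec j)
      have hsg : sgn (frameDet (n + 1) (bdryFrame rfl ν J)) * sgn G.det = sgn P.det := by
        rw [mul_comm, ← sgn_mul, hsign, sgn_mul, hGν, sgn_pos hν, one_mul]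
      -- The signs collapse to `sgn (det P)`, and with the factor `det P` from the top coefficient
      -- they give `|det P|`, as a density requires.
      rw [hδ i' y hy s.1 hmem ν hν, h.eq_familyInChart hΦ hx hy₁t (by rw [hy₁s]; exact hsΦ),
        map_smul, map_smul, smul_eq_mul, ← mul_assoc, hsg, ← pb_comp, hGJ, pb_comp, topCoeff_pb,
        ← mul_assoc, sgn_mul_ofReal, ← hΞ1 _ (chartTrans_mem (by rw [hy₁s]; exact hsΦ)), chartTrans,
        hy₁s, hΦΦ' s hsΦ]
      rfl)
  refine ⟨h1.1, h1.2.trans ?_⟩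
  refine setIntegral_eq_integral_of_forall_compl_eq_zero fun u hu => hF0 u ?_
  rintro ⟨z, hz, rfl⟩
  exact hu (Φ'.map_source (hKΦ hz))

end Boundary

/-! ### Stokes for sublevel sets: localization and partition of unity -/

section Stokes

variable {n : ℕ} {W : Type*} [TopologicalSpace W] [T2Space W] [SigmaCompactSpace W]
  [ChartedSpace (Eu (n + 1)) W] [IsManifold (𝓡 (n + 1)) ∞ W] {c : W → ℝ} {t : ℝ}
  [ChartedSpace (Eu n) {w // c w = t}] [SigmaCompactSpace {w // c w = t}]
  [IsManifold (𝓡 n) ∞ {w // c w = t}]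

/-- A set between the open and the closed ray is one of the two. Both are admitted because `[a, b]`
is obtained by removing `(-∞, a)` from `(-∞, b]`. -/
theorem measurableSet_coord_preimage {t : ℝ} {T : Set ℝ} (hT : Set.Iio t ⊆ T)
    (hT' : T ⊆ Set.Iic t) : MeasurableSet {y : Eu (n + 1) | y 0 ∈ T} := by
  have hm : MeasurableSet T := by
    by_cases ht : t ∈ T
    · have : T = Set.Iic t := Set.Subset.antisymm hT' fun s hs => by
        rcases lt_or_eq_of_le (Set.mem_Iic.1 hs) with h | h
        · exact hT h
        · rwa [h]
      rw [this]
      exact measurableSet_Iic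
    · have : T = Set.Iio t := Set.Subset.antisymm
        (fun s hs => lt_of_le_of_ne (Set.mem_Iic.1 (hT' hs)) fun h : s = t => ht (h ▸ hs)) hT
      rw [this]
      exact measurableSet_Iio
  exact (EuclideanSpace.proj (𝕜 := ℝ) (0 : Fin (n + 1))).continuous.measurable hm

/-- The two candidates differ by a hyperplane, which is a null set. -/
theorem coord_preimage_ae_eq {t : ℝ} {T : Set ℝ} (hT : Set.Iio t ⊆ T) (hT' : T ⊆ Set.Iic t) :
    {y : Eu (n + 1) | y 0 ∈ T} =ᵐ[volume] {y : Eu (n + 1) | y 0 ≤ t} := by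
  have h0 : volume {y : Eu (n + 1) | y 0 = t} = 0 := by
    have h1 := (PiLp.volume_preserving_ofLp (Fin (n + 1))).measure_preimage
      (s := {f : Fin (n + 1) → ℝ | f 0 = t})
      (measurableSet_eq_fun (measurable_pi_apply 0) measurable_const).nullMeasurableSet
    exact h1.trans (Measure.pi_hyperplane (fun _ : Fin (n + 1) => (volume : Measure ℝ)) 0 t)
  have h1 : ∀ᵐ y : Eu (n + 1), y 0 ≠ t := measure_eq_zero_iff_ae_notMem.1 h0
  filter_upwards [h1] with y hy
  refine propext ⟨fun h => hT' h, fun h => hT (lt_of_le_of_ne h hy)⟩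

/-- Shrinking the adapted chart into the domain of the chart at `w` makes `familyInChart` available
on it, and `consCLE` moves it to the model space `ℝ^{n+1}`. -/
theorem exists_adapted_chart_subset (hc : ContMDiff (𝓡 (n + 1)) 𝓘(ℝ, ℝ) ∞ c) (w : W)
    (hw : Function.Surjective (mfderiv (𝓡 (n + 1)) 𝓘(ℝ, ℝ) c w)) :
    ∃ Φ : OpenPartialHomeomorph W (ℝ × Eu n), w ∈ Φ.source ∧
      (∀ x ∈ Φ.source, (Φ x).1 = c x) ∧ Φ.source ⊆ (chartAt (Eu (n + 1)) w).source ∧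
      SmoothChart (Φ.transHomeomorph (consCLE n).toHomeomorph) := by
  obtain ⟨Φ, h1, h2, h3, h4⟩ : ∃ Φ : OpenPartialHomeomorph W (ℝ × Eu n), w ∈ Φ.source ∧
      (∀ x ∈ Φ.source, (Φ x).1 = c x) ∧
      ContMDiffOn (𝓡 (n + 1)) 𝓘(ℝ, ℝ × Eu n) ∞ Φ Φ.source ∧
      ContMDiffOn 𝓘(ℝ, ℝ × Eu n) (𝓡 (n + 1)) ∞ Φ.symm Φ.target :=
    exists_adapted_chart hc w hw
  have ho := (chartAt (Eu (n + 1)) w).open_source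
  refine ⟨Φ.restrOpen _ ho, ⟨h1, mem_chart_source _ w⟩, fun x hx => h2 x hx.1,
    fun x hx => hx.2, ?_, ?_⟩
  · exact (contMDiff_iff_contDiff.2 (consCLE n).contDiff).comp_contMDiffOn
      (h3.mono fun x hx => hx.1)
  · refine ContMDiffOn.comp (g := Φ.symm) (t := Φ.target) h4
      (contMDiff_iff_contDiff.2 (consCLE n).symm.contDiff).contMDiffOn fun u hu => ?_
    exact hu.1

/-- The theorem of Stokes for forms supported in a neighbourhood of a point. -/
theorem exists_nhds_stokes (hc : ContMDiff (𝓡 (n + 1)) 𝓘(ℝ, ℝ) ∞ c)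
    (hreg : ∀ w, c w = t → Function.Surjective (mfderiv (𝓡 (n + 1)) 𝓘(ℝ, ℝ) c w))
    (hι : ContMDiff (𝓡 n) (𝓡 (n + 1)) ∞ (Subtype.val : {w // c w = t} → W)) {T : Set ℝ}
    (hT : Set.Iio t ⊆ T) (hT' : T ⊆ Set.Iic t) (x : W) :
    ∃ U : Set W, IsOpen U ∧ x ∈ U ∧ ∀ (K : Set W), IsCompact K → K ⊆ U →
      ∀ (ξ : W → Eu (n + 1) → Ext (n + 1)) (δ : {w // c w = t} → Eu n → ℂ), TwistedFamily ξ →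
      FamilyVanishesOff ξ K → IsBoundaryDensity rfl c t ξ δ →
      DensityIntegrable (densityOn (c ⁻¹' T) fun i y => topCoeff (n + 1) (dE (ξ i) y)) K ∧
      DensityIntegrable δ (Subtype.val ⁻¹' K) ∧
      densityIntegral W (densityOn (c ⁻¹' T) fun i y => topCoeff (n + 1) (dE (ξ i) y)) =
        densityIntegral {w // c w = t} δ := by
  by_cases hxt : c x = t
  · obtain ⟨Φ, h1, h2, h3, h4⟩ := exists_adapted_chart_subset hc x (hreg x hxt)
    refine ⟨Φ.source, Φ.open_source, h1, fun K hK hKU ξ δ hξ hv hδ => ?_⟩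
    obtain ⟨Ξ, hΞ, hΞ0, hΞ1⟩ := hξ.exists_extension h4 h3 hK hKU hv
    have h5 := hξ.densityIntegral_piece h4 h3 hK hKU hv hΞ hΞ0 hΞ1 (S := c ⁻¹' T)
      (measurableSet_coord_preimage hT hT') (fun w hw => by
        change c w ∈ T ↔ (Φ w).1 ∈ T
        rw [h2 w hw])
    have h6 := hδ.densityIntegral_piece hξ hc hreg hι ⟨x, hxt⟩ h2 h4 h3 hK hKU hv hΞ hΞ0 hΞ1
    refine ⟨h5.1, h6.1, ?_⟩
    rw [h5.2, h6.2, setIntegral_congr_set (coord_preimage_ae_eq hT hT')]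
    exact integral_halfSpace_topCoeff_dE hΞ (HasCompactSupport.intro (hK.image_of_continuousOn
      ((Φ.transHomeomorph (consCLE n).toHomeomorph).continuousOn.mono hKU)) hΞ0) t
  -- Away from the level set, `O` is the side of the level on which `x` lies. It is contained in the
  -- sublevel set or disjoint from it, so both integrals vanish.
  · let O : Set W := if c x < t then {w | c w < t} else {w | t < c w}
    have hO : IsOpen O := by
      simp only [O]
      split_ifs
      · exact isOpen_lt hc.continuous continuous_const
      · exact isOpen_lt continuous_const hc.continuous
    have hxO : x ∈ O := by
      simp only [O]
      split_ifs with h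
      · exact h
      · exact lt_of_le_of_ne (not_lt.1 h) (Ne.symm hxt)
    have hOt : ∀ w ∈ O, c w ≠ t := by
      intro w hw
      simp only [O] at hw
      split_ifs at hw
      · exact ne_of_lt hw
      · exact ne_of_gt hw
    have hOS : O ⊆ (c ⁻¹' T) ∨ Disjoint O (c ⁻¹' T) := by
      simp only [O]
      split_ifs
      · exact Or.inl fun w hw => hT hw
      · exact Or.inr (Set.disjoint_left.2 fun w hw hw' =>
        not_le.2 (show t < c w from hw) (hT' hw'))
    let Φ := (chartAt (Eu (n + 1)) x).restrOpen O hO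
    have hΦ : SmoothChart Φ :=
      ⟨(smoothChart_chartAt x).smooth.mono fun w hw => hw.1,
        (smoothChart_chartAt x).smooth_symm.mono fun u hu => hu.1⟩
    have hΦO : Φ.source ⊆ O := fun w hw => hw.2
    refine ⟨Φ.source, Φ.open_source, ⟨mem_chart_source _ x, hxO⟩,
      fun K hK hKU ξ δ hξ hv hδ => ?_⟩
    have h1 := hξ.densityIntegral_interior hΦ (x := x) (fun w hw => hw.1) hK hKU hv
      (S := (c ⁻¹' T)) (hOS.imp (fun h => hΦO.trans h) (fun h => h.mono_left hΦO))
    have h2 : ∀ i', ∀ y ∈ (chartAt (Eu n) i').target, δ i' y = 0 := fun i' y hy =>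
      hδ.vanishesOff hc hreg hv i' y hy fun h => hOt _ (hΦO (hKU h)) ((chartAt (Eu n) i').symm y).2
    refine ⟨h1.1, ⟨hδ.vanishesOff hc hreg hv, fun i => ?_⟩, ?_⟩
    · refine (integrableOn_zero (ε' := ℂ)).congr_fun (fun y hy => ?_)
        (chartAt (Eu n) i).open_target.measurableSet
      simp [h2 i y hy]
    · rw [h1.2, densityIntegral_congr h2, densityIntegral_zero]

variable {ξ : W → Eu (n + 1) → Ext (n + 1)} {δ : {w // c w = t} → Eu n → ℂ} {K : Set W}

/-- The theorem of Stokes for a sublevel set of a regular value. -/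
theorem stokes_sublevel_succ (hc : ContMDiff (𝓡 (n + 1)) 𝓘(ℝ, ℝ) ∞ c)
    (hreg : ∀ w, c w = t → Function.Surjective (mfderiv (𝓡 (n + 1)) 𝓘(ℝ, ℝ) c w))
    (hι : ContMDiff (𝓡 n) (𝓡 (n + 1)) ∞ (Subtype.val : {w // c w = t} → W))
    {T : Set ℝ} (hT : Set.Iio t ⊆ T) (hT' : T ⊆ Set.Iic t)
    (hξ : TwistedFamily ξ) (hK : IsCompact K) (hv : FamilyVanishesOff ξ K)
    (hδ : IsBoundaryDensity rfl c t ξ δ) :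
    densityIntegral W (densityOn (c ⁻¹' T) fun i y => topCoeff (n + 1) (dE (ξ i) y)) =
      densityIntegral {w // c w = t} δ := by
  classical
  -- The form is cut into pieces supported in the neighbourhoods where the local theorem holds; only
  -- finitely many pieces meet `K`.
  choose U hUo hxU hU using exists_nhds_stokes hc hreg hι hT hT'
  obtain ⟨ρ, hρ⟩ := SmoothPartitionOfUnity.exists_isSubordinate (𝓡 (n + 1)) isClosed_univ U hUo
    (fun x _ => Set.mem_iUnion.2 ⟨x, hxU x⟩)
  have hfin := ρ.locallyFinite.finite_nonempty_inter_compact hK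
  set s := hfin.toFinset with hs
  have hs0 : ∀ x ∉ s, ∀ z ∈ K, ρ x z = 0 := by
    intro x hx z hz
    by_contra h'
    exact hx (hfin.mem_toFinset.2 ⟨z, h', hz⟩)
  have hsum : ∀ z ∈ K, ∑ x ∈ s, ρ x z = 1 := by
    intro z hz
    rw [← ρ.sum_eq_one (Set.mem_univ z)]
    refine (finsum_eq_sum_of_support_subset _ fun i hi => ?_).symm
    by_contra hit
    exact hi (hs0 i (by simpa using hit) z hz)
  let Kx : W → Set W := fun x => K ∩ tsupport (ρ x)
  let δx : W → {w // c w = t} → Eu n → ℂ := fun x i' y =>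
    (ρ x ((chartAt (Eu n) i').symm y).1 : ℂ) * δ i' y
  have hKx : ∀ x, IsCompact (Kx x) := fun x => hK.inter_right (isClosed_tsupport _)
  have hξx : ∀ x, TwistedFamily (familySMul (ρ x) ξ) := fun x => hξ.smul (ρ x).contMDiff
  have hvx : ∀ x, FamilyVanishesOff (familySMul (ρ x) ξ) (Kx x) := by
    intro x i y hy hz
    by_cases h1 : (chartAt (Eu (n + 1)) i).symm y ∈ K
    · have h2 : (chartAt (Eu (n + 1)) i).symm y ∉ tsupport (ρ x) := fun h => hz ⟨h1, h⟩
      rw [familySMul, image_eq_zero_of_notMem_tsupport h2, Complex.ofReal_zero, zero_smul]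
    · rw [familySMul, hv i y hy h1, smul_zero]
  -- Restricting to the level set commutes with multiplication by a function, so the pieces of `δ`
  -- are the boundary densities of the pieces of `ξ`.
  have hδx : ∀ x, IsBoundaryDensity rfl c t (familySMul (ρ x) ξ) (δx x) := by
    intro x i' y hy i hi ν hν
    simp only [δx]
    rw [hδ i' y hy i hi ν hν, familySMul, map_smul, map_smul, smul_eq_mul, mul_left_comm, inclLoc,
      (chartAt (Eu (n + 1)) i).left_inv hi]
  have hpiece := fun x => hU x (Kx x) (hKx x) (Set.inter_subset_right.trans (hρ x)) _ _ (hξx x)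
    (hvx x) (hδx x)
  have hKc : IsCompact (Subtype.val ⁻¹' K : Set {w // c w = t}) :=
    (isClosed_singleton.preimage hc.continuous).isClosedEmbedding_subtypeVal.isCompact_preimage hK
  have hL : densityIntegral W (densityOn (c ⁻¹' T) fun i y => topCoeff (n + 1) (dE (ξ i) y)) =
      densityIntegral W (fun i y => ∑ x ∈ s, densityOn (c ⁻¹' T)
        (fun i y => topCoeff (n + 1) (dE (familySMul (ρ x) ξ i) y)) i y) := by
    refine densityIntegral_congr fun i y hy => ?_
    simp only [densityOn]
    split_ifs
    · rw [← map_sum, ← dE_sum s fun x _ => ((hξx x).smooth i y hy).differentiableAt (by simp)]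
      congr 1
      refine dE_congr ?_
      -- The pieces sum to `ξ` on a whole neighbourhood of `y`, not just at `y`: on `K` the weights
      -- sum to one, and off `K` the form is zero. This is needed since `dE` differentiates.
      filter_upwards [(chartAt (Eu (n + 1)) i).open_target.mem_nhds hy] with z hz
      simp only [familySMul]
      rw [← Finset.sum_smul]
      by_cases h1 : (chartAt (Eu (n + 1)) i).symm z ∈ K
      · rw [← Complex.ofReal_sum, hsum _ h1, Complex.ofReal_one, one_smul]
      · rw [hv i z hz h1, smul_zero]
    · rw [Finset.sum_const_zero]
  have hR : densityIntegral {w // c w = t} δ =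
      densityIntegral {w // c w = t} (fun i y => ∑ x ∈ s, δx x i y) := by
    refine densityIntegral_congr fun i y hy => ?_
    simp only [δx]
    rw [← Finset.sum_mul]
    by_cases h1 : ((chartAt (Eu n) i).symm y).1 ∈ K
    · rw [← Complex.ofReal_sum, hsum _ h1, Complex.ofReal_one, one_mul]
    · rw [hδ.vanishesOff hc hreg hv i y hy h1, mul_zero]
  rw [hL, hR, densityIntegral_sum s hK fun x _ => (hpiece x).1.mono Set.inter_subset_left,
    densityIntegral_sum s hKc fun x _ => (hpiece x).2.1.mono fun z hz => hz.1]
  exact Finset.sum_congr rfl fun x _ => (hpiece x).2.2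

end Stokes

/-! ### Stokes between two level sets -/

section StokesGeneral

variable {m n : ℕ} {W : Type*} [TopologicalSpace W] [T2Space W] [SigmaCompactSpace W]
  [ChartedSpace (Eu m) W] [IsManifold (𝓡 m) ∞ W] {ξ : W → Eu m → Ext m} {K : Set W}

theorem TwistedFamily.densityIntegrable (hξ : TwistedFamily ξ) (hK : IsCompact K)
    (hv : FamilyVanishesOff ξ K) : DensityIntegrable (fun i y => topCoeff m (dE (ξ i) y)) K := by
  refine DensityIntegrable.of_continuousOn hK (fun i y hy hz => ?_) fun i y hy => ?_
  · have : ξ i =ᶠ[𝓝 y] fun _ => 0 := by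
      filter_upwards [((chartAt (Eu m) i).isOpen_inter_preimage_symm
        hK.isClosed.isOpen_compl).mem_nhds ⟨hy, hz⟩] with z hz
      exact hv i z hz.1 hz.2
    rw [dE_congr this, dE_const, map_zero]
  · exact ((topCoeffL m).continuous.continuousAt.comp
      (contDiffAt_dE (hξ.smooth i y hy)).continuousAt).continuousWithinAt

/-- For a cycle of dimension `m` the fibres have dimension `m - 1` with truncated subtraction, so `m
= n + 1` is only a propositional equality; substituting it returns to the previous case. -/
theorem stokes_sublevel (hmn : m = n + 1) {c : W → ℝ} {t : ℝ}
    [ChartedSpace (Eu n) {w // c w = t}] [SigmaCompactSpace {w // c w = t}]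
    [IsManifold (𝓡 n) ∞ {w // c w = t}] {δ : {w // c w = t} → Eu n → ℂ}
    (hc : ContMDiff (𝓡 m) 𝓘(ℝ, ℝ) ∞ c)
    (hreg : ∀ w, c w = t → Function.Surjective (mfderiv (𝓡 m) 𝓘(ℝ, ℝ) c w))
    (hι : ContMDiff (𝓡 n) (𝓡 m) ∞ (Subtype.val : {w // c w = t} → W))
    {T : Set ℝ} (hT : Set.Iio t ⊆ T) (hT' : T ⊆ Set.Iic t)
    (hξ : TwistedFamily ξ) (hK : IsCompact K) (hv : FamilyVanishesOff ξ K)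
    (hδ : IsBoundaryDensity hmn c t ξ δ) :
    densityIntegral W (densityOn (c ⁻¹' T) fun i y => topCoeff m (dE (ξ i) y)) =
      densityIntegral {w // c w = t} δ := by
  subst hmn
  exact stokes_sublevel_succ hc hreg hι hT hT' hξ hK hv hδ

/-- The theorem of Stokes for the part of the manifold between two level sets. -/
theorem stokes_Icc (hmn : m = n + 1) {c : W → ℝ} {a b : ℝ} (hab : a < b)
    [ChartedSpace (Eu n) {w // c w = a}] [SigmaCompactSpace {w // c w = a}]
    [IsManifold (𝓡 n) ∞ {w // c w = a}] {δ : {w // c w = a} → Eu n → ℂ}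
    [ChartedSpace (Eu n) {w // c w = b}] [SigmaCompactSpace {w // c w = b}]
    [IsManifold (𝓡 n) ∞ {w // c w = b}] {δ' : {w // c w = b} → Eu n → ℂ}
    (hc : ContMDiff (𝓡 m) 𝓘(ℝ, ℝ) ∞ c)
    (ha : ∀ w, c w = a → Function.Surjective (mfderiv (𝓡 m) 𝓘(ℝ, ℝ) c w))
    (hb : ∀ w, c w = b → Function.Surjective (mfderiv (𝓡 m) 𝓘(ℝ, ℝ) c w))
    (hιa : ContMDiff (𝓡 n) (𝓡 m) ∞ (Subtype.val : {w // c w = a} → W))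
    (hιb : ContMDiff (𝓡 n) (𝓡 m) ∞ (Subtype.val : {w // c w = b} → W))
    (hξ : TwistedFamily ξ) (hK : IsCompact K) (hv : FamilyVanishesOff ξ K)
    (hδ : IsBoundaryDensity hmn c a ξ δ) (hδ' : IsBoundaryDensity hmn c b ξ δ') :
    densityIntegral W (densityOn (c ⁻¹' Set.Icc a b) fun i y => topCoeff m (dE (ξ i) y)) =
      densityIntegral {w // c w = b} δ' - densityIntegral {w // c w = a} δ := by
  classical
  have hi := hξ.densityIntegrable hK hv
  -- For the lower level the open ray `(-∞, a)` is chosen, so that it and `[a, b]` partition `(-∞,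
  -- b]` without overlap.
  have h1 := stokes_sublevel hmn hc ha hιa subset_rfl Set.Iio_subset_Iic_self hξ hK hv hδ
  have h2 := stokes_sublevel hmn hc hb hιb Set.Iio_subset_Iic_self subset_rfl hξ hK hv hδ'
  rw [← h1, ← h2, eq_sub_iff_add_eq, ← densityIntegral_add hK
    (hi.densityOn (isClosed_Icc.preimage hc.continuous))
    (hi.densityOn_open (isOpen_Iio.preimage hc.continuous))]
  refine densityIntegral_congr fun i y _ => ?_
  simp only [densityOn, Set.mem_preimage, Set.mem_Icc, Set.mem_Iio, Set.mem_Iic]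
  by_cases h3 : c ((chartAt (Eu m) i).symm y) < a
  · simp [h3, not_le.2 h3, (h3.trans hab).le]
  · simp [h3, not_lt.1 h3]

end StokesGeneral

/-! ### Orientations -/

section Frames

theorem mem_span_complexFrame (r : ℕ) (z : Fin r → ℂ) :
    z ∈ Submodule.span ℝ (Set.range (complexFrame r)) := by
  have h : ∀ (j : Fin r) (e : Fin 2), Pi.single j (if e = 0 then 1 else Complex.I) ∈
      Submodule.span ℝ (Set.range (complexFrame r)) := by
    intro j e
    refine Submodule.subset_span ⟨finProdFinEquiv (j, e), ?_⟩
    have h1 := finProdFinEquiv.symm_apply_apply (j, e)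
    rw [finProdFinEquiv_symm_apply, Prod.ext_iff] at h1
    have h2 : (finProdFinEquiv (j, e)).divNat = j := h1.1
    have h3 : (finProdFinEquiv (j, e)).modNat = e := h1.2
    rw [complexFrame, h2, h3]
  have hz : z = ∑ j, ((z j).re • (Pi.single j 1 : Fin r → ℂ) +
      (z j).im • (Pi.single j Complex.I : Fin r → ℂ)) := by
    funext l
    simp only [Finset.sum_apply, Pi.add_apply, Pi.smul_apply, Pi.single_apply, smul_ite, smul_zero]
    simp only [Finset.sum_add_distrib, Finset.sum_ite_eq, Finset.mem_univ, if_true]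
    simp [Complex.re_add_im]
  rw [hz]
  refine Submodule.sum_mem _ fun j _ => add_mem (Submodule.smul_mem _ _ ?_)
    (Submodule.smul_mem _ _ ?_)
  · simpa using h j 0
  · simpa using h j 1

theorem mem_span_append {A : Type*} [AddCommGroup A] [Module ℝ A] {a b : ℕ} {v : Fin a → A}
    {w : Fin b → A} {x y : A} (hx : x ∈ Submodule.span ℝ (Set.range v))
    (hy : y ∈ Submodule.span ℝ (Set.range w)) :
    x + y ∈ Submodule.span ℝ (Set.range (Fin.append v w)) := by
  refine add_mem (Submodule.span_mono ?_ hx) (Submodule.span_mono ?_ hy)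
  · rintro _ ⟨i, rfl⟩
    exact ⟨Fin.castAdd b i, Fin.append_left _ _ _⟩
  · rintro _ ⟨i, rfl⟩
    exact ⟨Fin.natAdd a i, Fin.append_right _ _ _⟩

theorem mem_span_map {A B : Type*} [AddCommGroup A] [Module ℝ A] [AddCommGroup B] [Module ℝ B]
    {ι : Type*} {v : ι → A} (L : A →ₗ[ℝ] B) {x : A} (hx : x ∈ Submodule.span ℝ (Set.range v)) :
    L x ∈ Submodule.span ℝ (Set.range fun i => L (v i)) := by
  have h := Submodule.mem_map_of_mem (f := L) hx
  rwa [Submodule.map_span, ← Set.range_comp] at h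

/-- The oriented real basis of `ℂ^r ⊕ ℂ^k`. -/
def normalBasis (r k : ℕ) : Module.Basis (Fin (r * 2 + k * 2)) ℝ (Nor r k) :=
  basisOfTopLeSpanOfCardEqFinrank (normalFrame r k) (fun x _ => by
    have h1 := mem_span_map (LinearMap.inl ℝ (Fin r → ℂ) (Fin k → ℂ)) (mem_span_complexFrame r x.1)
    have h2 := mem_span_map (LinearMap.inr ℝ (Fin r → ℂ) (Fin k → ℂ)) (mem_span_complexFrame k x.2)
    have h3 : x = LinearMap.inl ℝ (Fin r → ℂ) (Fin k → ℂ) x.1 +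
        LinearMap.inr ℝ (Fin r → ℂ) (Fin k → ℂ) x.2 := by simp
    rw [h3]
    exact mem_span_append h1 h2) (by simp [Module.finrank_pi_fintype])

theorem coe_normalBasis (r k : ℕ) : ⇑(normalBasis r k) = normalFrame r k :=
  coe_basisOfTopLeSpanOfCardEqFinrank _ _ _

/-- The basis of the ambient space obtained from a basis of the tangent space. -/
def ambBasis {E : Type*} [NormedAddCommGroup E] [NormedSpace ℝ E] [FiniteDimensional ℝ E] (n : ℤ)
    (N : ℕ) {D : ℕ} (b : Module.Basis (Fin D) ℝ E) :
    Module.Basis (Fin (D + par n + N * 2)) ℝ (Amb E n N) :=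
  basisOfTopLeSpanOfCardEqFinrank (ambFrame n N b) (fun x _ => by
    have h1 := mem_span_map (LinearMap.inl ℝ E ((Fin (par n) → ℝ) × (Fin N → ℂ)))
      (b.mem_span x.1)
    have h2 := mem_span_map (LinearMap.inr ℝ E ((Fin (par n) → ℝ) × (Fin N → ℂ)) ∘ₗ
      LinearMap.inl ℝ (Fin (par n) → ℝ) (Fin N → ℂ)) ((Pi.basisFun ℝ (Fin (par n))).mem_span x.2.1)
    have h3 := mem_span_map (LinearMap.inr ℝ E ((Fin (par n) → ℝ) × (Fin N → ℂ)) ∘ₗ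
      LinearMap.inr ℝ (Fin (par n) → ℝ) (Fin N → ℂ)) (mem_span_complexFrame N x.2.2)
    have h4 : x = (x.1, 0, 0) + (0, x.2.1, 0) + (0, 0, x.2.2) := by simp
    rw [h4]
    simp only [Pi.basisFun_apply] at h2
    exact mem_span_append (mem_span_append h1 h2) h3) (by
      simp [Module.finrank_pi_fintype, Module.finrank_eq_card_basis b, add_assoc])

theorem coe_ambBasis {E : Type*} [NormedAddCommGroup E] [NormedSpace ℝ E] [FiniteDimensional ℝ E]
    (n : ℤ) (N : ℕ) {D : ℕ} (b : Module.Basis (Fin D) ℝ E) :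
    ⇑(ambBasis n N b) = ambFrame n N b :=
  coe_basisOfTopLeSpanOfCardEqFinrank _ _ _

/-- Top-dimensional forms are multiples of `b.det`, and the multiple enters squared. Since the
inequality is not strict, it can be turned into an equality of signs only for nondegenerate frames.
-/
theorem sameOrientation_iff {A : Type*} [AddCommGroup A] [Module ℝ A] {M : ℕ}
    (b : Module.Basis (Fin M) ℝ A) (v w : Fin M → A) :
    SameOrientation v w ↔ 0 ≤ b.det v * b.det w := by
  refine ⟨fun h => h b.det, fun h μ => ?_⟩
  rw [μ.eq_smul_basis_det b]
  simp only [AlternatingMap.smul_apply, smul_eq_mul]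
  nlinarith [mul_nonneg (mul_self_nonneg (μ b)) h]

/-- A top-dimensional form on an extension of `ℂ^r ⊕ ℂ^k` by `ℝ^m`, evaluated on frames that start
with a frame of `ℝ^m`. -/
theorem exists_blockDet {A : Type*} [AddCommGroup A] [Module ℝ A] {m r k M : ℕ}
    (hM : M = m + (r * 2 + k * 2)) (T : Eu m →ₗ[ℝ] A) (hT : Function.Injective T)
    (q : A →ₗ[ℝ] Nor r k) (hq : Function.Surjective q) (hqT : ∀ x, q x = 0 ↔ ∃ v, x = T v)
    (b : Module.Basis (Fin M) ℝ A) :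
    ∃ κ : ℝ, κ ≠ 0 ∧ ∀ (v : Fin m → Eu m) (s : Fin (r * 2 + k * 2) → A),
      b.det (Fin.append (fun x => T (v x)) s ∘ Fin.cast hM) =
        κ * (frameDet m v * (normalBasis r k).det fun x => q (s x)) := by
  -- A section of `q` splits the extension. In the product basis transported along the splitting,
  -- the frame `(T v, s)` has a block triangular matrix, so the vectors `s` matter only through `q ∘
  -- s`.
  obtain ⟨σ, hσ⟩ := q.exists_rightInverse_of_surjective (LinearMap.range_eq_top.2 hq)
  have hσ' : ∀ x, q (σ x) = x := fun x => DFunLike.congr_fun hσ x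
  have hqT0 : ∀ v, q (T v) = 0 := fun v => (hqT _).2 ⟨v, rfl⟩
  let ψ : (Eu m × Nor r k) ≃ₗ[ℝ] A := LinearEquiv.ofBijective (T.coprod σ) (by
    constructor
    · rw [← LinearMap.ker_eq_bot, LinearMap.ker_eq_bot']
      rintro ⟨v, x⟩ h
      have h1 : T v + σ x = 0 := by simpa using h
      have h2 : x = 0 := by
        have := congrArg q h1
        simpa [hqT0, hσ'] using this
      rw [h2, map_zero, add_zero] at h1
      rw [h2, hT (h1.trans (map_zero T).symm)]
      rfl
    · intro x
      obtain ⟨v, hv⟩ := (hqT (x - σ (q x))).1 (by simp [hσ'])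
      refine ⟨(v, q x), ?_⟩
      simp [← hv])
  have hψ1 : ∀ v, ψ.symm (T v) = (v, 0) := by
    intro v
    rw [LinearEquiv.symm_apply_eq]
    change T v = T v + σ 0
    rw [map_zero, add_zero]
  have hψ2 : ∀ x, (ψ.symm x).2 = q x := by
    intro x
    obtain ⟨p, rfl⟩ := ψ.surjective x
    rw [LinearEquiv.symm_apply_apply]
    change p.2 = q (T p.1 + σ p.2)
    rw [map_add, hqT0, hσ', zero_add]
  let B := ((EuclideanSpace.basisFun (Fin m) ℝ).toBasis.prod (normalBasis r k)).map ψ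
  let e : Fin M ≃ Fin m ⊕ Fin (r * 2 + k * 2) := (finCongr hM).trans finSumFinEquiv.symm
  have hcomp : ∀ (f : Fin m → A) (s : Fin (r * 2 + k * 2) → A),
      Fin.append f s ∘ Fin.cast hM = Sum.elim f s ∘ e := by
    intro f s
    funext x
    obtain ⟨y, rfl⟩ := e.symm.surjective x
    rcases y with y | y
    · simp [e]
    · simp [e]
  have hdet : ∀ (v : Fin m → Eu m) (s : Fin (r * 2 + k * 2) → A),
      B.det (Sum.elim (fun x => T (v x)) s) =
        frameDet m v * (normalBasis r k).det fun x => q (s x) := by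
    intro v s
    rw [Module.Basis.det_apply, frameDet, Module.Basis.det_apply, Module.Basis.det_apply,
      ← Matrix.det_fromBlocks_zero₂₁ _
        (Matrix.of fun i j => (EuclideanSpace.basisFun (Fin m) ℝ).toBasis.repr (ψ.symm (s j)).1 i)]
    congr 1
    ext i j
    rcases i with i | i <;> rcases j with j | j
    · simp [B, Module.Basis.toMatrix_apply, hψ1]
    · simp [B, Module.Basis.toMatrix_apply]
    · simp [B, Module.Basis.toMatrix_apply, hψ1]
    · simp [B, Module.Basis.toMatrix_apply, hψ2]
  -- The given volume form is a multiple of the adapted one; the factor `κ` is nonzero because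
  -- `b.det` is.
  have h1 := (b.det.domDomCongr e).eq_smul_basis_det B
  refine ⟨(b.det.domDomCongr e) B, fun h0 => ?_, fun v s => ?_⟩
  · rw [h0, zero_smul] at h1
    have h2 := DFunLike.congr_fun h1 (b ∘ e.symm)
    rw [AlternatingMap.domDomCongr_apply] at h2
    have h3 : (⇑b ∘ ⇑e.symm) ∘ ⇑e = b := by
      funext x
      simp
    rw [h3, b.det_self] at h2
    simp at h2
  · rw [hcomp, ← AlternatingMap.domDomCongr_apply, h1]
    simp only [AlternatingMap.smul_apply, smul_eq_mul, hdet]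
    rw [B.det_self, mul_one]

/-- The real determinant of a complex-linear map is the squared absolute value of its complex
determinant. Hence the complex orientation of the normal space does not depend on the
trivialization. -/
theorem normalBasis_det_pos {r k : ℕ} (G : Nor r k →ₗ[ℂ] Nor r k) (hG : Function.Surjective G) :
    0 < (normalBasis r k).det fun x => G (normalFrame r k x) := by
  have h1 := (normalBasis r k).det_comp (G.restrictScalars ℝ) (normalFrame r k)
  rw [← coe_normalBasis, (normalBasis r k).det_self, mul_one, LinearMap.det_restrictScalars,
    Algebra.norm_complex_apply] at h1
  rw [← coe_normalBasis]
  refine lt_of_lt_of_eq (Complex.normSq_pos.2 fun h0 => ?_) h1.symm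
  have h2 : LinearMap.ker G = ⊥ := by
    rw [LinearMap.ker_eq_bot]
    exact LinearMap.injective_iff_surjective.2 hG
  have := LinearEquiv.isUnit_det' (LinearEquiv.ofBijective G ⟨LinearMap.ker_eq_bot.1 h2, hG⟩)
  exact this.ne_zero h0

end Frames

/-! ### Derivatives of maps in arbitrary charts -/

section Coordinates

variable {m d : ℕ} {Z : Type*} [TopologicalSpace Z] [ChartedSpace (Eu m) Z] [IsManifold (𝓡 m) ∞ Z]
  {X : Type*} [TopologicalSpace X] [ChartedSpace (Eu d) X] [IsManifold (𝓡 d) ∞ X]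

theorem tangentCoordChange_eq_fderiv (i j z : Z) :
    tangentCoordChange (𝓡 m) i j z = fderiv ℝ (coordChange i j) (chartAt (Eu m) i z) := by
  rw [tangentCoordChange_def]
  simp only [mfld_simps, fderivWithin_univ]
  rfl

variable (m d) in
/-- The coordinate expression of a map. -/
def locMap (h : Z → X) (i : Z) (j : X) : Eu m → Eu d :=
  fun y => chartAt (Eu d) j (h ((chartAt (Eu m) i).symm y))

theorem contDiffAt_locMap {h : Z → X} (hh : ContMDiff (𝓡 m) (𝓡 d) ∞ h) (i : Z) (j : X) {y : Eu m}
    (hy : y ∈ (chartAt (Eu m) i).target)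
    (hj : h ((chartAt (Eu m) i).symm y) ∈ (chartAt (Eu d) j).source) :
    ContDiffAt ℝ ∞ (locMap m d h i j) y :=
  (smoothChart_chartAt i).contDiffAt_comp_symm hy (f := fun z => chartAt (Eu d) j (h z))
    (((smoothChart_chartAt j).smooth.contMDiffAt
      ((chartAt (Eu d) j).open_source.mem_nhds hj)).comp _ hh.contMDiffAt)

theorem fderiv_locMap_comp_right {h : Z → X} (hh : ContMDiff (𝓡 m) (𝓡 d) ∞ h) (i i' : Z) (j : X)
    {y : Eu m} (hy : y ∈ (chartAt (Eu m) i).target)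
    (hi' : (chartAt (Eu m) i).symm y ∈ (chartAt (Eu m) i').source)
    (hj : h ((chartAt (Eu m) i).symm y) ∈ (chartAt (Eu d) j).source) :
    fderiv ℝ (locMap m d h i j) y =
      (fderiv ℝ (locMap m d h i' j) (coordChange i i' y)).comp (fderiv ℝ (coordChange i i') y) := by
  have hs : (chartAt (Eu m) i').symm (coordChange i i' y) = (chartAt (Eu m) i).symm y :=
    (chartAt (Eu m) i').left_inv hi'
  have hj' : h ((chartAt (Eu m) i').symm (coordChange i i' y)) ∈ (chartAt (Eu d) j).source := by
    rwa [hs]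
  rw [← fderiv_comp y ((contDiffAt_locMap hh i' j ((chartAt (Eu m) i').map_source hi')
    hj').differentiableAt (by simp))
    ((coordChange_contDiffAt i i' hy hi').differentiableAt (by simp))]
  refine Filter.EventuallyEq.fderiv_eq ?_
  filter_upwards [eventually_coordChange i i' hy hi'] with z hz
  simp only [locMap, coordChange, Function.comp_apply, (chartAt (Eu m) i').left_inv hz.2]

theorem fderiv_locMap_comp_left {h : Z → X} (hh : ContMDiff (𝓡 m) (𝓡 d) ∞ h) (i : Z) (j j' : X)
    {y : Eu m} (hy : y ∈ (chartAt (Eu m) i).target)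
    (hj : h ((chartAt (Eu m) i).symm y) ∈ (chartAt (Eu d) j).source)
    (hj' : h ((chartAt (Eu m) i).symm y) ∈ (chartAt (Eu d) j').source) :
    fderiv ℝ (locMap m d h i j') y =
      (fderiv ℝ (coordChange j j') (locMap m d h i j y)).comp (fderiv ℝ (locMap m d h i j) y) := by
  have hs : (chartAt (Eu d) j).symm (locMap m d h i j y) = h ((chartAt (Eu m) i).symm y) :=
    (chartAt (Eu d) j).left_inv hj
  have hj'' : (chartAt (Eu d) j).symm (locMap m d h i j y) ∈ (chartAt (Eu d) j').source := by
    rwa [hs]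
  rw [← fderiv_comp y ((coordChange_contDiffAt j j' ((chartAt (Eu d) j).map_source hj)
    hj'').differentiableAt (by simp))
    ((contDiffAt_locMap hh i j hy hj).differentiableAt (by simp))]
  refine Filter.EventuallyEq.fderiv_eq ?_
  have h1 : ∀ᶠ z in 𝓝 y, h ((chartAt (Eu m) i).symm z) ∈ (chartAt (Eu d) j).source :=
    (hh.continuous.continuousAt.comp ((chartAt (Eu m) i).continuousAt_symm hy)).eventually_mem
      ((chartAt (Eu d) j).open_source.mem_nhds hj)
  filter_upwards [h1] with z hz
  simp only [locMap, coordChange, Function.comp_apply, (chartAt (Eu d) j).left_inv hz]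

/-- `mfderiv` at `z` is the derivative in the preferred charts at `z` and `h z`. Precomposing with
`tangentCoordChange` replaces the chart at `z` by the fixed chart at `i`. -/
theorem mfderiv_tangentCoordChange {h : Z → X} (hh : ContMDiff (𝓡 m) (𝓡 d) ∞ h) (i : Z) {z : Z}
    (hz : z ∈ (chartAt (Eu m) i).source) (v : Eu m) :
    mfderiv (𝓡 m) (𝓡 d) h z (tangentCoordChange (𝓡 m) i z z v) =
      fderiv ℝ (locMap m d h i (h z)) (chartAt (Eu m) i z) v := by
  have hy := (chartAt (Eu m) i).map_source hz
  have hs := (chartAt (Eu m) i).left_inv hz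
  have h1 : mfderiv (𝓡 m) (𝓡 d) h z = fderiv ℝ (locMap m d h z (h z)) (chartAt (Eu m) z z) := by
    rw [(hh.mdifferentiableAt (by simp)).mfderiv]
    simp only [mfld_simps, fderivWithin_univ]
    rfl
  rw [fderiv_locMap_comp_right hh i z (h z) hy (by rw [hs]; exact mem_chart_source _ _)
    (by rw [hs]; exact mem_chart_source _ _), tangentCoordChange_eq_fderiv, h1, coordChange, hs]
  rfl

theorem mfderiv_vec_tangentCoordChange {F : Type*} [NormedAddCommGroup F] [NormedSpace ℝ F]
    {h : Z → F} (i : Z) {z : Z} (hh : ContMDiffAt (𝓡 m) 𝓘(ℝ, F) ∞ h z)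
    (hz : z ∈ (chartAt (Eu m) i).source) (v : Eu m) :
    mfderiv (𝓡 m) 𝓘(ℝ, F) h z (tangentCoordChange (𝓡 m) i z z v) =
      fderiv ℝ (fun y => h ((chartAt (Eu m) i).symm y)) (chartAt (Eu m) i z) v := by
  have hy := (chartAt (Eu m) i).map_source hz
  have hs := (chartAt (Eu m) i).left_inv hz
  have h1 : mfderiv (𝓡 m) 𝓘(ℝ, F) h z =
      fderiv ℝ (fun y => h ((chartAt (Eu m) z).symm y)) (chartAt (Eu m) z z) := by
    rw [(hh.mdifferentiableAt (by simp)).mfderiv]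
    simp only [mfld_simps, fderivWithin_univ]
    rfl
  have hz' : (chartAt (Eu m) i).symm (chartAt (Eu m) i z) ∈ (chartAt (Eu m) z).source := by
    rw [hs]; exact mem_chart_source _ _
  have hh' : ContMDiffAt (𝓡 m) 𝓘(ℝ, F) ∞ h
      ((chartAt (Eu m) z).symm (coordChange i z (chartAt (Eu m) i z))) := by
    rw [coordChange, (chartAt (Eu m) z).left_inv hz', hs]
    exact hh
  have h2 : fderiv ℝ (fun y => h ((chartAt (Eu m) i).symm y)) (chartAt (Eu m) i z) =
      (fderiv ℝ (fun y => h ((chartAt (Eu m) z).symm y)) (coordChange i z (chartAt (Eu m) i z))).comp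
        (fderiv ℝ (coordChange i z) (chartAt (Eu m) i z)) := by
    have h3 : DifferentiableAt ℝ (fun y => h ((chartAt (Eu m) z).symm y))
        (coordChange i z (chartAt (Eu m) i z)) :=
      ((smoothChart_chartAt z).contDiffAt_comp_symm ((chartAt (Eu m) z).map_source hz')
        hh').differentiableAt (by simp)
    rw [← fderiv_comp _ h3 ((coordChange_contDiffAt i z hy hz').differentiableAt (by simp))]
    refine Filter.EventuallyEq.fderiv_eq ?_
    filter_upwards [eventually_coordChange i z hy hz'] with y hy
    simp only [coordChange, Function.comp_apply, (chartAt (Eu m) z).left_inv hy.2]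
  rw [h2, tangentCoordChange_eq_fderiv, h1, coordChange, hs]
  rfl

end Coordinates

namespace GeometricCycle

/-! ### The orientation sign of a cycle -/

section Sign

variable {E : Type*} [NormedAddCommGroup E] [NormedSpace ℝ E] [FiniteDimensional ℝ E] {H : Type*}
  [TopologicalSpace H] {I : ModelWithCorners ℝ E H} {Y : Type*} [TopologicalSpace Y]
  [ChartedSpace H Y] [IsManifold I ∞ Y] {n : ℤ} (c : GeometricCycle I Y n)

/-- The inclusion of the tangent space at `z` into the ambient space. -/
def tangentIncl (z : c.Z) : Eu c.m →ₗ[ℝ] Amb E n c.N :=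
  (mfderiv (𝓡 c.m) I c.f z : Eu c.m →L[ℝ] E).toLinearMap.prod
    (LinearMap.prod 0 (mfderiv (𝓡 c.m) 𝓘(ℝ, Fin c.N → ℂ) c.u z :
      Eu c.m →L[ℝ] (Fin c.N → ℂ)).toLinearMap)

theorem tangentIncl_injective (z : c.Z) : Function.Injective (c.tangentIncl z) := by
  rw [← LinearMap.ker_eq_bot, LinearMap.ker_eq_bot']
  intro v hv
  exact c.immersion z v (congrArg Prod.fst hv) (congrArg (fun x => x.2.2) hv)

theorem q_eq_zero_iff {a : c.A} {z : c.Z} (hz : z ∈ c.U a) (x : Amb E n c.N) :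
    c.q a z x = 0 ↔ ∃ v, x = c.tangentIncl z v := c.q_exact a z hz x

theorem det_coordVec_ne_zero {i z : c.Z} (hz : z ∈ (chartAt (Eu c.m) i).source) :
    (c.coordVec i z : Eu c.m →L[ℝ] Eu c.m).det ≠ 0 := by
  have h : (c.coordVec i z : Eu c.m →L[ℝ] Eu c.m) =
      fderiv ℝ (coordChange i z) (chartAt (Eu c.m) i z) := tangentCoordChange_eq_fderiv i z z
  rw [h]
  refine coordChange_det_ne_zero i z ((chartAt (Eu c.m) i).map_source hz) ?_
  rw [(chartAt (Eu c.m) i).left_inv hz]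
  exact mem_chart_source _ _

/-- Counts dimensions in the exact sequence of the tangent space at `z`, the ambient space and the
normal space. -/
theorem dim_eq {D : ℕ} (b : Module.Basis (Fin D) ℝ E) (z : c.Z) :
    D + par n + c.N * 2 = c.m + (c.r * 2 + c.k * 2) := by
  obtain ⟨a, ha⟩ := c.cover z
  have h1 := (c.q a z).toLinearMap.finrank_range_add_finrank_ker
  have h2 : LinearMap.range (c.q a z).toLinearMap = ⊤ :=
    LinearMap.range_eq_top.2 (c.q_surjective a z ha)
  have h3 : LinearMap.ker (c.q a z).toLinearMap = LinearMap.range (c.tangentIncl z) := by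
    ext x
    rw [LinearMap.mem_ker, LinearMap.mem_range]
    exact (c.q_eq_zero_iff ha x).trans ⟨fun ⟨v, hv⟩ => ⟨v, hv.symm⟩, fun ⟨v, hv⟩ => ⟨v, hv.symm⟩⟩
  rw [h2, h3, finrank_top, LinearMap.finrank_range_of_inj (c.tangentIncl_injective z),
    Module.finrank_eq_card_basis (ambBasis n c.N b),
    Module.finrank_eq_card_basis (normalBasis c.r c.k)] at h1
  simp at h1
  omega

/-- The sign of a cycle in a chart, expressed by the determinant of an adapted frame. -/
theorem orientationSign_eq {D : ℕ} (b : Module.Basis (Fin D) ℝ E) {i z : c.Z}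
    (hz : z ∈ (chartAt (Eu c.m) i).source) {a : c.A} (ha : z ∈ c.U a) {κ : ℝ} (hκ0 : κ ≠ 0)
    (hκ : ∀ (v : Fin c.m → Eu c.m) (s : Fin (c.r * 2 + c.k * 2) → Amb E n c.N),
      (ambBasis n c.N b).det (Fin.append (fun x => c.tangentIncl z (v x)) s ∘
        Fin.cast (c.dim_eq b z)) =
        κ * (frameDet c.m v * (normalBasis c.r c.k).det fun x => c.q a z (s x))) :
    c.orientationSign i z b = sgn (κ * (c.coordVec i z : Eu c.m →L[ℝ] Eu c.m).det) := by
  have hne := mul_ne_zero hκ0 (c.det_coordVec_ne_zero hz)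
  have hv : frameDet c.m (fun x => c.coordVec i z (stdVec x)) =
      (c.coordVec i z : Eu c.m →L[ℝ] Eu c.m).det := frameDet_clm _
  have hiff : ∀ s : Fin (c.r * 2 + c.k * 2) → Amb E n c.N,
      SameOrientation (ambFrame n c.N b) (Fin.append (fun x =>
        ((mfderiv (𝓡 c.m) I c.f z (c.coordVec i z (stdVec x)), 0,
          mfderiv (𝓡 c.m) 𝓘(ℝ, Fin c.N → ℂ) c.u z (c.coordVec i z (stdVec x))) : Amb E n c.N)) s ∘
          Fin.cast (c.dim_eq b z)) ↔
      0 ≤ κ * (c.coordVec i z : Eu c.m →L[ℝ] Eu c.m).det *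
        (normalBasis c.r c.k).det fun x => c.q a z (s x) := by
    intro s
    have h1 := hκ (fun x => c.coordVec i z (stdVec x)) s
    rw [hv, ← mul_assoc] at h1
    rw [sameOrientation_iff (ambBasis n c.N b), ← h1, ← coe_ambBasis, (ambBasis n c.N b).det_self,
      one_mul]
    rfl
  rcases lt_or_gt_of_ne hne with h | h
  · rw [sgn_neg h, orientationSign, if_neg]
    rintro ⟨h0, a', s, ha', hs, hso⟩
    have h1 := (hiff s).1 hso
    refine absurd h1 (not_le.2 (mul_neg_of_neg_of_pos h ?_))
    -- Incompatibility has to be shown for every trivialization `a'` and every lift `s` of the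
    -- normal frame. Passing from `a'` to the fixed `a` is complex linear and so preserves the
    -- positivity of the normal determinant.
    let G : Nor c.r c.k →ₗ[ℂ] Nor c.r c.k :=
      (Matrix.mulVecLin (c.g a a' z)).prodMap LinearMap.id
    have hG : ∀ x, c.q a z x = G (c.q a' z x) := fun x => c.q_trans a a' z ha ha' x
    have h2 := normalBasis_det_pos G fun y => by
      obtain ⟨x, hx⟩ := c.q_surjective a z ha y
      exact ⟨c.q a' z x, (hG x).symm.trans hx⟩
    simp only [hG, hs]
    exact h2
  · rw [sgn_pos h, orientationSign, if_pos]
    -- In the positive case any one lift of the normal frame witnesses compatibility.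
    choose s hs using fun x => c.q_surjective a z ha (normalFrame c.r c.k x)
    refine ⟨c.dim_eq b z, a, s, ha, hs, (hiff s).2 ?_⟩
    simp only [hs]
    have h1 : (normalBasis c.r c.k).det (fun x => normalFrame c.r c.k x) = 1 := by
      rw [← coe_normalBasis]
      exact (normalBasis c.r c.k).det_self
    rw [h1, mul_one]
    exact h.le

theorem exists_sign_factor {D : ℕ} (b : Module.Basis (Fin D) ℝ E) {z : c.Z} {a : c.A}
    (ha : z ∈ c.U a) :
    ∃ κ : ℝ, κ ≠ 0 ∧ ∀ (v : Fin c.m → Eu c.m) (s : Fin (c.r * 2 + c.k * 2) → Amb E n c.N),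
      (ambBasis n c.N b).det (Fin.append (fun x => c.tangentIncl z (v x)) s ∘
        Fin.cast (c.dim_eq b z)) =
        κ * (frameDet c.m v * (normalBasis c.r c.k).det fun x => c.q a z (s x)) :=
  exists_blockDet (c.dim_eq b z) (c.tangentIncl z) (c.tangentIncl_injective z)
    (c.q a z).toLinearMap (c.q_surjective a z ha) (c.q_eq_zero_iff ha) (ambBasis n c.N b)

end Sign

end GeometricCycle

/-! ### Frames of the ambient space over a cylinder -/

section CylinderFrames

variable {d : ℕ} {n : ℤ} {N : ℕ}

/-- The standard basis of `ℝ^d`. -/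
def euBasis (d : ℕ) : Module.Basis (Fin d) ℝ (Eu d) := (EuclideanSpace.basisFun (Fin d) ℝ).toBasis

theorem coe_euBasis : ⇑(euBasis d) = stdVec := by
  funext j
  simp [euBasis, stdVec]

/-- The basis of `ℝ ⊕ ℝ^d` which consists of `∂/∂t` and the coordinate vectors. -/
def cylBasis (d : ℕ) : Module.Basis (Fin (d + 1)) ℝ (ℝ × Eu d) :=
  (euBasis (d + 1)).map (consCLE d).symm.toLinearEquiv

theorem coe_cylBasis : ⇑(cylBasis d) = cylFrame d := by
  funext j
  rw [cylBasis, Module.Basis.map_apply, coe_euBasis]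
  change (consCLE d).symm (stdVec j) = cylFrame d j
  rw [ContinuousLinearEquiv.symm_apply_eq, consCLE_apply]
  refine Fin.cases ?_ (fun j => ?_) j
  · ext l
    refine Fin.cases ?_ (fun l => ?_) l <;> simp [cylFrame, stdVec]
  · ext l
    refine Fin.cases ?_ (fun l => ?_) l <;> simp [cylFrame, stdVec]

theorem cons_append_cast {A : Type*} {m m' R M M' : ℕ} (hm : m = m' + 1) (h₁ : M = m + R)
    (h₂ : M' = m' + R) (h₃ : M = M' + 1) (a : A) (f : Fin m' → A) (s : Fin R → A) :
    Fin.append (Fin.cons a f ∘ Fin.cast hm) s ∘ Fin.cast h₁ =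
      (Fin.cons a (Fin.append f s ∘ Fin.cast h₂) : Fin (M' + 1) → A) ∘ Fin.cast h₃ := by
  subst hm h₂ h₁
  have h : (Fin.cons a f : Fin (m' + 1) → A) ∘ Fin.cast rfl = Fin.cons a f := rfl
  rw [h, Fin.append_cons]
  rfl

/-- Expresses the convention that `∂/∂t` comes first: the rest of the frame is the ambient frame
over `X`. -/
theorem ambFrame_cylFrame (h : d + 1 + par n + N * 2 = d + par n + N * 2 + 1) :
    ambFrame n N (cylFrame d) =
      (Fin.cons ((1, 0), 0, 0) (fun x => GeometricCycle.sliceMap d n N (ambFrame n N stdVec x)) :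
        Fin (d + par n + N * 2 + 1) → Amb (ℝ × Eu d) n N) ∘ Fin.cast h := by
  have h1 : (fun x => (cylFrame d x, 0, 0) : Fin (d + 1) → Amb (ℝ × Eu d) n N) =
      (Fin.cons ((1, 0), 0, 0) (fun x => ((0, stdVec x), 0, 0) : Fin d → Amb (ℝ × Eu d) n N) :
        Fin (d + 1) → Amb (ℝ × Eu d) n N) ∘ Fin.cast rfl := by
    funext x
    refine Fin.cases rfl (fun x => rfl) x
  have h2 := cons_append_cast (M := d + 1 + par n) rfl rfl rfl (by omega) ((1, 0), 0, 0)
    (fun x => ((0, stdVec x), 0, 0) : Fin d → Amb (ℝ × Eu d) n N)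
    (fun x => (0, Pi.single x 1, 0) : Fin (par n) → Amb (ℝ × Eu d) n N)
  have h3 := cons_append_cast (M := d + 1 + par n + N * 2) (by omega) rfl rfl h ((1, 0), 0, 0)
    (Fin.append (fun x => ((0, stdVec x), 0, 0) : Fin d → Amb (ℝ × Eu d) n N)
      (fun x => (0, Pi.single x 1, 0) : Fin (par n) → Amb (ℝ × Eu d) n N))
    (fun x => (0, 0, complexFrame N x) : Fin (N * 2) → Amb (ℝ × Eu d) n N)
  rw [ambFrame, h1]
  refine Eq.trans (congrArg (fun f => Fin.append f _) h2) (Eq.trans h3 ?_)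
  refine congrArg (fun f => (Fin.cons ((1, 0), 0, 0) f : Fin (d + par n + N * 2 + 1) →
    Amb (ℝ × Eu d) n N) ∘ Fin.cast h) ?_
  funext x
  have h4 : ∀ (a b : ℕ) (f : Fin a → Amb (Eu d) n N) (g : Fin b → Amb (Eu d) n N),
      (fun x => GeometricCycle.sliceMap d n N (Fin.append f g x)) =
      Fin.append (fun x => GeometricCycle.sliceMap d n N (f x))
        (fun x => GeometricCycle.sliceMap d n N (g x)) := by
    intro a b f g
    funext x
    refine Fin.addCases (fun x => ?_) (fun x => ?_) x <;> simp
  have h5 := h4 _ _ (Fin.append (fun x => (stdVec x, 0, 0) : Fin d → Amb (Eu d) n N)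
    (fun x => (0, Pi.single x 1, 0))) (fun x => (0, 0, complexFrame N x))
  rw [h4 d (par n) (fun x => (stdVec x, 0, 0)) (fun x => (0, Pi.single x 1, 0))] at h5
  exact (congrFun h5 x).symm

/-- A volume form on `ℝ ⊕ T ⊕ ℝ^{par n} ⊕ ℂ^N`, evaluated on frames all of whose vectors but the
first lie in `T ⊕ ℝ^{par n} ⊕ ℂ^N`. -/
theorem ambBasis_det_cons (h : d + 1 + par n + N * 2 = d + par n + N * 2 + 1)
    (p : Amb (ℝ × Eu d) n N) (x : Fin (d + par n + N * 2) → Amb (Eu d) n N) :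
    (ambBasis n N (cylBasis d)).det
      ((Fin.cons p (fun j => GeometricCycle.sliceMap d n N (x j)) :
        Fin (d + par n + N * 2 + 1) → Amb (ℝ × Eu d) n N) ∘ Fin.cast h) =
      p.1.1 * (ambBasis n N (euBasis d)).det x := by
  let μ := (ambBasis n N (cylBasis d)).det.domDomCongr (finCongr h)
  let S : Amb (Eu d) n N →ₗ[ℝ] Amb (ℝ × Eu d) n N := (GeometricCycle.sliceMap d n N).toLinearMap
  let ν : Amb (ℝ × Eu d) n N →ₗ[ℝ] Amb (Eu d) n N [⋀^Fin (d + par n + N * 2)]→ₗ[ℝ] ℝ :=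
    { toFun := fun p => (μ.curryLeft p).compLinearMap S
      map_add' := fun p q => by rw [map_add]; rfl
      map_smul' := fun a p => by rw [map_smul]; rfl }
  have hν : ∀ p x, ν p x = (ambBasis n N (cylBasis d)).det
      ((Fin.cons p (fun j => GeometricCycle.sliceMap d n N (x j)) :
        Fin (d + par n + N * 2 + 1) → Amb (ℝ × Eu d) n N) ∘ Fin.cast h) := fun p x => rfl
  have h1 : ν ((1, 0), 0, 0) = (ambBasis n N (euBasis d)).det := by
    rw [(ν ((1, 0), 0, 0)).eq_smul_basis_det (ambBasis n N (euBasis d)), hν, coe_ambBasis,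
      coe_euBasis, ← ambFrame_cylFrame h, ← coe_cylBasis, ← coe_ambBasis, Module.Basis.det_self,
      one_smul]
  -- If the first vector also lies in the slice, the whole frame lies in a subspace of too small a
  -- dimension and is linearly dependent. Hence only the `∂/∂t`-component of `p` counts.
  have h2 : ∀ p', ν (S p') = 0 := by
    intro p'
    ext x
    rw [hν]
    have h3 := ((ambBasis n N (cylBasis d)).det.domDomCongr (finCongr h)).compLinearMap S
      |>.map_linearDependent (Fin.cons p' x) (fun hl => by
        have := hl.fintype_card_le_finrank
        rw [Module.finrank_eq_card_basis (ambBasis n N (euBasis d))] at this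
        simp at this)
    refine Eq.trans (congrArg _ ?_) h3
    funext j
    change (Fin.cons (S p') fun j => S (x j) : Fin (d + par n + N * 2 + 1) → _) (Fin.cast h j) =
      S ((Fin.cons p' x : Fin (d + par n + N * 2 + 1) → _) (Fin.cast h j))
    generalize Fin.cast h j = l
    refine Fin.cases ?_ (fun j => ?_) l <;> rfl
  have h3 : p = p.1.1 • ((1, 0), 0, 0) + S (p.1.2, p.2) := by
    refine Prod.ext (Prod.ext ?_ ?_) (Prod.ext ?_ ?_) <;> simp [S, GeometricCycle.sliceMap, ambMap]
  rw [← hν]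
  conv_lhs => rw [h3]
  rw [map_add, map_smul, h1, h2, add_zero]
  rfl

end CylinderFrames

theorem continuous_basis_det {A : Type*} [NormedAddCommGroup A] [NormedSpace ℝ A] {M : ℕ}
    (b : Module.Basis (Fin M) ℝ A) : Continuous fun v : Fin M → A => b.det v := by
  have : FiniteDimensional ℝ A := Module.Basis.finiteDimensional_of_finite b
  simp only [Module.Basis.det_apply]
  refine Continuous.matrix_det (continuous_matrix fun i j => ?_)
  exact (LinearMap.continuous_of_finiteDimensional (b.coord i)).comp (continuous_apply j)

namespace GeometricCycle

/-! ### Local constancy of the orientation sign -/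

section Cylinder

variable {d : ℕ} {X : Type*} [TopologicalSpace X] [ChartedSpace (Eu d) X] [IsManifold (𝓡 d) ∞ X]
  {n : ℤ} (b : GeometricCycle (cylModel d) (ℝ × X) n)

theorem tangentCoordChange_cyl (t t' : ℝ) (x y : X) (hy : y ∈ (chartAt (Eu d) x).source) :
    tangentCoordChange (cylModel d) (t, x) (t', y) (t', y) =
      (ContinuousLinearMap.id ℝ ℝ).prodMap
        (fderiv ℝ (coordChange x y) (chartAt (Eu d) x y)) := by
  have h1 : HasFDerivWithinAt _ _ _ _ := hasFDerivWithinAt_tangentCoordChange (I := 𝓡 d)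
    (x := x) (y := y) (z := y) (by simp [hy])
  have h2 : HasFDerivWithinAt _ _ _ _ := hasFDerivWithinAt_tangentCoordChange (I := cylModel d)
    (x := ((t, x) : ℝ × X)) (y := (t', y)) (z := (t', y)) (by simp [hy, chartAt_self_eq])
  rw [ModelWithCorners.range_eq_univ, hasFDerivWithinAt_univ] at h1 h2
  have h3 : HasFDerivAt (Prod.map id (extChartAt (𝓡 d) y ∘ (extChartAt (𝓡 d) x).symm))
      (tangentCoordChange (cylModel d) (t, x) (t', y) (t', y)) (t', extChartAt (𝓡 d) x y) := h2
  have h4 := h3.unique ((hasFDerivAt_id (𝕜 := ℝ) t').prodMap (t', extChartAt (𝓡 d) x y) h1)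
  rw [h4, tangentCoordChange_eq_fderiv]

/-- The coordinate expression of the inclusion of the tangent spaces into the ambient space, for
the chart at `i` of the domain and the chart at `j` of `X`. -/
def tangentInclLoc (i : b.Z) (j : X) (y : Eu b.m) : Eu b.m →L[ℝ] Amb (ℝ × Eu d) n b.N :=
  ((fderiv ℝ (fun y => b.c (b.pt i y)) y).prod (fderiv ℝ (locMap b.m d b.fX i j) y)).prod
    ((0 : Eu b.m →L[ℝ] (Fin (par n) → ℝ)).prod (fderiv ℝ (fun y => b.u (b.pt i y)) y))

/-- The ambient space at `z` is read in the preferred chart of `X` at `f z`, which may jump as `z`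
moves. This factors the tangent inclusion into an expression in a fixed chart `j`, which varies
continuously, and a change of coordinates. -/
theorem tangentIncl_coordVec (i : b.Z) {z : b.Z} (hz : z ∈ (chartAt (Eu b.m) i).source)
    {j : X} (hj : b.fX z ∈ (chartAt (Eu d) j).source) (v : Eu b.m) :
    b.tangentIncl z (b.coordVec i z v) = ambMap n b.N ((ContinuousLinearMap.id ℝ ℝ).prodMap
      (fderiv ℝ (coordChange j (b.fX z)) (chartAt (Eu d) j (b.fX z))))
        (b.tangentInclLoc i j (chartAt (Eu b.m) i z) v) := by
  have hs : (chartAt (Eu b.m) i).symm (chartAt (Eu b.m) i z) = z := (chartAt (Eu b.m) i).left_inv hz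
  have h1 := mfderiv_vec_tangentCoordChange i b.c_smooth.contMDiffAt hz v
  have h2 := mfderiv_tangentCoordChange b.fX_smooth i hz v
  have h3 := mfderiv_vec_tangentCoordChange i b.u_smooth.contMDiffAt hz v
  rw [fderiv_locMap_comp_left b.fX_smooth i j (b.fX z) ((chartAt (Eu b.m) i).map_source hz)
    (by rw [hs]; exact hj) (by rw [hs]; exact mem_chart_source _ _)] at h2
  have h4 : locMap b.m d b.fX i j (chartAt (Eu b.m) i z) = chartAt (Eu d) j (b.fX z) := by
    rw [locMap, hs]
  rw [h4] at h2
  refine Prod.ext ((b.mfderiv_f z _).trans (Prod.ext h1 h2)) (Prod.ext rfl h3)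

theorem continuousAt_tangentInclLoc {i : b.Z} {y : Eu b.m} (hy : y ∈ (chartAt (Eu b.m) i).target)
    {j : X} (hj : b.fX (b.pt i y) ∈ (chartAt (Eu d) j).source) (v : Eu b.m) :
    ContinuousAt (fun y => b.tangentInclLoc i j y v) y := by
  have h1 := (((smoothChart_chartAt i).contDiffAt_comp_symm hy
    b.c_smooth.contMDiffAt).fderiv_right (m := 0) (by simp)).continuousAt
  have h2 := ((contDiffAt_locMap b.fX_smooth i j hy hj).fderiv_right
    (m := 0) (by simp)).continuousAt
  have h3 := (((smoothChart_chartAt i).contDiffAt_comp_symm hy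
    b.u_smooth.contMDiffAt).fderiv_right (m := 0) (by simp)).continuousAt
  exact ((h1.clm_apply continuousAt_const).prodMk (h2.clm_apply continuousAt_const)).prodMk
    (continuousAt_const.prodMk (h3.clm_apply continuousAt_const))

set_option maxHeartbeats 800000 in
/-- The orientation sign of a cycle over a cylinder is locally constant, up to the orientation
characters of the charts of `X`. -/
theorem eventually_orientationSign {i : b.Z} {y₀ : Eu b.m}
    (hy₀ : y₀ ∈ (chartAt (Eu b.m) i).target) :
    ∀ᶠ y in 𝓝 y₀, b.orientationSign i (b.pt i y) (cylFrame d) =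
      b.orientationSign i (b.pt i y₀) (cylFrame d) *
        sgn (fderiv ℝ (coordChange (b.fX (b.pt i y₀)) (b.fX (b.pt i y)))
          (chartAt (Eu d) (b.fX (b.pt i y₀)) (b.fX (b.pt i y)))).det := by
  set z₀ := b.pt i y₀ with hz₀
  set j := b.fX z₀ with hj
  have hpt : ContinuousAt (b.pt i) y₀ := (chartAt (Eu b.m) i).continuousAt_symm hy₀
  obtain ⟨a, ha⟩ := b.cover z₀
  choose s hs using fun x => b.q_surjective a z₀ ha (normalFrame b.r b.k x)
  have hdim := b.dim_eq (cylBasis d) z₀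
  -- `q` read in the fixed chart at `f z₀`; only in this form is it continuous in `z`.
  let q' := fun z => (b.q a z).comp (ambMap n b.N
    (tangentCoordChange (cylModel d) (b.f z₀) (b.f z) (b.f z)))
  have hq' : ContinuousAt q' z₀ := (b.q_smooth a z₀ ha).continuousAt
  -- With lifts `s` chosen once at `y₀`, both `Λ` (the volume of the adapted frame) and `D` (the
  -- determinant of the normal frame) are continuous at `y₀`, and `D y₀ = 1`.
  let Λ : Eu b.m → ℝ := fun y => (ambBasis n b.N (cylBasis d)).det
    (Fin.append (fun x => b.tangentInclLoc i j y (stdVec x)) s ∘ Fin.cast hdim)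
  let D : Eu b.m → ℝ := fun y => (normalBasis b.r b.k).det fun x => q' (b.pt i y) (s x)
  have hΛ : ContinuousAt Λ y₀ := by
    refine (continuous_basis_det _).continuousAt.comp (continuousAt_pi.2 fun x => ?_)
    have h1 : ∀ l, ContinuousAt (fun y => Fin.append (fun x => b.tangentInclLoc i j y (stdVec x)) s l)
        y₀ := by
      intro l
      refine Fin.addCases (fun l => ?_) (fun l => ?_) l
      · simp only [Fin.append_left]
        exact b.continuousAt_tangentInclLoc hy₀ (mem_chart_source _ _) _
      · simp only [Fin.append_right]
        exact continuousAt_const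
    exact h1 _
  have hD : ContinuousAt D y₀ := by
    refine (continuous_basis_det _).continuousAt.comp (continuousAt_pi.2 fun x => ?_)
    exact (ContinuousAt.comp (g := q') hq' hpt).clm_apply continuousAt_const
  have hD0 : D y₀ = 1 := by
    have h1 : ∀ x, q' z₀ (s x) = normalBasis b.r b.k x := by
      intro x
      rw [coe_normalBasis, ← hs x]
      simp only [q', ContinuousLinearMap.comp_apply]
      congr 1
      refine Prod.ext ?_ rfl
      exact tangentCoordChange_self (I := cylModel d) (x := b.f z₀) (z := b.f z₀) (by simp)
    simp only [D]
    change ((normalBasis b.r b.k).det fun x => q' z₀ (s x)) = 1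
    rw [funext h1]
    exact (normalBasis b.r b.k).det_self
  have hev1 : ∀ᶠ y in 𝓝 y₀, y ∈ (chartAt (Eu b.m) i).target :=
    (chartAt (Eu b.m) i).open_target.mem_nhds hy₀
  have hev2 : ∀ᶠ y in 𝓝 y₀, b.pt i y ∈ b.U a := hpt.eventually_mem ((b.U a).isOpen.mem_nhds ha)
  have hev3 : ∀ᶠ y in 𝓝 y₀, b.fX (b.pt i y) ∈ (chartAt (Eu d) j).source :=
    (b.fX_smooth.continuous.continuousAt.comp hpt).eventually_mem
      ((chartAt (Eu d) j).open_source.mem_nhds (mem_chart_source _ _))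
  have hev4 : ∀ᶠ y in 𝓝 y₀, 0 < D y := hD.eventually_const_lt (by rw [hD0]; exact one_pos)
  -- With `B` the derivative of the change of coordinates from `j` to the chart at `f z`, evaluating
  -- the volume form in two ways gives `det B · Λ = κ · det (coordVec) · D`. As `D > 0`, the
  -- orientation sign is `sgn (det B) · sgn Λ`, where `sgn Λ` is locally constant.
  have key : ∀ y, y ∈ (chartAt (Eu b.m) i).target → b.pt i y ∈ b.U a →
      b.fX (b.pt i y) ∈ (chartAt (Eu d) j).source → 0 < D y →
      b.orientationSign i (b.pt i y) (cylFrame d) =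
        sgn (fderiv ℝ (coordChange j (b.fX (b.pt i y)))
          (chartAt (Eu d) j (b.fX (b.pt i y)))).det * sgn (Λ y) ∧ Λ y ≠ 0 := by
    intro y hy hya hyj hDy
    set z := b.pt i y with hz
    have hzs : z ∈ (chartAt (Eu b.m) i).source := (chartAt (Eu b.m) i).map_target hy
    have hzy : chartAt (Eu b.m) i z = y := (chartAt (Eu b.m) i).right_inv hy
    obtain ⟨κ, hκ0, hκ⟩ := b.exists_sign_factor (cylBasis d) hya
    have h1 := b.orientationSign_eq (cylBasis d) hzs hya hκ0 hκ
    set B := fderiv ℝ (coordChange j (b.fX z)) (chartAt (Eu d) j (b.fX z)) with hB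
    have hA : tangentCoordChange (cylModel d) (b.f z₀) (b.f z) (b.f z) =
        (ContinuousLinearMap.id ℝ ℝ).prodMap B := tangentCoordChange_cyl _ _ _ _ hyj
    have h2 := hκ (fun x => b.coordVec i z (stdVec x)) (fun x => ambMap n b.N
      ((ContinuousLinearMap.id ℝ ℝ).prodMap B) (s x))
    have h3 : frameDet b.m (fun x => b.coordVec i z (stdVec x)) =
      (b.coordVec i z : Eu b.m →L[ℝ] Eu b.m).det := frameDet_clm _
    have h4 : ((normalBasis b.r b.k).det fun x => b.q a z (ambMap n b.N
      ((ContinuousLinearMap.id ℝ ℝ).prodMap B) (s x))) = D y := by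
      simp only [D, q', ← hz, hA]
      rfl
    have h5 : Fin.append (fun x => b.tangentIncl z (b.coordVec i z (stdVec x)))
        (fun x => ambMap n b.N ((ContinuousLinearMap.id ℝ ℝ).prodMap B) (s x)) ∘
          Fin.cast (b.dim_eq (cylBasis d) z) =
        (ambMap n b.N ((ContinuousLinearMap.id ℝ ℝ).prodMap B)).toLinearMap ∘
        (Fin.append (fun x => b.tangentInclLoc i j y (stdVec x)) s ∘ Fin.cast hdim) := by
      have h6 : ∀ l, Fin.append (fun x => b.tangentIncl z (b.coordVec i z (stdVec x)))
          (fun x => ambMap n b.N ((ContinuousLinearMap.id ℝ ℝ).prodMap B) (s x)) l =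
          ambMap n b.N ((ContinuousLinearMap.id ℝ ℝ).prodMap B)
            (Fin.append (fun x => b.tangentInclLoc i j y (stdVec x)) s l) := by
        intro l
        refine Fin.addCases (fun l => ?_) (fun l => ?_) l
        · simp only [Fin.append_left]
          rw [b.tangentIncl_coordVec i hzs hyj, hzy]
        · simp only [Fin.append_right]
      funext l
      exact h6 _
    have h6 : LinearMap.det (ambMap n b.N
        ((ContinuousLinearMap.id ℝ ℝ).prodMap B)).toLinearMap = B.det := by
      have h7 : (ambMap n b.N ((ContinuousLinearMap.id ℝ ℝ).prodMap B)).toLinearMap =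
          (LinearMap.prodMap LinearMap.id B.toLinearMap).prodMap LinearMap.id := rfl
      rw [h7, LinearMap.det_prodMap, LinearMap.det_prodMap, LinearMap.det_id, LinearMap.det_id,
        one_mul, mul_one]
    rw [h5, Module.Basis.det_comp, h6, h3, h4, ← mul_assoc] at h2
    have hne : κ * (b.coordVec i z : Eu b.m →L[ℝ] Eu b.m).det ≠ 0 :=
      mul_ne_zero hκ0 (b.det_coordVec_ne_zero hzs)
    refine ⟨?_, ?_⟩
    · rw [← coe_cylBasis, h1, ← sgn_mul]
      change _ = sgn (B.det * (ambBasis n b.N (cylBasis d)).det _)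
      rw [h2, sgn_mul _ (D y), sgn_pos hDy, mul_one]
    · intro h0
      have h8 : B.det * Λ y = κ * (b.coordVec i z : Eu b.m →L[ℝ] Eu b.m).det * D y := h2
      rw [h0, mul_zero] at h8
      exact mul_ne_zero hne hDy.ne' h8.symm
  have key0 := key y₀ hy₀ ha (mem_chart_source _ _) (by rw [hD0]; exact one_pos)
  have hid : fderiv ℝ (coordChange (d := d) j j) (chartAt (Eu d) j j) =
      ContinuousLinearMap.id ℝ (Eu d) :=
    fderiv_chartTrans_self (Φ := chartAt (Eu d) j)
      ((chartAt (Eu d) j).map_source (mem_chart_source _ _))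
  filter_upwards [hev1, hev2, hev3, hev4, eventually_sgn_eq hΛ key0.2] with y h1 h2 h3 h4 h5
  rw [(key y h1 h2 h3 h4).1, key0.1, h5]
  change _ = sgn (fderiv ℝ (coordChange (d := d) j j) (chartAt (Eu d) j j)).det * _ * _
  rw [hid]
  simp [ContinuousLinearMap.det, sgn, mul_comm]

end Cylinder

end GeometricCycle

namespace GeometricCycle

/-! ### The orientation of a fibre as a boundary -/

section FiberSign

variable {d : ℕ} {X : Type*} [TopologicalSpace X] [ChartedSpace (Eu d) X] [IsManifold (𝓡 d) ∞ X]
  {n : ℤ} (b : GeometricCycle (cylModel d) (ℝ × X) n) (t : ℝ) (ht : b.RegularAt t)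

/-- The coordinate expression of the inclusion of a fiber. -/
def fibLoc (i' : b.Fib t) (i : b.Z) : Eu (b.m - 1) → Eu b.m :=
  letI := b.fibCharted t ht
  inclLoc i' i

theorem coordVec_fibLoc (i' : b.Fib t) (i : b.Z) {s : b.Fib t}
    (hs : s ∈ (letI := b.fibCharted t ht; (chartAt (Eu (b.m - 1)) i').source))
    (hi : s.1 ∈ (chartAt (Eu b.m) i).source) (v : Eu (b.m - 1)) :
    b.coordVec i s.1 (fderiv ℝ (b.fibLoc t ht i' i)
      (letI := b.fibCharted t ht; chartAt (Eu (b.m - 1)) i' s) v) =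
      (letI := b.fibCharted t ht
      haveI := b.fib_isManifold t ht
      mfderiv (𝓡 (b.m - 1)) (𝓡 b.m) (Subtype.val : b.Fib t → b.Z) s
        (tangentCoordChange (𝓡 (b.m - 1)) i' s s v)) := by
  let _ := b.fibCharted t ht
  have := b.fib_isManifold t ht
  have hs' : (chartAt (Eu (b.m - 1)) i').symm (chartAt (Eu (b.m - 1)) i' s) = s :=
    (chartAt (Eu (b.m - 1)) i').left_inv hs
  have h1 := mfderiv_tangentCoordChange (b.fib_incl_smooth t ht) i' hs v
  rw [fderiv_locMap_comp_left (b.fib_incl_smooth t ht) i' i s.1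
    ((chartAt (Eu (b.m - 1)) i').map_source hs) (by rw [hs']; exact hi)
    (by rw [hs']; exact mem_chart_source _ _)] at h1
  refine Eq.trans ?_ h1.symm
  have h2 : locMap (b.m - 1) b.m (Subtype.val : b.Fib t → b.Z) i' i (chartAt (Eu (b.m - 1)) i' s) =
      chartAt (Eu b.m) i s.1 := by rw [locMap, hs']
  rw [h2, coordVec, tangentCoordChange_eq_fderiv]
  rfl

/-- Since `dc` vanishes on vectors tangent to a fibre, their images in the ambient space lie in the
slice. -/
theorem tangentIncl_fiber (s : b.Fib t) (w : Eu (b.m - 1)) :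
    b.tangentIncl s.1 (letI := b.fibCharted t ht
      mfderiv (𝓡 (b.m - 1)) (𝓡 b.m) (Subtype.val : b.Fib t → b.Z) s w) =
      sliceMap d n b.N ((b.fiber t ht).tangentIncl s w) := by
  let _ := b.fibCharted t ht
  have h1 := b.mfderiv_f s.1
    (mfderiv (𝓡 (b.m - 1)) (𝓡 b.m) (Subtype.val : b.Fib t → b.Z) s w)
  have h2 := b.fib_mfderiv_f t ht s w
  have h3 := b.fib_mfderiv_c t ht s w
  have h4 := b.fib_mfderiv_u t ht s w
  refine Prod.ext (h1.trans (Prod.ext h3 h2.symm)) (Prod.ext rfl h4.symm)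

set_option maxHeartbeats 400000 in
/-- The orientation of a fiber, compared with that of the total space. -/
theorem orientationSign_fiber (hm : b.m = b.m - 1 + 1) (i' : b.Fib t) (i : b.Z) {s : b.Fib t}
    (hs : s ∈ (letI := b.fibCharted t ht; (chartAt (Eu (b.m - 1)) i').source))
    (hi : s.1 ∈ (chartAt (Eu b.m) i).source) {ν : Eu b.m}
    (hν : 0 < fderiv ℝ (fun y => b.c ((chartAt (Eu b.m) i).symm y)) (chartAt (Eu b.m) i s.1) ν) :
    (b.fiber t ht).orientationSign i' s stdVec =
      sgn (frameDet b.m (bdryFrame hm ν (fderiv ℝ (b.fibLoc t ht i' i)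
        (letI := b.fibCharted t ht; chartAt (Eu (b.m - 1)) i' s)))) *
        b.orientationSign i s.1 (cylFrame d) := by
  obtain ⟨a, ha⟩ := b.cover s.1
  have haF : s ∈ (b.fiber t ht).U a := ha
  obtain ⟨κ, hκ0, hκ⟩ := b.exists_sign_factor (cylBasis d) ha
  obtain ⟨κ', hκ'0, hκ'⟩ := (b.fiber t ht).exists_sign_factor (euBasis d) haF
  have h1 := b.orientationSign_eq (cylBasis d) hi ha hκ0 hκ
  have h2 := (b.fiber t ht).orientationSign_eq (euBasis d) (i := i') (z := s) hs haF hκ'0 hκ'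
  rw [coe_cylBasis] at h1
  rw [coe_euBasis] at h2
  rw [h1, h2]
  -- Lifts for the fibre become lifts for `b` under `sliceMap`, because `q` of the fibre is `q` of
  -- `b` restricted to the slice. So both signs can be computed from the same normal vectors.
  choose s' hs' using fun x => (b.fiber t ht).q_surjective a s haF (normalFrame b.r b.k x)
  set J := fderiv ℝ (b.fibLoc t ht i' i)
    (letI := b.fibCharted t ht; chartAt (Eu (b.m - 1)) i' s) with hJ
  have hone : (normalBasis b.r b.k).det (fun x => normalFrame b.r b.k x) = 1 := by
    rw [← coe_normalBasis]
    exact (normalBasis b.r b.k).det_self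
  have h3 := hκ (fun x => b.coordVec i s.1 (bdryFrame hm ν J x)) (fun x => sliceMap d n b.N (s' x))
  have h4 : ((normalBasis b.r b.k).det fun x => b.q a s.1 (sliceMap d n b.N (s' x))) = 1 := by
    rw [← hone]
    congr 1
    funext x
    exact hs' x
  have h5 : frameDet b.m (fun x => b.coordVec i s.1 (bdryFrame hm ν J x)) =
      (b.coordVec i s.1 : Eu b.m →L[ℝ] Eu b.m).det * frameDet b.m (bdryFrame hm ν J) :=
    frameDet_map _ _
  rw [h4, h5, mul_one] at h3
  have h6 := hκ' (fun x => (b.fiber t ht).coordVec i' s (stdVec x)) s'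
  have h7 : ((normalBasis b.r b.k).det fun x => (b.fiber t ht).q a s (s' x)) = 1 := by
    rw [← hone]
    congr 1
    funext x
    exact hs' x
  have h8 : frameDet (b.m - 1) (fun x => (b.fiber t ht).coordVec i' s (stdVec x)) =
      ((b.fiber t ht).coordVec i' s : Eu (b.m - 1) →L[ℝ] Eu (b.m - 1)).det := frameDet_clm _
  have h6' : (ambBasis n b.N (euBasis d)).det (Fin.append (fun x => (b.fiber t ht).tangentIncl s
      ((b.fiber t ht).coordVec i' s (stdVec x))) s' ∘
        Fin.cast ((b.fiber t ht).dim_eq (euBasis d) s)) =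
      κ' * ((b.fiber t ht).coordVec i' s : Eu (b.m - 1) →L[ℝ] Eu (b.m - 1)).det := by
    refine h6.trans ?_
    congr 1
    refine (congrArg₂ (· * ·) h8 h7).trans (mul_one _)
  have hd : d + 1 + par n + b.N * 2 = d + par n + b.N * 2 + 1 := by omega
  have hcons : (Fin.append (fun x => b.tangentIncl s.1 (b.coordVec i s.1 (bdryFrame hm ν J x)))
      (fun x => sliceMap d n b.N (s' x)) ∘ Fin.cast (b.dim_eq (cylBasis d) s.1)) =
      (Fin.cons (b.tangentIncl s.1 (b.coordVec i s.1 ν)) (fun l => sliceMap d n b.N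
        ((Fin.append (fun x => (b.fiber t ht).tangentIncl s
          ((b.fiber t ht).coordVec i' s (stdVec x))) s' ∘
          Fin.cast ((b.fiber t ht).dim_eq (euBasis d) s)) l)) :
          Fin (d + par n + b.N * 2 + 1) → Amb (ℝ × Eu d) n b.N) ∘ Fin.cast hd := by
    have e1 : (fun x => b.tangentIncl s.1 (b.coordVec i s.1 (bdryFrame hm ν J x))) =
        (Fin.cons (b.tangentIncl s.1 (b.coordVec i s.1 ν)) (fun x => sliceMap d n b.N
          ((b.fiber t ht).tangentIncl s ((b.fiber t ht).coordVec i' s (stdVec x)))) :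
          Fin (b.m - 1 + 1) → Amb (ℝ × Eu d) n b.N) ∘ Fin.cast hm := by
      funext x
      simp only [bdryFrame, Function.comp_apply]
      generalize Fin.cast hm x = l
      refine Fin.cases rfl (fun l => ?_) l
      simp only [Fin.cons_succ]
      rw [b.coordVec_fibLoc t ht i' i hs hi]
      exact b.tangentIncl_fiber t ht s _
    rw [e1]
    refine (cons_append_cast hm (b.dim_eq (cylBasis d) s.1)
      ((b.fiber t ht).dim_eq (euBasis d) s) hd _ _ _).trans ?_
    congr 2
    have e2 : ∀ l, Fin.append (fun x => sliceMap d n b.N ((b.fiber t ht).tangentIncl s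
        ((b.fiber t ht).coordVec i' s (stdVec x)))) (fun x => sliceMap d n b.N (s' x)) l =
        sliceMap d n b.N (Fin.append (fun x => (b.fiber t ht).tangentIncl s
          ((b.fiber t ht).coordVec i' s (stdVec x))) s' l) := by
      intro l
      refine Fin.addCases (fun l => ?_) (fun l => ?_) l
      · exact (Fin.append_left _ _ l).trans
          (congrArg (sliceMap d n b.N) (Fin.append_left (fun x => (b.fiber t ht).tangentIncl s
            ((b.fiber t ht).coordVec i' s (stdVec x))) s' l).symm)
      · exact (Fin.append_right _ _ l).trans
          (congrArg (sliceMap d n b.N) (Fin.append_right (fun x => (b.fiber t ht).tangentIncl s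
            ((b.fiber t ht).coordVec i' s (stdVec x))) s' l).symm)
    funext l
    exact e2 _
  have h0 := ambBasis_det_cons hd (b.tangentIncl s.1 (b.coordVec i s.1 ν))
    (Fin.append (fun x => (b.fiber t ht).tangentIncl s
      ((b.fiber t ht).coordVec i' s (stdVec x))) s' ∘
      Fin.cast ((b.fiber t ht).dim_eq (euBasis d) s))
  -- The volume of the frame `(ν, tangent vectors of the fibre, lifts)` is computed through `κ` for
  -- `b`, and through `κ'` for the fibre after splitting off `ν`. The two differ by the factor
  -- `dc(ν) > 0`, which drops out of the signs.
  have h9 := h3.symm.trans ((congrArg _ hcons).trans (h0.trans (congrArg _ h6')))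
  have h10 : (b.tangentIncl s.1 (b.coordVec i s.1 ν)).1.1 =
      fderiv ℝ (fun y => b.c ((chartAt (Eu b.m) i).symm y)) (chartAt (Eu b.m) i s.1) ν :=
    (congrArg Prod.fst (b.mfderiv_f s.1 _)).trans
      (mfderiv_vec_tangentCoordChange i b.c_smooth.contMDiffAt hi ν)
  rw [h10] at h9
  have h11 := congrArg sgn h9
  rw [sgn_mul _ (κ' * _), sgn_pos hν, one_mul, ← mul_assoc, sgn_mul _ (frameDet _ _)] at h11
  exact h11.symm.trans (mul_comm _ _)

end FiberSign

end GeometricCycle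

namespace GeometricCycle

/-! ### Chern forms of a cycle in charts -/

section LocalForms

variable {E : Type*} [NormedAddCommGroup E] [NormedSpace ℝ E] {H : Type*}
  [TopologicalSpace H] {I : ModelWithCorners ℝ E H} {Y : Type*} [TopologicalSpace Y]
  [ChartedSpace H Y] [IsManifold I ∞ Y] {n : ℤ} (c : GeometricCycle I Y n)

theorem pt_mem_source {i : c.Z} {y : Eu c.m} (hy : y ∈ (chartAt (Eu c.m) i).target) :
    c.pt i y ∈ (chartAt (Eu c.m) i).source := (chartAt (Eu c.m) i).map_target hy

theorem chartAt_pt {i : c.Z} {y : Eu c.m} (hy : y ∈ (chartAt (Eu c.m) i).target) :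
    chartAt (Eu c.m) i (c.pt i y) = y := (chartAt (Eu c.m) i).right_inv hy

theorem pt_coordChange {i j : c.Z} {y : Eu c.m} (hj : c.pt i y ∈ (chartAt (Eu c.m) j).source) :
    c.pt j (coordChange i j y) = c.pt i y := (chartAt (Eu c.m) j).left_inv hj

theorem eventually_pt_mem {i : c.Z} {y : Eu c.m} (hy : y ∈ (chartAt (Eu c.m) i).target)
    {O : Set c.Z} (hO : IsOpen O) (h : c.pt i y ∈ O) :
    ∀ᶠ z in 𝓝 y, z ∈ (chartAt (Eu c.m) i).target ∧ c.pt i z ∈ O :=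
  ((chartAt (Eu c.m) i).isOpen_inter_preimage_symm hO).mem_nhds ⟨hy, h⟩

theorem coordVec_coordChange {i j : c.Z} {y : Eu c.m} (hy : y ∈ (chartAt (Eu c.m) i).target)
    (hj : c.pt i y ∈ (chartAt (Eu c.m) j).source) (v : Eu c.m) :
    c.coordVec i (c.pt i y) v =
      c.coordVec j (c.pt i y) (fderiv ℝ (coordChange i j) y v) := by
  have h := tangentCoordChange_comp (I := 𝓡 c.m) (w := i) (x := j) (y := c.pt i y)
    (z := c.pt i y) (v := v) (by simp [hj, c.pt_mem_source hy])
  rw [tangentCoordChange_eq_fderiv i j, c.chartAt_pt hy] at h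
  exact h.symm

theorem connLoc_coordChange (a : c.A) {i j : c.Z} {y : Eu c.m}
    (hy : y ∈ (chartAt (Eu c.m) i).target) (hj : c.pt i y ∈ (chartAt (Eu c.m) j).source)
    (s t : Fin c.r) : c.connLoc a i s t y =
      (c.connLoc a j s t (coordChange i j y)).comp (fderiv ℝ (coordChange i j) y) := by
  rw [connLoc, connLoc, c.pt_coordChange hj]
  refine ContinuousLinearMap.ext fun v => ?_
  exact congrArg (c.θ a (c.pt i y) s t) (c.coordVec_coordChange hy hj v)

/-- `θ_smooth` describes `θ` near a point in the chart at that point; composing with the derivative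
of the change of coordinates gives its expression in the chart at `i`. -/
theorem contDiffAt_connLoc {a : c.A} {i : c.Z} {y : Eu c.m}
    (hy : y ∈ (chartAt (Eu c.m) i).target) (ha : c.pt i y ∈ c.U a) (s t : Fin c.r) :
    ContDiffAt ℝ ∞ (c.connLoc a i s t) y := by
  have h1 := (smoothChart_chartAt i).contDiffAt_comp_symm hy (c.θ_smooth a s t (c.pt i y) ha)
  have h2 := (coordChange_contDiffAt i (c.pt i y) hy (mem_chart_source _ _)).fderiv_right
    (m := ∞) (by simp)
  refine (h1.clm_comp h2).congr_of_eventuallyEq ?_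
  filter_upwards [c.eventually_pt_mem hy (chartAt (Eu c.m) (c.pt i y)).open_source
    (mem_chart_source _ _)] with z hz
  refine ContinuousLinearMap.ext fun v => ?_
  exact congrArg (c.θ a (c.pt i z) s t) (c.coordVec_coordChange hz.1 hz.2 v)

/-- Invertibility of the transition matrices follows from the surjectivity of `q a`: every `v` is
the first component of some `q a z x`, hence of the form `g v'`. -/
theorem isUnit_det_g {a a' : c.A} {z : c.Z} (ha : z ∈ c.U a) (ha' : z ∈ c.U a') :
    IsUnit (c.g a a' z).det := by
  rw [← Matrix.isUnit_iff_isUnit_det, ← Matrix.mulVec_surjective_iff_isUnit]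
  intro v
  obtain ⟨x, hx⟩ := c.q_surjective a z ha (v, 0)
  refine ⟨(c.q a' z x).1, ?_⟩
  have h := c.q_trans a a' z ha ha' x
  rw [hx] at h
  exact (congrArg Prod.fst h).symm

theorem chernOf_connLoc_eq {a a' : c.A} {i : c.Z} {y : Eu c.m}
    (hy : y ∈ (chartAt (Eu c.m) i).target) (ha : c.pt i y ∈ c.U a) (ha' : c.pt i y ∈ c.U a')
    (l : ℕ) : chernOf (c.connLoc a i) l y = chernOf (c.connLoc a' i) l y := by
  have hg : ∀ z, z ∈ c.U a → z ∈ c.U a' → ∀ s t,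
      ContMDiffAt (𝓡 c.m) 𝓘(ℝ, ℂ) ∞ (fun z => c.g a a' z s t) z := fun z hz hz' s t =>
    (c.g_smooth a a' s t).contMDiffAt (((c.U a).isOpen.inter (c.U a').isOpen).mem_nhds ⟨hz, hz'⟩)
  refine chernOf_gauge (g := fun y => c.g a a' (c.pt i y))
    (fun s t => (c.contDiffAt_connLoc hy ha s t).differentiableAt (by simp))
    (fun s t => (c.contDiffAt_connLoc hy ha' s t).differentiableAt (by simp))
    (fun s t => (smoothChart_chartAt i).contDiffAt_comp_symm hy (hg _ ha ha' s t))
    (c.isUnit_det_g ha ha') ?_ l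
  filter_upwards [c.eventually_pt_mem hy (c.U a).isOpen ha,
    c.eventually_pt_mem hy (c.U a').isOpen ha'] with z hz hz' s t v
  have h1 := c.θ_trans a a' (c.pt i z) hz.2 hz'.2 (c.coordVec i (c.pt i z) v) s t
  have h2 := mfderiv_vec_tangentCoordChange i (hg _ hz.2 hz'.2 s t) (c.pt_mem_source hz.1) v
  rw [c.chartAt_pt hz.1] at h2
  refine Eq.trans ?_ h1
  exact congrArg₂ (· + ·) h2.symm rfl

/-- `chernForm` chooses a trivialization at each point separately, and the choice may jump. Gauge
invariance shows that it agrees near `y` with the form computed from one fixed trivialization, so it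
can be differentiated. -/
theorem eventually_chernForm_eq {a : c.A} {i : c.Z} {y : Eu c.m}
    (hy : y ∈ (chartAt (Eu c.m) i).target) (ha : c.pt i y ∈ c.U a) (l : ℕ) :
    c.chernForm l i =ᶠ[𝓝 y] chernOf (c.connLoc a i) l := by
  filter_upwards [c.eventually_pt_mem hy (c.U a).isOpen ha] with z hz
  exact c.chernOf_connLoc_eq hz.1 (c.cover (c.pt i z)).choose_spec hz.2 l

theorem chernForm_mem_closedEven {i : c.Z} {y : Eu c.m}
    (hy : y ∈ (chartAt (Eu c.m) i).target) (l : ℕ) : c.chernForm l i ∈ closedEven c.m y := by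
  obtain ⟨a, ha⟩ := c.cover (c.pt i y)
  have h1 := chernOf_mem_closedEven (fun s t => c.contDiffAt_connLoc hy ha s t) l
  have h2 : (fun z => (c.chernForm l i z).val) =ᶠ[𝓝 y]
      fun z => (chernOf (c.connLoc a i) l z).val := by
    filter_upwards [c.eventually_chernForm_eq hy ha l] with z hz
    rw [hz]
  exact ⟨h1.1.congr_of_eventuallyEq h2, (dE_congr h2).trans h1.2⟩

theorem chernMonomial_mem_closedEven {j : ℕ} (α : Fin j →₀ ℕ) {i : c.Z} {y : Eu c.m}
    (hy : y ∈ (chartAt (Eu c.m) i).target) :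
    (fun z => c.chernMonomial α i z) ∈ closedEven c.m y := by
  have h : (fun z => c.chernMonomial α i z) =
      α.prod fun x e => (c.chernForm (x + 1) i) ^ e := by
    funext z
    simp [chernMonomial, Finsupp.prod]
  rw [h]
  exact Subalgebra.prod_mem _ fun x _ => Subalgebra.pow_mem _ (c.chernForm_mem_closedEven hy _) _

theorem chernForm_coordChange {i j : c.Z} {y : Eu c.m}
    (hy : y ∈ (chartAt (Eu c.m) i).target) (hj : c.pt i y ∈ (chartAt (Eu c.m) j).source) (l : ℕ) :
    c.chernForm l i y =
      pbEven (fderiv ℝ (coordChange i j) y) (c.chernForm l j (coordChange i j y)) := by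
  obtain ⟨a, ha⟩ := c.cover (c.pt i y)
  have hy' : coordChange i j y ∈ (chartAt (Eu c.m) j).target := (chartAt (Eu c.m) j).map_source hj
  have ha' : c.pt j (coordChange i j y) ∈ c.U a := by rwa [c.pt_coordChange hj]
  rw [(c.eventually_chernForm_eq hy ha l).eq_of_nhds,
    (c.eventually_chernForm_eq hy' ha' l).eq_of_nhds]
  refine chernOf_pullback (coordChange_contDiffAt i j hy hj)
    (fun s t => c.contDiffAt_connLoc hy' ha' s t) ?_ l
  filter_upwards [eventually_coordChange i j hy hj] with z hz s t
  exact c.connLoc_coordChange a hz.1 hz.2 s t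

theorem chernMonomial_eq_pbEven {m' : ℕ} {j : ℕ} (α : Fin j →₀ ℕ) {L : Eu m' →L[ℝ] Eu c.m}
    {C : ℕ → EvenExt m'} {i : c.Z} {y : Eu c.m}
    (h : ∀ l, C l = pbEven L (c.chernForm l i y)) :
    (α.prod fun x e => C (x + 1) ^ e) = pbEven L (c.chernMonomial α i y) := by
  rw [chernMonomial, Finsupp.prod, Finsupp.prod, map_prod]
  exact Finset.prod_congr rfl fun x _ => by rw [h, map_pow]

theorem chernMonomial_coordChange {k : ℕ} (α : Fin k →₀ ℕ) {i j : c.Z} {y : Eu c.m}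
    (hy : y ∈ (chartAt (Eu c.m) i).target) (hj : c.pt i y ∈ (chartAt (Eu c.m) j).source) :
    c.chernMonomial α i y =
      pbEven (fderiv ℝ (coordChange i j) y) (c.chernMonomial α j (coordChange i j y)) :=
  c.chernMonomial_eq_pbEven α fun l => c.chernForm_coordChange hy hj l

theorem pbEven_two_smul_chernMonomial {k : ℕ} (α : Fin k →₀ ℕ) (i : c.Z) (y : Eu c.m) :
    pbEven ((2 : ℝ) • ContinuousLinearMap.id ℝ (Eu c.m)) (c.chernMonomial α i y) =
      (2 : ℂ) ^ (2 * α.sum fun x e => (x + 1) * e) • c.chernMonomial α i y := by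
  rw [chernMonomial, Finsupp.prod, Finsupp.sum, map_prod, Finset.mul_sum, ← Finset.prod_pow_eq_pow_sum,
    ← Finset.prod_smul]
  refine Finset.prod_congr rfl fun x _ => ?_
  have h : pbEven ((2 : ℝ) • ContinuousLinearMap.id ℝ (Eu c.m)) (c.chernForm (x + 1) i y) =
      (2 : ℂ) ^ (2 * ((x : ℕ) + 1)) • c.chernForm (x + 1) i y := pb_two_smul_chernOf _ _ _
  rw [map_pow, h, smul_pow, ← pow_mul, mul_assoc]

end LocalForms

/-! ### Chern forms of a fibre -/

section FiberForms

variable {d : ℕ} {X : Type*} [TopologicalSpace X] [ChartedSpace (Eu d) X] [IsManifold (𝓡 d) ∞ X]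
  {n : ℤ} (b : GeometricCycle (cylModel d) (ℝ × X) n) (t : ℝ) (ht : b.RegularAt t)

theorem contDiffAt_fibLoc {i' : b.Fib t} {i : b.Z} {y : Eu (b.m - 1)}
    (hy : y ∈ (letI := b.fibCharted t ht; (chartAt (Eu (b.m - 1)) i').target))
    (hi : (letI := b.fibCharted t ht; ((chartAt (Eu (b.m - 1)) i').symm y).1) ∈
      (chartAt (Eu b.m) i).source) : ContDiffAt ℝ ∞ (b.fibLoc t ht i' i) y := by
  let _ := b.fibCharted t ht
  have := b.fib_isManifold t ht
  exact contDiffAt_locMap (b.fib_incl_smooth t ht) i' i hy hi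

theorem connLoc_fiber (a : b.A) {i' : b.Fib t} {i : b.Z} {y : Eu (b.m - 1)}
    (hy : y ∈ (letI := b.fibCharted t ht; (chartAt (Eu (b.m - 1)) i').target))
    (hi : (letI := b.fibCharted t ht; ((chartAt (Eu (b.m - 1)) i').symm y).1) ∈
      (chartAt (Eu b.m) i).source) (s s' : Fin b.r) :
    (b.fiber t ht).connLoc a i' s s' y =
      (b.connLoc a i s s' (b.fibLoc t ht i' i y)).comp (fderiv ℝ (b.fibLoc t ht i' i) y) := by
  let _ := b.fibCharted t ht
  have hz : b.pt i (b.fibLoc t ht i' i y) = ((chartAt (Eu (b.m - 1)) i').symm y).1 :=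
    (chartAt (Eu b.m) i).left_inv hi
  have h0 : b.connLoc a i s s' (b.fibLoc t ht i' i y) =
      (b.θ a ((chartAt (Eu (b.m - 1)) i').symm y).1 s s').comp
        (b.coordVec i ((chartAt (Eu (b.m - 1)) i').symm y).1) := by
    rw [connLoc, hz]
  refine ContinuousLinearMap.ext fun v => ?_
  have h1 := b.coordVec_fibLoc t ht i' i ((chartAt (Eu (b.m - 1)) i').map_target hy) hi v
  have h2 : chartAt (Eu (b.m - 1)) i' ((chartAt (Eu (b.m - 1)) i').symm y) = y :=
    (chartAt (Eu (b.m - 1)) i').right_inv hy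
  rw [h2] at h1
  exact (congrArg (b.θ a ((chartAt (Eu (b.m - 1)) i').symm y).1 s s') h1).symm.trans
    (DFunLike.congr_fun h0 _).symm

theorem chernForm_fiber {i' : b.Fib t} {i : b.Z} {y : Eu (b.m - 1)}
    (hy : y ∈ (letI := b.fibCharted t ht; (chartAt (Eu (b.m - 1)) i').target))
    (hi : (letI := b.fibCharted t ht; ((chartAt (Eu (b.m - 1)) i').symm y).1) ∈
      (chartAt (Eu b.m) i).source) (l : ℕ) :
    (b.fiber t ht).chernForm l i' y =
      pbEven (fderiv ℝ (b.fibLoc t ht i' i) y) (b.chernForm l i (b.fibLoc t ht i' i y)) := by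
  let _ := b.fibCharted t ht
  have := b.fib_isManifold t ht
  obtain ⟨a, ha⟩ := b.cover ((chartAt (Eu (b.m - 1)) i').symm y).1
  have hz : b.pt i (b.fibLoc t ht i' i y) = ((chartAt (Eu (b.m - 1)) i').symm y).1 :=
    (chartAt (Eu b.m) i).left_inv hi
  have hy' : b.fibLoc t ht i' i y ∈ (chartAt (Eu b.m) i).target := (chartAt (Eu b.m) i).map_source hi
  have ha' : b.pt i (b.fibLoc t ht i' i y) ∈ b.U a := by rwa [hz]
  have h1 := ((b.fiber t ht).eventually_chernForm_eq (a := a) (i := i') hy ha l).eq_of_nhds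
  rw [(b.eventually_chernForm_eq hy' ha' l).eq_of_nhds]
  refine h1.trans ?_
  refine chernOf_pullback (b.contDiffAt_fibLoc t ht hy hi)
    (fun s t => b.contDiffAt_connLoc hy' ha' s t) ?_ l
  have h2 := ((chartAt (Eu (b.m - 1)) i').isOpen_inter_preimage_symm
    ((chartAt (Eu b.m) i).open_source.preimage continuous_subtype_val)).mem_nhds ⟨hy, hi⟩
  filter_upwards [h2] with z hz s s'
  exact b.connLoc_fiber t ht a hz.1 hz.2 s s'

theorem chernMonomial_fiber {k : ℕ} (α : Fin k →₀ ℕ) {i' : b.Fib t} {i : b.Z} {y : Eu (b.m - 1)}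
    (hy : y ∈ (letI := b.fibCharted t ht; (chartAt (Eu (b.m - 1)) i').target))
    (hi : (letI := b.fibCharted t ht; ((chartAt (Eu (b.m - 1)) i').symm y).1) ∈
      (chartAt (Eu b.m) i).source) :
    (b.fiber t ht).chernMonomial α i' y =
      pbEven (fderiv ℝ (b.fibLoc t ht i' i) y) (b.chernMonomial α i (b.fibLoc t ht i' i y)) :=
  b.chernMonomial_eq_pbEven α fun l => b.chernForm_fiber t ht hy hi l

end FiberForms

end GeometricCycle

theorem toExt_real_smul {m k : ℕ} (r : ℝ) (η : Eu m [⋀^Fin k]→L[ℝ] ℂ) :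
    toExt (r • η) = (r : ℂ) • toExt η := by
  rw [toExt_eq, toExt_eq, smul_comm (r : ℂ),
    Finset.smul_sum (r := (r : ℂ))]
  refine congrArg _ (Finset.sum_congr rfl fun s _ => ?_)
  rw [smul_smul, ContinuousAlternatingMap.smul_apply, Complex.real_smul]

theorem sgn_transSign {d : ℕ} {X : Type*} [TopologicalSpace X] [ChartedSpace (Eu d) X] (i j : X)
    (y : Eu d) : ((transSign true i j y : ℝ) : ℂ) =
      sgn (fderiv ℝ (coordChange (d := d) i j) y).det := rfl

namespace GeometricCycle

/-! ### The integrand of the push-forward -/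

section PushFamily

variable {E : Type*} [NormedAddCommGroup E] [NormedSpace ℝ E] {H : Type*}
  [TopologicalSpace H] {I : ModelWithCorners ℝ E H} {Y : Type*} [TopologicalSpace Y]
  [ChartedSpace H Y] [IsManifold I ∞ Y] {n : ℤ} (c : GeometricCycle I Y n)
  {d : ℕ} {X : Type*} [TopologicalSpace X] [ChartedSpace (Eu d) X]

/-- The pullback of a form along `h`, in the coordinates of the chart at `i`. -/
def pulledForm (h : c.Z → X) {k : ℕ} (σ : RawForm d X k) (i : c.Z) (y : Eu c.m) : Ext c.m :=
  toExt ((σ (h (c.pt i y)) (chartAt (Eu d) (h (c.pt i y)) (h (c.pt i y)))).compContinuousLinearMap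
    ((mfderiv (𝓡 c.m) (𝓡 d) h (c.pt i y)).comp (c.coordVec i (c.pt i y))))

/-- The integrand of the push-forward of a monomial in the Chern forms. -/
def pushFamily (h : c.Z → X) {D : ℕ} (w : Fin D → E) {j : ℕ} (α : Fin j →₀ ℕ) {k : ℕ}
    (σ : RawForm d X k) (i : c.Z) (y : Eu c.m) : Ext c.m :=
  c.orientationSign i (c.pt i y) w • ((c.chernMonomial α i y).val * c.pulledForm h σ i y)

theorem pulledForm_coordChange (h : c.Z → X) {k : ℕ} (σ : RawForm d X k) {i j : c.Z} {y : Eu c.m}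
    (hy : y ∈ (chartAt (Eu c.m) i).target) (hj : c.pt i y ∈ (chartAt (Eu c.m) j).source) :
    c.pulledForm h σ i y =
      pb (fderiv ℝ (coordChange i j) y) (c.pulledForm h σ j (coordChange i j y)) := by
  rw [pulledForm, pulledForm, pb_toExt, c.pt_coordChange hj]
  congr 1
  refine ContinuousAlternatingMap.ext fun v => ?_
  refine congrArg (σ (h (c.pt i y)) (chartAt (Eu d) (h (c.pt i y)) (h (c.pt i y)))) ?_
  funext x
  exact congrArg (mfderiv (𝓡 c.m) (𝓡 d) h (c.pt i y)) (c.coordVec_coordChange hy hj (v x))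

theorem pulledForm_eq_zero {h : c.Z → X} {k : ℕ} {σ : RawForm d X k} {C : Set X}
    (hσ : VanishesOff σ C) {i : c.Z} {y : Eu c.m} (hy : h (c.pt i y) ∉ C) :
    c.pulledForm h σ i y = 0 := by
  have h0 : (chartAt (Eu d) (h (c.pt i y))).symm (chartAt (Eu d) (h (c.pt i y)) (h (c.pt i y))) =
      h (c.pt i y) := (chartAt (Eu d) (h (c.pt i y))).left_inv (mem_chart_source _ _)
  rw [pulledForm, hσ _ _ ((chartAt (Eu d) (h (c.pt i y))).map_source (mem_chart_source _ _))
    (by rwa [h0]), ← toExtL_apply]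
  have h1 : (0 : Eu d [⋀^Fin k]→L[ℝ] ℂ).compContinuousLinearMap
      ((mfderiv (𝓡 c.m) (𝓡 d) h (c.pt i y)).comp (c.coordVec i (c.pt i y)) : Eu c.m →L[ℝ] Eu d) =
      0 := rfl
  exact (congrArg _ h1).trans (map_zero _)

/-- `pulledForm` reads `σ` in the preferred chart at `h z`, which may jump with `z`. The
transformation law of twisted forms replaces it by a fixed chart `j`, at the price of the sign of a
Jacobian. -/
theorem pulledForm_eq [IsManifold (𝓡 d) ∞ X] {h : c.Z → X} (hh : ContMDiff (𝓡 c.m) (𝓡 d) ∞ h)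
    {k : ℕ} {σ : RawForm d X k} (hσ : σ ∈ dForm d true k (⊤ : Opens X)) {i : c.Z} {y : Eu c.m}
    (hy : y ∈ (chartAt (Eu c.m) i).target) {j : X}
    (hj : h (c.pt i y) ∈ (chartAt (Eu d) j).source) :
    c.pulledForm h σ i y = sgn (fderiv ℝ (coordChange (h (c.pt i y)) j)
        (chartAt (Eu d) (h (c.pt i y)) (h (c.pt i y)))).det •
      pb (fderiv ℝ (locMap c.m d h i j) y) (toExt (σ j (locMap c.m d h i j y))) := by
  set x := h (c.pt i y) with hx
  have hxs : (chartAt (Eu d) x).symm (chartAt (Eu d) x x) = x :=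
    (chartAt (Eu d) x).left_inv (mem_chart_source _ _)
  have hxt : chartAt (Eu d) x x ∈ chartDom (⊤ : Opens X) x :=
    ⟨(chartAt (Eu d) x).map_source (mem_chart_source _ _), trivial⟩
  have h1 := hσ.2.2 x j (chartAt (Eu d) x x) hxt (by rw [hxs]; exact hj)
  have h2 : locMap c.m d h i j y = coordChange x j (chartAt (Eu d) x x) := by
    rw [coordChange, hxs]
    rfl
  have h3 : ((mfderiv (𝓡 c.m) (𝓡 d) h (c.pt i y)).comp (c.coordVec i (c.pt i y)) :
      Eu c.m →L[ℝ] Eu d) = fderiv ℝ (locMap c.m d h i x) y := by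
    refine ContinuousLinearMap.ext fun v => ?_
    have h4 := mfderiv_tangentCoordChange hh i (c.pt_mem_source hy) v
    rw [c.chartAt_pt hy] at h4
    exact h4
  have h5 := fderiv_locMap_comp_left hh i x j hy (mem_chart_source _ _) hj
  have h6 : locMap c.m d h i x y = chartAt (Eu d) x x := rfl
  rw [h6] at h5
  rw [pb_toExt, h5, h2, ← sgn_transSign, ← toExt_real_smul]
  refine congrArg toExt ?_
  refine (congrArg _ h3).trans ?_
  rw [h1]
  rfl

/-- The factor `κ` does not involve the chart of the domain; only the determinant of `coordVec`
does, and it obeys the chain rule. -/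
theorem orientationSign_coordChange [FiniteDimensional ℝ E] {D : ℕ} (w : Module.Basis (Fin D) ℝ E)
    {i j : c.Z} {y : Eu c.m} (hy : y ∈ (chartAt (Eu c.m) i).target)
    (hj : c.pt i y ∈ (chartAt (Eu c.m) j).source) :
    c.orientationSign i (c.pt i y) w = sgn (fderiv ℝ (coordChange i j) y).det *
      c.orientationSign j (c.pt i y) w := by
  obtain ⟨a, ha⟩ := c.cover (c.pt i y)
  obtain ⟨κ, hκ0, hκ⟩ := c.exists_sign_factor w ha
  rw [c.orientationSign_eq w (c.pt_mem_source hy) ha hκ0 hκ, c.orientationSign_eq w hj ha hκ0 hκ]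
  have h1 : (c.coordVec i (c.pt i y) : Eu c.m →L[ℝ] Eu c.m) =
      (c.coordVec j (c.pt i y) : Eu c.m →L[ℝ] Eu c.m).comp (fderiv ℝ (coordChange i j) y) :=
    ContinuousLinearMap.ext fun v => c.coordVec_coordChange hy hj v
  have h2 := (congrArg ContinuousLinearMap.det h1).trans (det_comp_clm _ _)
  refine (congrArg (fun x => sgn (κ * x)) h2).trans ?_
  simp only [sgn_mul]
  ring

theorem pushFamily_coordChange [FiniteDimensional ℝ E] {D : ℕ} (w : Module.Basis (Fin D) ℝ E)
    (h : c.Z → X) {l : ℕ} (α : Fin l →₀ ℕ) {k : ℕ} (σ : RawForm d X k) {i j : c.Z} {y : Eu c.m}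
    (hy : y ∈ (chartAt (Eu c.m) i).target) (hj : c.pt i y ∈ (chartAt (Eu c.m) j).source) :
    c.pushFamily h w α σ i y = sgn (fderiv ℝ (coordChange i j) y).det •
      pb (fderiv ℝ (coordChange i j) y) (c.pushFamily h w α σ j (coordChange i j y)) := by
  rw [pushFamily, pushFamily, c.orientationSign_coordChange w hy hj, c.pt_coordChange hj,
    c.pulledForm_coordChange h σ hy hj, c.chernMonomial_coordChange α hy hj, pbEven_val,
    map_smul, map_mul, mul_smul]

theorem pushFamily_eq_zero (h : c.Z → X) {D : ℕ} (w : Fin D → E) {j : ℕ} (α : Fin j →₀ ℕ) {k : ℕ}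
    {σ : RawForm d X k} {C : Set X} (hσ : VanishesOff σ C) {i : c.Z} {y : Eu c.m}
    (hy : h (c.pt i y) ∉ C) : c.pushFamily h w α σ i y = 0 := by
  rw [pushFamily, c.pulledForm_eq_zero hσ hy, mul_zero, smul_zero]

/-- The integrand vanishes unless its degree is the dimension. -/
theorem topCoeff_pushFamily_eq_zero (h : c.Z → X) {D : ℕ} (w : Fin D → E) {j : ℕ} (α : Fin j →₀ ℕ)
    {k : ℕ} (σ : RawForm d X k) (i : c.Z) (y : Eu c.m)
    (hk : 2 * (α.sum fun x e => (x + 1) * e) + k ≠ c.m) :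
    topCoeff c.m (c.pushFamily h w α σ i y) = 0 := by
  set x := c.pushFamily h w α σ i y with hx
  -- Pulling back along multiplication by `2` scales the integrand by `2` to the power of its
  -- degree, while it scales top coefficients by `det = 2^m`. If the degree is not `m`, these powers
  -- differ and the coefficient is zero.
  have h1 : pb ((2 : ℝ) • ContinuousLinearMap.id ℝ (Eu c.m)) x =
      (2 : ℂ) ^ (2 * (α.sum fun x e => (x + 1) * e) + k) • x := by
    have h2 := congrArg EvenExt.val (c.pbEven_two_smul_chernMonomial α i y)
    rw [pbEven_val, EvenExt.val_smul] at h2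
    have h3 : pb ((2 : ℝ) • ContinuousLinearMap.id ℝ (Eu c.m)) (c.pulledForm h σ i y) =
        (2 : ℂ) ^ k • c.pulledForm h σ i y := by
      have h4 : ((2 : ℂ) ^ k) = (((2 : ℝ) ^ k : ℝ) : ℂ) := by push_cast; rfl
      rw [pulledForm, pb_toExt, h4, ← toExt_real_smul]
      refine congrArg toExt (ContinuousAlternatingMap.ext fun v => ?_)
      have h5 := (((σ (h (c.pt i y)) (chartAt (Eu d) (h (c.pt i y)) (h (c.pt i y)))
        ).compContinuousLinearMap ((mfderiv (𝓡 c.m) (𝓡 d) h (c.pt i y)).comp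
        (c.coordVec i (c.pt i y)) : Eu c.m →L[ℝ] Eu d))).toMultilinearMap.map_smul_univ
        (fun _ => (2 : ℝ)) v
      rw [Finset.prod_const, Finset.card_univ, Fintype.card_fin] at h5
      exact h5
    rw [hx, pushFamily, map_smul, map_mul, h2, h3, smul_mul_smul_comm, ← pow_add, smul_comm]
  have h2 := congrArg (topCoeff c.m) h1
  rw [topCoeff_pb, map_smul, smul_eq_mul] at h2
  have h3 : ((2 : ℝ) • ContinuousLinearMap.id ℝ (Eu c.m)).det = 2 ^ c.m := by
    rw [ContinuousLinearMap.det, ContinuousLinearMap.toLinearMap_smul, LinearMap.det_smul]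
    simp
  rw [h3, ← sub_eq_zero, ← sub_mul] at h2
  refine (mul_eq_zero.1 h2).resolve_left ?_
  rw [sub_eq_zero]
  intro h4
  refine hk (Nat.pow_right_injective (le_refl 2) ?_)
  have h5 : ((2 ^ (2 * (α.sum fun x e => (x + 1) * e) + k) : ℕ) : ℂ) = ((2 ^ c.m : ℕ) : ℂ) := by
    push_cast
    push_cast at h4
    exact h4.symm
  exact_mod_cast h5

end PushFamily

/-! ### The integrand over a cylinder: smoothness, derivative, boundary values -/

section CylinderFamily

variable {d : ℕ} {X : Type*} [TopologicalSpace X] [ChartedSpace (Eu d) X] [IsManifold (𝓡 d) ∞ X]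
  {n : ℤ} (b : GeometricCycle (cylModel d) (ℝ × X) n)

/-- The integrand of the push-forward to `X` of a monomial in the Chern forms of a cycle over the
cylinder. -/
abbrev cylFamily {l : ℕ} (α : Fin l →₀ ℕ) {k : ℕ} (σ : RawForm d X k) : b.Z → Eu b.m → Ext b.m :=
  b.pushFamily b.fX (cylFrame d) α σ

/-- The coordinate expression of the integrand with respect to fixed charts of `b.Z` and `X`. -/
theorem eventually_cylFamily_forall {l : ℕ} (α : Fin l →₀ ℕ) (k : ℕ) {i : b.Z} {y : Eu b.m}
    (hy : y ∈ (chartAt (Eu b.m) i).target) :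
    ∀ᶠ z in 𝓝 y, ∀ σ : RawForm d X k, σ ∈ dForm d true k (⊤ : Opens X) →
      b.cylFamily α σ i z = b.orientationSign i (b.pt i y) (cylFrame d) •
      ((b.chernMonomial α i z).val * pb (fderiv ℝ (locMap b.m d b.fX i (b.fX (b.pt i y))) z)
        (toExt (σ (b.fX (b.pt i y)) (locMap b.m d b.fX i (b.fX (b.pt i y)) z)))) := by
  have h1 := b.eventually_pt_mem hy
    ((chartAt (Eu d) (b.fX (b.pt i y))).open_source.preimage b.fX_smooth.continuous)
    (mem_chart_source _ _)
  filter_upwards [b.eventually_orientationSign hy, h1] with z hz hz' σ hσ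
  set x := b.fX (b.pt i z) with hx
  set j := b.fX (b.pt i y) with hj
  have hxj : x ∈ (chartAt (Eu d) j).source := hz'.2
  have hs : (chartAt (Eu d) j).symm (chartAt (Eu d) j x) = x := (chartAt (Eu d) j).left_inv hxj
  have hjt : chartAt (Eu d) j x ∈ (chartAt (Eu d) j).target := (chartAt (Eu d) j).map_source hxj
  have h2 := fderiv_chartTrans_comp (smoothChart_chartAt (m := d) j) (smoothChart_chartAt x)
    (smoothChart_chartAt j) hjt (by rw [hs]; exact mem_chart_source _ _) (by rw [hs]; exact hxj)
  rw [fderiv_chartTrans_self hjt] at h2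
  have h3 := congrArg ContinuousLinearMap.det h2
  rw [det_comp_clm] at h3
  have h4 := congrArg sgn h3
  have h5 : sgn (ContinuousLinearMap.id ℝ (Eu d)).det = 1 := by
    rw [ContinuousLinearMap.det]
    simp [sgn]
  have h6 : chartTrans (chartAt (Eu d) j) (chartAt (Eu d) x) (chartAt (Eu d) j x) =
      chartAt (Eu d) x x := by rw [chartTrans, hs]
  rw [h5, sgn_mul, h6] at h4
  -- The jump of the orientation sign (from chart `j` to the chart at `x`) and the jump of the
  -- twisted form (back from `x` to `j`) cancel. This is why the integrand is smooth although
  -- neither factor is.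
  have h7 : sgn (fderiv ℝ (coordChange j x) (chartAt (Eu d) j x)).det *
      sgn (fderiv ℝ (coordChange x j) (chartAt (Eu d) x x)).det = 1 :=
    (mul_comm _ _).trans h4.symm
  rw [cylFamily, pushFamily, hz, b.pulledForm_eq b.fX_smooth hσ hz'.1 hxj, mul_smul_comm, smul_smul,
    mul_assoc, h7, mul_one]

theorem eventually_cylFamily {l : ℕ} (α : Fin l →₀ ℕ) {k : ℕ} {σ : RawForm d X k}
    (hσ : σ ∈ dForm d true k (⊤ : Opens X)) {i : b.Z} {y : Eu b.m}
    (hy : y ∈ (chartAt (Eu b.m) i).target) :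
    b.cylFamily α σ i =ᶠ[𝓝 y] fun z => b.orientationSign i (b.pt i y) (cylFrame d) •
      ((b.chernMonomial α i z).val * pb (fderiv ℝ (locMap b.m d b.fX i (b.fX (b.pt i y))) z)
        (toExt (σ (b.fX (b.pt i y)) (locMap b.m d b.fX i (b.fX (b.pt i y)) z)))) := by
  filter_upwards [b.eventually_cylFamily_forall α k hy] with z hz
  exact hz σ hσ

theorem contDiffAt_locForm {k : ℕ} {σ : RawForm d X k} (hσ : σ ∈ dForm d true k (⊤ : Opens X))
    {i : b.Z} {j : X} {y : Eu b.m} (hy : y ∈ (chartAt (Eu b.m) i).target)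
    (hj : b.fX (b.pt i y) ∈ (chartAt (Eu d) j).source) :
    ContDiffAt ℝ ∞ (fun z => toExt (σ j z)) (locMap b.m d b.fX i j y) ∧
    ContDiffAt ℝ ∞ (fun z => pb (fderiv ℝ (locMap b.m d b.fX i j) z)
        (toExt (σ j (locMap b.m d b.fX i j z)))) y := by
  have h1 := contDiffAt_locMap b.fX_smooth i j hy hj
  have h2 : locMap b.m d b.fX i j y ∈ chartDom (⊤ : Opens X) j :=
    ⟨(chartAt (Eu d) j).map_source hj, trivial⟩
  have h3 : ContDiffAt ℝ ∞ (fun z => toExt (σ j z)) (locMap b.m d b.fX i j y) := by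
    simp only [← toExtL_apply]
    exact (toExtL d k).contDiff.contDiffAt.comp _
      ((hσ.1 j).contDiffAt ((isOpen_chartDom _ j).mem_nhds h2))
  exact ⟨h3, contDiffAt_pb (h1.fderiv_right (by simp)) (h3.comp y h1)⟩

theorem twistedFamily_cylFamily {l : ℕ} (α : Fin l →₀ ℕ) {k : ℕ} {σ : RawForm d X k}
    (hσ : σ ∈ dForm d true k (⊤ : Opens X)) : TwistedFamily (b.cylFamily α σ) := by
  refine ⟨fun i y hy => ?_, fun i j y hy hj => ?_⟩
  · refine ContDiffAt.congr_of_eventuallyEq ?_ (b.eventually_cylFamily α hσ hy)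
    exact ContDiffAt.const_smul _ ((b.chernMonomial_mem_closedEven α hy).1.mul
      (b.contDiffAt_locForm hσ hy (mem_chart_source _ _)).2)
  · have h := b.pushFamily_coordChange (cylBasis d) b.fX α σ hy hj
    rwa [coe_cylBasis] at h

/-- Near `y` the sign is constant, the Chern monomial is even and closed, and `d` commutes with
pullback; so `d` falls on the test form alone, without a sign. -/
theorem dE_cylFamily {l : ℕ} (α : Fin l →₀ ℕ) {k : ℕ} {σ : RawForm d X k}
    (hσ : σ ∈ dForm d true k (⊤ : Opens X)) {i : b.Z} {y : Eu b.m}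
    (hy : y ∈ (chartAt (Eu b.m) i).target) :
    dE (b.cylFamily α σ i) y = b.cylFamily α (rawD ⊤ σ) i y := by
  have hK := b.chernMonomial_mem_closedEven α hy
  obtain ⟨hs, hp⟩ := b.contDiffAt_locForm hσ hy (j := b.fX (b.pt i y)) (mem_chart_source _ _)
  have hd : locMap b.m d b.fX i (b.fX (b.pt i y)) y ∈ chartDom (⊤ : Opens X) (b.fX (b.pt i y)) :=
    ⟨(chartAt (Eu d) (b.fX (b.pt i y))).map_source (mem_chart_source _ _), trivial⟩
  rw [(b.eventually_cylFamily α (rawD_mem hσ) hy).eq_of_nhds,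
    dE_congr (b.eventually_cylFamily α hσ hy), dE_const_smul _
      ((hK.1.mul hp).differentiableAt (by simp)),
    dE_mul_of_commute (hK.1.differentiableAt (by simp)) (hp.differentiableAt (by simp))
      (fun j => EvenExt.dx_mul_val _ j), hK.2, zero_mul, zero_add,
    dE_pb (contDiffAt_locMap b.fX_smooth i (b.fX (b.pt i y)) hy (mem_chart_source _ _))
      (hs.differentiableAt (by simp)),
    toExt_extDeriv (((hσ.1 _).contDiffAt ((isOpen_chartDom _ _).mem_nhds hd)).differentiableAt
      (by simp)), rawD, if_pos hd]

variable (t : ℝ) (ht : b.RegularAt t)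

theorem pulledForm_fiber {k : ℕ} (σ : RawForm d X k) {i' : b.Fib t} {i : b.Z} {y : Eu (b.m - 1)}
    (hy : y ∈ (letI := b.fibCharted t ht; (chartAt (Eu (b.m - 1)) i').target))
    (hi : (letI := b.fibCharted t ht; ((chartAt (Eu (b.m - 1)) i').symm y).1) ∈
      (chartAt (Eu b.m) i).source) :
    (b.fiber t ht).pulledForm (b.fiber t ht).f σ i' y =
      pb (fderiv ℝ (b.fibLoc t ht i' i) y) (b.pulledForm b.fX σ i (b.fibLoc t ht i' i y)) := by
  let _ := b.fibCharted t ht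
  have hz : b.pt i (b.fibLoc t ht i' i y) = ((chartAt (Eu (b.m - 1)) i').symm y).1 :=
    (chartAt (Eu b.m) i).left_inv hi
  have h0 : b.pulledForm b.fX σ i (b.fibLoc t ht i' i y) = toExt ((σ
      (b.fX ((chartAt (Eu (b.m - 1)) i').symm y).1) (chartAt (Eu d)
        (b.fX ((chartAt (Eu (b.m - 1)) i').symm y).1)
        (b.fX ((chartAt (Eu (b.m - 1)) i').symm y).1))).compContinuousLinearMap
      ((mfderiv (𝓡 b.m) (𝓡 d) b.fX ((chartAt (Eu (b.m - 1)) i').symm y).1).comp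
        (b.coordVec i ((chartAt (Eu (b.m - 1)) i').symm y).1))) := by
    rw [pulledForm, hz]
  refine Eq.trans ?_ ((congrArg _ h0).trans (pb_toExt _ _)).symm
  refine congrArg toExt (ContinuousAlternatingMap.ext fun v => ?_)
  refine congrArg (σ (b.fX ((chartAt (Eu (b.m - 1)) i').symm y).1) (chartAt (Eu d)
    (b.fX ((chartAt (Eu (b.m - 1)) i').symm y).1) (b.fX ((chartAt (Eu (b.m - 1)) i').symm y).1)))
    (funext fun x => ?_)
  have h1 := b.coordVec_fibLoc t ht i' i ((chartAt (Eu (b.m - 1)) i').map_target hy) hi (v x)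
  have h2 : chartAt (Eu (b.m - 1)) i' ((chartAt (Eu (b.m - 1)) i').symm y) = y :=
    (chartAt (Eu (b.m - 1)) i').right_inv hy
  rw [h2] at h1
  refine (b.fib_mfderiv_f t ht _ _).trans ?_
  exact (congrArg (mfderiv (𝓡 b.m) (𝓡 d) b.fX ((chartAt (Eu (b.m - 1)) i').symm y).1) h1).symm

/-- The integrand for a fiber is the boundary value of the integrand for the total space. -/
theorem isBoundaryDensity_fiber (hm : b.m = b.m - 1 + 1) {l : ℕ} (α : Fin l →₀ ℕ) {k : ℕ}
    (σ : RawForm d X k) :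
    letI := b.fibCharted t ht
    IsBoundaryDensity hm b.c t (b.cylFamily α σ) fun i' y => topCoeff (b.m - 1)
      ((b.fiber t ht).pushFamily (b.fiber t ht).f stdVec α σ i' y) := by
  let _ := b.fibCharted t ht
  intro i' y hy i hi ν hν
  have hz : b.pt i (b.fibLoc t ht i' i y) = ((chartAt (Eu (b.m - 1)) i').symm y).1 :=
    (chartAt (Eu b.m) i).left_inv hi
  have h2 : chartAt (Eu (b.m - 1)) i' ((chartAt (Eu (b.m - 1)) i').symm y) = y :=
    (chartAt (Eu (b.m - 1)) i').right_inv hy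
  have h1 := b.orientationSign_fiber t ht hm i' i ((chartAt (Eu (b.m - 1)) i').map_target hy) hi hν
  rw [h2] at h1
  have h3 := b.pulledForm_fiber t ht σ hy hi
  have h4 := congrArg EvenExt.val (b.chernMonomial_fiber t ht α hy hi)
  have h6 : sgn (frameDet b.m (bdryFrame hm ν (fderiv ℝ (b.fibLoc t ht i' i) y))) •
        pb (fderiv ℝ (b.fibLoc t ht i' i) y) (b.cylFamily α σ i (b.fibLoc t ht i' i y)) =
      (sgn (frameDet b.m (bdryFrame hm ν (fderiv ℝ (b.fibLoc t ht i' i) y))) *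
        b.orientationSign i ((chartAt (Eu (b.m - 1)) i').symm y).1 (cylFrame d)) •
        (pb (fderiv ℝ (b.fibLoc t ht i' i) y)
          (b.chernMonomial α i (b.fibLoc t ht i' i y)).val *
        pb (fderiv ℝ (b.fibLoc t ht i' i) y) (b.pulledForm b.fX σ i (b.fibLoc t ht i' i y))) := by
    rw [cylFamily, pushFamily, map_smul, map_mul, hz, smul_smul]
  have h5 : (b.fiber t ht).pushFamily (b.fiber t ht).f stdVec α σ i' y =
      sgn (frameDet b.m (bdryFrame hm ν (fderiv ℝ (b.fibLoc t ht i' i) y))) •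
        pb (fderiv ℝ (b.fibLoc t ht i' i) y) (b.cylFamily α σ i (b.fibLoc t ht i' i y)) :=
    Eq.trans (congrArg₂ (· • ·) h1 (congrArg₂ (· * ·) h4 h3)) h6.symm
  refine (congrArg (topCoeff (b.m - 1)) h5).trans ?_
  rw [map_smul]
  rfl

end CylinderFamily

end GeometricCycle

/-- Local smallness becomes uniform on the compact coordinate images of the patches, which have
finite volume; finitely many patches suffice for all `n`, since the support `K` is common. -/
theorem tendsto_densityIntegral_zero {m : ℕ} {Z : Type*} [TopologicalSpace Z] [T2Space Z]
    [SigmaCompactSpace Z] [ChartedSpace (Eu m) Z] [IsManifold (𝓡 m) ∞ Z] {δ : ℕ → Z → Eu m → ℂ}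
    {K : Set Z} (hK : IsCompact K) (hv : ∀ n, DensityVanishesOff (δ n) K)
    (h : ∀ i, ∀ y ∈ (chartAt (Eu m) i).target, ∀ ε > 0, ∃ O ∈ 𝓝 y, ∀ᶠ n in Filter.atTop,
      ∀ z ∈ O, ‖δ n i z‖ ≤ ε) :
    Filter.Tendsto (fun n => densityIntegral Z (δ n)) Filter.atTop (𝓝 0) := by
  obtain ⟨s, hs⟩ := exists_finset_chartPartition m hK
  simp only [fun n => densityIntegral_eq_sum (hv n) hs]
  rw [← Finset.sum_const_zero (s := s)]
  refine tendsto_finsetSum s fun i _ => ?_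
  obtain ⟨hA, hAt, hA0⟩ := isCompact_image_chartPartition (m := m) hK i
  set A := (chartAt (Eu m) i) '' (K ∩ tsupport (chartPartition (m := m) Z i)) with hAdef
  have hunif : ∀ ε > 0, ∀ᶠ n in Filter.atTop, ∀ z ∈ A, ‖δ n i z‖ ≤ ε := by
    intro ε hε
    refine hA.induction_on (p := fun B => ∀ᶠ n in Filter.atTop, ∀ z ∈ B, ‖δ n i z‖ ≤ ε)
      (by simp) (fun B B' hB h' => h'.mono fun n hn z hz => hn z (hB hz))
      (fun B B' h1 h2 => by
        filter_upwards [h1, h2] with n h1 h2 z hz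
        exact hz.elim (h1 z) (h2 z)) fun y hy => ?_
    obtain ⟨O, hO, hO'⟩ := h i y (hAt hy) ε hε
    exact ⟨O, mem_nhdsWithin_of_mem_nhds hO, hO'⟩
  have hint : ∀ n, ∫ y in (chartAt (Eu m) i).target,
      (chartPartition (m := m) Z i ((chartAt (Eu m) i).symm y) : ℂ) * δ n i y =
      ∫ y in A, (chartPartition (m := m) Z i ((chartAt (Eu m) i).symm y) : ℂ) * δ n i y := fun n =>
    setIntegral_eq_of_subset_of_forall_sdiff_eq_zero
      (chartAt (Eu m) i).open_target.measurableSet hAt (hA0 (δ n) (hv n))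
  simp only [hint]
  rw [Metric.tendsto_nhds]
  intro ε hε
  have hfin : volume A < ⊤ := hA.measure_lt_top
  set M := volume.real A with hM
  have hM0 : 0 ≤ M := measureReal_nonneg
  filter_upwards [hunif (ε / (M + 1)) (by positivity)] with n hn
  rw [dist_zero_right]
  have h1 : ‖∫ y in A, (chartPartition (m := m) Z i ((chartAt (Eu m) i).symm y) : ℂ) * δ n i y‖ ≤
      ε / (M + 1) * M := by
    refine norm_setIntegral_le_of_norm_le_const hfin fun y hy => ?_
    rw [norm_mul, Complex.norm_real, Real.norm_eq_abs,
      abs_of_nonneg ((chartPartition (m := m) Z).nonneg i _)]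
    exact (mul_le_of_le_one_left (norm_nonneg _) ((chartPartition (m := m) Z).le_one i _)).trans
      (hn y hy)
  refine h1.trans_lt ?_
  rw [div_mul_eq_mul_div, div_lt_iff₀ (by positivity)]
  nlinarith

/-! ### Cut-off near the unit interval, and Stokes over it -/

/-- A smooth function with compact support that is `1` near `[0, 1]`. -/
def cutBump : ContDiffBump (1 / 2 : ℝ) := ⟨1, 2, by norm_num, by norm_num⟩

namespace GeometricCycle

variable {d : ℕ} {X : Type*} [TopologicalSpace X] [ChartedSpace (Eu d) X] [IsManifold (𝓡 d) ∞ X]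
  {n : ℤ} (b : GeometricCycle (cylModel d) (ℝ × X) n)

/-- The part of a cycle over the cylinder over `[0, 1]`. -/
abbrev unitPart : Set b.Z := b.c ⁻¹' Set.Icc 0 1

/-- The integrand, cut off away from the part over `[0, 1]`. -/
abbrev cutFamily {l : ℕ} (α : Fin l →₀ ℕ) {k : ℕ} (σ : RawForm d X k) : b.Z → Eu b.m → Ext b.m :=
  familySMul (fun z => cutBump (b.c z)) (b.cylFamily α σ)

/-- The compact set which contains the support of the cut-off integrand. -/
abbrev cutSupport (C : Set X) : Set b.Z := b.f ⁻¹' (Metric.closedBall (1 / 2) 2 ×ˢ C)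

/-- Properness of `b.f` enters here. The component `b.fX` alone need not be proper, so the support
of the pulled-back test form is made compact by the cut-off in the direction of `ℝ`. -/
theorem isCompact_cutSupport {C : Set X} (hC : IsCompact C) : IsCompact (b.cutSupport C) :=
  b.f_proper.isCompact_preimage ((isCompact_closedBall _ _).prod hC)

/-- The cut-off is `1` on a neighbourhood of each point of `[0, 1]`, so it affects neither the
integrand there nor its derivatives. -/
theorem cutBump_eq_one {t : ℝ} (ht : t ∈ Set.Icc 0 1) : ∀ᶠ s in 𝓝 t, cutBump s = 1 := by
  filter_upwards [Ioo_mem_nhds (a := -1 / 2) (b := 3 / 2) (by linarith [ht.1])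
    (by linarith [ht.2])] with s hs
  refine cutBump.one_of_mem_closedBall ?_
  rw [Metric.mem_closedBall, Real.dist_eq, abs_le]
  change -1 ≤ _ ∧ _ ≤ 1
  constructor <;> linarith [hs.1, hs.2]

variable {l : ℕ} (α : Fin l →₀ ℕ) {k : ℕ} {σ : RawForm d X k}

theorem cutFamily_vanishesOff {C : Set X} (hσ : VanishesOff σ C) :
    FamilyVanishesOff (b.cutFamily α σ) (b.cutSupport C) := by
  intro i y hy hz
  have hz' : ¬ (b.c (b.pt i y) ∈ Metric.closedBall (1 / 2) 2 ∧ b.fX (b.pt i y) ∈ C) := hz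
  change ((cutBump (b.c (b.pt i y)) : ℝ) : ℂ) • _ = _
  by_cases h : b.fX (b.pt i y) ∈ C
  · have h1 : cutBump (b.c (b.pt i y)) = 0 := by
      refine cutBump.zero_of_le_dist ?_
      have h2 : b.c (b.pt i y) ∉ Metric.closedBall (1 / 2) 2 := fun h' => hz' ⟨h', h⟩
      rw [Metric.mem_closedBall, not_le] at h2
      exact h2.le
    rw [h1, Complex.ofReal_zero, zero_smul]
  · rw [cylFamily, b.pushFamily_eq_zero _ _ _ hσ h, smul_zero]

theorem twistedFamily_cutFamily (hσ : σ ∈ dForm d true k (⊤ : Opens X)) :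
    TwistedFamily (b.cutFamily α σ) :=
  (b.twistedFamily_cylFamily α hσ).smul
    (cutBump.contDiff.contMDiff.comp b.c_smooth)

theorem eventually_cutFamily (σ : RawForm d X k) {i : b.Z} {y : Eu b.m}
    (hy : y ∈ (chartAt (Eu b.m) i).target) (h : b.pt i y ∈ b.unitPart) :
    b.cutFamily α σ i =ᶠ[𝓝 y] b.cylFamily α σ i := by
  have h1 : ContinuousAt (fun z => b.c (b.pt i z)) y :=
    b.c_smooth.continuous.continuousAt.comp ((chartAt (Eu b.m) i).continuousAt_symm hy)
  filter_upwards [h1.eventually (cutBump_eq_one h)] with z hz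
  change ((cutBump (b.c (b.pt i z)) : ℝ) : ℂ) • _ = _
  rw [hz, Complex.ofReal_one, one_smul]

theorem isBoundaryDensity_cutFamily (t : ℝ) (ht : b.RegularAt t) (h01 : t ∈ Set.Icc 0 1)
    (hm : b.m = b.m - 1 + 1) (σ : RawForm d X k) :
    letI := b.fibCharted t ht
    IsBoundaryDensity hm b.c t (b.cutFamily α σ) fun i' y => topCoeff (b.m - 1)
      ((b.fiber t ht).pushFamily (b.fiber t ht).f stdVec α σ i' y) := by
  let _ := b.fibCharted t ht
  intro i' y hy i hi ν hν
  have h1 := b.isBoundaryDensity_fiber t ht hm α σ i' y hy i hi ν hν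
  have hs : b.pt i (inclLoc i' i y) = ((chartAt (Eu (b.m - 1)) i').symm y).1 :=
    (chartAt (Eu b.m) i).left_inv hi
  have h2 : b.pt i (inclLoc i' i y) ∈ b.unitPart := by
    change b.c (b.pt i (inclLoc i' i y)) ∈ Set.Icc (0 : ℝ) 1
    rw [hs, ((chartAt (Eu (b.m - 1)) i').symm y).2]
    exact h01
  have h3 : b.cutFamily α σ i (inclLoc i' i y) = b.cylFamily α σ i (inclLoc i' i y) :=
    (b.eventually_cutFamily α σ ((chartAt (Eu b.m) i).map_source hi) h2).eq_of_nhds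
  exact h1.trans (by rw [h3])

/-- The push-forward of a monomial in the Chern forms over `[0, 1]`. -/
def cylIntegral (σ : RawForm d X k) : ℂ :=
  densityIntegral b.Z (densityOn b.unitPart fun i y => topCoeff b.m (b.cylFamily α σ i y))

theorem cylIntegral_eq_cut (σ : RawForm d X k) : b.cylIntegral α σ =
    densityIntegral b.Z (densityOn b.unitPart fun i y => topCoeff b.m (b.cutFamily α σ i y)) := by
  refine densityIntegral_congr fun i y hy => ?_
  simp only [densityOn]
  split_ifs with h
  · rw [(b.eventually_cutFamily α σ hy h).eq_of_nhds]
  · rfl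

/-- The theorem of Stokes for the part over `[0, 1]` of a cycle over the cylinder. -/
theorem cylIntegral_rawD (h0 : b.RegularAt 0) (h1 : b.RegularAt 1) (σ : testForm d X k) :
    b.cylIntegral α (rawD ⊤ σ.1) =
      densityIntegral (b.fiber 1 h1).Z (fun i y => topCoeff (b.fiber 1 h1).m
        ((b.fiber 1 h1).pushFamily (b.fiber 1 h1).f stdVec α σ.1 i y)) -
      densityIntegral (b.fiber 0 h0).Z (fun i y => topCoeff (b.fiber 0 h0).m
        ((b.fiber 0 h0).pushFamily (b.fiber 0 h0).f stdVec α σ.1 i y)) := by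
  -- In dimension `0` the fibres over regular values are empty, and a form of degree `k + 1` has no
  -- top coefficient. This case is separate because `m - 1` is truncated subtraction.
  by_cases hm : b.m = 0
  · have hE : ∀ t (ht : b.RegularAt t), IsEmpty (b.fiber t ht).Z := fun t ht =>
      ⟨fun s => by have := b.fib_dim_pos t s ht; omega⟩
    have := hE 0 h0
    have := hE 1 h1
    rw [densityIntegral, densityIntegral, finsum_of_isEmpty, finsum_of_isEmpty, sub_zero,
      cylIntegral]
    refine (densityIntegral_congr fun i y hy => ?_).trans densityIntegral_zero
    simp only [densityOn]
    rw [cylFamily, b.topCoeff_pushFamily_eq_zero _ _ _ _ _ _ (by omega), ite_self]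
  · obtain ⟨C, hC, hσ⟩ := σ.2.2
    let _ := b.fibCharted 0 h0
    have := b.fib_isManifold 0 h0
    let _ := b.fibCharted 1 h1
    have := b.fib_isManifold 1 h1
    have : SigmaCompactSpace (b.Fib 0) := (b.fiber 0 h0).instSigmaCompact
    have : SigmaCompactSpace (b.Fib 1) := (b.fiber 1 h1).instSigmaCompact
    have hm' : b.m = b.m - 1 + 1 := by omega
    have h2 := stokes_Icc hm' zero_lt_one b.c_smooth h0 h1 (b.fib_incl_smooth 0 h0)
      (b.fib_incl_smooth 1 h1) (b.twistedFamily_cutFamily α σ.2.1) (b.isCompact_cutSupport hC)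
      (b.cutFamily_vanishesOff α hσ)
      (b.isBoundaryDensity_cutFamily α 0 h0 (by simp) hm' σ.1)
      (b.isBoundaryDensity_cutFamily α 1 h1 (by simp) hm' σ.1)
    refine Eq.trans ?_ h2
    refine densityIntegral_congr fun i y hy => ?_
    simp only [densityOn]
    split_ifs with h
    · rw [dE_congr (b.eventually_cutFamily α σ.1 hy h), b.dE_cylFamily α σ.2.1 hy]
    · rfl

end GeometricCycle

/-! ### Linearity and continuity of the push-forward -/

theorem toExt_smul {m k : ℕ} (a : ℂ) (η : Eu m [⋀^Fin k]→L[ℝ] ℂ) :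
    toExt (a • η) = a • toExt η := by
  rw [toExt_eq, toExt_eq, smul_comm a, Finset.smul_sum (r := a)]
  refine congrArg _ (Finset.sum_congr rfl fun s _ => ?_)
  rw [smul_smul, ContinuousAlternatingMap.smul_apply, smul_eq_mul]

theorem toExt_add {m k : ℕ} (η η' : Eu m [⋀^Fin k]→L[ℝ] ℂ) :
    toExt (η + η') = toExt η + toExt η' := by
  rw [← toExtL_apply, ← toExtL_apply, ← toExtL_apply, map_add]

namespace GeometricCycle

section Linear

variable {E : Type*} [NormedAddCommGroup E] [NormedSpace ℝ E] {H : Type*}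
  [TopologicalSpace H] {I : ModelWithCorners ℝ E H} {Y : Type*} [TopologicalSpace Y]
  [ChartedSpace H Y] [IsManifold I ∞ Y] {n : ℤ} (c : GeometricCycle I Y n)
  {d : ℕ} {X : Type*} [TopologicalSpace X] [ChartedSpace (Eu d) X] {D : ℕ} {l k : ℕ}

theorem pushFamily_add (h : c.Z → X) (w : Fin D → E) (α : Fin l →₀ ℕ) (σ σ' : RawForm d X k)
    (i : c.Z) (y : Eu c.m) : c.pushFamily h w α (σ + σ') i y =
      c.pushFamily h w α σ i y + c.pushFamily h w α σ' i y := by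
  have h1 : c.pulledForm h (σ + σ') i y = c.pulledForm h σ i y + c.pulledForm h σ' i y := by
    rw [pulledForm, pulledForm, pulledForm, ← toExt_add]
    exact congrArg toExt (ContinuousAlternatingMap.ext fun v => rfl)
  rw [pushFamily, pushFamily, pushFamily, h1, mul_add, smul_add]

theorem pushFamily_smul (h : c.Z → X) (w : Fin D → E) (α : Fin l →₀ ℕ) (a : ℂ)
    (σ : RawForm d X k) (i : c.Z) (y : Eu c.m) : c.pushFamily h w α (a • σ) i y =
      a • c.pushFamily h w α σ i y := by
  have h1 : c.pulledForm h (a • σ) i y = a • c.pulledForm h σ i y := by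
    rw [pulledForm, pulledForm, ← toExt_smul]
    exact congrArg toExt (ContinuousAlternatingMap.ext fun v => rfl)
  rw [pushFamily, pushFamily, h1, mul_smul_comm, smul_comm]

end Linear

variable {d : ℕ} {X : Type*} [TopologicalSpace X] [ChartedSpace (Eu d) X] [IsManifold (𝓡 d) ∞ X]
  {n : ℤ} (b : GeometricCycle (cylModel d) (ℝ × X) n) {l : ℕ} (α : Fin l →₀ ℕ) {k : ℕ}

/-- The density whose integral is the push-forward over `[0, 1]`. -/
abbrev cutDensity (σ : RawForm d X k) : b.Z → Eu b.m → ℂ :=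
  densityOn b.unitPart fun i y => topCoeff b.m (b.cutFamily α σ i y)

theorem cutDensity_vanishesOff {σ : RawForm d X k} {C : Set X} (hσ : VanishesOff σ C) :
    DensityVanishesOff (b.cutDensity α σ) (b.cutSupport C) := by
  intro i y hy hz
  simp only [densityOn]
  rw [b.cutFamily_vanishesOff α hσ i y hy hz, map_zero, ite_self]

theorem densityIntegrable_cutDensity {σ : RawForm d X k} (hσ : σ ∈ dForm d true k (⊤ : Opens X))
    {C : Set X} (hC : IsCompact C) (hσC : VanishesOff σ C) :
    DensityIntegrable (b.cutDensity α σ) (b.cutSupport C) := by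
  refine DensityIntegrable.densityOn (isClosed_Icc.preimage b.c_smooth.continuous)
    (DensityIntegrable.of_continuousOn (b.isCompact_cutSupport hC) (fun i y hy hz => ?_)
      fun i y hy => ?_)
  · rw [b.cutFamily_vanishesOff α hσC i y hy hz, map_zero]
  · exact ((topCoeffL b.m).continuous.continuousAt.comp
      ((b.twistedFamily_cutFamily α hσ).smooth i y hy).continuousAt).continuousWithinAt

theorem norm_cutDensity_le (σ : RawForm d X k) {i : b.Z} {y : Eu b.m}
    (hy : y ∈ (chartAt (Eu b.m) i).target) :
    ‖b.cutDensity α σ i y‖ ≤ ‖topCoeffL b.m‖ * ‖b.cylFamily α σ i y‖ := by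
  simp only [densityOn]
  split_ifs with h
  · rw [(b.eventually_cutFamily α σ hy h).eq_of_nhds, ← topCoeffL_apply]
    exact (topCoeffL b.m).le_opNorm _
  · rw [norm_zero]
    positivity

/-- The constant and the neighbourhood are chosen before `σ`, so one estimate serves a whole
sequence of test forms. `M` is the value at `y` of a continuous bound, increased by `1`. -/
theorem eventually_norm_cylFamily_le {i : b.Z} {y : Eu b.m}
    (hy : y ∈ (chartAt (Eu b.m) i).target) : ∃ M : ℝ, 0 ≤ M ∧ ∀ᶠ z in 𝓝 y,
      ∀ σ : RawForm d X k, σ ∈ dForm d true k (⊤ : Opens X) →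
        ‖b.cylFamily α σ i z‖ ≤
          M * ‖σ (b.fX (b.pt i y)) (locMap b.m d b.fX i (b.fX (b.pt i y)) z)‖ := by
  have h1 := (contDiffAt_locMap b.fX_smooth i (b.fX (b.pt i y)) hy
    (mem_chart_source _ _)).fderiv_right (m := 0) (by simp)
  have h2 : ContinuousAt (fun z => ‖b.orientationSign i (b.pt i y) (cylFrame d)‖ *
      (‖(b.chernMonomial α i z).val‖ * (‖toExtL b.m k‖ *
        ‖fderiv ℝ (locMap b.m d b.fX i (b.fX (b.pt i y))) z‖ ^ k))) y :=
    continuousAt_const.mul ((b.chernMonomial_mem_closedEven α hy).1.continuousAt.norm.mul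
      (continuousAt_const.mul (h1.continuousAt.norm.pow k)))
  refine ⟨‖b.orientationSign i (b.pt i y) (cylFrame d)‖ *
      (‖(b.chernMonomial α i y).val‖ * (‖toExtL b.m k‖ *
        ‖fderiv ℝ (locMap b.m d b.fX i (b.fX (b.pt i y))) y‖ ^ k)) + 1, by positivity, ?_⟩
  · filter_upwards [b.eventually_cylFamily_forall α k hy,
      h2.eventually_le_const (lt_add_one _)] with z hz hz' σ hσ
    rw [hz σ hσ, norm_smul, pb_toExt, ← toExtL_apply]
    refine le_trans ?_ (mul_le_mul_of_nonneg_right hz' (norm_nonneg _))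
    rw [mul_assoc]
    refine mul_le_mul_of_nonneg_left ((norm_mul_le _ _).trans ?_) (norm_nonneg _)
    rw [mul_assoc]
    refine mul_le_mul_of_nonneg_left (((toExtL b.m k).le_opNorm _).trans ?_) (norm_nonneg _)
    rw [mul_assoc]
    refine mul_le_mul_of_nonneg_left ?_ (norm_nonneg _)
    refine (ContinuousAlternatingMap.norm_compContinuousLinearMap_le _ _).trans (le_of_eq ?_)
    simp [mul_comm]

theorem isCurrent_cylIntegral : IsCurrent fun σ : testForm d X k => b.cylIntegral α σ.1 := by
  refine ⟨⟨fun σ σ' => ?_, fun a σ => ?_⟩, fun s ⟨C, hC, hs⟩ hlim => ?_⟩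
  · obtain ⟨C, hC, hσ⟩ := σ.2.2
    obtain ⟨C', hC', hσ'⟩ := σ'.2.2
    have hm : VanishesOff σ.1 (C ∪ C') := fun i y hy hz => hσ i y hy fun h => hz (Or.inl h)
    have hm' : VanishesOff σ'.1 (C ∪ C') := fun i y hy hz => hσ' i y hy fun h => hz (Or.inr h)
    simp only [cylIntegral_eq_cut]
    -- Additivity of the integral needs a common compact support, provided by the union of the two
    -- supports.
    rw [← densityIntegral_add (b.isCompact_cutSupport (hC.union hC'))
      (b.densityIntegrable_cutDensity α σ.2.1 (hC.union hC') hm)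
      (b.densityIntegrable_cutDensity α σ'.2.1 (hC.union hC') hm')]
    refine densityIntegral_congr fun i y hy => ?_
    simp only [densityOn]
    split_ifs with h
    · simp only [familySMul, cylFamily]
      rw [Submodule.coe_add, b.pushFamily_add, smul_add, map_add]
    · rw [add_zero]
  · obtain ⟨C, hC, hσ⟩ := σ.2.2
    simp only [cylIntegral_eq_cut]
    rw [smul_eq_mul, ← densityIntegral_const_mul a (b.isCompact_cutSupport hC)
      (b.cutDensity_vanishesOff α hσ)]
    refine densityIntegral_congr fun i y hy => ?_
    simp only [densityOn]
    split_ifs with h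
    · simp only [familySMul, cylFamily]
      rw [Submodule.coe_smul, b.pushFamily_smul, smul_comm, map_smul, smul_eq_mul]
    · rw [mul_zero]
  · simp only [cylIntegral_eq_cut]
    refine tendsto_densityIntegral_zero (b.isCompact_cutSupport hC)
      (fun n => b.cutDensity_vanishesOff α (hs n)) fun i y hy ε hε => ?_
    obtain ⟨M, hM0, hM⟩ := b.eventually_norm_cylFamily_le α (k := k) hy
    have hg := (contDiffAt_locMap b.fX_smooth i (b.fX (b.pt i y)) hy
      (mem_chart_source _ _)).continuousAt
    obtain ⟨A, hA, hAt, hAc⟩ := local_compact_nhds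
      ((chartAt (Eu d) (b.fX (b.pt i y))).open_target.mem_nhds
        ((chartAt (Eu d) (b.fX (b.pt i y))).map_source (mem_chart_source _ _)))
    have hnhds := Filter.inter_mem (Filter.inter_mem hM (hg.preimage_mem_nhds hA))
      ((chartAt (Eu b.m) i).open_target.mem_nhds hy)
    refine ⟨_, hnhds, ?_⟩
    -- Only the derivative of order `0` is used: the push-forward is bounded locally by the supremum
    -- of the coefficients of the test form, here on a compact neighbourhood `A` of the image point.
    have h1 := Metric.tendstoUniformlyOn_iff.1 (hlim (b.fX (b.pt i y)) 0 A hAc hAt)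
      (ε / (‖topCoeffL b.m‖ * M + 1)) (by positivity)
    filter_upwards [h1] with n hn z hz
    have h2 := hn _ hz.1.2
    rw [dist_zero_left, norm_iteratedFDeriv_zero] at h2
    refine (b.norm_cutDensity_le α (s n).1 hz.2).trans ?_
    have h3 := mul_le_mul_of_nonneg_left (hz.1.1 (s n).1 (s n).2.1) (norm_nonneg (topCoeffL b.m))
    refine h3.trans ?_
    rw [← mul_assoc]
    have h4 : 0 ≤ ‖topCoeffL b.m‖ * M := by positivity
    refine (mul_le_mul_of_nonneg_left h2.le h4).trans ?_
    rw [mul_div_assoc', div_le_iff₀ (by positivity)]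
    nlinarith

end GeometricCycle

/-! ### The coefficients of multiplicative sequences -/

section MultSeq

open MvPolynomial

/-- The product of elementary symmetric polynomials given by a monomial. -/
def esymmMonomial (R : Type*) [CommRing R] {j : ℕ} (α : Fin j →₀ ℕ) : MvPolynomial (Fin j) R :=
  α.prod fun i e => esymm (Fin j) R (i + 1) ^ e

theorem esymm_isHomogeneous (σ R : Type*) [CommRing R] [Fintype σ] (n : ℕ) :
    (esymm σ R n).IsHomogeneous n := by
  rw [esymm]
  refine IsHomogeneous.sum _ _ _ fun t ht => ?_
  have h := IsHomogeneous.prod t (fun i => (X i : MvPolynomial σ R)) (fun _ => 1)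
    fun i _ => isHomogeneous_X R i
  rwa [Finset.sum_const, smul_eq_mul, mul_one, (Finset.mem_powersetCard.1 ht).2] at h

theorem esymmMonomial_isHomogeneous (R : Type*) [CommRing R] {j : ℕ} (α : Fin j →₀ ℕ) :
    (esymmMonomial R α).IsHomogeneous (α.sum fun x e => (x + 1) * e) :=
  IsHomogeneous.prod _ _ _ fun i _ => (esymm_isHomogeneous (Fin j) R (i + 1)).pow _

theorem map_esymmMonomial {R S : Type*} [CommRing R] [CommRing S] (φ : R →+* S) {j : ℕ}
    (α : Fin j →₀ ℕ) : map φ (esymmMonomial R α) = esymmMonomial S α := by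
  rw [esymmMonomial, esymmMonomial, Finsupp.prod, Finsupp.prod, map_prod]
  exact Finset.prod_congr rfl fun i _ => by rw [map_pow, map_esymm]

variable {V : Type*} [CommRing V]

theorem coeff_aeval_esymm {j : ℕ} (s : Finset (Fin j →₀ ℕ)) (v : (Fin j →₀ ℕ) → V)
    (β : Fin j →₀ ℕ) :
    coeff β (aeval (fun i : Fin j => esymm (Fin j) V (i + 1)) (∑ α ∈ s, monomial α (v α))) =
      ∑ α ∈ s, v α * coeff β (esymmMonomial V α) := by
  rw [map_sum, coeff_sum]
  refine Finset.sum_congr rfl fun α _ => ?_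
  rw [aeval_monomial, algebraMap_eq, coeff_C_mul]
  rfl

theorem coe_esymmAlgEquiv (j : ℕ) (p : MvPolynomial (Fin j) V) :
    (esymmAlgEquiv (Fin j) V (Fintype.card_fin j) p).1 =
      aeval (fun i : Fin j => esymm (Fin j) V (i + 1)) p := by
  rw [esymmAlgEquiv_apply, ← esymmAlgHom_apply]

theorem aeval_esymm_multSeq (Q : PowerSeries V) (j : ℕ) :
    aeval (fun i : Fin j => esymm (Fin j) V (i + 1)) (multSeq Q j) =
      homogeneousComponent j (prodQ Q j) :=
  (coe_esymmAlgEquiv j _).symm.trans <| congrArg Subtype.val ((esymmAlgEquiv (Fin j) V (Fintype.card_fin j)).apply_symm_apply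
    ⟨homogeneousComponent j (prodQ Q j),
      isSymmetric_homogeneousComponent j (prodQ_isSymmetric Q j)⟩)

theorem aeval_esymm_injective (j : ℕ) :
    Function.Injective (aeval (R := V) fun i : Fin j => esymm (Fin j) V (i + 1)) := fun p p' h =>
  (esymmAlgEquiv (Fin j) V (Fintype.card_fin j)).injective (Subtype.ext (by
    rwa [coe_esymmAlgEquiv, coe_esymmAlgEquiv]))

variable [Algebra ℂ V] (𝒱 : ℤ → Submodule ℂ V) [GradedAlgebra 𝒱]

/-- Each factor contributes `r_a ∈ 𝒱_{2a}` at `X_i^a`; the condition is multiplicative because the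
degree of a monomial is additive. -/
theorem coeff_prodQ_mem {Q : PowerSeries V} (hQ : ∀ j : ℕ, PowerSeries.coeff j Q ∈ 𝒱 (2 * j))
    (j : ℕ) (β : Fin j →₀ ℕ) : coeff β (prodQ Q j) ∈ 𝒱 (2 * (β.degree : ℕ)) := by
  classical
  suffices h : ∀ p : MvPolynomial (Fin j) V, p = prodQ Q j →
      ∀ β, coeff β p ∈ 𝒱 (2 * (β.degree : ℕ)) from h _ rfl β
  intro p hp
  subst hp
  refine Finset.prod_induction _ (fun p => ∀ β, coeff β p ∈ 𝒱 (2 * (β.degree : ℕ))) ?_ ?_ ?_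
  · intro p p' h h' β
    rw [coeff_mul]
    refine Submodule.sum_mem _ fun x hx => ?_
    have hx' : x.1 + x.2 = β := Finset.HasAntidiagonal.mem_antidiagonal.1 hx
    have h1 := SetLike.mul_mem_graded (h x.1) (h' x.2)
    have h2 : (2 * (β.degree : ℕ) : ℤ) = 2 * (x.1.degree : ℕ) + 2 * (x.2.degree : ℕ) := by
      rw [← hx', map_add]
      push_cast
      ring
    rwa [h2]
  · intro β
    rw [coeff_one]
    split_ifs with h
    · subst h
      simpa using SetLike.one_mem_graded 𝒱
    · exact zero_mem _
  · intro i _ β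
    rw [Polynomial.aeval_eq_sum_range, coeff_sum]
    refine Submodule.sum_mem _ fun a _ => ?_
    rw [coeff_smul, coeff_X_pow, PowerSeries.coeff_trunc]
    split_ifs with h1 h2 h2
    · subst h2
      simpa using hQ a
    all_goals simp

/-- The coefficients of the multiplicative sequence have the expected degrees, and it is weighted
homogeneous. -/
theorem coeff_multSeq {Q : PowerSeries V} (hQ : ∀ j : ℕ, PowerSeries.coeff j Q ∈ 𝒱 (2 * j))
    (j : ℕ) (α : Fin j →₀ ℕ) : coeff α (multSeq Q j) =
      if (α.sum fun x e => (x + 1) * e) = j then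
        GradedAlgebra.proj 𝒱 (2 * j) (coeff α (multSeq Q j)) else 0 := by
  classical
  set K := multSeq Q j with hK
  -- `K'` keeps only the monomials of weight `j`, with coefficients projected to `𝒱_{2j}`. It is
  -- shown that `K'` and `K` agree after substituting elementary symmetric polynomials; as this
  -- substitution is injective, `K' = K`.
  let v : (Fin j →₀ ℕ) → V := fun α => if (α.sum fun x e => (x + 1) * e) = j then
        GradedAlgebra.proj 𝒱 (2 * j) (coeff α K) else 0
  let K' : MvPolynomial (Fin j) V := ∑ α ∈ K.support, monomial α (v α)
  -- Products of elementary symmetric polynomials have scalar coefficients, so multiplication by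
  -- them commutes with the `ℂ`-linear projection to a graded piece.
  have hcast : ∀ α β : Fin j →₀ ℕ, ∃ z : ℂ, coeff β (esymmMonomial V α) = algebraMap ℂ V z :=
    fun α β => ⟨coeff β (esymmMonomial ℂ α), by
      rw [← coeff_map, map_esymmMonomial]⟩
  have hproj : ∀ (x : V) (α β : Fin j →₀ ℕ), GradedAlgebra.proj 𝒱 (2 * j) x * coeff β (esymmMonomial V α) =
      GradedAlgebra.proj 𝒱 (2 * j) (x * coeff β (esymmMonomial V α)) := by
    intro x α β
    obtain ⟨z, hz⟩ := hcast α β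
    rw [hz, mul_comm, ← Algebra.smul_def, mul_comm x, ← Algebra.smul_def, map_smul]
  have h1 : ∀ β, coeff β (homogeneousComponent j (prodQ Q j)) =
      ∑ α ∈ K.support, coeff α K * coeff β (esymmMonomial V α) := by
    intro β
    rw [← aeval_esymm_multSeq, ← coeff_aeval_esymm, ← K.as_sum]
  have h2 : K' = K := by
    refine aeval_esymm_injective j (MvPolynomial.ext _ _ fun β => ?_)
    rw [hK, aeval_esymm_multSeq, coeff_aeval_esymm]
    by_cases hβ : β.degree = j
    · have h3 : coeff β (homogeneousComponent j (prodQ Q j)) ∈ 𝒱 (2 * j) := by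
        rw [coeff_homogeneousComponent, if_pos hβ]
        have := coeff_prodQ_mem 𝒱 hQ j β
        rwa [hβ] at this
      have h4 : GradedAlgebra.proj 𝒱 (2 * j) (coeff β (homogeneousComponent j (prodQ Q j))) =
          coeff β (homogeneousComponent j (prodQ Q j)) := DirectSum.decompose_of_mem_same 𝒱 h3
      rw [← h4, h1, map_sum]
      refine Finset.sum_congr rfl fun α _ => ?_
      by_cases hα : (α.sum fun x e => (x + 1) * e) = j
      · simp only [v, if_pos hα, hproj]
      -- A monomial of weight different from `j` becomes a homogeneous polynomial of degree
      -- different from `j`, and does not contribute in degree `j`.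
      · have h5 := (esymmMonomial_isHomogeneous V α).coeff_eq_zero (d := β)
          (by rw [hβ]; exact fun h => hα h.symm)
        rw [h5, mul_zero, mul_zero, map_zero]
    · rw [coeff_homogeneousComponent, if_neg hβ]
      refine Finset.sum_eq_zero fun α _ => ?_
      by_cases hα : (α.sum fun x e => (x + 1) * e) = j
      · rw [(esymmMonomial_isHomogeneous V α).coeff_eq_zero (d := β) (by rwa [hα]), mul_zero]
      · simp only [v, if_neg hα, zero_mul]
  have h3 : coeff α K' = v α := by
    simp only [K', coeff_sum, coeff_monomial]
    rw [Finset.sum_ite_eq' K.support α v]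
    split_ifs with h
    · rfl
    · simp only [v]
      rw [notMem_support_iff.1 h, map_zero, ite_self]
  rw [h2] at h3
  exact h3

theorem sum_eq_of_mem_support_multSeq {Q : PowerSeries V}
    (hQ : ∀ j : ℕ, PowerSeries.coeff j Q ∈ 𝒱 (2 * j)) {j : ℕ} {α : Fin j →₀ ℕ}
    (hα : α ∈ (multSeq Q j).support) : (α.sum fun x e => (x + 1) * e) = j := by
  by_contra h
  have h1 := coeff_multSeq 𝒱 hQ j α
  rw [if_neg h] at h1
  exact mem_support_iff.1 hα h1

theorem coeff_multSeq_mem {Q : PowerSeries V}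
    (hQ : ∀ j : ℕ, PowerSeries.coeff j Q ∈ 𝒱 (2 * j)) (j : ℕ) (α : Fin j →₀ ℕ) :
    coeff α (multSeq Q j) ∈ 𝒱 (2 * j) := by
  rw [coeff_multSeq 𝒱 hQ j α]
  split_ifs
  · exact SetLike.coe_mem _
  · exact zero_mem _

end MultSeq

/-! ### The currents of cycles and bordism data -/

section PushForward

variable {d : ℕ} {X : Type*} [TopologicalSpace X] [ChartedSpace (Eu d) X]
  {V : Type*} [CommRing V] [Algebra ℂ V]

theorem pushCurrent_apply {E : Type*} [NormedAddCommGroup E] [NormedSpace ℝ E] {H : Type*}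
    [TopologicalSpace H] {I : ModelWithCorners ℝ E H} {Y : Type*} [TopologicalSpace Y]
    [ChartedSpace H Y] [IsManifold I ∞ Y] {n : ℤ} (c : GeometricCycle I Y n) (S : Set c.Z)
    (h : c.Z → X) {D : ℕ} (w : Fin D → E) (Q : PowerSeries V) (p : ℤ) (k : ℕ)
    (σ : testForm d X k) : pushCurrent c S h w Q p k σ =
      ((2 * Real.pi * Complex.I : ℂ) ^ p) • ∑ j ∈ Finset.range (c.m + 1),
        ∑ α ∈ (multSeq Q j).support, densityIntegral c.Z (densityOn S fun i y =>
          topCoeff c.m (c.pushFamily h w α σ.1 i y)) • (multSeq Q j).coeff α := by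
  rw [pushCurrent]
  congr 1
  refine Finset.sum_congr rfl fun j _ => Finset.sum_congr rfl fun α _ => ?_
  congr 1
  refine densityIntegral_congr fun i y _ => ?_
  simp only [densityOn, GeometricCycle.pushFamily, map_smul, smul_eq_mul]
  rfl

variable [IsManifold (𝓡 d) ∞ X] {n : ℤ}

theorem cyclePhi_apply (Q : PowerSeries V) (p : ℤ) (c : GeometricCycle (𝓡 d) X n) (k : ℕ)
    (σ : testForm d X k) : cyclePhi Q p c k σ =
      ((2 * Real.pi * Complex.I : ℂ) ^ p) • ∑ j ∈ Finset.range (c.m + 1),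
        ∑ α ∈ (multSeq Q j).support, densityIntegral c.Z (fun i y =>
          topCoeff c.m (c.pushFamily c.f stdVec α σ.1 i y)) • (multSeq Q j).coeff α := by
  rw [cyclePhi, pushCurrent_apply]
  refine congrArg _ (Finset.sum_congr rfl fun j _ => Finset.sum_congr rfl fun α _ => ?_)
  refine congrArg (· • _) (densityIntegral_congr fun i y _ => ?_)
  simp [densityOn]

theorem bordismPsi_apply (Q : PowerSeries V) (p : ℤ) (b : BordismDatum d X n) (k : ℕ)
    (σ : testForm d X k) : bordismPsi Q p b k σ =
      ((-1 : ℂ) ^ n) • ((2 * Real.pi * Complex.I : ℂ) ^ p) • ∑ j ∈ Finset.range (b.1.m + 1),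
        ∑ α ∈ (multSeq Q j).support, b.1.cylIntegral α σ.1 • (multSeq Q j).coeff α :=
  congrArg (((-1 : ℂ) ^ n) • ·) (pushCurrent_apply b.1 _ b.1.fX (cylFrame d) Q p k σ)

namespace GeometricCycle

theorem codim_cyl (b : GeometricCycle (cylModel d) (ℝ × X) n) [h : Nonempty b.Z] :
    (b.m : ℤ) + n = d + 1 := by
  rw [b.codim h, Module.finrank_prod, Module.finrank_self, finrank_euclideanSpace_fin]
  push_cast
  ring

theorem cylIntegral_eq_zero (b : GeometricCycle (cylModel d) (ℝ × X) n) {l : ℕ}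
    (α : Fin l →₀ ℕ) {k : ℕ} (σ : RawForm d X k)
    (h : ¬ (Nonempty b.Z ∧ 2 * (α.sum fun x e => (x + 1) * e) + k = b.m)) :
    b.cylIntegral α σ = 0 := by
  by_cases hne : Nonempty b.Z
  · refine (densityIntegral_congr fun i y hy => ?_).trans densityIntegral_zero
    simp only [densityOn]
    rw [cylFamily, b.topCoeff_pushFamily_eq_zero _ _ _ _ _ _ fun h' => h ⟨hne, h'⟩, ite_self]
  · have := not_nonempty_iff.1 hne
    rw [cylIntegral, densityIntegral, finsum_of_isEmpty]

end GeometricCycle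

variable (𝒱 : ℤ → Submodule ℂ V) [GradedAlgebra 𝒱] {Q : PowerSeries V}
  (p : ℤ) (b : BordismDatum d X n)

/-- The sum for a fibre ends at `j = m - 1`, that for `b` at `j = m`. The extra term has degree at
least `2m`, more than the dimension of the fibre, so the ranges can be made equal. -/
theorem cyclePhi_fiber (hQ : ∀ j : ℕ, PowerSeries.coeff j Q ∈ 𝒱 (2 * j))
    {t : ℝ} (ht : b.1.RegularAt t) (k : ℕ) (σ : testForm d X k) :
    cyclePhi Q p (b.1.fiber t ht) k σ =
      ((2 * Real.pi * Complex.I : ℂ) ^ p) • ∑ j ∈ Finset.range (b.1.m + 1),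
        ∑ α ∈ (multSeq Q j).support, densityIntegral (b.1.fiber t ht).Z (fun i y =>
          topCoeff (b.1.fiber t ht).m ((b.1.fiber t ht).pushFamily (b.1.fiber t ht).f stdVec α σ.1
            i y)) • (multSeq Q j).coeff α := by
  rw [cyclePhi_apply]
  refine congrArg _ (Finset.sum_subset ?_ fun j hj hj' => Finset.sum_eq_zero fun α hα => ?_)
  · exact Finset.range_subset_range.2 (Nat.succ_le_succ (Nat.sub_le _ _))
  · have h1 : j < b.1.m + 1 := Finset.mem_range.1 hj
    have h2 : ¬ j < b.1.m - 1 + 1 := fun h => hj' (Finset.mem_range.2 h)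
    have h3 := sum_eq_of_mem_support_multSeq 𝒱 hQ hα
    have h4 : 2 * (α.sum fun x e => (x + 1) * e) + k ≠ (b.1.fiber t ht).m := by
      change _ ≠ b.1.m - 1
      omega
    refine (congrArg (· • _) ((densityIntegral_congr fun i y _ => ?_).trans
      densityIntegral_zero)).trans (zero_smul _ _)
    exact (b.1.fiber t ht).topCoeff_pushFamily_eq_zero _ _ _ _ _ _ h4

/-- The theorem of Stokes for geometric bordism data. -/
theorem cyclePhi_boundary [T2Space X] (hQ : ∀ j : ℕ, PowerSeries.coeff j Q ∈ 𝒱 (2 * j)) :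
    cyclePhi Q p (b.1.fiber 1 b.2.2) - cyclePhi Q p (b.1.fiber 0 b.2.1) =
      dCurrent (bordismPsi Q p b) := by
  funext k σ
  change cyclePhi Q p (b.1.fiber 1 b.2.2) k σ - cyclePhi Q p (b.1.fiber 0 b.2.1) k σ =
    ((-1 : ℂ) ^ (((d : ℤ) - (k + 1)) + 1)) • bordismPsi Q p b (k + 1) (testForm.extD σ)
  rw [cyclePhi_fiber 𝒱 p b hQ, cyclePhi_fiber 𝒱 p b hQ, bordismPsi_apply, ← smul_sub,
    smul_smul, smul_comm _ ((2 * Real.pi * Complex.I : ℂ) ^ p)]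
  congr 1
  rw [← Finset.sum_sub_distrib, Finset.smul_sum]
  refine Finset.sum_congr rfl fun j _ => ?_
  rw [← Finset.sum_sub_distrib, Finset.smul_sum]
  refine Finset.sum_congr rfl fun α hα => ?_
  rw [← sub_smul, ← b.1.cylIntegral_rawD α b.2.1 b.2.2 σ, smul_smul]
  congr 1
  -- If the degrees match, then `2j + k + 1 = m` and `m + n = d + 1` give `d - k = n + 2j`, so the
  -- signs `(-1)^(d-k)` and `(-1)^n` cancel. Otherwise the integral is zero and the signs are
  -- irrelevant.
  by_cases h : Nonempty b.1.Z ∧ 2 * (α.sum fun x e => (x + 1) * e) + (k + 1) = b.1.m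
  · have := h.1
    have h1 := b.1.codim_cyl
    have h2 : (((2 * (α.sum fun x e => (x + 1) * e) + (k + 1) : ℕ)) : ℤ) = b.1.m := by rw [h.2]
    have h3 : Even (((d : ℤ) - (k + 1)) + 1 + n) := by
      push_cast at h2
      refine ⟨d - k - (α.sum fun x e => (x + 1) * e : ℕ), ?_⟩
      push_cast
      linarith
    rw [← zpow_add₀ (by norm_num), h3.neg_one_zpow, one_mul]
    rfl
  · have h1 := b.1.cylIntegral_eq_zero α (rawD ⊤ σ.1) h
    have h2 : b.1.cylIntegral α (testForm.extD σ).1 = 0 := h1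
    rw [h1, h2, mul_zero]

/-- A Chern monomial of weight `j` acts nontrivially only on test forms of degree `m - 2j`. As `m +
n = d + 1`, it gives a current of degree `n - 1 + 2j`, and its coefficient lies in `𝒱_{2j}`. -/
theorem bordismPsi_mem (hQ : ∀ j : ℕ, PowerSeries.coeff j Q ∈ 𝒱 (2 * j)) :
    bordismPsi Q p b ∈ currents d X 𝒱 (n - 1) := by
  have h : bordismPsi Q p b = ((-1 : ℂ) ^ n) • ((2 * Real.pi * Complex.I : ℂ) ^ p) •
      ∑ j ∈ Finset.range (b.1.m + 1), ∑ α ∈ (multSeq Q j).support,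
        (fun k σ => b.1.cylIntegral α σ.1 • (multSeq Q j).coeff α : CurrentFamily d X V) := by
    funext k σ
    rw [bordismPsi_apply]
    simp only [Pi.smul_apply, Finset.sum_apply]
  rw [h]
  refine Submodule.smul_mem _ _ (Submodule.smul_mem _ _ (Submodule.sum_mem _ fun j _ =>
    Submodule.sum_mem _ fun α hα => ?_))
  have hj := sum_eq_of_mem_support_multSeq 𝒱 hQ hα
  -- An empty domain may carry any dimension `m`, and `m - 2j` is truncated when `2j > m`; in both
  -- cases the contribution is zero.
  by_cases hne : Nonempty b.1.Z ∧ 2 * j ≤ b.1.m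
  · have := hne.1
    have h1 := b.1.codim_cyl
    refine Submodule.subset_span ⟨j, b.1.m - 2 * j, fun σ => b.1.cylIntegral α σ.1, ?_,
      b.1.isCurrent_cylIntegral α, (multSeq Q j).coeff α, coeff_multSeq_mem 𝒱 hQ j α, ?_⟩
    · have h2 : ((b.1.m - 2 * j : ℕ) : ℤ) = b.1.m - 2 * j := by
        rw [Nat.cast_sub hne.2]
        push_cast
        ring
      rw [h2]
      linarith
    · funext k
      by_cases hk : k = b.1.m - 2 * j
      · subst hk
        rw [Pi.single_eq_same]
      · rw [Pi.single_eq_of_ne hk]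
        funext σ
        rw [b.1.cylIntegral_eq_zero α σ.1 fun h' => hk (by have := h'.2; omega), zero_smul]
        rfl
  · have h1 : (fun k σ => b.1.cylIntegral α σ.1 • (multSeq Q j).coeff α : CurrentFamily d X V) =
        0 := by
      funext k σ
      rw [b.1.cylIntegral_eq_zero α σ.1 fun h' => hne ⟨h'.1, by have := h'.2; omega⟩, zero_smul]
      rfl
    rw [h1]
    exact zero_mem _

theorem phi_boundary [T2Space X] (hQ : ∀ j : ℕ, PowerSeries.coeff j Q ∈ 𝒱 (2 * j))
    (x : FreeAbelianGroup (BordismDatum d X n)) :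
    phi Q p (boundary x) = dCurrent (psi Q p x) := by
  induction x using FreeAbelianGroup.induction_on with
  | zero => simp
  | of b =>
    rw [boundary, psi, FreeAbelianGroup.lift_apply_of, FreeAbelianGroup.lift_apply_of, map_sub,
      phi, FreeAbelianGroup.lift_apply_of, FreeAbelianGroup.lift_apply_of,
      cyclePhi_boundary 𝒱 p b hQ]
  | neg b h => rw [map_neg, map_neg, map_neg, map_neg, h]
  | add x y hx hy => rw [map_add, map_add, map_add, map_add, hx, hy]

theorem psi_mem (hQ : ∀ j : ℕ, PowerSeries.coeff j Q ∈ 𝒱 (2 * j))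
    (x : FreeAbelianGroup (BordismDatum d X n)) :
    psi Q p x ∈ currents d X 𝒱 (n - 1) := by
  induction x using FreeAbelianGroup.induction_on with
  | zero => rw [map_zero]; exact zero_mem _
  | of b => rw [psi, FreeAbelianGroup.lift_apply_of]; exact bordismPsi_mem 𝒱 p b hQ
  | neg b h => rw [map_neg]; exact neg_mem h
  | add x y hx hy => rw [map_add]; exact add_mem hx hy

end PushForward

end HodgeFiltered

end

open HodgeFiltered

theorem proposition2 {d : ℕ} {X : Type*} [TopologicalSpace X] [T2Space X] [SigmaCompactSpace X]
    [ChartedSpace (Eu d) X] [IsManifold (𝓡 d) ∞ X] (F : DeRhamFiltration d X)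
    {V : Type*} [CommRing V] [Algebra ℂ V] (𝒱 : ℤ → Submodule ℂ V) [GradedAlgebra 𝒱]
    (h_even : ∀ i, Odd i → 𝒱 i = ⊥) (Q : PowerSeries V)
    (hQ_one : PowerSeries.constantCoeff Q = 1) (hQ_deg : ∀ j : ℕ, PowerSeries.coeff j Q ∈ 𝒱 (2 * j))
    (n p : ℤ) (b : FreeAbelianGroup (BordismDatum d X n)) :
    phi Q p (boundary b) - dCurrent (psi Q p b) = 0 ∧
      ∃ h : psi Q p b ∈ currents d X 𝒱 (n - 1),
        ((QuotientAddGroup.mk (boundary b) : CycleGroup (𝓡 d) X n),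
          (exactCurrents d X 𝒱 (n - 1)).mkQ ⟨psi Q p b, h⟩) ∈ hodgeFilteredCycles F 𝒱 Q n p := by
  have h1 := phi_boundary 𝒱 p hQ_deg b
  have h2 := psi_mem 𝒱 p hQ_deg b
  refine ⟨sub_eq_zero.2 h1, h2, ?_⟩
  -- `hodgeFilteredCycles` is the image of a subgroup of formal sums and actual currents; the formal
  -- boundary and `psi` itself are the preimage.
  refine AddSubgroup.mem_map.2 ⟨(boundary b, ⟨psi Q p b, h2⟩), ?_, rfl⟩
  -- The difference is zero, and zero belongs to every step of the filtration.
  have h3 : phi Q p (boundary b) - dCurrent (psi Q p b) ∈ filteredForms F 𝒱 p n := by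
    rw [sub_eq_zero.2 h1]
    exact zero_mem _
  exact h3
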